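/- **Setting.** Let $M>0$, $k>0$, $\Delta=r^2+k^2r^4-2Mr$, let $r_+$ be the largest real zero of $\Delta$, and $w=\Delta/r^4$. Let $\mathcal M=\mathbb R_{t^\star}\times[r_+,\infty)_r\times\mathbb S^2_{\vartheta,\varphi}$ be the Schwarzschild–AdS exterior, with horizon $\mathcal H^+=\{r=r_+\}$, conformal boundary $\mathcal I=\{r=\infty\}$, and $t=t^\star-r^\star+\frac1k\arctan(kr)$, where $\frac{dr^\star}{dr}=\frac{r^2}{\Delta}$, $r^\star(\infty)=\frac\pi2$. In the coordinates $(t,r,\vartheta,\varphi)$ put $$L=\partial_t+\tfrac{\Delta}{r^2}\partial_r,\qquad \underline L=\partial_t-\tfrac{\Delta}{r^2}\partial_r,$$ $$\mathcal L_n=\partial_\vartheta+\tfrac{i}{\sin\vartheta}\partial_\varphi+n\cot\vartheta,\qquad \mathcal L_n^\dagger=\partial_\vartheta-\tfrac{i}{\sin\vartheta}\partial_\varphi+n\cot\vartheta,$$ $$-\mathcal L^{[\pm2]}=\tfrac1{\sin\vartheta}\partial_\vartheta(\sin\vartheta\,\partial_\vartheta)+\tfrac1{\sin^2\vartheta}\partial_\varphi^2+2(\pm2)i\tfrac{\cos\vartheta}{\sin^2\vartheta}\partial_\varphi-4\cot^2\vartheta-4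 .$$ A star denotes complex conjugation. A function $\phi$ of spin weight $s$ is *regular at $\mathcal H^+$* if all $L^p(\Delta^{-1}\underline L)^q\tilde Z_1^{k_1}\tilde Z_2^{k_2}\tilde Z_3^{k_3}\phi$ extend continuously to $\mathcal H^+$, and *regular at infinity* if all $(L-\underline L)^p(L+\underline L)^q\tilde Z_1^{k_1}\tilde Z_2^{k_2}\tilde Z_3^{k_3}\phi$ extend continuously to $\mathcal I$, where $$\tilde Z_1=-\sin\varphi\,\partial_\vartheta+\cos\varphi\,(-is\csc\vartheta-\cot\vartheta\,\partial_\varphi),\quad \tilde Z_2=-\cos\varphi\,\partial_\vartheta-\sin\varphi\,(-is\csc\vartheta-\cot\vartheta\,\partial_\varphi),\quad \tilde Z_3=\partial_\varphi .$$ Continuity of a function $f$ of spin weight $s$ at the poles means that $e^{is\varphi}f$ extends continuously to $\vartheta=0$ and $e^{-is\varphi}f$ extends continuously to $\vartheta=\pi$. Let $(S_{m\ell}(\vartheta)e^{im\varphi})_{\ell\ge2,\,|m|\le\ell}$, with $S_{m\ell}$ real, be a Hilbert basis of the $L^2(\mathbb S^2)$ functions of spin weight $+2$ with $\mathcal L^{[\pm2]}(S_{m\ell}e^{\pm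 im\varphi})=\ell(\ell+1)S_{m\ell}e^{\pm im\varphi}$ and $\mathcal L_{-1}^\dagger\mathcal L_0^\dagger\mathcal L_1^\dagger\mathcal L_2^\dagger(S_{m\ell}e^{im\varphi})=(\ell-1)\ell(\ell+1)(\ell+2)\,S_{-m\ell}e^{im\varphi}$ (the spin-weighted spherical harmonics, suitably signed). Let $\mathcal C$ be the operator from spin weight $+2$ to spin weight $-2$ with $\mathcal C(S_{m\ell}e^{im\varphi})=S_{-m\ell}e^{im\varphi}$, and put $$\phi^{[+2]}_{s}=\tfrac12\phi^{[+2]}+\tfrac12(\mathcal C\phi^{[+2]})^\ast,\qquad \phi^{[+2]}_{a}=\tfrac12\phi^{[+2]}-\tfrac12(\mathcal C\phi^{[+2]})^\ast,$$ $$\phi^{[-2]}_{s}=\tfrac12\phi^{[-2]}+\tfrac12\mathcal C\big((\phi^{[-2]})^\ast\big),\qquad \phi^{[-2]}_{a}=\tfrac12\phi^{[-2]}-\tfrac12\mathcal C\big((\phi^{[-2]})^\ast\big).$$ **Statement.** Let $t^\star_0\in\mathbb R$ and let $\widetilde\alpha^{[\pm2]}$ be smooth functions of spin weight $\pm2$ on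 $(\mathcal M\setminus\mathcal H^+)\cap\{t^\star\ge t_0^\star\}$ which solve the Teukolsky problem: $\widetilde\alpha^{[+2]}$ and $\Delta^{-2}\widetilde\alpha^{[-2]}$ are regular at $\mathcal H^+$, $\widetilde\alpha^{[\pm2]}$ are regular at infinity, $$0=-L\underline L\widetilde\alpha^{[+2]}+2\tfrac{\Delta}{r^2}\partial_r\big(\log\tfrac{\Delta}{r^4}\big)\underline L\widetilde\alpha^{[+2]}-\tfrac{\Delta}{r^4}\big(\mathcal L^{[+2]}-2+\tfrac{6M}r\big)\widetilde\alpha^{[+2]},$$ $$0=-L\underline L\widetilde\alpha^{[-2]}-2\tfrac{\Delta}{r^2}\partial_r\big(\log\tfrac{\Delta}{r^4}\big)L\widetilde\alpha^{[-2]}-\tfrac{\Delta}{r^4}\big(\mathcal L^{[-2]}-2+\tfrac{6M}r\big)\widetilde\alpha^{[-2]},$$ and, as $r\to+\infty$, $$\widetilde\alpha^{[+2]}-(\widetilde\alpha^{[-2]})^\ast\to0,\qquad r^2\partial_r\widetilde\alpha^{[+2]}+r^2\partial_r(\widetilde\alpha^{[-2]})^\ast\to0 .$$ Suppose in addition that the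 Teukolsky–Starobinsky identities hold: $$w^2(w^{-1}L)^4(\widetilde\alpha^{[-2]})^\ast=\mathcal L_{-1}\mathcal L_0\mathcal L_1\mathcal L_2(\widetilde\alpha^{[+2]})^\ast-12M\partial_t\widetilde\alpha^{[+2]},$$ $$w^2(w^{-1}\underline L)^4(\widetilde\alpha^{[+2]})^\ast=\mathcal L^\dagger_{-1}\mathcal L^\dagger_0\mathcal L^\dagger_1\mathcal L^\dagger_2(\widetilde\alpha^{[-2]})^\ast+12M\partial_t\widetilde\alpha^{[-2]}.$$ Then, as $r\to+\infty$, $$k^2\mathcal L^{[+2]}\underline L\widetilde\alpha^{[+2]}_s+\partial_t\underline L\,\underline L\widetilde\alpha^{[+2]}_s\to0,\qquad \underline L\,\underline L\widetilde\alpha^{[+2]}_a\to0,$$ $$k^2\mathcal L^{[-2]}L\widetilde\alpha^{[-2]}_s+\partial_tLL\widetilde\alpha^{[-2]}_s\to0,\qquad LL\widetilde\alpha^{[-2]}_a\to0 .$$ The limits $r\to+\infty$ are taken at each fixed $(t^\star,\vartheta,\varphi)$. -/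

import Mathlib

open Real Set Filter Topology
open scoped ComplexConjugate

namespace SchwarzschildAdS

noncomputable section

/-! ## Background -/

/-- The radial function `Δ = r² + k² r⁴ - 2 M r`. -/
def Delta (M k r : ℝ) : ℝ := r ^ 2 + k ^ 2 * r ^ 4 - 2 * M * r

/-- The horizon radius `r₊`: the largest real zero of `Δ`. -/
def rPlus (M k : ℝ) : ℝ := sSup {r : ℝ | Delta M k r = 0}

/-- The weight `w = Δ / r⁴`. -/
def w (M k r : ℝ) : ℝ := Delta M k r / r ^ 4

/-- A complex valued function of the regular coordinates `(t⋆, r, ϑ, φ)`; only its values for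
`t⋆ ≥ t₀`, `r > r₊`, `0 < ϑ < π` matter. -/
abbrev Field := ℝ → ℝ → ℝ → ℝ → ℂ

/-- Pointwise complex conjugation. -/
def conjField (F : Field) : Field := fun t r θ φ => conj (F t r θ φ)

/-- Multiplication by a radial function. -/
def radMul (f : ℝ → ℝ) (F : Field) : Field := fun t r θ φ => (f r : ℂ) * F t r θ φ

/-! ## Coordinate derivatives and null vector fields

The domain is `{t⋆ ≥ t₀}`, a manifold with boundary, so the `t⋆`-derivative is taken within
`[t₀, ∞)`, i.e. it is one-sided at `t⋆ = t₀`. -/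

/-- `∂_{t⋆}` in the coordinates `(t⋆, r, ϑ, φ)`; this is also `∂_t` in the coordinates
`(t, r, ϑ, φ)`. -/
def dT (t₀ : ℝ) (F : Field) : Field :=
  fun t r θ φ => derivWithin (fun τ => F τ r θ φ) (Ici t₀) t

/-- `∂_r` in the regular coordinates `(t⋆, r, ϑ, φ)`. -/
def dRstar (F : Field) : Field := fun t r θ φ => deriv (fun ρ => F t ρ θ φ) r

/-- `∂_ϑ`. -/
def dTheta (F : Field) : Field := fun t r θ φ => deriv (fun ϑ => F t r ϑ φ) θ

/-- `∂_φ`. -/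
def dPhi (F : Field) : Field := fun t r θ φ => deriv (fun ψ => F t r θ ψ) φ

/-- `∂_r` in the Schwarzschild coordinates `(t, r, ϑ, φ)`. Since
`t⋆ = t + r⋆ - k⁻¹ arctan (k r)` with `dr⋆ / dr = r² / Δ`, the chain rule gives
`∂_r|_t = ∂_r|_{t⋆} + (r² / Δ - 1 / (1 + k² r²)) ∂_{t⋆}`. -/
def dR (M k t₀ : ℝ) (F : Field) : Field := fun t r θ φ =>
  dRstar F t r θ φ
    + ((r ^ 2 / Delta M k r - 1 / (1 + k ^ 2 * r ^ 2) : ℝ) : ℂ) * dT t₀ F t r θ φ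

/-- `L = ∂_t + (Δ / r²) ∂_r`. -/
def L (M k t₀ : ℝ) (F : Field) : Field :=
  dT t₀ F + radMul (fun r => Delta M k r / r ^ 2) (dR M k t₀ F)

/-- `L̲ = ∂_t - (Δ / r²) ∂_r`. -/
def Lbar (M k t₀ : ℝ) (F : Field) : Field :=
  dT t₀ F - radMul (fun r => Delta M k r / r ^ 2) (dR M k t₀ F)

/-- `w⁻¹ L`. -/
def wL (M k t₀ : ℝ) (F : Field) : Field := radMul (fun r => (w M k r)⁻¹) (L M k t₀ F)

/-- `w⁻¹ L̲`. -/
def wLbar (M k t₀ : ℝ) (F : Field) : Field := radMul (fun r => (w M k r)⁻¹) (Lbar M k t₀ F)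

/-- `Δ⁻¹ L̲`. -/
def DLbar (M k t₀ : ℝ) (F : Field) : Field :=
  radMul (fun r => (Delta M k r)⁻¹) (Lbar M k t₀ F)

/-! ## Angular operators -/

/-- `ℒ_n = ∂_ϑ + (i / sin ϑ) ∂_φ + n cot ϑ`. -/
def angL (n : ℤ) (F : Field) : Field := fun t r θ φ =>
  dTheta F t r θ φ + Complex.I / (Real.sin θ : ℂ) * dPhi F t r θ φ
    + (n : ℂ) * (Real.cot θ : ℂ) * F t r θ φ

/-- `ℒ_n† = ∂_ϑ - (i / sin ϑ) ∂_φ + n cot ϑ`. -/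
def angLdag (n : ℤ) (F : Field) : Field := fun t r θ φ =>
  dTheta F t r θ φ - Complex.I / (Real.sin θ : ℂ) * dPhi F t r θ φ
    + (n : ℂ) * (Real.cot θ : ℂ) * F t r θ φ

/-- The operator `ℒ^{[s]}`, `s = ±2`:
`-ℒ^{[s]} = (sin ϑ)⁻¹ ∂_ϑ (sin ϑ ∂_ϑ) + (sin ϑ)⁻² ∂_φ² + 2 s i (cos ϑ / sin² ϑ) ∂_φ
  - 4 cot² ϑ - 4`. -/
def angOp (s : ℤ) (F : Field) : Field := fun t r θ φ =>
  -(1 / (Real.sin θ : ℂ)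
        * dTheta (fun t' r' θ' φ' => (Real.sin θ' : ℂ) * dTheta F t' r' θ' φ') t r θ φ
      + 1 / (Real.sin θ : ℂ) ^ 2 * dPhi (dPhi F) t r θ φ
      + 2 * (s : ℂ) * Complex.I * ((Real.cos θ : ℂ) / (Real.sin θ : ℂ) ^ 2) * dPhi F t r θ φ
      - 4 * (Real.cot θ : ℂ) ^ 2 * F t r θ φ
      - 4 * F t r θ φ)

/-- `Z̃₁` on functions of spin weight `s`. -/
def Z1 (s : ℤ) (F : Field) : Field := fun t r θ φ =>
  -(Real.sin φ : ℂ) * dTheta F t r θ φ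
    + (Real.cos φ : ℂ) * (-(Complex.I * s / (Real.sin θ : ℂ)) * F t r θ φ
        - (Real.cot θ : ℂ) * dPhi F t r θ φ)

/-- `Z̃₂` on functions of spin weight `s`. -/
def Z2 (s : ℤ) (F : Field) : Field := fun t r θ φ =>
  -(Real.cos φ : ℂ) * dTheta F t r θ φ
    - (Real.sin φ : ℂ) * (-(Complex.I * s / (Real.sin θ : ℂ)) * F t r θ φ
        - (Real.cot θ : ℂ) * dPhi F t r θ φ)

/-- `Z̃₁^{a} Z̃₂^{b} Z̃₃^{c}`, with `Z̃₃ = ∂_φ`. -/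
def ZZZ (s : ℤ) (a b c : ℕ) (F : Field) : Field := (Z1 s)^[a] ((Z2 s)^[b] (dPhi^[c] F))

/-! ## Spin-weighted functions and their regularity -/

/-- `F p ϑ φ` is a continuous function of spin weight `s` on `A × 𝕊²`: it is continuous away from
the poles, and `e^{isφ} F` resp. `e^{-isφ} F` extends continuously to the north pole `ϑ = 0` resp.
to the south pole `ϑ = π`. -/
def SpinContinuousOn (s : ℤ) (A : Set (ℝ × ℝ)) (F : ℝ × ℝ → ℝ → ℝ → ℂ) : Prop :=
  ContinuousOn (fun z : (ℝ × ℝ) × ℝ × ℝ => F z.1 z.2.1 z.2.2) (A ×ˢ Ioo 0 π ×ˢ univ) ∧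
  (∀ p ∈ A, ∃ c : ℂ, Tendsto
    (fun z : (ℝ × ℝ) × ℝ × ℝ => Complex.exp (Complex.I * s * z.2.2) * F z.1 z.2.1 z.2.2)
    (𝓝[A] p ×ˢ 𝓝[>] 0 ×ˢ ⊤) (𝓝 c)) ∧
  (∀ p ∈ A, ∃ c : ℂ, Tendsto
    (fun z : (ℝ × ℝ) × ℝ × ℝ => Complex.exp (-(Complex.I * s * z.2.2)) * F z.1 z.2.1 z.2.2)
    (𝓝[A] p ×ˢ 𝓝[<] π ×ˢ ⊤) (𝓝 c))

/-- `F` is a smooth function of spin weight `s` on `{t⋆ ≥ t₀} ∩ {r > r₊}`: it is `2π`-periodic in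
`φ`, smooth away from the poles, and all its derivatives along `∂_{t⋆}`, `∂_r`, `Z̃₁`, `Z̃₂`, `Z̃₃`
are continuous functions of spin weight `s` on the spheres, poles included. -/
def SmoothSpin (M k t₀ : ℝ) (s : ℤ) (F : Field) : Prop :=
  (∀ t ∈ Ici t₀, ∀ r ∈ Ioi (rPlus M k), ∀ θ ∈ Ioo 0 π, ∀ φ : ℝ,
    F t r θ (φ + 2 * π) = F t r θ φ) ∧
  ContDiffOn ℝ (⊤ : ℕ∞) (fun z : ℝ × ℝ × ℝ × ℝ => F z.1 z.2.1 z.2.2.1 z.2.2.2)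
    (Ici t₀ ×ˢ Ioi (rPlus M k) ×ˢ Ioo 0 π ×ˢ univ) ∧
  ∀ p q a b c : ℕ, SpinContinuousOn s (Ici t₀ ×ˢ Ioi (rPlus M k))
    (fun y => ((dT t₀)^[p] (dRstar^[q] (ZZZ s a b c F))) y.1 y.2)

/-- `F` extends continuously, as a function of spin weight `s`, to the future event horizon
`r = r₊`. -/
def ExtendsToHorizon (M k t₀ : ℝ) (s : ℤ) (F : Field) : Prop :=
  ∃ G : ℝ × ℝ → ℝ → ℝ → ℂ, SpinContinuousOn s (Ici t₀ ×ˢ Ici (rPlus M k)) G ∧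
    ∀ t ∈ Ici t₀, ∀ r ∈ Ioi (rPlus M k), ∀ θ ∈ Ioo 0 π, ∀ φ : ℝ, G (t, r) θ φ = F t r θ φ

/-- `F` extends continuously, as a function of spin weight `s`, to the conformal boundary
`r = ∞`, which is `x = 0` in the coordinate `x = 1 / r`. -/
def ExtendsToInfinity (M k t₀ : ℝ) (s : ℤ) (F : Field) : Prop :=
  ∃ G : ℝ × ℝ → ℝ → ℝ → ℂ, SpinContinuousOn s (Ici t₀ ×ˢ Ico 0 (rPlus M k)⁻¹) G ∧
    ∀ t ∈ Ici t₀, ∀ r ∈ Ioi (rPlus M k), ∀ θ ∈ Ioo 0 π, ∀ φ : ℝ, G (t, r⁻¹) θ φ = F t r θ φ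

/-- Regularity at the future event horizon. -/
def RegularAtHorizon (M k t₀ : ℝ) (s : ℤ) (F : Field) : Prop :=
  ∀ p q a b c : ℕ,
    ExtendsToHorizon M k t₀ s ((L M k t₀)^[p] ((DLbar M k t₀)^[q] (ZZZ s a b c F)))

/-- Regularity at the conformal boundary. -/
def RegularAtInfinity (M k t₀ : ℝ) (s : ℤ) (F : Field) : Prop :=
  ∀ p q a b c : ℕ,
    ExtendsToInfinity M k t₀ s
      ((fun G => L M k t₀ G - Lbar M k t₀ G)^[p]
        ((fun G => L M k t₀ G + Lbar M k t₀ G)^[q] (ZZZ s a b c F)))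

/-- `F → 0` as `r → ∞`, at each `(t⋆, ϑ, φ)`. -/
def VanishesAtInfinity (t₀ : ℝ) (F : Field) : Prop :=
  ∀ t ∈ Ici t₀, ∀ θ ∈ Ioo 0 π, ∀ φ : ℝ, Tendsto (fun r => F t r θ φ) atTop (𝓝 0)

/-! ## The Teukolsky problem -/

/-- The Teukolsky operator of spin `+2`. -/
def teukPlus (M k t₀ : ℝ) (F : Field) : Field :=
  - L M k t₀ (Lbar M k t₀ F)
    + radMul (fun r => 2 * (Delta M k r / r ^ 2)
        * deriv (fun ρ => Real.log (Delta M k ρ / ρ ^ 4)) r) (Lbar M k t₀ F)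
    - radMul (fun r => Delta M k r / r ^ 4)
        (angOp 2 F + radMul (fun r => -2 + 6 * M / r) F)

/-- The Teukolsky operator of spin `-2`. -/
def teukMinus (M k t₀ : ℝ) (F : Field) : Field :=
  - L M k t₀ (Lbar M k t₀ F)
    - radMul (fun r => 2 * (Delta M k r / r ^ 2)
        * deriv (fun ρ => Real.log (Delta M k ρ / ρ ^ 4)) r) (L M k t₀ F)
    - radMul (fun r => Delta M k r / r ^ 4)
        (angOp (-2) F + radMul (fun r => -2 + 6 * M / r) F)

/-- `F` and `G` agree on `{t⋆ ≥ t₀} ∩ {r > r₊}`, away from the coordinate axis. -/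
def EqOnDomain (M k t₀ : ℝ) (F G : Field) : Prop :=
  ∀ t ∈ Ici t₀, ∀ r ∈ Ioi (rPlus M k), ∀ θ ∈ Ioo 0 π, ∀ φ : ℝ, F t r θ φ = G t r θ φ

/-- `(αp, αm)` is a solution of the Teukolsky problem on `{t⋆ ≥ t₀}`; `αp` and `αm` are the
rescaled Teukolsky quantities of spin `+2` and `-2`. -/
structure IsTeukolskySolution (M k t₀ : ℝ) (αp αm : Field) : Prop where
  smooth_plus : SmoothSpin M k t₀ 2 αp
  smooth_minus : SmoothSpin M k t₀ (-2) αm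
  horizon_plus : RegularAtHorizon M k t₀ 2 αp
  horizon_minus : RegularAtHorizon M k t₀ (-2) (radMul (fun r => (Delta M k r ^ 2)⁻¹) αm)
  infinity_plus : RegularAtInfinity M k t₀ 2 αp
  infinity_minus : RegularAtInfinity M k t₀ (-2) αm
  eq_plus : EqOnDomain M k t₀ (teukPlus M k t₀ αp) 0
  eq_minus : EqOnDomain M k t₀ (teukMinus M k t₀ αm) 0
  dirichlet : VanishesAtInfinity t₀ (αp - conjField αm)
  neumann : VanishesAtInfinity t₀
    (radMul (fun r => r ^ 2) (dR M k t₀ αp) + radMul (fun r => r ^ 2) (dR M k t₀ (conjField αm)))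

/-- The Teukolsky-Starobinsky identities. -/
structure TeukolskyStarobinsky (M k t₀ : ℝ) (αp αm : Field) : Prop where
  plus : EqOnDomain M k t₀
    (radMul (fun r => w M k r ^ 2) ((wL M k t₀)^[4] (conjField αm)))
    (angL (-1) (angL 0 (angL 1 (angL 2 (conjField αp)))) - radMul (fun _ => 12 * M) (dT t₀ αp))
  minus : EqOnDomain M k t₀
    (radMul (fun r => w M k r ^ 2) ((wLbar M k t₀)^[4] (conjField αp)))
    (angLdag (-1) (angLdag 0 (angLdag 1 (angLdag 2 (conjField αm))))
      + radMul (fun _ => 12 * M) (dT t₀ αm))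

/-! ## Spherical modes and the conjugacy operator -/

/-- The real functions `S_{mℓ}(ϑ)`, for `ℓ ≥ 2` and `|m| ≤ ℓ`, such that `S_{mℓ}(ϑ) e^{imφ}` is a
Hilbert basis of the functions of spin weight `+2` in `L²(𝕊²)`, with
`ℒ^{[±2]} (S_{mℓ} e^{±imφ}) = ℓ (ℓ + 1) S_{mℓ} e^{±imφ}` and
`ℒ₋₁† ℒ₀† ℒ₁† ℒ₂† (S_{mℓ} e^{imφ}) = (ℓ - 1) ℓ (ℓ + 1) (ℓ + 2) S_{-mℓ} e^{imφ}`. They are the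
spin-weighted spherical harmonics of weight `2`, here by their Rodrigues formula
`S_{mℓ}(ϑ) = ± N sin(ϑ/2)^{-(m+2)} cos(ϑ/2)^{-(m-2)} (d/dx)^{ℓ-m} [(1-x)^{ℓ+2} (1+x)^{ℓ-2}]`
at `x = cos ϑ`, where `N > 0` normalises and the sign is `(-1)^m` for `m < 0` and `+` otherwise. -/
def S (m : ℤ) (ℓ : ℕ) (θ : ℝ) : ℝ :=
  (if m < 0 then (-1 : ℝ) ^ m else 1)
    * Real.sqrt ((2 * ℓ + 1) / (4 * π)
        * (Nat.factorial (ℓ + m).toNat : ℝ)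
        / ((Nat.factorial (ℓ - m).toNat : ℝ) * (Nat.factorial (ℓ + 2) : ℝ)
            * (Nat.factorial (ℓ - 2) : ℝ)))
    * (2 : ℝ) ^ (-(ℓ + m : ℤ))
    * Real.sin (θ / 2) ^ (-(m + 2)) * Real.cos (θ / 2) ^ (-(m - 2))
    * Polynomial.eval (Real.cos θ)
        (Polynomial.derivative^[(ℓ - m).toNat]
          ((1 - Polynomial.X) ^ (ℓ + 2) * (1 + Polynomial.X) ^ (ℓ - 2) : Polynomial ℝ))

/-- The coefficient `F_{mℓ}(t⋆, r)` of a function of spin weight `+2` on `S_{mℓ}(ϑ) e^{imφ}`, i.e.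
the `L²(𝕊²)` inner product with this basis element. -/
def coeff (m : ℤ) (ℓ : ℕ) (F : Field) (t r : ℝ) : ℂ :=
  ∫ φ in (0 : ℝ)..(2 * π), ∫ θ in (0 : ℝ)..π,
    F t r θ φ * ((S m ℓ θ : ℂ) * Complex.exp (-(Complex.I * m * φ))) * (Real.sin θ : ℂ)

/-- The conjugacy operator `𝒞` from spin weight `+2` to spin weight `-2`, on each sphere: it is
determined by `S_{mℓ}(ϑ) e^{imφ} ↦ S_{-mℓ}(ϑ) e^{imφ}` for `ℓ ≥ 2`, `|m| ≤ ℓ`. -/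
def CC (F : Field) : Field := fun t r θ φ =>
  ∑' n : ℕ, ∑ m ∈ Finset.Icc (-((n : ℤ) + 2)) ((n : ℤ) + 2),
    coeff m (n + 2) F t r * ((S (-m) (n + 2) θ : ℂ) * Complex.exp (Complex.I * m * φ))

/-- `F_s = ½ F + ½ (𝒞 F)^*`, for spin weight `+2`. -/
def symPlus (F : Field) : Field := (1 / 2 : ℂ) • F + (1 / 2 : ℂ) • conjField (CC F)

/-- `F_a = ½ F - ½ (𝒞 F)^*`, for spin weight `+2`. -/
def antiPlus (F : Field) : Field := (1 / 2 : ℂ) • F - (1 / 2 : ℂ) • conjField (CC F)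

/-- `F_s = ½ F + ½ 𝒞 (F^*)`, for spin weight `-2`. -/
def symMinus (F : Field) : Field := (1 / 2 : ℂ) • F + (1 / 2 : ℂ) • CC (conjField F)

/-- `F_a = ½ F - ½ 𝒞 (F^*)`, for spin weight `-2`. -/
def antiMinus (F : Field) : Field := (1 / 2 : ℂ) • F - (1 / 2 : ℂ) • CC (conjField F)

end

end SchwarzschildAdS

open SchwarzschildAdS

namespace SchwarzschildAdS

section

/-! ## Wigner functions -/

section Wigner

open Polynomial

/-! The proof works mode by mode. Put D = (Δ/r²)∂_r and X = ∂_t - εD, so that X is L̲ for ε = 1 and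
L for ε = -1. Both halves of the theorem are one statement about a `TeukPair` (F, G): F = α⁺, G =
(α⁻)^* with ε = 1, and F = (α⁻)^*, G = α⁺ with ε = -1. Let Φ_j be the coefficient of (w⁻¹X)^j F on
the mode (m, ℓ), Ψ_j the conjugate of its coefficient on (-m, ℓ), and l = ℓ(ℓ+1). Since (𝒞F)^* has
coefficients conj(F_{-m}), the symmetric and antisymmetric parts of F have coefficients (Φ ± Ψ)/2.

On one mode the Teukolsky equation is a transport equation for 2∂_tΦ_1 - wΦ_2; applying X three more
times gives equations up to 2∂_tΦ_4 - wΦ_5 (`ModeChain.first` to `ModeChain.fourth`). The boundary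
conditions say that, at infinity, G agrees with F and (2∂_t - X)G agrees with XF. The
Teukolsky-Starobinsky identity w²Φ_4 = l(l-2) conj(G_{-m}) + 12εM ∂_tG_m is then used twice.
Eliminating Φ_4, Φ_3 and ∂_tΦ_1 yields 4∂_t²Φ_2 + 2lk²Φ_2 - l(l-2)(Φ_0 + Ψ_0) → 0
(`ModeChain.boundary_first`). Applying the opposite null derivation 2∂_t - X first yields 2∂_tΦ_2 +
l(Φ_1 + Ψ_1) → 0 (`ModeChain.boundary_second`). In both the terms with M cancel in the limit, by the
boundary conditions. The last bracket of each is symmetric in Φ and Ψ. Hence the sum of the second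
limits over Φ and Ψ is the claim on the symmetric part; the difference of their time derivatives
gives ∂_t²(Φ_2 - Ψ_2) → 0, and the difference of the first limits then gives Φ_2 - Ψ_2 → 0, because
lk² ≠ 0. This is `ModeChain.boundary_limits`.

Two analytic points remain. The boundary conditions are pointwise limits, and their time derivatives
follow from the boundedness of second time derivatives (`tendsto_zero_time_deriv`). To return from
modes to fields the coefficients must decay rapidly, uniformly up to r = ∞: the Teukolsky equation
expresses ℒF through ∂_t and D derivatives of F, which are bounded there, so powers of ℒ come for
free (`TeukField.tame_angOp`, `Tame.locRapid`), and dominated convergence sums the series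
(`RapidInf.tendsto_Ser`).

The harmonics are matrix coefficients of SU(2): Rodrigues' formula identifies them with normalised
Wigner functions (`S_eq_harm`), whose ladder relations (`hasDerivAt_wigE`, `wigE_ladder`) give the
differential equation, orthonormality and the action of the angular operators. Completeness
(`SphereReg.eq_zero_of_coeff`) combines Fourier series in φ with Weierstrass approximation in cos ϑ.
-/

/-- `P'` is the coefficientwise derivative of the polynomial valued function `P` at `θ`. -/
def HasCoeffDerivAt (P : ℝ → ℝ[X]) (P' : ℝ[X]) (θ : ℝ) : Prop :=
  ∀ k, HasDerivAt (fun x => (P x).coeff k) (P'.coeff k) θ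

theorem HasCoeffDerivAt.mul {P Q : ℝ → ℝ[X]} {P' Q' : ℝ[X]} {θ : ℝ}
    (hP : HasCoeffDerivAt P P' θ) (hQ : HasCoeffDerivAt Q Q' θ) :
    HasCoeffDerivAt (fun x => P x * Q x) (P' * Q θ + P θ * Q') θ := by
  intro k
  simp only [coeff_mul, coeff_add, ← Finset.sum_add_distrib]
  exact HasDerivAt.fun_sum fun x _ => (hP x.1).mul (hQ x.2)

theorem HasCoeffDerivAt.pow {P : ℝ → ℝ[X]} {P' : ℝ[X]} {θ : ℝ}
    (hP : HasCoeffDerivAt P P' θ) (n : ℕ) :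
    HasCoeffDerivAt (fun x => P x ^ n) (C (n : ℝ) * P θ ^ (n - 1) * P') θ := by
  induction n with
  | zero =>
    intro k
    simpa using hasDerivAt_const θ (((1 : ℝ[X])).coeff k)
  | succ n ih =>
    have h := ih.mul hP
    simp only [← pow_succ] at h
    convert h using 1
    rcases n with _ | n
    · simp
    · simp only [Nat.add_sub_cancel, Nat.cast_add, Nat.cast_one, C_add, C_1]
      ring

/-- The rotated linear form `sin (θ/2) - cos (θ/2) z`. -/
noncomputable def uPoly (θ : ℝ) : ℝ[X] := C (Real.sin (θ / 2)) - C (Real.cos (θ / 2)) * X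

/-- The rotated linear form `cos (θ/2) + sin (θ/2) z`. -/
noncomputable def vPoly (θ : ℝ) : ℝ[X] := C (Real.cos (θ / 2)) + C (Real.sin (θ / 2)) * X

theorem hasDerivAt_sin_half (θ : ℝ) :
    HasDerivAt (fun x => Real.sin (x / 2)) (1 / 2 * Real.cos (θ / 2)) θ := by
  have := ((hasDerivAt_id θ).div_const 2).sin
  simp only [id] at this
  exact this.congr_deriv (by ring)

theorem hasDerivAt_cos_half (θ : ℝ) :
    HasDerivAt (fun x => Real.cos (x / 2)) (-(1 / 2) * Real.sin (θ / 2)) θ := by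
  have := ((hasDerivAt_id θ).div_const 2).cos
  simp only [id] at this
  exact this.congr_deriv (by ring)

theorem hasCoeffDerivAt_linear {a b : ℝ → ℝ} {a' b' θ : ℝ} (ha : HasDerivAt a a' θ)
    (hb : HasDerivAt b b' θ) :
    HasCoeffDerivAt (fun x => C (a x) + C (b x) * X) (C a' + C b' * X) θ := by
  intro k
  simp only [coeff_add, coeff_C, coeff_C_mul, coeff_X]
  split_ifs
  · exact ha.add (hb.mul_const _)
  · exact ha.add (hb.mul_const _)
  · exact (hasDerivAt_const _ _).add (hb.mul_const _)
  · exact (hasDerivAt_const _ _).add (hb.mul_const _)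

theorem hasCoeffDerivAt_uPoly (θ : ℝ) :
    HasCoeffDerivAt uPoly (C (1 / 2) * vPoly θ) θ := by
  have := hasCoeffDerivAt_linear (hasDerivAt_sin_half θ) (hasDerivAt_cos_half θ).neg
  convert this using 1
  · funext x
    simp only [uPoly, Pi.neg_apply, C_neg]
    ring
  · rw [vPoly]
    simp only [C_mul, C_neg]
    ring

theorem hasCoeffDerivAt_vPoly (θ : ℝ) :
    HasCoeffDerivAt vPoly (-C (1 / 2) * uPoly θ) θ := by
  have := hasCoeffDerivAt_linear (hasDerivAt_cos_half θ) (hasDerivAt_sin_half θ)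
  have h2 : -C (1 / 2) * uPoly θ = C (-(1 / 2) * Real.sin (θ / 2))
      + C (1 / 2 * Real.cos (θ / 2)) * X := by
    simp only [uPoly, C_mul, C_neg]
    ring
  rw [h2]
  exact this

/-- The coefficient of `z ^ k` in `(sin (θ/2) - cos (θ/2) z) ^ p * (cos (θ/2) + sin (θ/2) z) ^ q`. -/
noncomputable def wigG (p q k : ℕ) (θ : ℝ) : ℝ := (uPoly θ ^ p * vPoly θ ^ q).coeff k

/-- The two linear forms rotate into each other, u' = v/2 and v' = -u/2, so differentiation trades
one factor u for v or conversely. -/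
theorem hasDerivAt_wigG (p q k : ℕ) (θ : ℝ) :
    HasDerivAt (wigG p q k)
      (1 / 2 * (p * wigG (p - 1) (q + 1) k θ - q * wigG (p + 1) (q - 1) k θ)) θ := by
  have h := ((hasCoeffDerivAt_uPoly θ).pow p).mul ((hasCoeffDerivAt_vPoly θ).pow q) k
  refine h.congr_deriv ?_
  have : C (p : ℝ) * uPoly θ ^ (p - 1) * (C (1 / 2) * vPoly θ) * vPoly θ ^ q
      + uPoly θ ^ p * (C (q : ℝ) * vPoly θ ^ (q - 1) * (-C (1 / 2) * uPoly θ))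
      = C (1 / 2) * (C (p : ℝ) * (uPoly θ ^ (p - 1) * vPoly θ ^ (q + 1))
        - C (q : ℝ) * (uPoly θ ^ (p + 1) * vPoly θ ^ (q - 1))) := by ring
  rw [this, coeff_C_mul, coeff_sub, coeff_C_mul, coeff_C_mul]
  rfl

/-- The Euler operator z d/dz multiplies the coefficient of z^k by k. Applied to u^p v^q it can be
rewritten, by half-angle identities for each linear factor, through the two neighbouring products;
comparing coefficients gives the relation. -/
theorem wigG_ladder (p q k : ℕ) (θ : ℝ) :
    ((p : ℝ) + q - 2 * k + (p - q) * Real.cos θ) * wigG p q k θ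
      = Real.sin θ * (p * wigG (p - 1) (q + 1) k θ + q * wigG (p + 1) (q - 1) k θ) := by
  set σ := Real.sin (θ / 2) with hσ
  set c := Real.cos (θ / 2) with hc
  have hsc : σ ^ 2 + c ^ 2 = 1 := Real.sin_sq_add_cos_sq _
  have hsin : Real.sin θ = 2 * σ * c := by
    rw [hσ, hc, ← Real.sin_two_mul]; congr 1; ring
  have hcos : Real.cos θ = 2 * c ^ 2 - 1 := by
    rw [hc, ← Real.cos_two_mul]; congr 1; ring
  have hu : derivative (uPoly θ) = - C c := by simp [uPoly, hc]
  have hv : derivative (vPoly θ) = C σ := by simp [vPoly, hσ]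
  have hCsc : (C σ) ^ 2 + (C c) ^ 2 = (1 : ℝ[X]) := by
    rw [← C_pow, ← C_pow, ← C_add, hsc, C_1]
  -- The single-factor identity behind this is 2c²u + 2cz = 2σc v; `key2` rests in the same way on
  -- 2σ²v - 2σz = 2σc u.
  have key1 : (C (p : ℝ)) * uPoly θ ^ p * vPoly θ ^ q * (C (2 * c ^ 2))
      - 2 * X * ((C (p : ℝ) * uPoly θ ^ (p - 1) * (-C c)) * vPoly θ ^ q)
      = C (2 * σ * c) * (C (p : ℝ) * (uPoly θ ^ (p - 1) * vPoly θ ^ (q + 1))) := by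
    rcases p with _ | p
    · simp
    · simp only [Nat.add_sub_cancel]
      have : uPoly θ * C (2 * c ^ 2) + 2 * X * C c = C (2 * σ * c) * vPoly θ := by
        simp only [uPoly, vPoly, ← hσ, ← hc, C_mul, C_pow]
        have h2 : (C (2 : ℝ) : ℝ[X]) = 2 := rfl
        rw [h2]
        linear_combination (-2 * X * C c) * hCsc
      linear_combination (C ((p + 1 : ℕ) : ℝ)) * uPoly θ ^ p * vPoly θ ^ q * this
  have key2 : (C (q : ℝ)) * uPoly θ ^ p * vPoly θ ^ q * (C (2 - 2 * c ^ 2))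
      - 2 * X * (uPoly θ ^ p * (C (q : ℝ) * vPoly θ ^ (q - 1) * (C σ)))
      = C (2 * σ * c) * (C (q : ℝ) * (uPoly θ ^ (p + 1) * vPoly θ ^ (q - 1))) := by
    rcases q with _ | q
    · simp
    · simp only [Nat.add_sub_cancel]
      have : vPoly θ * C (2 - 2 * c ^ 2) - 2 * X * C σ = C (2 * σ * c) * uPoly θ := by
        simp only [uPoly, vPoly, ← hσ, ← hc, C_mul, C_pow, C_sub]
        have h2 : (C (2 : ℝ) : ℝ[X]) = 2 := rfl
        rw [h2]
        linear_combination (-2 * C c) * hCsc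
      linear_combination (C ((q + 1 : ℕ) : ℝ)) * uPoly θ ^ p * vPoly θ ^ q * this
  have key : C ((p : ℝ) + q + (p - q) * Real.cos θ) * (uPoly θ ^ p * vPoly θ ^ q)
      - 2 * (X * derivative (uPoly θ ^ p * vPoly θ ^ q))
      = C (Real.sin θ) * (C (p : ℝ) * (uPoly θ ^ (p - 1) * vPoly θ ^ (q + 1))
        + C (q : ℝ) * (uPoly θ ^ (p + 1) * vPoly θ ^ (q - 1))) := by
    rw [derivative_mul, derivative_pow, derivative_pow, hu, hv, hsin]
    have : C ((p : ℝ) + q + (p - q) * Real.cos θ)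
        = C (p : ℝ) * C (2 * c ^ 2) + C (q : ℝ) * C (2 - 2 * c ^ 2) := by
      rw [hcos, ← C_mul, ← C_mul, ← C_add]; congr 1; ring
    rw [this]
    linear_combination key1 + key2
  have hk := congrArg (fun P : ℝ[X] => P.coeff k) key
  have hX : (X * derivative (uPoly θ ^ p * vPoly θ ^ q)).coeff k
      = k * (uPoly θ ^ p * vPoly θ ^ q).coeff k := by
    rcases k with _ | k
    · simp
    · rw [coeff_X_mul, coeff_derivative]; push_cast; ring
  have h2 : (2 : ℝ[X]) = C 2 := rfl
  simp only [coeff_sub, coeff_C_mul, coeff_add, h2, hX] at hk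
  simp only [wigG]
  linear_combination hk

theorem wigG_zero (p q k : ℕ) : wigG p q k 0 = if k = p then (-1) ^ p else 0 := by
  have hu : uPoly 0 ^ p = C ((-1) ^ p) * X ^ p := by
    simp [uPoly, neg_pow (X : ℝ[X])]
  have hv : vPoly 0 = 1 := by simp [vPoly]
  rw [wigG, hu, hv, one_pow, mul_one, coeff_C_mul, coeff_X_pow]
  simp

end Wigner

end

section

/-! ### Normalised Wigner functions: ladder relations and orthogonality -/

section WignerNormalised

open Polynomial

/-- The normalising factor of the Wigner functions. -/
noncomputable def wigNu (N k p : ℕ) : ℝ :=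
  Real.sqrt ((k.factorial * (N - k).factorial : ℝ) / (p.factorial * (N - p).factorial))

/-- The normalised Wigner functions. -/
noncomputable def wigE (N k p : ℕ) (θ : ℝ) : ℝ :=
  if p ≤ N then wigNu N k p * wigG p (N - p) k θ else 0

/-- The ladder constants. -/
noncomputable def wigA (N p : ℕ) : ℝ := Real.sqrt (p * (N + 1 - p))

theorem wigA_zero (N : ℕ) : wigA N 0 = 0 := by simp [wigA]

theorem wigA_top (N : ℕ) : wigA N (N + 1) = 0 := by simp [wigA]

/-- The radicand is non-positive there and the real square root vanishes. This lets the ladder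
relations hold for every p, without a range condition. -/
theorem wigA_of_lt {N p : ℕ} (h : N < p) : wigA N p = 0 := by
  refine Real.sqrt_eq_zero_of_nonpos (mul_nonpos_of_nonneg_of_nonpos (by positivity) ?_)
  have : (N : ℝ) + 1 ≤ p := by exact_mod_cast h
  linarith

theorem wigA_nonneg (N p : ℕ) : 0 ≤ wigA N p := Real.sqrt_nonneg _

theorem wigA_pos {N p : ℕ} (h1 : 1 ≤ p) (h2 : p ≤ N) : 0 < wigA N p := by
  refine Real.sqrt_pos.2 (mul_pos (by exact_mod_cast h1) ?_)
  have : (p : ℝ) ≤ N := by exact_mod_cast h2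
  linarith

theorem wigA_sq {N p : ℕ} (h : p ≤ N) : wigA N p ^ 2 = p * (N + 1 - p) := by
  refine Real.sq_sqrt (mul_nonneg (by positivity) ?_)
  have : (p : ℝ) ≤ N := by exact_mod_cast h
  linarith

theorem wigA_le (N p : ℕ) : wigA N p ≤ N + 1 := by
  refine Real.sqrt_le_iff.2 ⟨by positivity, ?_⟩
  nlinarith [sq_nonneg ((p : ℝ)), sq_nonneg ((N : ℝ) + 1 - p), sq_nonneg ((N : ℝ) + 1 - 2 * p)]

theorem wigNu_down {N p : ℕ} (k : ℕ) (h : p + 1 ≤ N) :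
    wigNu N k (p + 1) * (p + 1) = wigA N (p + 1) * wigNu N k p := by
  have hp : (0 : ℝ) ≤ p + 1 := by positivity
  obtain ⟨d, rfl⟩ := Nat.exists_eq_add_of_le h
  have e1 : p + 1 + d - p = d + 1 := by omega
  have e2 : p + 1 + d - (p + 1) = d := by omega
  rw [wigNu, wigNu, wigA, ← Real.sqrt_mul' _ (by positivity), ← Real.sqrt_sq hp,
    ← Real.sqrt_mul (by positivity), e1, e2, Nat.factorial_succ, Nat.factorial_succ]
  congr 1
  push_cast
  field_simp
  ring

theorem wigNu_up {N p : ℕ} (k : ℕ) (h : p + 1 ≤ N) :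
    wigNu N k p * (N - p) = wigA N (p + 1) * wigNu N k (p + 1) := by
  obtain ⟨d, rfl⟩ := Nat.exists_eq_add_of_le h
  have e1 : p + 1 + d - p = d + 1 := by omega
  have e2 : p + 1 + d - (p + 1) = d := by omega
  have hp : (0 : ℝ) ≤ d + 1 := by positivity
  have e3 : ((p + 1 + d : ℕ) : ℝ) - p = d + 1 := by push_cast; ring
  rw [e3, wigNu, wigNu, wigA, ← Real.sqrt_mul' _ (by positivity), ← Real.sqrt_sq hp,
    ← Real.sqrt_mul (by positivity), e1, e2, Nat.factorial_succ, Nat.factorial_succ]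
  congr 1
  push_cast
  field_simp
  ring

theorem wigE_lower {N p : ℕ} (k : ℕ) (θ : ℝ) (h : p ≤ N) :
    wigNu N k p * (p * wigG (p - 1) (N - p + 1) k θ) = wigA N p * wigE N k (p - 1) θ := by
  rcases p with _ | p
  · simp [wigA_zero]
  · rw [Nat.add_sub_cancel, wigE, if_pos (by omega)]
    have : N - (p + 1) + 1 = N - p := by omega
    rw [this]
    have := wigNu_down k h
    push_cast
    linear_combination wigG p (N - p) k θ * this

theorem wigE_raise {N p : ℕ} (k : ℕ) (θ : ℝ) (h : p ≤ N) :
    wigNu N k p * ((N - p : ℕ) * wigG (p + 1) (N - p - 1) k θ)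
      = wigA N (p + 1) * wigE N k (p + 1) θ := by
  rcases h.eq_or_lt with rfl | h
  · simp [wigA_top]
  · rw [wigE, if_pos (by omega), Nat.cast_sub h.le]
    have := wigNu_up k (Nat.succ_le_of_lt h)
    rw [Nat.sub_sub]
    linear_combination wigG (p + 1) (N - (p + 1)) k θ * this

/-- With this normalisation both neighbours carry the symmetric constants `wigA`. The truncated
index p - 1 at p = 0 is harmless, as its constant is zero. -/
theorem hasDerivAt_wigE (N k p : ℕ) (θ : ℝ) :
    HasDerivAt (wigE N k p)
      (1 / 2 * (wigA N p * wigE N k (p - 1) θ - wigA N (p + 1) * wigE N k (p + 1) θ)) θ := by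
  by_cases h : p ≤ N
  · have hE : wigE N k p = fun x => wigNu N k p * wigG p (N - p) k x := by
      funext x; rw [wigE, if_pos h]
    rw [hE]
    refine ((hasDerivAt_wigG p (N - p) k θ).const_mul (wigNu N k p)).congr_deriv ?_
    rw [← wigE_lower k θ h, ← wigE_raise k θ h]
    ring
  · have hE : wigE N k p = fun x => 0 := by
      funext x; rw [wigE, if_neg h]
    rw [hE, wigA_of_lt (by omega), wigA_of_lt (by omega)]
    simpa using hasDerivAt_const θ (0 : ℝ)

theorem wigE_ladder (N k p : ℕ) (θ : ℝ) :
    ((N : ℝ) - 2 * k + (2 * p - N) * Real.cos θ) * wigE N k p θ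
      = Real.sin θ * (wigA N p * wigE N k (p - 1) θ + wigA N (p + 1) * wigE N k (p + 1) θ) := by
  by_cases h : p ≤ N
  · rw [← wigE_lower k θ h, ← wigE_raise k θ h, wigE, if_pos h]
    have := wigG_ladder p (N - p) k θ
    rw [Nat.cast_sub h] at this ⊢
    linear_combination wigNu N k p * this
  · rw [wigE, if_neg h, wigA_of_lt (by omega), wigA_of_lt (by omega)]
    simp

theorem continuous_wigE (N k p : ℕ) : Continuous (wigE N k p) :=
  continuous_iff_continuousAt.2 fun θ => (hasDerivAt_wigE N k p θ).continuousAt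

/-- The rotation acts orthogonally: by the ladder formula the derivative of the sum telescopes to
boundary terms with constants `wigA N 0` and `wigA N (N + 1)`, both zero. At θ = 0 only p = k
contributes. -/
theorem sum_wigE_sq {N k : ℕ} (hk : k ≤ N) (θ : ℝ) :
    ∑ p ∈ Finset.range (N + 1), wigE N k p θ ^ 2 = 1 := by
  have hd : ∀ x, HasDerivAt (fun x => ∑ p ∈ Finset.range (N + 1), wigE N k p x ^ 2) 0 x := by
    intro x
    have h := HasDerivAt.fun_sum (u := Finset.range (N + 1)) fun p _ =>
      (hasDerivAt_wigE N k p x).pow 2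
    simp only [Pi.pow_def] at h
    refine h.congr_deriv ?_
    have : ∀ p ∈ Finset.range (N + 1), ((2 : ℕ) : ℝ) * wigE N k p x ^ (2 - 1) *
        (1 / 2 * (wigA N p * wigE N k (p - 1) x - wigA N (p + 1) * wigE N k (p + 1) x))
        = (fun p => - (wigA N p * wigE N k (p - 1) x * wigE N k p x)) (p + 1)
          - (fun p => - (wigA N p * wigE N k (p - 1) x * wigE N k p x)) p := by
      intro p _
      simp only [Nat.add_sub_cancel]
      push_cast
      ring
    rw [Finset.sum_congr rfl this,
      Finset.sum_range_sub fun p => - (wigA N p * wigE N k (p - 1) x * wigE N k p x)]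
    simp [wigA_top, wigA_zero]
  have hc := is_const_of_deriv_eq_zero (fun x => (hd x).differentiableAt) (fun x => (hd x).deriv)
    θ 0
  rw [hc, Finset.sum_eq_single k]
  · rw [wigE, if_pos hk, wigG_zero, if_pos rfl, wigNu, div_self (by positivity)]
    simp [← pow_mul]
  · intro p hp hpk
    rw [wigE, if_pos (by simpa [Nat.lt_succ_iff] using hp), wigG_zero, if_neg (Ne.symm hpk)]
    simp
  · intro h
    exact absurd (Finset.mem_range.2 (by omega)) h

theorem abs_wigE_le {N k : ℕ} (hk : k ≤ N) (p : ℕ) (θ : ℝ) : |wigE N k p θ| ≤ 1 := by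
  by_cases h : p ≤ N
  · rw [← sq_le_one_iff_abs_le_one, ← sum_wigE_sq hk θ]
    exact Finset.single_le_sum (f := fun p => wigE N k p θ ^ 2) (fun _ _ => sq_nonneg _)
      (Finset.mem_range.2 (by omega))
  · simp [wigE, h]

/-- The overlap integral of two Wigner functions. -/
noncomputable def wigJ (N k p N' k' p' : ℕ) : ℝ :=
  ∫ θ in (0 : ℝ)..π, Real.sin θ * (wigE N k p θ * wigE N' k' p' θ)

theorem wigJ_comm (N k p N' k' p' : ℕ) : wigJ N k p N' k' p' = wigJ N' k' p' N k p := by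
  simp only [wigJ]
  congr 1
  funext θ
  ring

/-- Integrate the derivative of sin θ · E_{p+1} · E'_{p'}; the boundary terms vanish with sin θ. The
hypotheses say that the azimuthal numbers and the spin weights of the two functions agree, which
makes the terms with cot θ and 1/sin θ cancel. -/
theorem wigJ_ladder {N k p N' k' p' : ℕ} (h1 : (N : ℝ) - 2 * k = N' - 2 * k')
    (h2 : 2 * (p : ℝ) - N = 2 * p' - N') :
    wigA N (p + 1) * wigJ N k p N' k' p' = wigA N' (p' + 1) * wigJ N k (p + 1) N' k' (p' + 1) := by
  have hd : ∀ θ, HasDerivAt (fun θ => Real.sin θ * (wigE N k (p + 1) θ * wigE N' k' p' θ))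
      (wigA N (p + 1) * (Real.sin θ * (wigE N k p θ * wigE N' k' p' θ))
        - wigA N' (p' + 1) * (Real.sin θ * (wigE N k (p + 1) θ * wigE N' k' (p' + 1) θ))) θ := by
    intro θ
    refine ((Real.hasDerivAt_sin θ).mul
      ((hasDerivAt_wigE N k (p + 1) θ).mul (hasDerivAt_wigE N' k' p' θ))).congr_deriv ?_
    have l1 := wigE_ladder N k (p + 1) θ
    have l2 := wigE_ladder N' k' p' θ
    have h2' : 2 * ((p + 1 : ℕ) : ℝ) - N = 2 * p' - N' + 2 := by push_cast; linarith
    rw [h1, h2'] at l1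
    simp only [Nat.add_sub_cancel, Pi.mul_apply] at *
    linear_combination (1 / 2) * wigE N' k' p' θ * l1 - (1 / 2) * wigE N k (p + 1) θ * l2
  have hi := intervalIntegral.integral_eq_sub_of_hasDerivAt (a := 0) (b := π)
    (fun θ _ => hd θ) (Continuous.intervalIntegrable (by
      have := continuous_wigE; fun_prop) _ _)
  rw [intervalIntegral.integral_sub, intervalIntegral.integral_const_mul,
    intervalIntegral.integral_const_mul] at hi
  · simp only [Real.sin_pi, Real.sin_zero, zero_mul, sub_zero] at hi
    simp only [wigJ]
    linarith
  · exact Continuous.intervalIntegrable (by have := continuous_wigE; fun_prop) _ _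
  · exact Continuous.intervalIntegrable (by have := continuous_wigE; fun_prop) _ _

/-- By the ladder all N + 1 norms are equal, and by `sum_wigE_sq` they add up to ∫ sin θ = 2. -/
theorem wigJ_self {N k p : ℕ} (hk : k ≤ N) (hp : p ≤ N) : wigJ N k p N k p = 2 / (N + 1) := by
  have hstep : ∀ q, q ≤ N → wigJ N k q N k q = wigJ N k 0 N k 0 := by
    intro q
    induction q with
    | zero => intro _; rfl
    | succ q ih =>
      intro hq
      rw [← ih (by omega)]
      have := wigJ_ladder (N := N) (k := k) (p := q) (N' := N) (k' := k) (p' := q) rfl rfl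
      exact (mul_left_cancel₀ (wigA_pos (by omega) hq).ne' this).symm
  have hsum : ∑ q ∈ Finset.range (N + 1), wigJ N k q N k q = 2 := by
    simp only [wigJ]
    rw [← intervalIntegral.integral_finsetSum]
    · simp only [← Finset.mul_sum, ← sq, sum_wigE_sq hk]
      simp [integral_sin]
      norm_num
    · intro q _
      exact Continuous.intervalIntegrable (by have := continuous_wigE; fun_prop) _ _
  rw [Finset.sum_congr rfl fun q hq => hstep q (by simpa [Nat.lt_succ_iff] using hq)] at hsum
  rw [hstep p hp, eq_div_iff (by positivity)]
  simp only [Finset.sum_const, Finset.card_range, nsmul_eq_mul] at hsum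
  push_cast at hsum
  linarith

/-- The usual argument for distinct eigenvalues, in factorised form: moving one ladder step across
the integral in both orders gives (a² - b²)J = 0, and a², b² are the eigenvalues ℓ(ℓ+1) - 2. -/
theorem wigJ_orthogonal {n n' k k' : ℕ} (hn : n ≠ n') (h : (n : ℤ) + 2 - k = n' + 2 - k') :
    wigJ (2 * (n + 2)) k (n + 4) (2 * (n' + 2)) k' (n' + 4) = 0 := by
  have hr : (n : ℝ) + 2 - k = n' + 2 - k' := by exact_mod_cast h
  have e1 := wigJ_ladder (N := 2 * (n + 2)) (k := k) (p := n + 3) (N' := 2 * (n' + 2)) (k' := k')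
    (p' := n' + 3) (by push_cast; linarith) (by push_cast; ring)
  have e2 := wigJ_ladder (N := 2 * (n' + 2)) (k := k') (p := n' + 3) (N' := 2 * (n + 2)) (k' := k)
    (p' := n + 3) (by push_cast; linarith) (by push_cast; ring)
  rw [wigJ_comm, wigJ_comm (2 * (n' + 2)) k' (n' + 3 + 1)] at e2
  simp only [show n + 3 + 1 = n + 4 from rfl, show n' + 3 + 1 = n' + 4 from rfl] at e1 e2
  have p1 := wigA_pos (N := 2 * (n + 2)) (p := n + 4) (by omega) (by omega)
  have p2 := wigA_pos (N := 2 * (n' + 2)) (p := n' + 4) (by omega) (by omega)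
  have s1 := wigA_sq (N := 2 * (n + 2)) (p := n + 4) (by omega)
  have s2 := wigA_sq (N := 2 * (n' + 2)) (p := n' + 4) (by omega)
  set a := wigA (2 * (n + 2)) (n + 4)
  set b := wigA (2 * (n' + 2)) (n' + 4)
  set J := wigJ (2 * (n + 2)) k (n + 4) (2 * (n' + 2)) k' (n' + 4)
  have h3 : (a ^ 2 - b ^ 2) * J = 0 := by
    linear_combination b * e1 - a * e2
  have h4 : a ^ 2 - b ^ 2 = ((n : ℝ) - n') * (n + n' + 5) := by
    rw [s1, s2]; push_cast; ring
  rcases mul_eq_zero.1 h3 with h5 | h5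
  · rw [h4] at h5
    rcases mul_eq_zero.1 h5 with h6 | h6
    · exact absurd (by exact_mod_cast sub_eq_zero.1 h6) hn
    · exact absurd h6 (by positivity)
  · exact h5

end WignerNormalised

end

section

/-! ### Rodrigues' formula and the spin-weighted harmonics -/

section Rodrigues

open Polynomial

theorem reflect_uPoly_pow (θ : ℝ) (p : ℕ) :
    reflect p (uPoly θ ^ p) = (C (Real.sin (θ / 2)) * X - C (Real.cos (θ / 2))) ^ p ∧
      (uPoly θ ^ p).natDegree ≤ p := by
  have hd : (uPoly θ).natDegree ≤ 1 := by
    rw [uPoly]; compute_degree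
  have h1 : reflect 1 (uPoly θ) = C (Real.sin (θ / 2)) * X - C (Real.cos (θ / 2)) := by
    ext i
    rcases i with _ | _ | i
    · simp [uPoly]
    · simp [uPoly]
    · simp [uPoly]
  induction p with
  | zero => simp
  | succ p ih =>
    refine ⟨?_, (natDegree_pow_le_of_le _ hd).trans (by omega)⟩
    rw [pow_succ, reflect_mul _ _ ih.2 hd, ih.1, h1, pow_succ]

theorem reflect_vPoly_pow (θ : ℝ) (p : ℕ) :
    reflect p (vPoly θ ^ p) = (C (Real.cos (θ / 2)) * X + C (Real.sin (θ / 2))) ^ p ∧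
      (vPoly θ ^ p).natDegree ≤ p := by
  have hd : (vPoly θ).natDegree ≤ 1 := by
    rw [vPoly]; compute_degree
  have h1 : reflect 1 (vPoly θ) = C (Real.cos (θ / 2)) * X + C (Real.sin (θ / 2)) := by
    ext i
    rcases i with _ | _ | i
    · simp [vPoly]
    · simp [vPoly]
    · simp [vPoly]
  induction p with
  | zero => simp
  | succ p ih =>
    refine ⟨?_, (natDegree_pow_le_of_le _ hd).trans (by omega)⟩
    rw [pow_succ, reflect_mul _ _ ih.2 hd, ih.1, h1, pow_succ]

/-- Reversing the coefficients of u^p v^q and substituting z ↦ -z exchanges the two linear forms up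
to sign. This is the symmetry under simultaneous change of sign of m and of the spin weight. -/
theorem wigG_reflect {p q k : ℕ} (hk : k ≤ p + q) (θ : ℝ) :
    wigG p q k θ = (-1) ^ (p + q - k + p) * wigG q p (p + q - k) θ := by
  have hu := reflect_uPoly_pow θ p
  have hv := reflect_vPoly_pow θ q
  have h1 : wigG p q k θ = ((C (Real.sin (θ / 2)) * X - C (Real.cos (θ / 2))) ^ p
      * (C (Real.cos (θ / 2)) * X + C (Real.sin (θ / 2))) ^ q).coeff (p + q - k) := by
    rw [← hu.1, ← hv.1, ← reflect_mul _ _ hu.2 hv.2, coeff_reflect, wigG,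
      revAt_le (Nat.sub_le _ _)]
    congr 1
    omega
  have h2 : (uPoly θ ^ q * vPoly θ ^ p).comp (C (-1) * X)
      = C ((-1) ^ p) * ((C (Real.sin (θ / 2)) * X - C (Real.cos (θ / 2))) ^ p
      * (C (Real.cos (θ / 2)) * X + C (Real.sin (θ / 2))) ^ q) := by
    have e : (vPoly θ).comp (C (-1) * X)
        = C (-1) * (C (Real.sin (θ / 2)) * X - C (Real.cos (θ / 2))) := by
      simp [vPoly]; ring
    have e' : (uPoly θ).comp (C (-1) * X)
        = C (Real.cos (θ / 2)) * X + C (Real.sin (θ / 2)) := by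
      simp [uPoly]; ring
    rw [mul_comp, pow_comp, pow_comp, e, e', mul_pow, ← C_pow]
    ring
  have h3 := congrArg (fun P : ℝ[X] => P.coeff (p + q - k)) h2
  simp only [comp_C_mul_X_coeff, coeff_C_mul] at h3
  rw [h1, wigG, pow_add]
  have hs : ((-1 : ℝ) ^ p) ^ 2 = 1 := by rw [← pow_mul, mul_comm, pow_mul]; simp
  linear_combination (-(-1) ^ p) * h3 - ((C (Real.sin (θ / 2)) * X - C (Real.cos (θ / 2))) ^ p
      * (C (Real.cos (θ / 2)) * X + C (Real.sin (θ / 2))) ^ q).coeff (p + q - k) * hs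

/-- Taylor expand (1-x)^a (1+x)^b at cos θ with step 2σc z, where σ and c are the half-angle sine
and cosine: 1 - x becomes 2σ u and 1 + x becomes 2c v, so the n-th Taylor coefficient is a Wigner
function up to powers of 2σ and 2c. -/
theorem eval_iterate_derivative_rodrigues (a b n : ℕ) (θ : ℝ) :
    Polynomial.eval (Real.cos θ) (Polynomial.derivative^[n]
        ((1 - Polynomial.X) ^ a * (1 + Polynomial.X) ^ b : ℝ[X]))
      * (2 * Real.sin (θ / 2) * Real.cos (θ / 2)) ^ n
      = n.factorial * ((2 * Real.sin (θ / 2)) ^ a * (2 * Real.cos (θ / 2)) ^ b)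
        * wigG a b n θ := by
  set σ := Real.sin (θ / 2) with hσ
  set c := Real.cos (θ / 2) with hc
  have hsc : σ ^ 2 + c ^ 2 = 1 := Real.sin_sq_add_cos_sq _
  have hcos : Real.cos θ = 2 * c ^ 2 - 1 := by
    rw [hc, ← Real.cos_two_mul]; congr 1; ring
  set P : ℝ[X] := (1 - X) ^ a * (1 + X) ^ b with hP
  have h1 : (derivative^[n] P).eval (Real.cos θ)
      = n.factorial * (taylor (Real.cos θ) P).coeff n := by
    rw [taylor_coeff, ← factorial_smul_hasseDeriv]
    simp
  have h2 : (taylor (Real.cos θ) P).comp (C (2 * σ * c) * X)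
      = C ((2 * σ) ^ a * (2 * c) ^ b) * (uPoly θ ^ a * vPoly θ ^ b) := by
    have e1 : ((1 : ℝ[X]) - (C (2 * σ * c) * X + C (Real.cos θ))) = C (2 * σ) * uPoly θ := by
      have : (1 : ℝ[X]) - C (Real.cos θ) = C (2 * σ) * C σ := by
        rw [← C_1, ← C_sub, ← C_mul]; congr 1; rw [hcos]; linear_combination (-2) * hsc
      rw [uPoly, ← hσ, ← hc, C_mul (a := 2 * σ)]
      linear_combination this
    have e2 : ((1 : ℝ[X]) + (C (2 * σ * c) * X + C (Real.cos θ))) = C (2 * c) * vPoly θ := by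
      have : (1 : ℝ[X]) + C (Real.cos θ) = C (2 * c) * C c := by
        rw [← C_1, ← C_add, ← C_mul]; congr 1; rw [hcos]; ring
      have h3 : C (2 * σ * c) = C (2 * c) * C σ := by rw [← C_mul]; congr 1; ring
      rw [vPoly, ← hσ, ← hc, h3]
      linear_combination this
    rw [taylor_apply, comp_assoc, hP, mul_comp, pow_comp, pow_comp, sub_comp, add_comp]
    simp only [one_comp, X_comp, add_comp, C_comp]
    rw [e1, e2, mul_pow, mul_pow, C_mul (a := (2 * σ) ^ a), C_pow, C_pow]
    ring
  have h3 := congrArg (fun P : ℝ[X] => P.coeff n) h2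
  simp only [comp_C_mul_X_coeff, coeff_C_mul] at h3
  rw [h1, wigG]
  linear_combination (n.factorial : ℝ) * h3

/-- The real spin weighted harmonics of spin weight `j - 2`, for `ℓ = n + 2`. -/
noncomputable def harm (m : ℤ) (n j : ℕ) (θ : ℝ) : ℝ :=
  (if m < 0 then (-1 : ℝ) ^ m else 1) * Real.sqrt ((2 * (n + 2) + 1) / (4 * π))
    * wigE (2 * (n + 2)) ((n : ℤ) + 2 - m).toNat (n + j) θ

/-- The singular prefactors in Rodrigues' formula are exactly those left over by
`eval_iterate_derivative_rodrigues`; with k = ℓ - m and k' = ℓ + m only the powers of 2 and the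
factorials under the root remain to be compared. The right side is smooth through the poles. -/
theorem S_eq_harm {m : ℤ} {n : ℕ} (h1 : -((n : ℤ) + 2) ≤ m) (h2 : m ≤ (n : ℤ) + 2) {θ : ℝ}
    (hθ : θ ∈ Ioo 0 π) : S m (n + 2) θ = harm m n 4 θ := by
  obtain ⟨k, hk⟩ := Int.eq_ofNat_of_zero_le (sub_nonneg.2 h2)
  obtain ⟨k', hk'⟩ := Int.eq_ofNat_of_zero_le (a := (n : ℤ) + 2 + m) (by omega)
  have hσ : 0 < Real.sin (θ / 2) :=
    Real.sin_pos_of_pos_of_lt_pi (by linarith [hθ.1]) (by linarith [hθ.2, Real.pi_pos])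
  have hc : 0 < Real.cos (θ / 2) :=
    Real.cos_pos_of_mem_Ioo ⟨by linarith [hθ.1, Real.pi_pos], by linarith [hθ.2]⟩
  have hR := eval_iterate_derivative_rodrigues (n + 2 + 2) n k θ
  have e1 : ((n + 2 : ℕ) : ℤ) - m = k := by push_cast; exact hk
  have e2 : ((n + 2 : ℕ) : ℤ) + m = k' := by push_cast; exact hk'
  have e3 : 2 * (n + 2) - k = k' := by omega
  have e4 : 2 * (n + 2) - (n + 4) = n := by omega
  have e5 : -(m + 2) = (k : ℤ) - (n + 4) := by omega
  have e6 : -(m - 2) = (k : ℤ) - n := by omega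
  rw [S, harm, wigE, if_pos (show n + 4 ≤ 2 * (n + 2) by omega), hk, wigNu]
  simp only [e1, e2, Int.toNat_natCast, e3, e4, e5, e6, Nat.add_sub_cancel]
  set σ := Real.sin (θ / 2)
  set c := Real.cos (θ / 2)
  set R := Polynomial.eval (Real.cos θ) (Polynomial.derivative^[k]
        ((1 - Polynomial.X) ^ (n + 2 + 2) * (1 + Polynomial.X) ^ n : ℝ[X]))
  have hs : Real.sqrt ((2 * ((n + 2 : ℕ) : ℝ) + 1) / (4 * π) * (k'.factorial : ℝ)
        / ((k.factorial : ℝ) * ((n + 2 + 2).factorial : ℝ) * (n.factorial : ℝ))) * k.factorial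
      = Real.sqrt ((2 * (n + 2) + 1) / (4 * π))
        * Real.sqrt ((k.factorial * k'.factorial : ℝ) / ((n + 4).factorial * n.factorial)) := by
    rw [← Real.sqrt_mul (by positivity)]
    have hk0 : (0 : ℝ) ≤ k.factorial := by positivity
    nth_rewrite 2 [← Real.sqrt_sq hk0]
    rw [← Real.sqrt_mul' _ (by positivity)]
    congr 1
    push_cast
    field_simp
  have hz : (2 : ℝ) ^ (-(k' : ℤ)) * σ ^ ((k : ℤ) - (n + 4)) * c ^ ((k : ℤ) - n) * R
      = k.factorial * wigG (n + 4) n k θ := by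
    have hkk : (2 : ℝ) ^ (n + 4) * 2 ^ n = 2 ^ k * 2 ^ k' := by
      rw [← pow_add, ← pow_add]; congr 1; omega
    rw [zpow_neg, zpow_sub₀ hσ.ne', zpow_sub₀ hc.ne', zpow_natCast, zpow_natCast, zpow_natCast,
      zpow_natCast, show ((n : ℤ) + 4) = ((n + 4 : ℕ) : ℤ) by push_cast; rfl, zpow_natCast]
    rw [mul_pow, mul_pow, mul_pow, mul_pow] at hR
    have h2k : (2 : ℝ) ^ k ≠ 0 := by positivity
    have hR' : R * (σ ^ k * c ^ k) = k.factorial * (2 ^ k' * (σ ^ (n + 4) * c ^ n))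
        * wigG (n + 4) n k θ := by
      refine mul_left_cancel₀ h2k ?_
      linear_combination hR + (k.factorial : ℝ) * σ ^ (n + 4) * c ^ n * wigG (n + 4) n k θ * hkk
    field_simp
    linear_combination hR'
  linear_combination (if m < 0 then (-1 : ℝ) ^ m else 1) * Real.sqrt
    ((2 * ((n + 2 : ℕ) : ℝ) + 1) / (4 * π) * (k'.factorial : ℝ)
        / ((k.factorial : ℝ) * ((n + 2 + 2).factorial : ℝ) * (n.factorial : ℝ))) * hz
    + (if m < 0 then (-1 : ℝ) ^ m else 1) * wigG (n + 4) n k θ * hs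

/-- Thus S_{-mℓ} is the harmonic of spin weight -2 in the same ladder. The sign (-1)^m of the
reflection is absorbed by the sign convention for m < 0. -/
theorem harm_neg {m : ℤ} {n : ℕ} (h1 : -((n : ℤ) + 2) ≤ m) (h2 : m ≤ (n : ℤ) + 2) (θ : ℝ) :
    harm (-m) n 4 θ = harm m n 0 θ := by
  obtain ⟨k, hk⟩ := Int.eq_ofNat_of_zero_le (sub_nonneg.2 h2)
  obtain ⟨k', hk'⟩ := Int.eq_ofNat_of_zero_le (a := (n : ℤ) + 2 + m) (by omega)
  have hN : k + k' = 2 * (n + 2) := by omega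
  have e1 : 2 * (n + 2) - (n + 4) = n := by omega
  have e2 : 2 * (n + 2) - (n + 0) = n + 4 := by omega
  have e3 : 2 * (n + 2) - k = k' := by omega
  have e4 : 2 * (n + 2) - k' = k := by omega
  rw [harm, harm, hk, show (n : ℤ) + 2 - -m = Int.ofNat k' by rw [sub_neg_eq_add]; exact hk']
  simp only [Int.ofNat_eq_natCast, Int.toNat_natCast]
  rw [wigE, wigE, if_pos (show n + 4 ≤ 2 * (n + 2) by omega),
    if_pos (show n + 0 ≤ 2 * (n + 2) by omega), wigNu, wigNu, e1, e2, e3, e4,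
    wigG_reflect (p := n + 4) (q := n) (k := k') (by omega)]
  have e5 : n + 4 + n - k' = k := by omega
  have hsign : (if -m < 0 then (-1 : ℝ) ^ (-m) else 1) * (-1) ^ (k + (n + 4))
      = if m < 0 then (-1 : ℝ) ^ m else 1 := by
    have h3 : (-1 : ℝ) ^ (k + (n + 4)) = (-1 : ℝ) ^ m := by
      rw [← zpow_natCast]
      have : ((k + (n + 4) : ℕ) : ℤ) = m + 2 * (n + 3 - m) := by
        have : (k : ℤ) = n + 2 - m := by omega
        push_cast; rw [this]; ring
      rw [this, zpow_add₀ (by norm_num), zpow_mul]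
      simp
    rw [h3]
    rcases lt_trichotomy m 0 with h | h | h
    · rw [if_neg (by omega), if_pos h, one_mul]
    · subst h; simp
    · rw [if_pos (by omega), if_neg (by omega), ← zpow_add₀ (by norm_num)]; simp
  rw [e5, ← hsign]
  simp only [Nat.add_zero]
  rw [mul_comm (k'.factorial : ℝ), mul_comm ((n + 4).factorial : ℝ)]
  ring

end Rodrigues

end

section

/-! ### Density of polynomials in cos ϑ and of Fourier modes -/

section Completeness

open Polynomial

theorem natDegree_iterate_derivative_eq (P : ℝ[X]) (n : ℕ) :
    (derivative^[n] P).natDegree = P.natDegree - n := by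
  induction n with
  | zero => simp
  | succ n ih => rw [Function.iterate_succ_apply', natDegree_derivative, ih]; omega

theorem iterate_derivative_ne_zero {P : ℝ[X]} {n : ℕ} (hP : P ≠ 0) (hn : n ≤ P.natDegree) :
    derivative^[n] P ≠ 0 := by
  intro h
  have := congrArg (fun Q : ℝ[X] => Q.coeff (P.natDegree - n)) h
  simp only [coeff_iterate_derivative, Nat.sub_add_cancel hn, coeff_zero, nsmul_eq_mul,
    mul_eq_zero, Nat.cast_eq_zero, Nat.descFactorial_eq_zero_iff_lt] at this
  rcases this with h1 | h1
  · omega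
  · exact hP (leadingCoeff_eq_zero.1 h1)

/-- The factorisation of the polynomial in Rodrigues' formula. -/
theorem exists_rodrigues_factor {m : ℤ} {n : ℕ} (h1 : -((n : ℤ) + 2) ≤ m)
    (h2 : m ≤ (n : ℤ) + 2) : ∃ Q : ℝ[X],
      derivative^[((n + 2 : ℕ) - m : ℤ).toNat] ((1 - X) ^ (n + 2 + 2) * (1 + X) ^ (n + 2 - 2))
        = (1 - X) ^ (m + 2).toNat * (1 + X) ^ (m - 2).toNat * Q ∧
      Q.degree = ((n + 2 + m - (m + 2).toNat - (m - 2).toNat : ℤ).toNat : ℕ) := by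
  set k := ((n + 2 : ℕ) - m : ℤ).toNat with hk
  have hkm : (k : ℤ) = n + 2 - m := by rw [hk, Int.toNat_of_nonneg (by push_cast; omega)]; push_cast; ring
  set P : ℝ[X] := (1 - X) ^ (n + 2 + 2) * (1 + X) ^ (n + 2 - 2) with hP
  have d1 : (1 - X : ℝ[X]).natDegree = 1 := by
    rw [← natDegree_neg, neg_sub, ← C_1, natDegree_X_sub_C]
  have d2 : (1 + X : ℝ[X]).natDegree = 1 := by
    rw [add_comm, ← C_1, natDegree_X_add_C]
  have n1 : (1 - X : ℝ[X]) ≠ 0 := by intro h; rw [h] at d1; simp at d1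
  have n2 : (1 + X : ℝ[X]) ≠ 0 := by intro h; rw [h] at d2; simp at d2
  have hP0 : P ≠ 0 := mul_ne_zero (pow_ne_zero _ n1) (pow_ne_zero _ n2)
  have hPd : P.natDegree = 2 * (n + 2) := by
    rw [hP, natDegree_mul (pow_ne_zero _ n1) (pow_ne_zero _ n2), natDegree_pow, natDegree_pow,
      d1, d2]
    omega
  -- Each derivative lowers the order of a zero by at most one: k = ℓ - m derivatives of a zero of
  -- order ℓ + 2 leave order m + 2, and below `hdv2` gets ℓ - 2 - k = m - 2 at the other end.
  have hdv1 : (1 - X : ℝ[X]) ^ (m + 2).toNat ∣ derivative^[k] P := by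
    refine dvd_trans (pow_dvd_pow _ ?_) (pow_sub_dvd_iterate_derivative_of_pow_dvd k
      (Dvd.intro _ rfl : (1 - X) ^ (n + 2 + 2) ∣ P))
    omega
  have hdv2 : (1 + X : ℝ[X]) ^ (m - 2).toNat ∣ derivative^[k] P := by
    refine dvd_trans (pow_dvd_pow _ ?_) (pow_sub_dvd_iterate_derivative_of_pow_dvd k
      (Dvd.intro_left _ rfl : (1 + X) ^ (n + 2 - 2) ∣ P))
    omega
  have hcop : IsCoprime ((1 - X : ℝ[X]) ^ (m + 2).toNat) ((1 + X) ^ (m - 2).toNat) := by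
    refine IsCoprime.pow ⟨C (1 / 2), C (1 / 2), ?_⟩
    have : C (1 / 2 : ℝ) * 2 = (1 : ℝ[X]) := by
      rw [show (2 : ℝ[X]) = C 2 from rfl, ← C_mul]; norm_num
    linear_combination this
  obtain ⟨Q, hQ⟩ := hcop.mul_dvd hdv1 hdv2
  refine ⟨Q, hQ, ?_⟩
  have hne := iterate_derivative_ne_zero (n := k) hP0 (by rw [hPd]; omega)
  have hQ0 : Q ≠ 0 := by
    rintro rfl
    exact hne (by rw [hQ, mul_zero])
  have hdeg := natDegree_iterate_derivative_eq P k
  rw [hQ, hPd, natDegree_mul (mul_ne_zero (pow_ne_zero _ n1) (pow_ne_zero _ n2)) hQ0,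
    natDegree_mul (pow_ne_zero _ n1) (pow_ne_zero _ n2), natDegree_pow, natDegree_pow, d1, d2]
    at hdeg
  rw [degree_eq_natDegree hQ0]
  congr 1
  omega

/-- Weierstrass: h is uniformly close to a polynomial P in cos θ, and ∫ h² = ∫ h(h - P(cos θ)) is
then arbitrarily small. -/
theorem eq_zero_of_integral_polynomial_cos {h : ℝ → ℝ} (hc : ContinuousOn h (Icc 0 π))
    (hint : ∀ P : ℝ[X], ∫ θ in (0 : ℝ)..π, h θ * P.eval (Real.cos θ) = 0) :
    ∀ θ ∈ Icc 0 π, h θ = 0 := by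
  have hpi := Real.pi_pos
  have hIcc : uIcc 0 π = Icc 0 π := uIcc_of_le hpi.le
  obtain ⟨B, hB⟩ := isCompact_Icc.exists_bound_of_continuousOn hc
  have hB0 : 0 ≤ B := (norm_nonneg _).trans (hB 0 ⟨le_rfl, hpi.le⟩)
  have hcos : ContinuousOn (fun x => h (Real.arccos x)) (Icc (-1) 1) :=
    hc.comp Real.continuous_arccos.continuousOn fun x _ => ⟨Real.arccos_nonneg x, Real.arccos_le_pi x⟩
  have hsq : ∫ θ in (0 : ℝ)..π, h θ * h θ ≤ 0 := by
    refine le_of_forall_pos_le_add fun ε hε => ?_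
    obtain ⟨P, hP⟩ := exists_polynomial_near_of_continuousOn (-1) 1 _ hcos (ε / (π * (B + 1)))
      (by positivity)
    have h1 : ∫ θ in (0 : ℝ)..π, h θ * h θ
        = ∫ θ in (0 : ℝ)..π, (h θ * h θ - h θ * P.eval (Real.cos θ)) := by
      rw [intervalIntegral.integral_sub, hint P, sub_zero]
      · exact ContinuousOn.intervalIntegrable (by rw [hIcc]; exact hc.mul hc)
      · refine ContinuousOn.intervalIntegrable ?_
        rw [hIcc]
        exact hc.mul (P.continuous.comp Real.continuous_cos).continuousOn
    rw [h1, zero_add]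
    have h2 := intervalIntegral.norm_integral_le_of_norm_le_const (a := 0) (b := π)
      (f := fun θ => h θ * h θ - h θ * P.eval (Real.cos θ)) (C := B * (ε / (π * (B + 1)))) ?_
    · refine (le_abs_self _).trans (h2.trans ?_)
      rw [sub_zero, abs_of_pos hpi]
      have : B * (ε / (π * (B + 1))) * π = ε * (B / (B + 1)) := by field_simp
      rw [this]
      exact mul_le_of_le_one_right hε.le ((div_le_one (by positivity)).2 (by linarith))
    · intro θ hθ
      rw [uIoc_of_le hpi.le] at hθ
      have hθ' : θ ∈ Icc 0 π := ⟨hθ.1.le, hθ.2⟩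
      rw [← mul_sub, norm_mul]
      refine mul_le_mul (hB θ hθ') ?_ (norm_nonneg _) hB0
      have := hP (Real.cos θ) ⟨Real.neg_one_le_cos θ, Real.cos_le_one θ⟩
      rw [Real.arccos_cos hθ'.1 hθ'.2] at this
      rw [Real.norm_eq_abs, abs_sub_comm]
      exact this.le
  by_contra hne
  push Not at hne
  obtain ⟨θ, hθ, hne⟩ := hne
  exact absurd hsq (not_le.2 (intervalIntegral.integral_pos hpi (hc.mul hc)
    (fun x _ => mul_self_nonneg _) ⟨θ, hθ, mul_self_pos.2 hne⟩))

/-- The Fourier coefficients vanish, hence are summable, so the Fourier series converges pointwise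
to f; its sum is 0. -/
theorem eq_zero_of_fourier {f : ℝ → ℂ} (hf : Continuous f) (hp : ∀ x, f (x + 2 * π) = f x)
    (hint : ∀ m : ℤ, ∫ x in (0 : ℝ)..(2 * π), f x * Complex.exp (-(Complex.I * m * x)) = 0) :
    ∀ x, f x = 0 := by
  have : Fact (0 < 2 * π) := ⟨by positivity⟩
  have hper : Function.Periodic f (2 * π) := hp
  let g : C(AddCircle (2 * π), ℂ) := ⟨hper.lift, by
    exact continuous_coinduced_dom.2 hf⟩
  have hg : ∀ x : ℝ, g x = f x := fun x => hper.lift_coe x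
  have hcoef : ∀ m : ℤ, fourierCoeff g m = 0 := by
    intro m
    rw [fourierCoeff_eq_intervalIntegral _ _ 0, zero_add]
    have : ∫ x in (0 : ℝ)..(2 * π), (fourier (-m) (x : AddCircle (2 * π))) • g x = 0 := by
      rw [← hint m]
      congr 1
      funext x
      rw [hg, fourier_coe_apply, smul_eq_mul, mul_comm]
      congr 2
      push_cast
      have : (π : ℂ) ≠ 0 := by exact_mod_cast Real.pi_ne_zero
      field_simp
    rw [this, smul_zero]
  have hs : Summable (fourierCoeff g) := by
    rw [show fourierCoeff g = fun _ => 0 from funext hcoef]; exact summable_zero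
  intro x
  have := has_pointwise_sum_fourier_series_of_summable hs (x : AddCircle (2 * π))
  simp only [hcoef, zero_smul] at this
  rw [← hg]
  exact this.unique hasSum_zero

end Completeness

end

section

/-! ### Completeness in ϑ of the harmonics at fixed azimuthal number -/

section HarmonicCompleteness

open Polynomial

theorem sin_half_pos {θ : ℝ} (hθ : θ ∈ Ioo 0 π) : 0 < Real.sin (θ / 2) :=
  Real.sin_pos_of_pos_of_lt_pi (by linarith [hθ.1]) (by linarith [hθ.2, Real.pi_pos])

theorem cos_half_pos {θ : ℝ} (hθ : θ ∈ Ioo 0 π) : 0 < Real.cos (θ / 2) :=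
  Real.cos_pos_of_mem_Ioo ⟨by linarith [hθ.1, Real.pi_pos], by linarith [hθ.2]⟩

/-- Isolates a weight that depends on m only; what varies with ℓ is a polynomial in cos θ of degree
ℓ - max(|m|, 2). -/
theorem exists_S_factor {m : ℤ} {n : ℕ} (h1 : -((n : ℤ) + 2) ≤ m) (h2 : m ≤ (n : ℤ) + 2) :
    ∃ (K : ℝ) (Q : ℝ[X]), K ≠ 0 ∧
      Q.degree = ((n + 2 + m - (m + 2).toNat - (m - 2).toNat : ℤ).toNat : ℕ) ∧
      ∀ θ ∈ Ioo 0 π, S m (n + 2) θ = K * (Real.sin (θ / 2) ^ (m + 2).natAbs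
        * Real.cos (θ / 2) ^ (m - 2).natAbs * Q.eval (Real.cos θ)) := by
  obtain ⟨Q, hQ, hdeg⟩ := exists_rodrigues_factor h1 h2
  refine ⟨(if m < 0 then (-1 : ℝ) ^ m else 1)
    * Real.sqrt ((2 * (n + 2 : ℕ) + 1) / (4 * π)
        * (Nat.factorial ((n + 2 : ℕ) + m).toNat : ℝ)
        / ((Nat.factorial ((n + 2 : ℕ) - m).toNat : ℝ) * (Nat.factorial (n + 2 + 2) : ℝ)
            * (Nat.factorial (n + 2 - 2) : ℝ)))
    * (2 : ℝ) ^ (-((n + 2 : ℕ) + m : ℤ)) * (2 ^ (m + 2).toNat * 2 ^ (m - 2).toNat), Q, ?_, hdeg,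
    fun θ hθ => ?_⟩
  · refine mul_ne_zero (mul_ne_zero (mul_ne_zero ?_ ?_) ?_) ?_
    · split_ifs
      · exact zpow_ne_zero _ (by norm_num)
      · exact one_ne_zero
    · exact (Real.sqrt_pos.2 (by positivity)).ne'
    · positivity
    · positivity
  · have hσ := sin_half_pos hθ
    have hc := cos_half_pos hθ
    rw [S, hQ]
    simp only [eval_mul, eval_pow, eval_sub, eval_add, eval_one, eval_X]
    have hcs : Real.cos θ = 2 * Real.cos (θ / 2) ^ 2 - 1 := by
      rw [← Real.cos_two_mul]; congr 1; ring
    have e1 : 1 - Real.cos θ = 2 * Real.sin (θ / 2) ^ 2 := by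
      rw [hcs]; linear_combination (-2) * Real.sin_sq_add_cos_sq (θ / 2)
    have e2 : 1 + Real.cos θ = 2 * Real.cos (θ / 2) ^ 2 := by rw [hcs]; ring
    rw [e1, e2]
    set σ := Real.sin (θ / 2)
    set c := Real.cos (θ / 2)
    have p1 : σ ^ (-(m + 2)) * (σ ^ 2) ^ (m + 2).toNat = σ ^ (m + 2).natAbs := by
      rw [← pow_mul, ← zpow_natCast, ← zpow_natCast, ← zpow_add₀ hσ.ne']
      congr 1
      omega
    have p2 : c ^ (-(m - 2)) * (c ^ 2) ^ (m - 2).toNat = c ^ (m - 2).natAbs := by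
      rw [← pow_mul, ← zpow_natCast, ← zpow_natCast, ← zpow_add₀ hc.ne']
      congr 1
      omega
    rw [← p1, ← p2, mul_pow, mul_pow]
    ring

/-- The polynomials of `exists_S_factor` have each degree once, so they span all polynomials. Hence
f times the weight and sin θ is orthogonal to every polynomial in cos θ. -/
theorem eq_zero_of_real_coefficients {m : ℤ} {f : ℝ → ℝ} (hc : ContinuousOn f (Ioo 0 π)) {B : ℝ}
    (hb : ∀ θ ∈ Ioo 0 π, |f θ| ≤ B)
    (hint : ∀ n : ℕ, -((n : ℤ) + 2) ≤ m → m ≤ (n : ℤ) + 2 →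
      ∫ θ in (0 : ℝ)..π, f θ * S m (n + 2) θ * Real.sin θ = 0) :
    ∀ θ ∈ Ioo 0 π, f θ = 0 := by
  have hpi := Real.pi_pos
  set h : ℝ → ℝ := fun θ => f θ * (Real.sin (θ / 2) ^ (m + 2).natAbs
        * Real.cos (θ / 2) ^ (m - 2).natAbs) * Real.sin θ with hh
  -- f is only bounded near the poles; the factor sin θ makes h continuous there, with value 0.
  have hhc : ContinuousOn h (Icc 0 π) := by
    have hbd : ∀ θ ∈ Ioo 0 π, |h θ| ≤ B * |Real.sin θ| := by
      intro θ hθ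
      rw [hh, abs_mul, abs_mul]
      refine mul_le_mul_of_nonneg_right ?_ (abs_nonneg _)
      refine (mul_le_of_le_one_right (abs_nonneg _) ?_).trans (hb θ hθ)
      rw [abs_mul, abs_pow, abs_pow]
      exact mul_le_one₀ (pow_le_one₀ (abs_nonneg _) (Real.abs_sin_le_one _))
        (pow_nonneg (abs_nonneg _) _) (pow_le_one₀ (abs_nonneg _) (Real.abs_cos_le_one _))
    have hend : ∀ x ∈ ({0, π} : Set ℝ), ContinuousWithinAt h (Icc 0 π) x := by
      intro x hx
      have hsx : Real.sin x = 0 := by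
        rcases hx with rfl | rfl
        · exact Real.sin_zero
        · exact Real.sin_pi
      have hx0 : h x = 0 := by simp [hh, hsx]
      have hbd' : ∀ θ ∈ Icc 0 π, |h θ| ≤ B * |Real.sin θ| := by
        intro θ hθ
        rcases eq_or_lt_of_le hθ.1 with h0 | h0
        · simp [hh, ← h0]
        rcases eq_or_lt_of_le hθ.2 with h1 | h1
        · simp [hh, h1]
        exact hbd θ ⟨h0, h1⟩
      rw [ContinuousWithinAt, hx0]
      refine squeeze_zero_norm' (a := fun θ => B * |Real.sin θ|)
        (eventually_nhdsWithin_of_forall hbd') ?_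
      have : Tendsto (fun θ => B * |Real.sin θ|) (𝓝 x) (𝓝 (B * |Real.sin x|)) :=
        (Continuous.tendsto (by fun_prop) x)
      rw [hsx, abs_zero, mul_zero] at this
      exact this.mono_left nhdsWithin_le_nhds
    intro x hx
    rcases eq_or_lt_of_le hx.1 with h0 | h0
    · exact hend x (Or.inl h0.symm)
    rcases eq_or_lt_of_le hx.2 with h1 | h1
    · exact hend x (Or.inr h1)
    have : ContinuousAt f x := hc.continuousAt (Ioo_mem_nhds h0 h1)
    exact ContinuousAt.continuousWithinAt (by fun_prop)
  -- Degree d occurs for ℓ = d + max(|m|, 2), and ℓ = n + 2.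
  have hindex : ∀ d : ℕ, ∃ n : ℕ, -((n : ℤ) + 2) ≤ m ∧ m ≤ (n : ℤ) + 2 ∧
      (n + 2 + m - (m + 2).toNat - (m - 2).toNat : ℤ).toNat = d := fun d =>
    ⟨d + max m.natAbs 2 - 2, by omega, by omega, by omega⟩
  have hQ : ∀ d : ℕ, ∃ Q : ℝ[X], Q.degree = d ∧
      ∫ θ in (0 : ℝ)..π, h θ * Q.eval (Real.cos θ) = 0 := by
    intro d
    obtain ⟨n, h1, h2, h3⟩ := hindex d
    obtain ⟨K, Q, hK, hdeg, hS⟩ := exists_S_factor h1 h2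
    refine ⟨Q, by rw [hdeg, h3], ?_⟩
    have h4 := hint n h1 h2
    have h5 : ∫ θ in (0 : ℝ)..π, f θ * S m (n + 2) θ * Real.sin θ
        = ∫ θ in (0 : ℝ)..π, K * (h θ * Q.eval (Real.cos θ)) := by
      refine intervalIntegral.integral_congr_Ioo_of_le hpi.le fun θ hθ => ?_
      simp only [hS θ hθ, hh]
      ring
    rw [h5, intervalIntegral.integral_const_mul] at h4
    exact (mul_eq_zero.1 h4).resolve_left hK
  choose Q hQd hQi using hQ
  let sq : Polynomial.Sequence ℝ := ⟨Q, hQd⟩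
  have hint' : ∀ P : ℝ[X], IntervalIntegrable (fun θ => h θ * P.eval (Real.cos θ))
      MeasureTheory.volume 0 π := by
    intro P
    refine ContinuousOn.intervalIntegrable ?_
    rw [uIcc_of_le hpi.le]
    exact hhc.mul (P.continuous.comp Real.continuous_cos).continuousOn
  have hall : ∀ P : ℝ[X], ∫ θ in (0 : ℝ)..π, h θ * P.eval (Real.cos θ) = 0 := by
    intro P
    have hP : P ∈ Submodule.span ℝ (Set.range sq) := by
      rw [sq.span fun i => ?_]
      · trivial
      · exact (leadingCoeff_ne_zero.2 (sq.ne_zero i)).isUnit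
    induction hP using Submodule.span_induction with
    | mem x hx =>
      obtain ⟨d, rfl⟩ := hx
      exact hQi d
    | zero => simp
    | add x y _ _ hx hy =>
      simp only [eval_add, mul_add]
      rw [intervalIntegral.integral_add (hint' x) (hint' y), hx, hy, add_zero]
    | smul a x _ hx =>
      have : ∀ θ, h θ * eval (Real.cos θ) (a • x) = a * (h θ * eval (Real.cos θ) x) := by
        intro θ; rw [eval_smul, smul_eq_mul]; ring
      simp only [this]
      rw [intervalIntegral.integral_const_mul, hx, mul_zero]
  intro θ hθ
  have h0 := eq_zero_of_integral_polynomial_cos hhc hall θ ⟨hθ.1.le, hθ.2.le⟩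
  have hs := Real.sin_pos_of_pos_of_lt_pi hθ.1 hθ.2
  rcases mul_eq_zero.1 h0 with h1 | h1
  · rcases mul_eq_zero.1 h1 with h2 | h2
    · exact h2
    · exact absurd h2 (mul_pos (pow_pos (sin_half_pos hθ) _) (pow_pos (cos_half_pos hθ) _)).ne'
  · exact absurd h1 hs.ne'

end HarmonicCompleteness

/-! ## The harmonics of spin weight between `-2` and `4` -/

theorem abs_harm_le {m : ℤ} {n : ℕ} (h1 : -((n : ℤ) + 2) ≤ m) (j : ℕ) (θ : ℝ) :
    |harm m n j θ| ≤ n + 3 := by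
  rw [harm, abs_mul, abs_mul]
  have hk : ((n : ℤ) + 2 - m).toNat ≤ 2 * (n + 2) := by omega
  have e1 : |if m < 0 then (-1 : ℝ) ^ m else 1| = 1 := by
    split_ifs
    · rw [abs_zpow]; simp
    · simp
  have e2 : Real.sqrt ((2 * ((n : ℝ) + 2) + 1) / (4 * π)) ≤ n + 3 := by
    refine Real.sqrt_le_iff.2 ⟨by positivity, ?_⟩
    rw [div_le_iff₀ (by positivity)]
    nlinarith [Real.pi_gt_three, sq_nonneg ((n : ℝ) + 3), (Nat.cast_nonneg n : (0 : ℝ) ≤ n)]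
  rw [e1, one_mul, abs_of_nonneg (Real.sqrt_nonneg _)]
  exact (mul_le_of_le_one_right (Real.sqrt_nonneg _) (abs_wigE_le hk _ _)).trans e2

/-- This form of the derivative has no 1/sin θ, so it gives bounds uniform up to the poles. The
one-sided forms `hasDerivAt_harm_lower` and `hasDerivAt_harm_raise`, which eliminate one neighbour
by `harm_ladder`, are those that match the angular operators. -/
theorem hasDerivAt_harm (m : ℤ) (n j : ℕ) (θ : ℝ) :
    HasDerivAt (harm m n (j + 1))
      (1 / 2 * (wigA (2 * (n + 2)) (n + j + 1) * harm m n j θ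
        - wigA (2 * (n + 2)) (n + j + 2) * harm m n (j + 2) θ)) θ := by
  have := (hasDerivAt_wigE (2 * (n + 2)) ((n : ℤ) + 2 - m).toNat (n + (j + 1)) θ).const_mul
    ((if m < 0 then (-1 : ℝ) ^ m else 1) * Real.sqrt ((2 * (n + 2) + 1) / (4 * π)))
  refine this.congr_deriv ?_
  simp only [harm]
  rw [show n + (j + 1) - 1 = n + j by omega, show n + (j + 1) + 1 = n + (j + 2) by omega,
    show n + (j + 1) = n + j + 1 by omega, show n + j + 2 = n + (j + 2) by omega]
  ring

theorem harm_ladder {m : ℤ} {n : ℕ} (h2 : m ≤ (n : ℤ) + 2) (j : ℕ) (θ : ℝ) :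
    2 * (m + ((j : ℝ) - 1) * Real.cos θ) * harm m n (j + 1) θ
      = Real.sin θ * (wigA (2 * (n + 2)) (n + j + 1) * harm m n j θ
        + wigA (2 * (n + 2)) (n + j + 2) * harm m n (j + 2) θ) := by
  have hl := wigE_ladder (2 * (n + 2)) ((n : ℤ) + 2 - m).toNat (n + (j + 1)) θ
  have hk : (((n : ℤ) + 2 - m).toNat : ℝ) = n + 2 - m := by
    have : (((n : ℤ) + 2 - m).toNat : ℤ) = n + 2 - m := Int.toNat_of_nonneg (by omega)
    exact_mod_cast this
  rw [hk] at hl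
  rw [show n + (j + 1) - 1 = n + j by omega, show n + (j + 1) + 1 = n + (j + 2) by omega] at hl
  push_cast at hl
  simp only [harm]
  rw [show n + j + 1 = n + (j + 1) by omega, show n + j + 2 = n + (j + 2) by omega]
  linear_combination (if m < 0 then (-1 : ℝ) ^ m else 1)
    * Real.sqrt ((2 * (n + 2) + 1) / (4 * π)) * hl

theorem hasDerivAt_harm_lower {m : ℤ} {n : ℕ} (h2 : m ≤ (n : ℤ) + 2) (j : ℕ) {θ : ℝ}
    (hθ : Real.sin θ ≠ 0) :
    HasDerivAt (harm m n (j + 1)) (wigA (2 * (n + 2)) (n + j + 1) * harm m n j θ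
        - (m + ((j : ℝ) - 1) * Real.cos θ) / Real.sin θ * harm m n (j + 1) θ) θ := by
  refine (hasDerivAt_harm m n j θ).congr_deriv ?_
  have := harm_ladder h2 j θ
  field_simp
  linear_combination this

theorem hasDerivAt_harm_raise {m : ℤ} {n : ℕ} (h2 : m ≤ (n : ℤ) + 2) (j : ℕ) {θ : ℝ}
    (hθ : Real.sin θ ≠ 0) :
    HasDerivAt (harm m n (j + 1)) ((m + ((j : ℝ) - 1) * Real.cos θ) / Real.sin θ
        * harm m n (j + 1) θ - wigA (2 * (n + 2)) (n + j + 2) * harm m n (j + 2) θ) θ := by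
  refine (hasDerivAt_harm m n j θ).congr_deriv ?_
  have := harm_ladder h2 j θ
  field_simp
  linear_combination -this

theorem continuous_harm (m : ℤ) (n j : ℕ) : Continuous (harm m n j) :=
  continuous_const.mul (continuous_wigE _ _ _)

/-- The derivative of `harm m n 4`. -/
noncomputable def harmD (m : ℤ) (n : ℕ) (θ : ℝ) : ℝ :=
  1 / 2 * (wigA (2 * (n + 2)) (n + 3 + 1) * harm m n 3 θ
    - wigA (2 * (n + 2)) (n + 3 + 2) * harm m n 5 θ)

/-- The second derivative of `harm m n 4`. -/
noncomputable def harmDD (m : ℤ) (n : ℕ) (θ : ℝ) : ℝ :=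
  1 / 2 * (wigA (2 * (n + 2)) (n + 3 + 1)
      * (1 / 2 * (wigA (2 * (n + 2)) (n + 2 + 1) * harm m n 2 θ
        - wigA (2 * (n + 2)) (n + 2 + 2) * harm m n 4 θ))
    - wigA (2 * (n + 2)) (n + 3 + 2)
      * (1 / 2 * (wigA (2 * (n + 2)) (n + 4 + 1) * harm m n 4 θ
        - wigA (2 * (n + 2)) (n + 4 + 2) * harm m n 6 θ)))

theorem hasDerivAt_harm_four (m : ℤ) (n : ℕ) (θ : ℝ) :
    HasDerivAt (harm m n 4) (harmD m n θ) θ := hasDerivAt_harm m n 3 θ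

theorem hasDerivAt_harmD (m : ℤ) (n : ℕ) (θ : ℝ) :
    HasDerivAt (harmD m n) (harmDD m n θ) θ :=
  (((hasDerivAt_harm m n 2 θ).const_mul _).sub ((hasDerivAt_harm m n 4 θ).const_mul _)).const_mul _

theorem abs_half_ladder_le {n : ℕ} {p q : ℕ} {a b B : ℝ} (ha : |a| ≤ B) (hb : |b| ≤ B) :
    |1 / 2 * (wigA (2 * (n + 2)) p * a - wigA (2 * (n + 2)) q * b)| ≤ (2 * n + 5) * B := by
  have h1 := wigA_le (2 * (n + 2)) p
  have h2 := wigA_le (2 * (n + 2)) q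
  push_cast at h1 h2
  have hB : 0 ≤ B := (abs_nonneg _).trans ha
  have hN : (0 : ℝ) ≤ 2 * n + 5 := by positivity
  have e1 : |wigA (2 * (n + 2)) p * a| ≤ (2 * n + 5) * B := by
    rw [abs_mul, abs_of_nonneg (wigA_nonneg _ _)]
    exact mul_le_mul (by linarith) ha (abs_nonneg _) hN
  have e2 : |wigA (2 * (n + 2)) q * b| ≤ (2 * n + 5) * B := by
    rw [abs_mul, abs_of_nonneg (wigA_nonneg _ _)]
    exact mul_le_mul (by linarith) hb (abs_nonneg _) hN
  rw [abs_mul, abs_of_pos (by norm_num : (0 : ℝ) < 1 / 2)]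
  have := abs_sub (wigA (2 * (n + 2)) p * a) (wigA (2 * (n + 2)) q * b)
  linarith

theorem abs_harmD_le {m : ℤ} {n : ℕ} (h1 : -((n : ℤ) + 2) ≤ m) (θ : ℝ) :
    |harmD m n θ| ≤ (2 * n + 5) * (n + 3) :=
  abs_half_ladder_le (abs_harm_le h1 _ _) (abs_harm_le h1 _ _)

theorem abs_harmDD_le {m : ℤ} {n : ℕ} (h1 : -((n : ℤ) + 2) ≤ m) (θ : ℝ) :
    |harmDD m n θ| ≤ (2 * n + 5) * ((2 * n + 5) * (n + 3)) :=
  abs_half_ladder_le (abs_half_ladder_le (abs_harm_le h1 _ _) (abs_harm_le h1 _ _))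
    (abs_half_ladder_le (abs_harm_le h1 _ _) (abs_harm_le h1 _ _))

/-- The eigenvalue `ℓ (ℓ + 1)` for `ℓ = n + 2`. -/
def lam (n : ℕ) : ℝ := ((n : ℝ) + 2) * (n + 3)

/-- The constant `(ℓ - 1) ℓ (ℓ + 1) (ℓ + 2)` for `ℓ = n + 2`. -/
def muTS (n : ℕ) : ℝ := lam n * (lam n - 2)

theorem wigA_four_sq (n : ℕ) : wigA (2 * (n + 2)) (n + 4) ^ 2 = lam n - 2 := by
  rw [wigA_sq (by omega), lam]; push_cast; ring

/-- The ladder constants are symmetric under p ↔ N + 1 - p, so the four factors pair up into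
squares, one equal to ℓ(ℓ+1) and one to ℓ(ℓ+1) - 2. -/
theorem wigA_prod (n : ℕ) : wigA (2 * (n + 2)) (n + 1) * (wigA (2 * (n + 2)) (n + 2)
    * (wigA (2 * (n + 2)) (n + 3) * wigA (2 * (n + 2)) (n + 4))) = muTS n := by
  have h1 : wigA (2 * (n + 2)) (n + 1) = wigA (2 * (n + 2)) (n + 4) := by
    rw [wigA, wigA]; congr 1; push_cast; ring
  have h2 : wigA (2 * (n + 2)) (n + 2) = wigA (2 * (n + 2)) (n + 3) := by
    rw [wigA, wigA]; congr 1; push_cast; ring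
  have h3 : wigA (2 * (n + 2)) (n + 3) ^ 2 = lam n := by
    rw [wigA_sq (by omega), lam]; push_cast; ring
  rw [h1, h2, muTS, ← wigA_four_sq, ← h3]
  ring

/-- Going down from spin weight 2 to 1 and up again multiplies by a squared ladder constant, ℓ(ℓ+1)
- 2; written out, this composition is the second order equation. -/
theorem harm_ode {m : ℤ} {n : ℕ} (h2 : m ≤ (n : ℤ) + 2) {θ : ℝ} (hθ : Real.sin θ ≠ 0) :
    harmDD m n θ + Real.cos θ / Real.sin θ * harmD m n θ
      - (m ^ 2 + 4 * m * Real.cos θ + 4 * Real.cos θ ^ 2) / Real.sin θ ^ 2 * harm m n 4 θ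
      - 4 * harm m n 4 θ + lam n * harm m n 4 θ = 0 := by
  have hev : ∀ᶠ x in 𝓝 θ, Real.sin x ≠ 0 := Real.continuous_sin.continuousAt.eventually_ne hθ
  have hD : ∀ᶠ x in 𝓝 θ, harmD m n x = wigA (2 * (n + 2)) (n + 4) * harm m n 3 x
        - (m + 2 * Real.cos x) / Real.sin x * harm m n 4 x := by
    filter_upwards [hev] with x hx
    have := (hasDerivAt_harm_four m n x).unique (hasDerivAt_harm_lower h2 3 hx)
    rw [this]
    push_cast
    ring
  have h3 := hasDerivAt_harm_raise h2 2 hθ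
  have h4 := hasDerivAt_harm_four m n θ
  have hq : HasDerivAt (fun x => (m + 2 * Real.cos x) / Real.sin x)
      ((-2 * Real.sin θ * Real.sin θ - (m + 2 * Real.cos θ) * Real.cos θ) / Real.sin θ ^ 2) θ := by
    refine ((((Real.hasDerivAt_cos θ).const_mul 2).const_add (m : ℝ)).div
      (Real.hasDerivAt_sin θ) hθ).congr_deriv ?_
    ring
  have hDD := ((h3.const_mul (wigA (2 * (n + 2)) (n + 4))).sub (hq.mul h4)).congr_of_eventuallyEq
    (f₁ := harmD m n) (by filter_upwards [hD] with x hx; rw [hx]; rfl)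
  have e := (hasDerivAt_harmD m n θ).unique hDD
  have e1 := hD.self_of_nhds
  have e2 := wigA_four_sq n
  simp only [show n + 2 + 2 = n + 4 from rfl, show 2 + 2 = 4 from rfl, show 2 + 1 = 3 from rfl] at e
  rw [e, e1]
  push_cast
  have hs : Real.sin θ ^ 2 = 1 - Real.cos θ ^ 2 := Real.sin_sq θ
  field_simp
  rw [← sub_eq_zero]
  linear_combination (-(Real.sin θ ^ 2 * harm m n 4 θ)) * e2

/-- The norm 2/(2ℓ+1) of the Wigner function times (2ℓ+1)/(4π) is 1/(2π), which the φ-integral later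
completes to 1. -/
theorem integral_harm_mul_harm {m : ℤ} {n n' : ℕ} (h1 : -((n : ℤ) + 2) ≤ m)
    (h2 : m ≤ (n : ℤ) + 2) (h2' : m ≤ (n' : ℤ) + 2) :
    ∫ θ in (0 : ℝ)..π, harm m n 4 θ * harm m n' 4 θ * Real.sin θ
      = if n = n' then 1 / (2 * π) else 0 := by
  have e : ∀ θ, harm m n 4 θ * harm m n' 4 θ * Real.sin θ
      = (if m < 0 then (-1 : ℝ) ^ m else 1) * (if m < 0 then (-1 : ℝ) ^ m else 1)
        * (Real.sqrt ((2 * (n + 2) + 1) / (4 * π)) * Real.sqrt ((2 * (n' + 2) + 1) / (4 * π)))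
        * (Real.sin θ * (wigE (2 * (n + 2)) ((n : ℤ) + 2 - m).toNat (n + 4) θ
          * wigE (2 * (n' + 2)) ((n' : ℤ) + 2 - m).toNat (n' + 4) θ)) := by
    intro θ; rw [harm, harm]; ring
  simp only [e]
  rw [intervalIntegral.integral_const_mul]
  change _ * wigJ _ _ _ _ _ _ = _
  by_cases hn : n = n'
  · subst hn
    have hs : (if m < 0 then (-1 : ℝ) ^ m else 1) * (if m < 0 then (-1 : ℝ) ^ m else 1) = 1 := by
      split_ifs
      · rw [← zpow_add₀ (by norm_num), ← two_mul, zpow_mul]; simp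
      · simp
    rw [if_pos rfl, hs, wigJ_self (by omega) (by omega), Real.mul_self_sqrt (by positivity)]
    push_cast
    field_simp
    norm_num
  · rw [if_neg hn, wigJ_orthogonal hn (by omega), mul_zero]

end

section

/-! ## Differentiation of sums and integrals -/

theorem norm_slope_le {s : Set ℝ} (hs : Convex ℝ s) {f f' : ℝ → ℂ} {C : ℝ}
    (hf : ∀ y ∈ s, HasDerivWithinAt f (f' y) s y) (hC : ∀ y ∈ s, ‖f' y‖ ≤ C) {x y : ℝ}
    (hx : x ∈ s) (hy : y ∈ s) (hxy : y ≠ x) : ‖slope f x y‖ ≤ C := by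
  have h := hs.norm_image_sub_le_of_norm_hasDerivWithin_le hf hC hx hy
  rw [slope_def_module, norm_smul, norm_inv]
  rw [inv_mul_le_iff₀ (norm_pos_iff.2 (sub_ne_zero.2 hxy)), mul_comm]
  exact h

/-- Dominated convergence for the difference quotients, which the mean value inequality bounds on a
convex set. Working within a set covers one-sided derivatives, needed at t⋆ = t₀. -/
theorem hasDerivWithinAt_tsum {s : Set ℝ} (hs : Convex ℝ s) {x : ℝ} (hx : x ∈ s)
    {u u' : ℕ → ℝ → ℂ} {b : ℕ → ℝ} (hb : Summable b)
    (hu : ∀ n, ∀ y ∈ s, HasDerivWithinAt (u n) (u' n y) s y)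
    (hbd : ∀ n, ∀ y ∈ s, ‖u' n y‖ ≤ b n) (hsum : ∀ y ∈ s, Summable fun n => u n y) :
    HasDerivWithinAt (fun y => ∑' n, u n y) (∑' n, u' n x) s x := by
  rw [hasDerivWithinAt_iff_tendsto_slope]
  have hmem : ∀ᶠ y in 𝓝[s \ {x}] x, y ∈ s \ {x} := self_mem_nhdsWithin
  have h1 : Tendsto (fun y => ∑' n, slope (u n) x y) (𝓝[s \ {x}] x) (𝓝 (∑' n, u' n x)) := by
    refine tendsto_tsum_of_dominated_convergence hb
      (fun n => hasDerivWithinAt_iff_tendsto_slope.1 (hu n x hx)) ?_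
    filter_upwards [hmem] with y hy n
    exact norm_slope_le hs (hu n) (hbd n) hx hy.1 hy.2
  refine h1.congr' ?_
  filter_upwards [hmem] with y hy
  simp only [slope_def_module]
  rw [((hsum y hy.1).sub (hsum x hx)).tsum_const_smul, (hsum y hy.1).tsum_sub (hsum x hx)]

theorem hasDerivWithinAt_integral {X : Type*} [MeasurableSpace X] {μ : MeasureTheory.Measure X}
    {s : Set ℝ} (hs : Convex ℝ s) {x : ℝ} (hx : x ∈ s) {f f' : ℝ → X → ℂ} {b : X → ℝ}
    (hb : MeasureTheory.Integrable b μ) (hint : ∀ y ∈ s, MeasureTheory.Integrable (f y) μ)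
    (hf : ∀ᵐ a ∂μ, ∀ y ∈ s, HasDerivWithinAt (fun y => f y a) (f' y a) s y)
    (hbd : ∀ᵐ a ∂μ, ∀ y ∈ s, ‖f' y a‖ ≤ b a) :
    HasDerivWithinAt (fun y => ∫ a, f y a ∂μ) (∫ a, f' x a ∂μ) s x := by
  rw [hasDerivWithinAt_iff_tendsto_slope]
  have hmem : ∀ᶠ y in 𝓝[s \ {x}] x, y ∈ s \ {x} := self_mem_nhdsWithin
  have h1 : Tendsto (fun y => ∫ a, slope (fun y => f y a) x y ∂μ) (𝓝[s \ {x}] x)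
      (𝓝 (∫ a, f' x a ∂μ)) := by
    refine MeasureTheory.tendsto_integral_filter_of_dominated_convergence b ?_ ?_ hb ?_
    · filter_upwards [hmem] with y hy
      simp only [slope_def_module]
      exact (((hint y hy.1).sub (hint x hx)).smul _).aestronglyMeasurable
    · filter_upwards [hmem] with y hy
      filter_upwards [hf, hbd] with a ha hba
      exact norm_slope_le hs ha hba hx hy.1 hy.2
    · filter_upwards [hf] with a ha
      exact hasDerivWithinAt_iff_tendsto_slope.1 (ha x hx)
  refine h1.congr' ?_
  filter_upwards [hmem] with y hy
  simp only [slope_def_module]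
  rw [MeasureTheory.integral_smul, MeasureTheory.integral_sub (hint y hy.1) (hint x hx)]

/-! ## Functions on the sphere -/

/-- Bounded continuous functions on the sphere without poles, in coordinates `(ϑ, φ)`. -/
structure SphereReg (f : ℝ → ℝ → ℂ) : Prop where
  cont : ContinuousOn (fun z : ℝ × ℝ => f z.1 z.2) (Ioo 0 π ×ˢ univ)
  bdd : ∃ B, ∀ θ ∈ Ioo 0 π, ∀ φ, ‖f θ φ‖ ≤ B
  per : ∀ θ ∈ Ioo 0 π, ∀ φ, f θ (φ + 2 * π) = f θ φ

/-- The coordinate measure on the sphere, in coordinates `(φ, ϑ)`. -/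
noncomputable def sphMeas : MeasureTheory.Measure (ℝ × ℝ) :=
  (MeasureTheory.volume.restrict (Ioc 0 (2 * π))).prod (MeasureTheory.volume.restrict (Ioo 0 π))

instance : MeasureTheory.IsFiniteMeasure sphMeas := by
  unfold sphMeas; infer_instance

theorem sphMeas_eq : sphMeas = MeasureTheory.volume.restrict (Ioc 0 (2 * π) ×ˢ Ioo 0 π) := by
  rw [sphMeas, MeasureTheory.Measure.prod_restrict]; rfl

theorem ae_sphMeas {p : ℝ × ℝ → Prop} (h : ∀ φ, ∀ θ ∈ Ioo 0 π, p (φ, θ)) :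
    ∀ᵐ z ∂sphMeas, p z := by
  rw [sphMeas_eq]
  refine (MeasureTheory.ae_restrict_iff' (measurableSet_Ioc.prod measurableSet_Ioo)).2
    (MeasureTheory.ae_of_all _ fun z hz => h z.1 z.2 hz.2)

theorem aestronglyMeasurable_sphMeas {g : ℝ × ℝ → ℂ} (hg : ContinuousOn g (univ ×ˢ Ioo 0 π)) :
    MeasureTheory.AEStronglyMeasurable g sphMeas := by
  rw [sphMeas_eq]
  exact (hg.mono (prod_mono (subset_univ _) le_rfl)).aestronglyMeasurable
    (measurableSet_Ioc.prod measurableSet_Ioo)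

theorem integrable_sphMeas {g : ℝ × ℝ → ℂ} (hg : ContinuousOn g (univ ×ˢ Ioo 0 π)) {B : ℝ}
    (hB : ∀ φ, ∀ θ ∈ Ioo 0 π, ‖g (φ, θ)‖ ≤ B) : MeasureTheory.Integrable g sphMeas :=
  MeasureTheory.Integrable.of_bound (aestronglyMeasurable_sphMeas hg) B (ae_sphMeas hB)

theorem SphereReg.cont_swap {f : ℝ → ℝ → ℂ} (hf : SphereReg f) :
    ContinuousOn (fun z : ℝ × ℝ => f z.2 z.1) (univ ×ˢ Ioo 0 π) :=
  hf.cont.comp (continuous_swap.continuousOn) fun _ hz => ⟨hz.2, hz.1⟩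

/-- The coefficient of a function on the sphere on `S_{m ℓ} e^{i m φ}`, `ℓ = n + 2`. -/
noncomputable def sphCoeff (m : ℤ) (n : ℕ) (f : ℝ → ℝ → ℂ) : ℂ :=
  ∫ φ in (0 : ℝ)..(2 * π), ∫ θ in (0 : ℝ)..π,
    f θ φ * ((S m (n + 2) θ : ℂ) * Complex.exp (-(Complex.I * m * φ))) * (Real.sin θ : ℂ)

theorem coeff_eq_sphCoeff (m : ℤ) (n : ℕ) (F : Field) (t r : ℝ) :
    coeff m (n + 2) F t r = sphCoeff m n (F t r) := rfl

/-- The kernel of `sphCoeff`. -/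
noncomputable def sphKer (m : ℤ) (n : ℕ) (z : ℝ × ℝ) : ℂ :=
  (harm m n 4 z.2 : ℂ) * Complex.exp (-(Complex.I * m * z.1)) * (Real.sin z.2 : ℂ)

theorem continuous_sphKer (m : ℤ) (n : ℕ) : Continuous (sphKer m n) := by
  have := continuous_harm m n 4
  unfold sphKer
  fun_prop

theorem norm_exp_neg_I_mul (m : ℤ) (x : ℝ) : ‖Complex.exp (-(Complex.I * m * x))‖ = 1 := by
  rw [Complex.norm_exp]; simp

theorem norm_exp_I_mul (m : ℤ) (x : ℝ) : ‖Complex.exp (Complex.I * m * x)‖ = 1 := by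
  rw [Complex.norm_exp]; simp

theorem norm_sphKer_le {m : ℤ} {n : ℕ} (h1 : -((n : ℤ) + 2) ≤ m) (z : ℝ × ℝ) :
    ‖sphKer m n z‖ ≤ n + 3 := by
  rw [sphKer, norm_mul, norm_mul, norm_exp_neg_I_mul, mul_one, Complex.norm_real,
    Complex.norm_real]
  exact (mul_le_of_le_one_right (norm_nonneg _) (Real.abs_sin_le_one _)).trans (abs_harm_le h1 _ _)

/-- The modes of degree `n + 2`. -/
noncomputable abbrev modes (n : ℕ) : Finset ℤ := Finset.Icc (-((n : ℤ) + 2)) ((n : ℤ) + 2)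

theorem neg_mem_modes {m : ℤ} {n : ℕ} : -m ∈ modes n ↔ m ∈ modes n := by
  simp only [Finset.mem_Icc]; omega

section Coeff

variable {f g : ℝ → ℝ → ℂ} {m : ℤ} {n : ℕ}

theorem SphereReg.integrable (hf : SphereReg f) (hm : m ∈ modes n) :
    MeasureTheory.Integrable (fun z : ℝ × ℝ => f z.2 z.1 * sphKer m n z) sphMeas := by
  obtain ⟨B, hB⟩ := hf.bdd
  refine integrable_sphMeas (B := B * (n + 3))
    (hf.cont_swap.mul (continuous_sphKer m n).continuousOn) fun φ θ hθ => ?_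
  rw [norm_mul]
  exact mul_le_mul (hB θ hθ φ) (norm_sphKer_le (Finset.mem_Icc.1 hm).1 _) (norm_nonneg _)
    ((norm_nonneg _).trans (hB θ hθ φ))

theorem sphCoeff_eq_integral (hf : SphereReg f) (hm : m ∈ modes n) :
    sphCoeff m n f = ∫ z, f z.2 z.1 * sphKer m n z ∂sphMeas := by
  have hpi := Real.pi_pos
  have hm' := Finset.mem_Icc.1 hm
  rw [sphMeas, MeasureTheory.integral_prod _ (hf.integrable hm), sphCoeff,
    intervalIntegral.integral_of_le (by positivity)]
  congr 1
  funext φ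
  rw [intervalIntegral.integral_of_le hpi.le, MeasureTheory.integral_Ioc_eq_integral_Ioo]
  refine MeasureTheory.setIntegral_congr_fun measurableSet_Ioo fun θ hθ => ?_
  simp only [sphKer, S_eq_harm hm'.1 hm'.2 hθ]
  ring

theorem sphCoeff_swap (hf : SphereReg f) (hm : m ∈ modes n) :
    sphCoeff m n f = ∫ θ in (0 : ℝ)..π, (∫ φ in (0 : ℝ)..(2 * π),
      f θ φ * Complex.exp (-(Complex.I * m * φ))) * (S m (n + 2) θ : ℂ) * (Real.sin θ : ℂ) := by
  have hpi := Real.pi_pos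
  have hm' := Finset.mem_Icc.1 hm
  rw [sphCoeff_eq_integral hf hm, sphMeas, MeasureTheory.integral_prod_symm _ (hf.integrable hm),
    intervalIntegral.integral_of_le hpi.le, MeasureTheory.integral_Ioc_eq_integral_Ioo]
  refine MeasureTheory.setIntegral_congr_fun measurableSet_Ioo fun θ hθ => ?_
  simp only
  rw [intervalIntegral.integral_of_le (by positivity), mul_assoc,
    ← MeasureTheory.integral_mul_const]
  congr 1
  funext φ
  simp only [sphKer, S_eq_harm hm'.1 hm'.2 hθ]
  ring

theorem norm_sphCoeff_le (hf : SphereReg f) (hm : m ∈ modes n) {B : ℝ}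
    (hB : ∀ θ ∈ Ioo 0 π, ∀ φ, ‖f θ φ‖ ≤ B) :
    ‖sphCoeff m n f‖ ≤ B * (n + 3) * sphMeas.real univ := by
  rw [sphCoeff_eq_integral hf hm]
  refine MeasureTheory.norm_integral_le_of_norm_le_const (ae_sphMeas fun φ θ hθ => ?_)
  rw [norm_mul]
  exact mul_le_mul (hB θ hθ φ) (norm_sphKer_le (Finset.mem_Icc.1 hm).1 _) (norm_nonneg _)
    ((norm_nonneg _).trans (hB θ hθ φ))

theorem SphereReg.add (hf : SphereReg f) (hg : SphereReg g) :
    SphereReg (fun θ φ => f θ φ + g θ φ) := by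
  obtain ⟨B, hB⟩ := hf.bdd
  obtain ⟨B', hB'⟩ := hg.bdd
  exact ⟨hf.cont.add hg.cont, ⟨B + B', fun θ hθ φ => norm_add_le_of_le (hB θ hθ φ) (hB' θ hθ φ)⟩,
    fun θ hθ φ => by rw [hf.per θ hθ, hg.per θ hθ]⟩

theorem SphereReg.const_mul (hf : SphereReg f) (c : ℂ) : SphereReg (fun θ φ => c * f θ φ) := by
  obtain ⟨B, hB⟩ := hf.bdd
  exact ⟨continuousOn_const.mul hf.cont, ⟨‖c‖ * B, fun θ hθ φ => by
    rw [norm_mul]; exact mul_le_mul_of_nonneg_left (hB θ hθ φ) (norm_nonneg _)⟩,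
    fun θ hθ φ => by rw [hf.per θ hθ]⟩

theorem SphereReg.sub (hf : SphereReg f) (hg : SphereReg g) :
    SphereReg (fun θ φ => f θ φ - g θ φ) := by
  have := hf.add (hg.const_mul (-1))
  simpa [sub_eq_add_neg] using this

theorem SphereReg.congr (hf : SphereReg f) (h : ∀ θ ∈ Ioo 0 π, ∀ φ, g θ φ = f θ φ) :
    SphereReg g := by
  obtain ⟨B, hB⟩ := hf.bdd
  exact ⟨hf.cont.congr fun z hz => h z.1 hz.1 z.2, ⟨B, fun θ hθ φ => by
    rw [h θ hθ]; exact hB θ hθ φ⟩, fun θ hθ φ => by rw [h θ hθ, h θ hθ, hf.per θ hθ]⟩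

theorem sphCoeff_congr (h : ∀ θ ∈ Ioo 0 π, ∀ φ, f θ φ = g θ φ) :
    sphCoeff m n f = sphCoeff m n g := by
  rw [sphCoeff, sphCoeff]
  congr 1
  funext φ
  exact intervalIntegral.integral_congr_Ioo_of_le Real.pi_pos.le fun θ hθ => by
    simp only [h θ hθ]

theorem sphCoeff_add (hf : SphereReg f) (hg : SphereReg g) (hm : m ∈ modes n) :
    sphCoeff m n (fun θ φ => f θ φ + g θ φ) = sphCoeff m n f + sphCoeff m n g := by
  rw [sphCoeff_eq_integral hf hm, sphCoeff_eq_integral hg hm,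
    sphCoeff_eq_integral (hf.add hg) hm, ← MeasureTheory.integral_add (hf.integrable hm)
    (hg.integrable hm)]
  simp only [add_mul]

theorem sphCoeff_const_mul (hf : SphereReg f) (c : ℂ) (hm : m ∈ modes n) :
    sphCoeff m n (fun θ φ => c * f θ φ) = c * sphCoeff m n f := by
  rw [sphCoeff_eq_integral hf hm, sphCoeff_eq_integral (hf.const_mul c) hm,
    ← MeasureTheory.integral_const_mul]
  simp only [mul_assoc]

theorem sphCoeff_sub (hf : SphereReg f) (hg : SphereReg g) (hm : m ∈ modes n) :
    sphCoeff m n (fun θ φ => f θ φ - g θ φ) = sphCoeff m n f - sphCoeff m n g := by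
  have h1 := sphCoeff_add hf (hg.const_mul (-1)) hm
  rw [sphCoeff_const_mul hg (-1) hm] at h1
  simp only [neg_one_mul, ← sub_eq_add_neg] at h1
  exact h1

theorem continuousOn_phi_coeff (hf : SphereReg f) (m : ℤ) :
    ContinuousOn (fun θ => ∫ φ in (0 : ℝ)..(2 * π), f θ φ * Complex.exp (-(Complex.I * m * φ)))
      (Ioo 0 π) := by
  obtain ⟨B, hB⟩ := hf.bdd
  have hslice : ∀ θ ∈ Ioo 0 π, Continuous fun φ => f θ φ := fun θ hθ => by
    have := hf.cont.comp (f := fun φ : ℝ => (θ, φ)) (s := univ) (by fun_prop)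
      fun φ _ => ⟨hθ, mem_univ _⟩
    exact continuousOn_univ.1 this
  intro θ hθ
  refine intervalIntegral.continuousWithinAt_of_dominated_interval (bound := fun _ => B) ?_ ?_ ?_ ?_
  · filter_upwards [self_mem_nhdsWithin] with x hx
    have := hslice x hx
    exact Continuous.aestronglyMeasurable (by fun_prop)
  · filter_upwards [self_mem_nhdsWithin] with x hx
    refine MeasureTheory.ae_of_all _ fun φ _ => ?_
    rw [norm_mul, norm_exp_neg_I_mul, mul_one]
    exact hB x hx φ
  · exact intervalIntegrable_const
  · refine MeasureTheory.ae_of_all _ fun φ _ => ContinuousWithinAt.mul ?_ continuousWithinAt_const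
    exact (hf.cont (θ, φ) ⟨hθ, mem_univ _⟩).comp (f := fun x : ℝ => (x, φ)) (by fun_prop)
      fun x hx => ⟨hx, mem_univ _⟩

/-- For each m, Fubini turns the hypothesis into the vanishing of all ϑ-integrals of the m-th
Fourier coefficient against S_{mℓ}. Completeness in ϑ kills that Fourier coefficient, and
completeness in φ then kills f. -/
theorem SphereReg.eq_zero_of_coeff (hf : SphereReg f)
    (h : ∀ n : ℕ, ∀ m ∈ modes n, sphCoeff m n f = 0) : ∀ θ ∈ Ioo 0 π, ∀ φ, f θ φ = 0 := by
  have hpi := Real.pi_pos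
  obtain ⟨B, hB⟩ := hf.bdd
  have key : ∀ m : ℤ, ∀ θ ∈ Ioo 0 π,
      ∫ φ in (0 : ℝ)..(2 * π), f θ φ * Complex.exp (-(Complex.I * m * φ)) = 0 := by
    intro m
    set F : ℝ → ℂ := fun θ => ∫ φ in (0 : ℝ)..(2 * π), f θ φ * Complex.exp (-(Complex.I * m * φ))
      with hF
    have hFc : ContinuousOn F (Ioo 0 π) := continuousOn_phi_coeff hf m
    have hFb : ∀ θ ∈ Ioo 0 π, ‖F θ‖ ≤ B * (2 * π) := by
      intro θ hθ
      have := intervalIntegral.norm_integral_le_of_norm_le_const (a := 0) (b := 2 * π) (C := B)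
        (f := fun φ => f θ φ * Complex.exp (-(Complex.I * m * φ))) fun φ _ => by
          rw [norm_mul, norm_exp_neg_I_mul, mul_one]; exact hB θ hθ φ
      rwa [sub_zero, abs_of_pos (by positivity)] at this
    have hint : ∀ n : ℕ, m ∈ modes n → MeasureTheory.IntegrableOn
        (fun θ => F θ * (S m (n + 2) θ : ℂ) * (Real.sin θ : ℂ)) (Ioo 0 π) := by
      intro n hm
      have hm' := Finset.mem_Icc.1 hm
      have h1 : MeasureTheory.IntegrableOn
          (fun θ => F θ * (harm m n 4 θ : ℂ) * (Real.sin θ : ℂ)) (Ioo 0 π) := by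
        refine MeasureTheory.IntegrableOn.of_bound (by simp) ?_ (B * (2 * π) * (n + 3)) ?_
        · have := continuous_harm m n 4
          exact ((hFc.mul (by fun_prop)).mul (by fun_prop)).aestronglyMeasurable measurableSet_Ioo
        · refine (MeasureTheory.ae_restrict_iff' measurableSet_Ioo).2 (MeasureTheory.ae_of_all _ fun θ hθ => ?_)
          rw [norm_mul, norm_mul, Complex.norm_real, Complex.norm_real]
          refine (mul_le_of_le_one_right (by positivity) (Real.abs_sin_le_one _)).trans ?_
          exact mul_le_mul (hFb θ hθ) (abs_harm_le hm'.1 _ _) (norm_nonneg _)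
            ((norm_nonneg _).trans (hFb θ hθ))
      refine h1.congr_fun (fun θ hθ => ?_) measurableSet_Ioo
      simp only [S_eq_harm hm'.1 hm'.2 hθ]
    -- L is the real or the imaginary part: the harmonics are real, so each part is orthogonal to
    -- them separately.
    have hpart : ∀ L : ℂ →L[ℝ] ℝ, (∀ x : ℝ, ∀ z : ℂ, L (z * x) = L z * x) →
        (∀ z, |L z| ≤ ‖z‖) → ∀ θ ∈ Ioo 0 π, L (F θ) = 0 := by
      intro L hL hLb
      refine eq_zero_of_real_coefficients (m := m) (f := fun θ => L (F θ)) (B := B * (2 * π))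
        (L.continuous.comp_continuousOn hFc) (fun θ hθ => (hLb _).trans (hFb θ hθ))
        fun n h1 h2 => ?_
      have hm : m ∈ modes n := Finset.mem_Icc.2 ⟨h1, h2⟩
      have h0 := h n m hm
      rw [sphCoeff_swap hf hm, intervalIntegral.integral_of_le hpi.le,
        MeasureTheory.integral_Ioc_eq_integral_Ioo] at h0
      have h3 := L.integral_comp_comm (hint n hm)
      rw [h0, map_zero] at h3
      rw [intervalIntegral.integral_of_le hpi.le, MeasureTheory.integral_Ioc_eq_integral_Ioo]
      simp only [hL] at h3
      exact h3
    intro θ hθ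
    refine Complex.ext ?_ ?_
    · exact hpart Complex.reCLM (by intro x z; simp) (fun z => Complex.abs_re_le_norm z) θ hθ
    · exact hpart Complex.imCLM (by intro x z; simp) (fun z => Complex.abs_im_le_norm z) θ hθ
  intro θ hθ
  refine eq_zero_of_fourier ?_ (hf.per θ hθ) fun m => key m θ hθ
  have := hf.cont.comp (f := fun φ : ℝ => (θ, φ)) (s := univ) (by fun_prop)
    fun φ _ => ⟨hθ, mem_univ _⟩
  exact continuousOn_univ.1 this

end Coeff

end

section

/-! ## Series of harmonics -/

/-- The series with coefficients `c` in the functions `h m n (ϑ) e^{i m φ}`. -/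
noncomputable def Ser (c : ℤ → ℕ → ℂ) (h : ℤ → ℕ → ℝ → ℝ) (θ φ : ℝ) : ℂ :=
  ∑' n : ℕ, ∑ m ∈ modes n, c m n * ((h m n θ : ℂ) * Complex.exp (Complex.I * m * φ))

theorem hasSum_of_eq {f g : ℕ → ℂ} {a : ℂ} (h : HasSum g a) (e : ∀ n, f n = g n) :
    HasSum f a := by
  rwa [show f = g from funext e]

/-- Coefficients which decay faster than any power of the degree. -/
def RapidDecay (c : ℤ → ℕ → ℂ) : Prop :=
  ∀ N : ℕ, ∃ C : ℝ, ∀ n : ℕ, ∀ m ∈ modes n, ‖c m n‖ * ((n : ℝ) + 1) ^ N ≤ C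

/-- Functions which grow at most polynomially in the degree. -/
def PolyBdd (h : ℤ → ℕ → ℝ → ℝ) : Prop :=
  ∃ (P : ℕ) (K : ℝ), ∀ n : ℕ, ∀ m ∈ modes n, ∀ θ, |h m n θ| ≤ K * ((n : ℝ) + 1) ^ P

theorem summable_majorant (B : ℝ) : Summable fun n : ℕ => B / ((n : ℝ) + 1) ^ 2 := by
  have h := (summable_nat_add_iff 1).2 (Real.summable_one_div_nat_pow.2 (one_lt_two))
  refine (h.mul_left B).congr fun n => ?_
  push_cast
  ring

/-- Of the three extra powers, one pays for the 2n + 5 modes of a given degree and two leave a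
summable bound. -/
theorem sum_modes_le {n P : ℕ} {C K : ℝ} {a x : ℤ → ℂ}
    (ha : ∀ m ∈ modes n, ‖a m‖ * ((n : ℝ) + 1) ^ (P + 3) ≤ C)
    (hx : ∀ m ∈ modes n, ‖x m‖ ≤ K * ((n : ℝ) + 1) ^ P) :
    ∑ m ∈ modes n, ‖a m * x m‖ ≤ 5 * C * K / ((n : ℝ) + 1) ^ 2 := by
  have hn : (0 : ℝ) < (n : ℝ) + 1 := by positivity
  have h0 : (0 : ℤ) ∈ modes n := Finset.mem_Icc.2 ⟨by omega, by omega⟩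
  have hC : 0 ≤ C := le_trans (by positivity) (ha 0 h0)
  have hK : 0 ≤ K := by
    by_contra hK
    exact absurd ((norm_nonneg _).trans (hx 0 h0)) (not_le.2 (mul_neg_of_neg_of_pos (by linarith)
      (by positivity)))
  have h1 : ∀ m ∈ modes n, ‖a m * x m‖ ≤ C * K / ((n : ℝ) + 1) ^ 3 := by
    intro m hm
    rw [norm_mul, le_div_iff₀ (by positivity)]
    calc ‖a m‖ * ‖x m‖ * ((n : ℝ) + 1) ^ 3
        ≤ ‖a m‖ * (K * ((n : ℝ) + 1) ^ P) * ((n : ℝ) + 1) ^ 3 := by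
          gcongr; exact hx m hm
      _ = (‖a m‖ * ((n : ℝ) + 1) ^ (P + 3)) * K := by ring
      _ ≤ C * K := mul_le_mul_of_nonneg_right (ha m hm) hK
  refine (Finset.sum_le_card_nsmul _ _ _ h1).trans ?_
  have hcard : ((modes n).card : ℝ) = 2 * n + 5 := by
    have : ((modes n).card : ℤ) = 2 * n + 5 := by rw [Int.card_Icc]; omega
    exact_mod_cast this
  rw [nsmul_eq_mul, hcard, ← mul_div_assoc, div_le_div_iff₀ (by positivity) (by positivity)]
  have : (2 * (n : ℝ) + 5) ≤ 5 * (n + 1) := by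
    have : (0 : ℝ) ≤ n := Nat.cast_nonneg n
    linarith
  have hCK : 0 ≤ C * K := mul_nonneg hC hK
  calc (2 * (n : ℝ) + 5) * (C * K) * ((n : ℝ) + 1) ^ 2
      ≤ (5 * (n + 1)) * (C * K) * ((n : ℝ) + 1) ^ 2 := by gcongr
    _ = 5 * C * K * ((n : ℝ) + 1) ^ 3 := by ring

section

variable {c : ℤ → ℕ → ℂ} {h h' : ℤ → ℕ → ℝ → ℝ}

theorem norm_harm_exp_le {K : ℝ} {P n : ℕ} {m : ℤ} {θ : ℝ}
    (hh : |h m n θ| ≤ K * ((n : ℝ) + 1) ^ P) (φ : ℝ) :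
    ‖(h m n θ : ℂ) * Complex.exp (Complex.I * m * φ)‖ ≤ K * ((n : ℝ) + 1) ^ P := by
  rw [norm_mul, norm_exp_I_mul, mul_one, Complex.norm_real]
  exact hh

theorem exists_majorant (hc : RapidDecay c) (hh : PolyBdd h) :
    ∃ B : ℝ, ∀ (n : ℕ) (θ φ : ℝ),
      ∑ m ∈ modes n, ‖c m n * ((h m n θ : ℂ) * Complex.exp (Complex.I * m * φ))‖
        ≤ B / ((n : ℝ) + 1) ^ 2 := by
  obtain ⟨P, K, hK⟩ := hh
  obtain ⟨C, hC⟩ := hc (P + 3)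
  exact ⟨5 * C * K, fun n θ φ => sum_modes_le (hC n)
    fun m hm => norm_harm_exp_le (hK n m hm θ) φ⟩

theorem summable_Ser (hc : RapidDecay c) (hh : PolyBdd h) (θ φ : ℝ) :
    Summable fun n : ℕ => ∑ m ∈ modes n,
      c m n * ((h m n θ : ℂ) * Complex.exp (Complex.I * m * φ)) := by
  obtain ⟨B, hB⟩ := exists_majorant hc hh
  exact Summable.of_norm_bounded (summable_majorant B)
    fun n => (norm_sum_le _ _).trans (hB n θ φ)

theorem hasSum_Ser (hc : RapidDecay c) (hh : PolyBdd h) (θ φ : ℝ) :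
    HasSum (fun n : ℕ => ∑ m ∈ modes n,
      c m n * ((h m n θ : ℂ) * Complex.exp (Complex.I * m * φ))) (Ser c h θ φ) :=
  (summable_Ser hc hh θ φ).hasSum

theorem sphereReg_Ser (hc : RapidDecay c) (hh : PolyBdd h) (hcont : ∀ m n, Continuous (h m n)) :
    SphereReg (Ser c h) := by
  obtain ⟨B, hB⟩ := exists_majorant hc hh
  refine ⟨Continuous.continuousOn ?_, ⟨∑' n : ℕ, B / ((n : ℝ) + 1) ^ 2, fun θ _ φ => ?_⟩, ?_⟩
  · refine continuous_tsum (fun n => ?_) (summable_majorant B) fun n z =>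
      (norm_sum_le _ _).trans (hB n z.1 z.2)
    refine continuous_finsetSum _ fun m _ => ?_
    have := hcont m n
    fun_prop
  · exact tsum_of_norm_bounded (summable_majorant B).hasSum
      fun n => (norm_sum_le _ _).trans (hB n θ φ)
  · intro θ _ φ
    have : ∀ m : ℤ, Complex.exp (Complex.I * m * (φ + 2 * π : ℝ)) = Complex.exp (Complex.I * m * φ) := by
      intro m
      rw [show Complex.I * m * (φ + 2 * π : ℝ) = Complex.I * m * φ + m * (2 * π * Complex.I) by
        push_cast; ring, Complex.exp_add, Complex.exp_int_mul_two_pi_mul_I, mul_one]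
    simp only [Ser, this]

theorem hasDerivAt_Ser_theta (hc : RapidDecay c) (hh : PolyBdd h) (hh' : PolyBdd h')
    (hd : ∀ m n θ, HasDerivAt (h m n) (h' m n θ) θ) (θ φ : ℝ) :
    HasDerivAt (fun x => Ser c h x φ) (Ser c h' θ φ) θ := by
  obtain ⟨B, hB⟩ := exists_majorant hc hh'
  rw [← hasDerivWithinAt_univ]
  refine hasDerivWithinAt_tsum convex_univ (mem_univ θ) (summable_majorant B)
    (u' := fun n θ => ∑ m ∈ modes n, c m n * ((h' m n θ : ℂ) * Complex.exp (Complex.I * m * φ)))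
    (fun n y _ => ?_) (fun n y _ => (norm_sum_le _ _).trans (hB n y φ))
    fun y _ => summable_Ser hc hh y φ
  exact (HasDerivAt.fun_sum fun m _ =>
    (((hd m n y).ofReal_comp).mul_const _).const_mul _).hasDerivWithinAt

theorem RapidDecay.mul {a : ℤ → ℕ → ℂ} (hc : RapidDecay c) {P : ℕ} {K : ℝ}
    (ha : ∀ n : ℕ, ∀ m ∈ modes n, ‖a m n‖ ≤ K * ((n : ℝ) + 1) ^ P) :
    RapidDecay fun m n => a m n * c m n := by
  intro N
  obtain ⟨C, hC⟩ := hc (N + P)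
  refine ⟨|K| * C, fun n m hm => ?_⟩
  rw [norm_mul]
  calc ‖a m n‖ * ‖c m n‖ * ((n : ℝ) + 1) ^ N
      ≤ (|K| * ((n : ℝ) + 1) ^ P) * ‖c m n‖ * ((n : ℝ) + 1) ^ N := by
        gcongr
        exact (ha n m hm).trans (by gcongr; exact le_abs_self K)
    _ = |K| * (‖c m n‖ * ((n : ℝ) + 1) ^ (N + P)) := by ring
    _ ≤ |K| * C := mul_le_mul_of_nonneg_left (hC n m hm) (abs_nonneg _)

theorem RapidDecay.conj_neg (hc : RapidDecay c) : RapidDecay fun m n => conj (c (-m) n) := by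
  intro N
  obtain ⟨C, hC⟩ := hc N
  refine ⟨C, fun n m hm => ?_⟩
  rw [RCLike.norm_conj]
  exact hC n (-m) (neg_mem_modes.2 hm)

theorem norm_mode_le {m : ℤ} {n : ℕ} (hm : m ∈ modes n) :
    ‖Complex.I * (m : ℂ)‖ ≤ 2 * ((n : ℝ) + 1) ^ 1 := by
  have hm' := Finset.mem_Icc.1 hm
  rw [norm_mul, Complex.norm_I, one_mul, Complex.norm_intCast]
  have h1 : (-((n : ℝ) + 2)) ≤ m := by exact_mod_cast hm'.1
  have h2 : (m : ℝ) ≤ (n : ℝ) + 2 := by exact_mod_cast hm'.2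
  have : (0 : ℝ) ≤ n := Nat.cast_nonneg n
  rw [abs_le]
  constructor <;> linarith

theorem RapidDecay.mode (hc : RapidDecay c) : RapidDecay fun m n => Complex.I * m * c m n :=
  hc.mul (a := fun m _ => Complex.I * m) fun _ _ hm => norm_mode_le hm

theorem hasDerivAt_Ser_phi (hc : RapidDecay c) (hh : PolyBdd h) (θ φ : ℝ) :
    HasDerivAt (fun x => Ser c h θ x) (Ser (fun m n => Complex.I * m * c m n) h θ φ) φ := by
  obtain ⟨B, hB⟩ := exists_majorant hc.mode hh
  rw [← hasDerivWithinAt_univ]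
  refine hasDerivWithinAt_tsum convex_univ (mem_univ φ) (summable_majorant B)
    (u' := fun n φ => ∑ m ∈ modes n,
      Complex.I * m * c m n * ((h m n θ : ℂ) * Complex.exp (Complex.I * m * φ)))
    (fun n y _ => ?_) (fun n y _ => (norm_sum_le _ _).trans (hB n θ y))
    fun y _ => summable_Ser hc hh θ y
  refine (HasDerivAt.fun_sum fun m _ => ?_).hasDerivWithinAt
  have h1 : HasDerivAt (fun x : ℝ => Complex.I * m * (x : ℂ)) (Complex.I * m) y := by
    simpa using (Complex.ofRealCLM.hasDerivAt (x := y)).const_mul (Complex.I * m)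
  exact ((h1.cexp.const_mul _).const_mul _).congr_deriv (by ring)

end

theorem polyBdd_harm (j : ℕ) : PolyBdd fun m n => harm m n j := by
  refine ⟨1, 3, fun n m hm θ => (abs_harm_le (Finset.mem_Icc.1 hm).1 j θ).trans ?_⟩
  have : (0 : ℝ) ≤ n := Nat.cast_nonneg n
  linarith

theorem polyBdd_harmD : PolyBdd harmD := by
  refine ⟨2, 15, fun n m hm θ => (abs_harmD_le (Finset.mem_Icc.1 hm).1 θ).trans ?_⟩
  have : (0 : ℝ) ≤ n := Nat.cast_nonneg n
  nlinarith

theorem polyBdd_harmDD : PolyBdd harmDD := by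
  refine ⟨3, 75, fun n m hm θ => (abs_harmDD_le (Finset.mem_Icc.1 hm).1 θ).trans ?_⟩
  have : (0 : ℝ) ≤ n := Nat.cast_nonneg n
  calc (2 * (n : ℝ) + 5) * ((2 * n + 5) * (n + 3))
      ≤ (5 * (n + 1)) * ((5 * (n + 1)) * (3 * (n + 1))) := by gcongr <;> linarith
    _ = _ := by ring

theorem polyBdd_half_ladder (j : ℕ) : PolyBdd fun m n θ =>
    1 / 2 * (wigA (2 * (n + 2)) (n + j + 1) * harm m n j θ
        - wigA (2 * (n + 2)) (n + j + 2) * harm m n (j + 2) θ) := by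
  refine ⟨2, 15, fun n m hm θ => (abs_half_ladder_le (abs_harm_le (Finset.mem_Icc.1 hm).1 j θ)
    (abs_harm_le (Finset.mem_Icc.1 hm).1 (j + 2) θ)).trans ?_⟩
  have : (0 : ℝ) ≤ n := Nat.cast_nonneg n
  nlinarith

theorem RapidDecay.wigA {c : ℤ → ℕ → ℂ} (hc : RapidDecay c) (j : ℕ) :
    RapidDecay fun m n => (wigA (2 * (n + 2)) (n + j) : ℂ) * c m n := by
  refine hc.mul (a := fun _ n => (SchwarzschildAdS.wigA (2 * (n + 2)) (n + j) : ℂ))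
    (P := 1) (K := 5) fun n m _ => ?_
  rw [Complex.norm_real, Real.norm_eq_abs, abs_of_nonneg (wigA_nonneg _ _)]
  refine (wigA_le _ _).trans ?_
  push_cast
  have : (0 : ℝ) ≤ n := Nat.cast_nonneg n
  linarith

theorem RapidDecay.lam {c : ℤ → ℕ → ℂ} (hc : RapidDecay c) :
    RapidDecay fun m n => (lam n : ℂ) * c m n := by
  refine hc.mul (a := fun _ n => (SchwarzschildAdS.lam n : ℂ)) (P := 2) (K := 6) fun n m _ => ?_
  rw [Complex.norm_real, Real.norm_eq_abs, abs_of_nonneg (by unfold SchwarzschildAdS.lam; positivity)]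
  unfold SchwarzschildAdS.lam
  have : (0 : ℝ) ≤ n := Nat.cast_nonneg n
  nlinarith

/-! ## Angular operators on series -/

section Angular

variable {F : Field} {t r : ℝ} {c : ℤ → ℕ → ℂ}

theorem dTheta_eq_of_eqOn {f : ℝ → ℝ → ℂ} (hF : ∀ θ ∈ Ioo 0 π, ∀ φ, F t r θ φ = f θ φ) {θ φ : ℝ}
    (hθ : θ ∈ Ioo 0 π) {f' : ℂ} (hf : HasDerivAt (fun x => f x φ) f' θ) :
    dTheta F t r θ φ = f' := by
  refine (hf.congr_of_eventuallyEq ?_).deriv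
  filter_upwards [isOpen_Ioo.mem_nhds hθ] with x hx using hF x hx φ

theorem dPhi_eq_of_eqOn {f : ℝ → ℝ → ℂ} (hF : ∀ θ ∈ Ioo 0 π, ∀ φ, F t r θ φ = f θ φ) {θ φ : ℝ}
    (hθ : θ ∈ Ioo 0 π) {f' : ℂ} (hf : HasDerivAt (fun x => f θ x) f' φ) :
    dPhi F t r θ φ = f' :=
  (hf.congr_of_eventuallyEq (Eventually.of_forall fun x => hF θ hθ x)).deriv

theorem sin_ne_zero {θ : ℝ} (hθ : θ ∈ Ioo 0 π) : Real.sin θ ≠ 0 :=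
  (Real.sin_pos_of_pos_of_lt_pi hθ.1 hθ.2).ne'

/-- On a mode, -(i/sin ϑ)∂_φ is multiplication by m/sin ϑ. At spin weight j - 1 the operator
ℒ†_{j-1} is therefore exactly the lowering operator of `hasDerivAt_harm_lower`. -/
theorem angLdag_of_eq_Ser (j : ℕ) (hc : RapidDecay c)
    (hF : ∀ θ ∈ Ioo 0 π, ∀ φ, F t r θ φ = Ser c (fun m n => harm m n (j + 1)) θ φ) :
    ∀ θ ∈ Ioo 0 π, ∀ φ, angLdag ((j : ℤ) - 1) F t r θ φ
      = Ser (fun m n => (wigA (2 * (n + 2)) (n + (j + 1)) : ℂ) * c m n) (fun m n => harm m n j) θ φ := by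
  intro θ hθ φ
  have hs := sin_ne_zero hθ
  have h1 := dTheta_eq_of_eqOn hF hθ (hasDerivAt_Ser_theta hc (polyBdd_harm (j + 1))
    (polyBdd_half_ladder j) (fun m n x => hasDerivAt_harm m n j x) θ φ)
  have h2 := dPhi_eq_of_eqOn hF hθ (hasDerivAt_Ser_phi hc (polyBdd_harm (j + 1)) θ φ)
  rw [angLdag, h1, h2, hF θ hθ φ]
  refine ((((hasSum_Ser hc (polyBdd_half_ladder j) θ φ).sub
    ((hasSum_Ser hc.mode (polyBdd_harm (j + 1)) θ φ).mul_left (Complex.I / (Real.sin θ : ℂ)))).add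
    ((hasSum_Ser hc (polyBdd_harm (j + 1)) θ φ).mul_left
      (((((j : ℤ) - 1 : ℤ)) : ℂ) * (Real.cot θ : ℂ))))).unique ?_
  refine hasSum_of_eq (hasSum_Ser (hc.wigA (j + 1)) (polyBdd_harm j) θ φ) fun n => ?_
  simp only [Finset.mul_sum, ← Finset.sum_add_distrib, ← Finset.sum_sub_distrib]
  refine Finset.sum_congr rfl fun m hm => ?_
  -- The series was differentiated with the bounded form of the derivative; it is now exchanged for
  -- the lowering form.
  have e := (hasDerivAt_harm m n j θ).unique
    (hasDerivAt_harm_lower (Finset.mem_Icc.1 hm).2 j hs)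
  rw [e, Real.cot_eq_cos_div_sin]
  push_cast
  have hsC : (Real.sin θ : ℂ) ≠ 0 := by exact_mod_cast hs
  have hI : Complex.I ^ 2 = -1 := Complex.I_sq
  rw [show n + (j + 1) = n + j + 1 by omega]
  rw [Complex.ofReal_sin] at hsC
  field_simp
  linear_combination (- c m n * m * harm m n (j + 1) θ) * hI

theorem angOp_of_eq_Ser (hc : RapidDecay c)
    (hF : ∀ θ ∈ Ioo 0 π, ∀ φ, F t r θ φ = Ser c (fun m n => harm m n 4) θ φ) :
    ∀ θ ∈ Ioo 0 π, ∀ φ, angOp 2 F t r θ φ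
      = Ser (fun m n => (lam n : ℂ) * c m n) (fun m n => harm m n 4) θ φ := by
  intro θ hθ φ
  have hs := sin_ne_zero hθ
  have h1 : ∀ x ∈ Ioo 0 π, ∀ y, dTheta F t r x y = Ser c harmD x y := fun x hx y =>
    dTheta_eq_of_eqOn hF hx (hasDerivAt_Ser_theta hc (polyBdd_harm 4)
      polyBdd_harmD (fun m n z => hasDerivAt_harm_four m n z) x y)
  have h2 : dTheta (fun t' r' θ' φ' => (Real.sin θ' : ℂ) * dTheta F t' r' θ' φ') t r θ φ
      = (Real.cos θ : ℂ) * Ser c harmD θ φ + (Real.sin θ : ℂ) * Ser c harmDD θ φ :=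
    dTheta_eq_of_eqOn (f := fun x y => (Real.sin x : ℂ) * Ser c harmD x y)
      (fun x hx y => by rw [h1 x hx y]) hθ
      ((Real.hasDerivAt_sin θ).ofReal_comp.mul (hasDerivAt_Ser_theta hc polyBdd_harmD
        polyBdd_harmDD (fun m n z => hasDerivAt_harmD m n z) θ φ))
  have h3 : ∀ x ∈ Ioo 0 π, ∀ y, dPhi F t r x y
      = Ser (fun m n => Complex.I * m * c m n) (fun m n => harm m n 4) x y := fun x hx y =>
    dPhi_eq_of_eqOn hF hx (hasDerivAt_Ser_phi hc (polyBdd_harm 4) x y)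
  have h4 := dPhi_eq_of_eqOn h3 hθ (hasDerivAt_Ser_phi hc.mode (polyBdd_harm 4) θ φ)
  rw [angOp, h2, h3 θ hθ φ, h4, hF θ hθ φ]
  have e := (((((((hasSum_Ser hc polyBdd_harmD θ φ).mul_left (Real.cos θ : ℂ)).add
    ((hasSum_Ser hc polyBdd_harmDD θ φ).mul_left (Real.sin θ : ℂ))).mul_left
      (1 / (Real.sin θ : ℂ))).add
    ((hasSum_Ser hc.mode.mode (polyBdd_harm 4) θ φ).mul_left (1 / (Real.sin θ : ℂ) ^ 2))).add
    ((hasSum_Ser hc.mode (polyBdd_harm 4) θ φ).mul_left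
      (2 * ((2 : ℤ) : ℂ) * Complex.I * ((Real.cos θ : ℂ) / (Real.sin θ : ℂ) ^ 2)))).sub
    ((hasSum_Ser hc (polyBdd_harm 4) θ φ).mul_left (4 * (Real.cot θ : ℂ) ^ 2))).sub
    ((hasSum_Ser hc (polyBdd_harm 4) θ φ).mul_left 4) |>.neg
  refine e.unique ?_
  refine hasSum_of_eq (hasSum_Ser hc.lam (polyBdd_harm 4) θ φ) fun n => ?_
  simp only [Finset.mul_sum, ← Finset.sum_add_distrib, ← Finset.sum_sub_distrib,
    ← Finset.sum_neg_distrib]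
  refine Finset.sum_congr rfl fun m hm => ?_
  have ode := harm_ode (Finset.mem_Icc.1 hm).2 hs (m := m) (n := n)
  have ode' : (harmDD m n θ : ℂ) + (Real.cos θ : ℂ) / Real.sin θ * harmD m n θ
      - ((m : ℂ) ^ 2 + 4 * m * Real.cos θ + 4 * (Real.cos θ : ℂ) ^ 2) / (Real.sin θ : ℂ) ^ 2
        * harm m n 4 θ - 4 * harm m n 4 θ + lam n * harm m n 4 θ = 0 := by
    exact_mod_cast congrArg (fun x : ℝ => (x : ℂ)) ode
  have hsC : (Real.sin θ : ℂ) ≠ 0 := by exact_mod_cast hs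
  rw [Real.cot_eq_cos_div_sin, Complex.ofReal_div]
  have hI : Complex.I ^ 2 = -1 := Complex.I_sq
  field_simp at ode' ⊢
  linear_combination (-c m n) * ode'
    - c m n * harm m n 4 θ * ((m : ℂ) ^ 2 + 4 * m * Real.cos θ) * hI

end Angular

end

section

/-! ## Expansion in harmonics -/

theorem integral_exp_modes (m m' : ℤ) :
    ∫ φ in Ioc 0 (2 * π), Complex.exp (Complex.I * m' * φ) * Complex.exp (-(Complex.I * m * φ))
      = if m' = m then (2 * π : ℂ) else 0 := by
  rw [← intervalIntegral.integral_of_le (by positivity)]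
  have h : ∀ φ : ℝ, Complex.exp (Complex.I * m' * φ) * Complex.exp (-(Complex.I * m * φ))
      = Complex.exp ((Complex.I * (m' - m : ℤ)) * φ) := by
    intro φ
    rw [← Complex.exp_add]; congr 1; push_cast; ring
  simp only [h]
  split_ifs with hm
  · simp [hm]
  · have hne : Complex.I * ((m' - m : ℤ) : ℂ) ≠ 0 :=
      mul_ne_zero Complex.I_ne_zero (by exact_mod_cast sub_ne_zero.2 hm)
    rw [integral_exp_mul_complex hne]
    have : Complex.I * ((m' - m : ℤ) : ℂ) * ((2 * π : ℝ) : ℂ)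
        = ((m' - m : ℤ) : ℂ) * (2 * π * Complex.I) := by push_cast; ring
    rw [this, Complex.exp_int_mul_two_pi_mul_I]
    simp

theorem integral_harm_mul_sphKer {m m' : ℤ} {n n' : ℕ} (hm : m ∈ modes n) (hm' : m' ∈ modes n') :
    ∫ z, ((harm m' n' 4 z.2 : ℂ) * Complex.exp (Complex.I * m' * z.1)) * sphKer m n z ∂sphMeas
      = if n' = n ∧ m' = m then 1 else 0 := by
  have e : ∀ z : ℝ × ℝ, ((harm m' n' 4 z.2 : ℂ) * Complex.exp (Complex.I * m' * z.1)) * sphKer m n z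
      = (Complex.exp (Complex.I * m' * z.1) * Complex.exp (-(Complex.I * m * z.1)))
        * ((harm m' n' 4 z.2 * harm m n 4 z.2 * Real.sin z.2 : ℝ) : ℂ) := by
    intro z; rw [sphKer]; push_cast; ring
  simp only [e]
  rw [sphMeas, MeasureTheory.integral_prod_mul
    (fun φ : ℝ => Complex.exp (Complex.I * m' * φ) * Complex.exp (-(Complex.I * m * φ)))
    (fun θ : ℝ => ((harm m' n' 4 θ * harm m n 4 θ * Real.sin θ : ℝ) : ℂ)), integral_exp_modes,
    integral_complex_ofReal, ← MeasureTheory.integral_Ioc_eq_integral_Ioo,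
    ← intervalIntegral.integral_of_le Real.pi_pos.le]
  have h1 := Finset.mem_Icc.1 hm
  have h2 := Finset.mem_Icc.1 hm'
  by_cases hmm : m' = m
  · subst hmm
    rw [integral_harm_mul_harm h2.1 h2.2 h1.2]
    simp only [if_true, and_true]
    split_ifs
    · have : (π : ℂ) ≠ 0 := by exact_mod_cast Real.pi_ne_zero
      push_cast
      field_simp
    · simp
  · simp [hmm]

/-- Orthonormality, once the sum and the integral are exchanged; rapid decay makes the integrals of
the norms summable. -/
theorem sphCoeff_Ser {c : ℤ → ℕ → ℂ} (hc : RapidDecay c) {m : ℤ} {n : ℕ} (hm : m ∈ modes n) :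
    sphCoeff m n (Ser c fun m n => harm m n 4) = c m n := by
  have hh := polyBdd_harm 4
  obtain ⟨B, hB⟩ := exists_majorant hc hh
  have hcont : ∀ m' n', Continuous fun z : ℝ × ℝ =>
      ((harm m' n' 4 z.2 : ℂ) * Complex.exp (Complex.I * m' * z.1)) := by
    intro m' n'
    have := continuous_harm m' n' 4
    fun_prop
  rw [sphCoeff_eq_integral (sphereReg_Ser hc hh fun m n => continuous_harm m n 4) hm]
  have hbd : ∀ (n' : ℕ) (z : ℝ × ℝ), ‖(∑ m' ∈ modes n', c m' n' * ((harm m' n' 4 z.2 : ℂ)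
      * Complex.exp (Complex.I * m' * z.1))) * sphKer m n z‖
      ≤ B / ((n' : ℝ) + 1) ^ 2 * (n + 3) := by
    intro n' z
    have h0 := (norm_sum_le _ _).trans (hB n' z.2 z.1)
    rw [norm_mul]
    exact mul_le_mul h0 (norm_sphKer_le (Finset.mem_Icc.1 hm).1 z) (norm_nonneg _)
      ((norm_nonneg _).trans h0)
  have hint : ∀ n' : ℕ, MeasureTheory.Integrable (fun z : ℝ × ℝ => (∑ m' ∈ modes n',
      c m' n' * ((harm m' n' 4 z.2 : ℂ) * Complex.exp (Complex.I * m' * z.1))) * sphKer m n z)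
      sphMeas := by
    intro n'
    refine integrable_sphMeas (Continuous.continuousOn ?_) fun φ θ _ => hbd n' (φ, θ)
    refine Continuous.mul (continuous_finsetSum _ fun m' _ => ?_) (continuous_sphKer m n)
    exact continuous_const.mul (hcont m' n')
  have hsum : Summable fun n' : ℕ => ∫ z, ‖(∑ m' ∈ modes n', c m' n' * ((harm m' n' 4 z.2 : ℂ)
      * Complex.exp (Complex.I * m' * z.1))) * sphKer m n z‖ ∂sphMeas := by
    refine Summable.of_nonneg_of_le (fun n' => MeasureTheory.integral_nonneg fun _ => norm_nonneg _)
      (fun n' => ?_) (((summable_majorant B).mul_right ((n : ℝ) + 3)).mul_right (sphMeas.real univ))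
    have := MeasureTheory.norm_integral_le_of_norm_le_const (μ := sphMeas)
      (f := fun z => ‖(∑ m' ∈ modes n', c m' n' * ((harm m' n' 4 z.2 : ℂ)
      * Complex.exp (Complex.I * m' * z.1))) * sphKer m n z‖)
      (MeasureTheory.ae_of_all _ fun z => by rw [norm_norm]; exact hbd n' z)
    exact (le_abs_self _).trans this
  have hswap := MeasureTheory.integral_tsum_of_summable_integral_norm hint hsum
  have hlhs : ∀ z : ℝ × ℝ, Ser c (fun m n => harm m n 4) z.2 z.1 * sphKer m n z
      = ∑' n' : ℕ, (∑ m' ∈ modes n', c m' n' * ((harm m' n' 4 z.2 : ℂ)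
      * Complex.exp (Complex.I * m' * z.1))) * sphKer m n z := by
    intro z; rw [Ser, tsum_mul_right]
  simp only [hlhs]
  rw [← hswap]
  have hterm : ∀ n' : ℕ, ∫ z, (∑ m' ∈ modes n', c m' n' * ((harm m' n' 4 z.2 : ℂ)
      * Complex.exp (Complex.I * m' * z.1))) * sphKer m n z ∂sphMeas
      = if n' = n then c m n else 0 := by
    intro n'
    simp only [Finset.sum_mul, mul_assoc (c _ n')]
    rw [MeasureTheory.integral_finsetSum]
    · have : ∀ m' ∈ modes n', ∫ z, c m' n' * ((harm m' n' 4 z.2 : ℂ)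
          * Complex.exp (Complex.I * m' * z.1) * sphKer m n z) ∂sphMeas
          = if n' = n ∧ m' = m then c m n else 0 := by
        intro m' hm'
        rw [MeasureTheory.integral_const_mul, integral_harm_mul_sphKer hm hm']
        split_ifs with h
        · rw [mul_one, h.1, h.2]
        · rw [mul_zero]
      rw [Finset.sum_congr rfl this]
      by_cases hn : n' = n
      · subst hn
        simp only [true_and, if_true]
        rw [Finset.sum_ite_eq' (modes n') m fun _ => c m n', if_pos hm]
      · simp [hn]
    · intro m' hm'
      refine (integrable_sphMeas (B := (n' + 3) * (n + 3)) (Continuous.continuousOn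
        ((hcont m' n').mul (continuous_sphKer m n))) fun φ θ _ => ?_).const_mul _
      simp only [Pi.mul_apply]
      rw [norm_mul, norm_mul, norm_exp_I_mul, mul_one, Complex.norm_real]
      exact mul_le_mul (abs_harm_le (Finset.mem_Icc.1 hm').1 _ _)
        (norm_sphKer_le (Finset.mem_Icc.1 hm).1 _) (norm_nonneg _) (by positivity)
  simp only [hterm]
  exact tsum_ite_eq n fun _ => c m n

/-- The difference of f and its series has vanishing coefficients, so completeness applies.
Convergence is pointwise, with no L² theory. -/
theorem SphereReg.eq_Ser {f : ℝ → ℝ → ℂ} (hf : SphereReg f)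
    (hc : RapidDecay fun m n => sphCoeff m n f) {θ : ℝ} (hθ : θ ∈ Ioo 0 π) (φ : ℝ) :
    f θ φ = Ser (fun m n => sphCoeff m n f) (fun m n => harm m n 4) θ φ := by
  have hS := sphereReg_Ser hc (polyBdd_harm 4) fun m n => continuous_harm m n 4
  have h := (hf.sub hS).eq_zero_of_coeff (fun n m hm => by
    rw [sphCoeff_sub hf hS hm, sphCoeff_Ser hc hm, sub_self]) θ hθ φ
  exact sub_eq_zero.1 h

/-! ## The angular operator is symmetric -/

theorem integral_deriv_mul_exp {f f' : ℝ → ℂ} (hf : ∀ x, HasDerivAt f (f' x) x)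
    (hf' : Continuous f') (hp : f (2 * π) = f 0) (m : ℤ) :
    ∫ x in (0 : ℝ)..(2 * π), f' x * Complex.exp (-(Complex.I * m * x))
      = Complex.I * m * ∫ x in (0 : ℝ)..(2 * π), f x * Complex.exp (-(Complex.I * m * x)) := by
  have hfc : Continuous f := continuous_iff_continuousAt.2 fun x => (hf x).continuousAt
  have hd : ∀ x : ℝ, HasDerivAt (fun x : ℝ => f x * Complex.exp (-(Complex.I * m * x)))
      (f' x * Complex.exp (-(Complex.I * m * x))
        - Complex.I * m * (f x * Complex.exp (-(Complex.I * m * x)))) x := by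
    intro x
    have h1 : HasDerivAt (fun x : ℝ => -(Complex.I * m * (x : ℂ))) (-(Complex.I * m)) x := by
      simpa using ((Complex.ofRealCLM.hasDerivAt (x := x)).const_mul (Complex.I * m)).fun_neg
    exact ((hf x).mul h1.cexp).congr_deriv (by ring)
  have h := intervalIntegral.integral_eq_sub_of_hasDerivAt (a := 0) (b := 2 * π)
    (fun x _ => hd x) (Continuous.intervalIntegrable (by fun_prop) _ _)
  rw [intervalIntegral.integral_sub (Continuous.intervalIntegrable (by fun_prop) _ _)
    (Continuous.intervalIntegrable (by fun_prop) _ _), intervalIntegral.integral_const_mul, hp] at h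
  have e : Complex.exp (-(Complex.I * m * ((2 * π : ℝ) : ℂ))) = 1 := by
    rw [show -(Complex.I * m * ((2 * π : ℝ) : ℂ)) = ((-m : ℤ) : ℂ) * (2 * π * Complex.I) by
      push_cast; ring, Complex.exp_int_mul_two_pi_mul_I]
  rw [e] at h
  simp only [Complex.ofReal_zero, mul_zero, neg_zero, Complex.exp_zero, sub_self] at h
  exact sub_eq_zero.1 h

theorem slice_continuous {g : ℝ → ℝ → ℂ}
    (hg : ContinuousOn (fun z : ℝ × ℝ => g z.1 z.2) (Ioo 0 π ×ˢ univ)) {θ : ℝ}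
    (hθ : θ ∈ Ioo 0 π) : Continuous (g θ) :=
  continuousOn_univ.1 (hg.comp (f := fun φ : ℝ => (θ, φ)) (s := univ) (by fun_prop)
    fun _ _ => ⟨hθ, mem_univ _⟩)

theorem hasDerivAt_phi_coeff {g g' : ℝ → ℝ → ℂ}
    (hg : ContinuousOn (fun z : ℝ × ℝ => g z.1 z.2) (Ioo 0 π ×ˢ univ))
    (hg' : ContinuousOn (fun z : ℝ × ℝ => g' z.1 z.2) (Ioo 0 π ×ˢ univ))
    (hd : ∀ θ ∈ Ioo 0 π, ∀ φ, HasDerivAt (fun x => g x φ) (g' θ φ) θ) (m : ℤ) {θ : ℝ}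
    (hθ : θ ∈ Ioo 0 π) :
    HasDerivAt (fun x => ∫ φ in (0 : ℝ)..(2 * π), g x φ * Complex.exp (-(Complex.I * m * φ)))
      (∫ φ in (0 : ℝ)..(2 * π), g' θ φ * Complex.exp (-(Complex.I * m * φ))) θ := by
  -- The derivative is local in θ, so a bound of g' on a compact θ-interval is enough; no bound up
  -- to the poles is required.
  obtain ⟨ε, hε, hsub⟩ := Metric.nhds_basis_closedBall.mem_iff.1 (isOpen_Ioo.mem_nhds hθ)
  obtain ⟨C, hC⟩ := ((isCompact_closedBall θ ε).prod (isCompact_Icc (a := 0) (b := 2 * π))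
    ).exists_bound_of_continuousOn (hg'.mono (prod_mono hsub (subset_univ _)))
  have h2 : (0 : ℝ) ≤ 2 * π := by positivity
  simp only [intervalIntegral.integral_of_le h2]
  refine (hasDerivWithinAt_integral (s := Metric.closedBall θ ε) (b := fun _ => C)
    (f := fun x φ => g x φ * Complex.exp (-(Complex.I * m * φ)))
    (f' := fun x φ => g' x φ * Complex.exp (-(Complex.I * m * φ))) (convex_closedBall θ ε)
    (Metric.mem_closedBall_self hε.le) (MeasureTheory.integrable_const C) ?_ ?_ ?_).hasDerivAt
    (Metric.closedBall_mem_nhds θ hε)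
  · intro y hy
    have := slice_continuous hg (hsub hy)
    exact (Continuous.integrableOn_Icc (by fun_prop)).mono_set Ioc_subset_Icc_self
  · exact MeasureTheory.ae_of_all _ fun φ y hy =>
      ((hd y (hsub hy) φ).mul_const _).hasDerivWithinAt
  · refine (MeasureTheory.ae_restrict_iff' measurableSet_Ioc).2
      (MeasureTheory.ae_of_all _ fun φ hφ y hy => ?_)
    rw [norm_mul, norm_exp_neg_I_mul, mul_one]
    exact hC (y, φ) ⟨hy, hφ.1.le, hφ.2⟩

theorem norm_phi_coeff_le {f : ℝ → ℂ} {B : ℝ} (hB : ∀ φ, ‖f φ‖ ≤ B) (m : ℤ) :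
    ‖∫ φ in (0 : ℝ)..(2 * π), f φ * Complex.exp (-(Complex.I * m * φ))‖ ≤ B * (2 * π) := by
  have := intervalIntegral.norm_integral_le_of_norm_le_const (a := 0) (b := 2 * π) (C := B)
    (f := fun φ => f φ * Complex.exp (-(Complex.I * m * φ))) fun φ _ => by
      rw [norm_mul, norm_exp_neg_I_mul, mul_one]; exact hB φ
  rwa [sub_zero, abs_of_pos (by positivity)] at this

theorem intervalIntegrable_of_continuousOn_Ioo {g : ℝ → ℂ} (hg : ContinuousOn g (Ioo 0 π)) {B : ℝ}
    (hB : ∀ θ ∈ Ioo 0 π, ‖g θ‖ ≤ B) : IntervalIntegrable g MeasureTheory.volume 0 π := by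
  rw [intervalIntegrable_iff_integrableOn_Ioo_of_le Real.pi_pos.le]
  exact MeasureTheory.IntegrableOn.of_bound (by simp) (hg.aestronglyMeasurable measurableSet_Ioo) B
    ((MeasureTheory.ae_restrict_iff' measurableSet_Ioo).2 (MeasureTheory.ae_of_all _ hB))

theorem tendsto_sin_mul_of_bounded {g : ℝ → ℂ} {l : Filter ℝ} {x : ℝ} (hl : l ≤ 𝓝 x)
    (hx : Real.sin x = 0) {B : ℝ} (hB : ∀ᶠ θ in l, ‖g θ‖ ≤ B) :
    Tendsto (fun θ => (Real.sin θ : ℂ) * g θ) l (𝓝 0) := by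
  have h1 : Tendsto (fun θ => (Real.sin θ : ℂ)) l (𝓝 0) := by
    have : Tendsto (fun θ => (Real.sin θ : ℂ)) (𝓝 x) (𝓝 (Real.sin x : ℂ)) :=
      Continuous.tendsto (by fun_prop) x
    rw [hx, Complex.ofReal_zero] at this
    exact this.mono_left hl
  refine squeeze_zero_norm' (a := fun θ => ‖(Real.sin θ : ℂ)‖ * B) ?_ ?_
  · filter_upwards [hB] with θ hθ
    rw [norm_mul]
    exact mul_le_mul_of_nonneg_left hθ (norm_nonneg _)
  · simpa using h1.norm.mul_const B

/-- Green's formula in ϑ after integrating out φ. The boundary terms are sin ϑ times a Wronskian, so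
bounds on F and ∂_ϑF suffice to kill them at the poles; second derivatives may be unbounded there.
-/
theorem sphCoeff_angOp {F : Field} {t r : ℝ} (h0 : SphereReg (F t r))
    (hA : SphereReg (angOp 2 F t r))
    (h1c : ContinuousOn (fun z : ℝ × ℝ => dTheta F t r z.1 z.2) (Ioo 0 π ×ˢ univ))
    (h1b : ∃ B, ∀ θ ∈ Ioo 0 π, ∀ φ, ‖dTheta F t r θ φ‖ ≤ B)
    (h2c : ContinuousOn (fun z : ℝ × ℝ => dTheta (dTheta F) t r z.1 z.2) (Ioo 0 π ×ˢ univ))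
    (hp1c : ContinuousOn (fun z : ℝ × ℝ => dPhi F t r z.1 z.2) (Ioo 0 π ×ˢ univ))
    (hp2c : ContinuousOn (fun z : ℝ × ℝ => dPhi (dPhi F) t r z.1 z.2) (Ioo 0 π ×ˢ univ))
    (hd1 : ∀ θ ∈ Ioo 0 π, ∀ φ, HasDerivAt (fun x => F t r x φ) (dTheta F t r θ φ) θ)
    (hd2 : ∀ θ ∈ Ioo 0 π, ∀ φ, HasDerivAt (fun x => dTheta F t r x φ)
      (dTheta (dTheta F) t r θ φ) θ)
    (hq1 : ∀ θ ∈ Ioo 0 π, ∀ φ, HasDerivAt (F t r θ) (dPhi F t r θ φ) φ)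
    (hq2 : ∀ θ ∈ Ioo 0 π, ∀ φ, HasDerivAt (dPhi F t r θ) (dPhi (dPhi F) t r θ φ) φ)
    {m : ℤ} {n : ℕ} (hm : m ∈ modes n) :
    sphCoeff m n (angOp 2 F t r) = lam n * sphCoeff m n (F t r) := by
  have hpi := Real.pi_pos
  have hm' := Finset.mem_Icc.1 hm
  obtain ⟨B0, hB0⟩ := h0.bdd
  obtain ⟨B1, hB1⟩ := h1b
  obtain ⟨BA, hBA⟩ := hA.bdd
  set f : ℝ → ℂ := fun θ => ∫ φ in (0 : ℝ)..(2 * π), F t r θ φ * Complex.exp (-(Complex.I * m * φ))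
    with hf
  set f1 : ℝ → ℂ := fun θ => ∫ φ in (0 : ℝ)..(2 * π),
    dTheta F t r θ φ * Complex.exp (-(Complex.I * m * φ)) with hf1
  set f2 : ℝ → ℂ := fun θ => ∫ φ in (0 : ℝ)..(2 * π),
    dTheta (dTheta F) t r θ φ * Complex.exp (-(Complex.I * m * φ)) with hf2
  set q : ℝ → ℂ := fun θ => ∫ φ in (0 : ℝ)..(2 * π),
    angOp 2 F t r θ φ * Complex.exp (-(Complex.I * m * φ)) with hq
  have hfd : ∀ θ ∈ Ioo 0 π, HasDerivAt f (f1 θ) θ := fun θ hθ =>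
    hasDerivAt_phi_coeff h0.cont h1c hd1 m hθ
  have hf1d : ∀ θ ∈ Ioo 0 π, HasDerivAt f1 (f2 θ) θ := fun θ hθ =>
    hasDerivAt_phi_coeff h1c h2c hd2 m hθ
  have hfb : ∀ θ ∈ Ioo 0 π, ‖f θ‖ ≤ B0 * (2 * π) := fun θ hθ => norm_phi_coeff_le (hB0 θ hθ) m
  have hf1b : ∀ θ ∈ Ioo 0 π, ‖f1 θ‖ ≤ B1 * (2 * π) := fun θ hθ => norm_phi_coeff_le (hB1 θ hθ) m
  have hqb : ∀ θ ∈ Ioo 0 π, ‖q θ‖ ≤ BA * (2 * π) := fun θ hθ => norm_phi_coeff_le (hBA θ hθ) m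
  have hfc : ContinuousOn f (Ioo 0 π) := continuousOn_phi_coeff h0 m
  have hqc : ContinuousOn q (Ioo 0 π) := continuousOn_phi_coeff hA m
  have hqe : ∀ θ ∈ Ioo 0 π, q θ = -(f2 θ + (Real.cos θ : ℂ) / Real.sin θ * f1 θ
      - ((m : ℂ) ^ 2 + 4 * m * Real.cos θ + 4 * (Real.cos θ : ℂ) ^ 2) / (Real.sin θ : ℂ) ^ 2 * f θ
      - 4 * f θ) := by
    intro θ hθ
    have hs := sin_ne_zero hθ
    have hsC : (Real.sin θ : ℂ) ≠ 0 := by exact_mod_cast hs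
    have c0 := slice_continuous h0.cont hθ
    have c1 := slice_continuous h1c hθ
    have c2 := slice_continuous h2c hθ
    have d1 := slice_continuous hp1c hθ
    have d2 := slice_continuous hp2c hθ
    have per0 : F t r θ (2 * π) = F t r θ 0 := by simpa using h0.per θ hθ 0
    have per1 : dPhi F t r θ (2 * π) = dPhi F t r θ 0 := by
      have h : ∀ᶠ x in 𝓝 (0 : ℝ), F t r θ (x + 2 * π) = F t r θ x :=
        Eventually.of_forall fun x => h0.per θ hθ x
      have h3 := (hq1 θ hθ (0 + 2 * π)).comp_add_const 0 (2 * π)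
      have h4 := h3.unique ((hq1 θ hθ 0).congr_of_eventuallyEq h)
      rwa [zero_add] at h4
    have i1 := integral_deriv_mul_exp (hq1 θ hθ) d1 per0 m
    have i2 := integral_deriv_mul_exp (hq2 θ hθ) d2 per1 m
    have hexp : ∀ φ, angOp 2 F t r θ φ * Complex.exp (-(Complex.I * m * φ))
        = -(((dTheta (dTheta F) t r θ φ * Complex.exp (-(Complex.I * m * φ))
          + (Real.cos θ : ℂ) / Real.sin θ * (dTheta F t r θ φ * Complex.exp (-(Complex.I * m * φ)))
          + 1 / (Real.sin θ : ℂ) ^ 2 * (dPhi (dPhi F) t r θ φ * Complex.exp (-(Complex.I * m * φ)))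
          + 4 * Complex.I * ((Real.cos θ : ℂ) / (Real.sin θ : ℂ) ^ 2)
            * (dPhi F t r θ φ * Complex.exp (-(Complex.I * m * φ))))
          - (4 * (Real.cot θ : ℂ) ^ 2 + 4) * (F t r θ φ * Complex.exp (-(Complex.I * m * φ))))) := by
      intro φ
      have hdd : dTheta (fun t' r' θ' φ' => (Real.sin θ' : ℂ) * dTheta F t' r' θ' φ') t r θ φ
          = (Real.cos θ : ℂ) * dTheta F t r θ φ + (Real.sin θ : ℂ) * dTheta (dTheta F) t r θ φ :=
        ((Real.hasDerivAt_sin θ).ofReal_comp.mul (hd2 θ hθ φ)).deriv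
      rw [angOp, hdd]
      field_simp
      push_cast
      ring
    have hint : q θ = -(((f2 θ + (Real.cos θ : ℂ) / Real.sin θ * f1 θ
        + 1 / (Real.sin θ : ℂ) ^ 2 * ∫ φ in (0 : ℝ)..(2 * π),
          (dPhi (dPhi F) t r θ φ * Complex.exp (-(Complex.I * m * φ))))
        + 4 * Complex.I * ((Real.cos θ : ℂ) / (Real.sin θ : ℂ) ^ 2) * ∫ φ in (0 : ℝ)..(2 * π),
          (dPhi F t r θ φ * Complex.exp (-(Complex.I * m * φ))))
        - (4 * (Real.cot θ : ℂ) ^ 2 + 4) * f θ) := by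
      simp only [hq, hf, hf1, hf2]
      simp only [hexp]
      rw [intervalIntegral.integral_neg, intervalIntegral.integral_sub,
        intervalIntegral.integral_add, intervalIntegral.integral_add, intervalIntegral.integral_add]
      · simp only [intervalIntegral.integral_const_mul]
      all_goals exact Continuous.intervalIntegrable (by fun_prop) _ _
    have hI : Complex.I ^ 2 = -1 := Complex.I_sq
    rw [hint, i2, i1, Real.cot_eq_cos_div_sin]
    change -(((f2 θ + (Real.cos θ : ℂ) / Real.sin θ * f1 θ
        + 1 / (Real.sin θ : ℂ) ^ 2 * (Complex.I * m * (Complex.I * m * f θ)))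
        + 4 * Complex.I * ((Real.cos θ : ℂ) / (Real.sin θ : ℂ) ^ 2) * (Complex.I * m * f θ))
        - (4 * ((Real.cos θ / Real.sin θ : ℝ) : ℂ) ^ 2 + 4) * f θ) = _
    push_cast
    rw [Complex.ofReal_sin] at hsC
    field_simp
    linear_combination (-(f θ) * ((m : ℂ) ^ 2 + 4 * m * Complex.cos θ)) * hI
  -- Derivative of the weighted Wronskian of the Fourier coefficient of F and the harmonic: the two
  -- second order expressions differ only by λf - q.
  have hderiv : ∀ θ ∈ Ioo 0 π, HasDerivAt
      (fun θ => (Real.sin θ : ℂ) * (f1 θ * (harm m n 4 θ : ℂ) - f θ * (harmD m n θ : ℂ)))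
      (lam n * (f θ * (harm m n 4 θ : ℂ) * (Real.sin θ : ℂ))
        - q θ * (harm m n 4 θ : ℂ) * (Real.sin θ : ℂ)) θ := by
    intro θ hθ
    have hs := sin_ne_zero hθ
    have hsC : (Real.sin θ : ℂ) ≠ 0 := by exact_mod_cast hs
    have ode := harm_ode hm'.2 hs (m := m) (n := n)
    have ode' : (harmDD m n θ : ℂ) + (Real.cos θ : ℂ) / Real.sin θ * harmD m n θ
        - ((m : ℂ) ^ 2 + 4 * m * Real.cos θ + 4 * (Real.cos θ : ℂ) ^ 2) / (Real.sin θ : ℂ) ^ 2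
          * harm m n 4 θ - 4 * harm m n 4 θ + lam n * harm m n 4 θ = 0 := by
      exact_mod_cast congrArg (fun x : ℝ => (x : ℂ)) ode
    refine ((Real.hasDerivAt_sin θ).ofReal_comp.mul
      (((hf1d θ hθ).mul (hasDerivAt_harm_four m n θ).ofReal_comp).sub
        ((hfd θ hθ).mul (hasDerivAt_harmD m n θ).ofReal_comp))).congr_deriv ?_
    rw [hqe θ hθ]
    simp only [Pi.sub_apply, Pi.mul_apply]
    field_simp at ode' ⊢
    linear_combination (-f θ) * ode'
  have hb : ∀ θ ∈ Ioo 0 π, ‖f1 θ * (harm m n 4 θ : ℂ) - f θ * (harmD m n θ : ℂ)‖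
      ≤ B1 * (2 * π) * (n + 3) + B0 * (2 * π) * ((2 * n + 5) * (n + 3)) := by
    intro θ hθ
    refine (norm_sub_le _ _).trans (add_le_add ?_ ?_)
    · rw [norm_mul, Complex.norm_real]
      exact mul_le_mul (hf1b θ hθ) (abs_harm_le hm'.1 _ _) (norm_nonneg _)
        ((norm_nonneg _).trans (hf1b θ hθ))
    · rw [norm_mul, Complex.norm_real]
      exact mul_le_mul (hfb θ hθ) (abs_harmD_le hm'.1 _) (norm_nonneg _)
        ((norm_nonneg _).trans (hfb θ hθ))
  have hharm := continuous_harm m n 4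
  have hbi : ∀ g : ℝ → ℂ, ∀ B, ContinuousOn g (Ioo 0 π) → (∀ θ ∈ Ioo 0 π, ‖g θ‖ ≤ B) →
      IntervalIntegrable (fun θ => g θ * (harm m n 4 θ : ℂ) * (Real.sin θ : ℂ))
        MeasureTheory.volume 0 π := by
    intro g B hg hgB
    refine intervalIntegrable_of_continuousOn_Ioo (B := B * (n + 3))
      ((hg.mul (by fun_prop)).mul (by fun_prop)) fun θ hθ => ?_
    rw [norm_mul, norm_mul, Complex.norm_real, Complex.norm_real]
    refine (mul_le_of_le_one_right (by positivity) (Real.abs_sin_le_one _)).trans ?_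
    exact mul_le_mul (hgB θ hθ) (abs_harm_le hm'.1 _ _) (norm_nonneg _)
      ((norm_nonneg _).trans (hgB θ hθ))
  have hi1 := hbi f _ hfc hfb
  have hi2 := hbi q _ hqc hqb
  have hftc := intervalIntegral.integral_eq_sub_of_hasDerivAt_of_tendsto hpi hderiv
    ((hi1.const_mul _).sub hi2)
    (tendsto_sin_mul_of_bounded nhdsWithin_le_nhds Real.sin_zero
      (by filter_upwards [Ioo_mem_nhdsGT hpi] with θ hθ using hb θ hθ))
    (tendsto_sin_mul_of_bounded nhdsWithin_le_nhds Real.sin_pi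
      (by filter_upwards [Ioo_mem_nhdsLT hpi] with θ hθ using hb θ hθ))
  rw [intervalIntegral.integral_sub (hi1.const_mul _) hi2, intervalIntegral.integral_const_mul,
    sub_zero] at hftc
  have e1 : sphCoeff m n (F t r) = ∫ θ in (0 : ℝ)..π,
      f θ * (harm m n 4 θ : ℂ) * (Real.sin θ : ℂ) := by
    rw [sphCoeff_swap h0 hm]
    exact intervalIntegral.integral_congr_Ioo_of_le hpi.le fun θ hθ => by
      simp only [S_eq_harm hm'.1 hm'.2 hθ, hf]
  have e2 : sphCoeff m n (angOp 2 F t r) = ∫ θ in (0 : ℝ)..π,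
      q θ * (harm m n 4 θ : ℂ) * (Real.sin θ : ℂ) := by
    rw [sphCoeff_swap hA hm]
    exact intervalIntegral.integral_congr_Ioo_of_le hpi.le fun θ hθ => by
      simp only [S_eq_harm hm'.1 hm'.2 hθ, hq]
  rw [e1, e2]
  exact (sub_eq_zero.1 hftc).symm

end

section

/-! ## Radial functions -/

variable {M k t₀ : ℝ}

theorem Delta_eq_mul (M k r : ℝ) : Delta M k r = r * (k ^ 2 * r ^ 3 + r - 2 * M) := by
  rw [Delta]; ring

/-- Δ/r = k²r³ + r - 2M changes sign on [0, 2M] and Δ > 0 beyond 2M, so the set of zeros is bounded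
above. Only the comparison r₀ ≤ r₊ is used later, with the monotonicity of this cubic. -/
theorem exists_root_le_rPlus (hM : 0 < M) (hk : 0 < k) :
    ∃ r₀, 0 < r₀ ∧ k ^ 2 * r₀ ^ 3 + r₀ - 2 * M = 0 ∧ r₀ ≤ rPlus M k := by
  have hc : ContinuousOn (fun r : ℝ => k ^ 2 * r ^ 3 + r - 2 * M) (Icc 0 (2 * M)) := by fun_prop
  have h := intermediate_value_Icc (by positivity : (0 : ℝ) ≤ 2 * M) hc
  obtain ⟨r₀, hr, h0⟩ := h (show (0 : ℝ) ∈ _ by constructor <;> simp <;> positivity)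
  replace h0 : k ^ 2 * r₀ ^ 3 + r₀ - 2 * M = 0 := h0
  have hr0 : r₀ ≠ 0 := by
    rintro rfl
    simp at h0
    exact hM.ne' h0
  refine ⟨r₀, lt_of_le_of_ne hr.1 hr0.symm, h0, le_csSup ⟨2 * M, fun r hr => ?_⟩ ?_⟩
  · by_contra! hlt
    have : 0 < Delta M k r := by
      rw [Delta_eq_mul]
      have : 0 < r := by linarith
      have : 0 < k ^ 2 * r ^ 3 := by positivity
      exact mul_pos (by linarith) (by linarith)
    exact this.ne' hr
  · rw [mem_ofPred_eq, Delta_eq_mul, h0, mul_zero]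

theorem rPlus_pos (hM : 0 < M) (hk : 0 < k) : 0 < rPlus M k := by
  obtain ⟨r₀, h, -, hle⟩ := exists_root_le_rPlus hM hk
  exact h.trans_le hle

theorem Delta_pos (hM : 0 < M) (hk : 0 < k) {r : ℝ} (hr : rPlus M k < r) : 0 < Delta M k r := by
  obtain ⟨r₀, h, h0, hle⟩ := exists_root_le_rPlus hM hk
  have hlt : r₀ < r := hle.trans_lt hr
  have h3 : r₀ ^ 3 < r ^ 3 := pow_lt_pow_left₀ hlt h.le (by norm_num)
  have := mul_lt_mul_of_pos_left h3 (by positivity : 0 < k ^ 2)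
  rw [Delta_eq_mul]
  exact mul_pos (h.trans hlt) (by linarith)

theorem w_pos (hM : 0 < M) (hk : 0 < k) {r : ℝ} (hr : rPlus M k < r) : 0 < w M k r := by
  have := (rPlus_pos hM hk).trans hr
  exact div_pos (Delta_pos hM hk hr) (by positivity)

theorem w_eq {r : ℝ} (hr : r ≠ 0) :
    w M k r = k ^ 2 + r⁻¹ ^ 2 - 2 * M * r⁻¹ ^ 3 := by
  rw [w, Delta]; field_simp; ring

/-- `(Δ / r²) ∂_r log w`. -/
noncomputable def hRad (M r : ℝ) : ℝ := -2 * r⁻¹ + 6 * M * r⁻¹ ^ 2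

/-- The derivative of `w` along `(Δ / r²) ∂_r` is `w h`. -/
theorem hasDerivAt_w (hM : 0 < M) (hk : 0 < k) {r : ℝ} (hr : rPlus M k < r) :
    HasDerivAt (w M k) (r ^ 2 / Delta M k r * (w M k r * hRad M r)) r := by
  have h0 : r ≠ 0 := ((rPlus_pos hM hk).trans hr).ne'
  have hD := (Delta_pos hM hk hr).ne'
  have h1 : HasDerivAt (fun r : ℝ => k ^ 2 + r⁻¹ ^ 2 - 2 * M * r⁻¹ ^ 3)
      (2 * r⁻¹ * (-(r ^ 2)⁻¹) - 2 * M * (3 * r⁻¹ ^ 2 * (-(r ^ 2)⁻¹))) r := by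
    have hi := hasDerivAt_inv h0
    simpa using ((hi.fun_pow 2).const_add (k ^ 2)).fun_sub ((hi.fun_pow 3).const_mul (2 * M))
  refine (h1.congr_of_eventuallyEq ?_).congr_deriv ?_
  · filter_upwards [eventually_ne_nhds h0] with x hx using w_eq hx
  · rw [w, hRad]
    field_simp
    ring

theorem hasDerivAt_w_inv (hM : 0 < M) (hk : 0 < k) {r : ℝ} (hr : rPlus M k < r) :
    HasDerivAt (fun r => (w M k r)⁻¹) (r ^ 2 / Delta M k r * (-(hRad M r) * (w M k r)⁻¹)) r := by
  have hw := (w_pos hM hk hr).ne'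
  refine ((hasDerivAt_w hM hk hr).inv hw).congr_deriv ?_
  field_simp

theorem hasDerivAt_inv_rad (hM : 0 < M) (hk : 0 < k) {r : ℝ} (hr : rPlus M k < r) :
    HasDerivAt (fun r : ℝ => r⁻¹) (r ^ 2 / Delta M k r * (-(w M k r))) r := by
  have h0 : r ≠ 0 := ((rPlus_pos hM hk).trans hr).ne'
  have hD := (Delta_pos hM hk hr).ne'
  refine (hasDerivAt_inv h0).congr_deriv ?_
  rw [w]
  field_simp

theorem deriv_log_w (hM : 0 < M) (hk : 0 < k) {r : ℝ} (hr : rPlus M k < r) :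
    (Delta M k r / r ^ 2) * deriv (fun ρ => Real.log (Delta M k ρ / ρ ^ 4)) r = hRad M r := by
  have h0 : r ≠ 0 := ((rPlus_pos hM hk).trans hr).ne'
  have hD := (Delta_pos hM hk hr).ne'
  have hw := (w_pos hM hk hr).ne'
  have h := ((hasDerivAt_w hM hk hr).log hw).deriv
  simp only [w] at h hw
  rw [h]
  field_simp

/-! ## The domain and smooth fields -/

/-- `(Δ / r²) ∂_r` in the coordinates `(t, r, ϑ, φ)`. -/
noncomputable def Dop (M k t₀ : ℝ) (F : Field) : Field :=
  radMul (fun r => Delta M k r / r ^ 2) (dR M k t₀ F)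

/-- The domain `{t⋆ ≥ t₀, r > r₊}` away from the coordinate axis. -/
def dom (M k t₀ : ℝ) : Set (ℝ × ℝ × ℝ × ℝ) := Ici t₀ ×ˢ Ioi (rPlus M k) ×ˢ Ioo 0 π ×ˢ univ

/-- A field as a function on `ℝ⁴`. -/
def unc (F : Field) (z : ℝ × ℝ × ℝ × ℝ) : ℂ := F z.1 z.2.1 z.2.2.1 z.2.2.2

/-- Smoothness on the domain. -/
def SmoothField (M k t₀ : ℝ) (F : Field) : Prop := ContDiffOn ℝ (⊤ : ℕ∞) (unc F) (dom M k t₀)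

theorem uniqueDiffOn_dom : UniqueDiffOn ℝ (dom M k t₀) :=
  (uniqueDiffOn_Ici t₀).prod (isOpen_Ioi.uniqueDiffOn.prod
    (isOpen_Ioo.uniqueDiffOn.prod uniqueDiffOn_univ))

/-- Needed for the symmetry of second derivatives at points of the boundary t⋆ = t₀. -/
theorem dom_subset_closure_interior : dom M k t₀ ⊆ closure (interior (dom M k t₀)) := by
  have h : Ioi t₀ ×ˢ Ioi (rPlus M k) ×ˢ Ioo 0 π ×ˢ (univ : Set ℝ) ⊆ interior (dom M k t₀) :=
    interior_maximal (prod_mono Ioi_subset_Ici_self le_rfl)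
      (isOpen_Ioi.prod (isOpen_Ioi.prod (isOpen_Ioo.prod isOpen_univ)))
  refine Subset.trans ?_ (closure_mono h)
  rw [closure_prod_eq, closure_Ioi]
  exact prod_mono le_rfl subset_closure

theorem SmoothField.hasFDerivWithinAt {F : Field} (hF : SmoothField M k t₀ F) {z}
    (hz : z ∈ dom M k t₀) :
    HasFDerivWithinAt (unc F) (fderivWithin ℝ (unc F) (dom M k t₀) z) (dom M k t₀) z :=
  ((hF.differentiableOn (by simp)) z hz).hasFDerivWithinAt

theorem SmoothField.hasDerivWithinAt_t {F : Field} (hF : SmoothField M k t₀ F) {t r θ φ : ℝ}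
    (hz : (t, r, θ, φ) ∈ dom M k t₀) :
    HasDerivWithinAt (fun τ => F τ r θ φ)
      (fderivWithin ℝ (unc F) (dom M k t₀) (t, r, θ, φ) (1, 0, 0, 0)) (Ici t₀) t :=
  (hF.hasFDerivWithinAt hz).comp_hasDerivWithinAt (f := fun τ => (τ, r, θ, φ)) t
    (((hasDerivWithinAt_id t _)).prodMk (hasDerivWithinAt_const t _ _)) fun _ hτ =>
      ⟨hτ, hz.2⟩

theorem SmoothField.hasDerivAt_r {F : Field} (hF : SmoothField M k t₀ F) {t r θ φ : ℝ}
    (hz : (t, r, θ, φ) ∈ dom M k t₀) :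
    HasDerivAt (fun ρ => F t ρ θ φ)
      (fderivWithin ℝ (unc F) (dom M k t₀) (t, r, θ, φ) (0, 1, 0, 0)) r :=
  ((hF.hasFDerivWithinAt hz).comp_hasDerivWithinAt (f := fun ρ => (t, ρ, θ, φ))
    (s := Ioi (rPlus M k)) r ((hasDerivWithinAt_const r _ t).prodMk
      ((hasDerivWithinAt_id r _).prodMk (hasDerivWithinAt_const r _ _))) fun _ hρ =>
      ⟨hz.1, hρ, hz.2.2⟩).hasDerivAt (isOpen_Ioi.mem_nhds hz.2.1)

theorem SmoothField.hasDerivAt_theta {F : Field} (hF : SmoothField M k t₀ F) {t r θ φ : ℝ}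
    (hz : (t, r, θ, φ) ∈ dom M k t₀) :
    HasDerivAt (fun ϑ => F t r ϑ φ)
      (fderivWithin ℝ (unc F) (dom M k t₀) (t, r, θ, φ) (0, 0, 1, 0)) θ :=
  ((hF.hasFDerivWithinAt hz).comp_hasDerivWithinAt (f := fun ϑ => (t, r, ϑ, φ))
    (s := Ioo 0 π) θ ((hasDerivWithinAt_const θ _ t).prodMk ((hasDerivWithinAt_const θ _ r).prodMk
      ((hasDerivWithinAt_id θ _).prodMk (hasDerivWithinAt_const θ _ _)))) fun _ hϑ =>
      ⟨hz.1, hz.2.1, hϑ, hz.2.2.2⟩).hasDerivAt (isOpen_Ioo.mem_nhds hz.2.2.1)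

theorem SmoothField.hasDerivAt_phi {F : Field} (hF : SmoothField M k t₀ F) {t r θ φ : ℝ}
    (hz : (t, r, θ, φ) ∈ dom M k t₀) :
    HasDerivAt (fun ψ => F t r θ ψ)
      (fderivWithin ℝ (unc F) (dom M k t₀) (t, r, θ, φ) (0, 0, 0, 1)) φ :=
  ((hF.hasFDerivWithinAt hz).comp_hasDerivWithinAt (f := fun ψ => (t, r, θ, ψ))
    (s := univ) φ ((hasDerivWithinAt_const φ _ t).prodMk ((hasDerivWithinAt_const φ _ r).prodMk
      ((hasDerivWithinAt_const φ _ θ).prodMk (hasDerivWithinAt_id φ _)))) fun _ hψ =>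
      ⟨hz.1, hz.2.1, hz.2.2.1, hψ⟩).hasDerivAt univ_mem

theorem SmoothField.dT_eq {F : Field} (hF : SmoothField M k t₀ F) {z} (hz : z ∈ dom M k t₀) :
    unc (dT t₀ F) z = fderivWithin ℝ (unc F) (dom M k t₀) z (1, 0, 0, 0) :=
  (hF.hasDerivWithinAt_t hz).derivWithin (uniqueDiffOn_Ici t₀ _ hz.1)

theorem SmoothField.dRstar_eq {F : Field} (hF : SmoothField M k t₀ F) {z} (hz : z ∈ dom M k t₀) :
    unc (dRstar F) z = fderivWithin ℝ (unc F) (dom M k t₀) z (0, 1, 0, 0) :=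
  (hF.hasDerivAt_r hz).deriv

theorem SmoothField.contDiffOn_apply {F : Field} (hF : SmoothField M k t₀ F)
    (e : ℝ × ℝ × ℝ × ℝ) : ContDiffOn ℝ (⊤ : ℕ∞)
      (fun z => fderivWithin ℝ (unc F) (dom M k t₀) z e) (dom M k t₀) :=
  (ContDiffOn.fderivWithin (m := (⊤ : ℕ∞)) hF uniqueDiffOn_dom (by simp)).clm_apply contDiffOn_const

theorem SmoothField.dT {F : Field} (hF : SmoothField M k t₀ F) : SmoothField M k t₀ (dT t₀ F) :=
  (hF.contDiffOn_apply _).congr fun _ hz => hF.dT_eq hz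

theorem SmoothField.dRstar {F : Field} (hF : SmoothField M k t₀ F) :
    SmoothField M k t₀ (dRstar F) :=
  (hF.contDiffOn_apply _).congr fun _ hz => hF.dRstar_eq hz

theorem SmoothField.dTheta {F : Field} (hF : SmoothField M k t₀ F) :
    SmoothField M k t₀ (dTheta F) :=
  (hF.contDiffOn_apply (0, 0, 1, 0)).congr fun _ hz => (hF.hasDerivAt_theta hz).deriv

theorem SmoothField.dPhi {F : Field} (hF : SmoothField M k t₀ F) :
    SmoothField M k t₀ (dPhi F) :=
  (hF.contDiffOn_apply (0, 0, 0, 1)).congr fun _ hz => (hF.hasDerivAt_phi hz).deriv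

theorem SmoothField.add {F G : Field} (hF : SmoothField M k t₀ F) (hG : SmoothField M k t₀ G) :
    SmoothField M k t₀ (F + G) := ContDiffOn.add hF hG

theorem SmoothField.const_smul {F : Field} (c : ℂ) (hF : SmoothField M k t₀ F) :
    SmoothField M k t₀ (c • F) := ContDiffOn.const_smul c hF

theorem SmoothField.radMul {F : Field} {f : ℝ → ℝ}
    (hf : ContDiffOn ℝ (⊤ : ℕ∞) f (Ioi (rPlus M k)))
    (hF : SmoothField M k t₀ F) : SmoothField M k t₀ (radMul f F) := by
  have h : ContDiffOn ℝ (⊤ : ℕ∞) (fun z : ℝ × ℝ × ℝ × ℝ => f z.2.1) (dom M k t₀) :=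
    hf.comp (contDiff_fst.comp contDiff_snd).contDiffOn fun z hz => hz.2.1
  exact (Complex.ofRealCLM.contDiff.comp_contDiffOn h).mul hF

theorem SmoothField.congr {F G : Field} (hF : SmoothField M k t₀ F)
    (h : EqOnDomain M k t₀ G F) : SmoothField M k t₀ G :=
  ContDiffOn.congr hF fun z hz => h z.1 hz.1 z.2.1 hz.2.1 z.2.2.1 hz.2.2.1 z.2.2.2

theorem SmoothField.dT_dRstar {F : Field} (hF : SmoothField M k t₀ F) :
    EqOnDomain M k t₀ (SchwarzschildAdS.dT t₀ (SchwarzschildAdS.dRstar F))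
      (SchwarzschildAdS.dRstar (SchwarzschildAdS.dT t₀ F)) := by
  intro t ht r hr θ hθ φ
  have hz : (t, r, θ, φ) ∈ dom M k t₀ := ⟨ht, hr, hθ, mem_univ _⟩
  have hu := uniqueDiffOn_dom (M := M) (k := k) (t₀ := t₀)
  have hfd : DifferentiableWithinAt ℝ (fderivWithin ℝ (unc F) (dom M k t₀)) (dom M k t₀)
      (t, r, θ, φ) :=
    ((ContDiffOn.fderivWithin (m := (⊤ : ℕ∞)) hF hu (by simp)).differentiableOn (by simp)) _ hz
  have key : ∀ e e' : ℝ × ℝ × ℝ × ℝ,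
      fderivWithin ℝ (fun z => fderivWithin ℝ (unc F) (dom M k t₀) z e) (dom M k t₀) (t, r, θ, φ) e'
      = fderivWithin ℝ (fderivWithin ℝ (unc F) (dom M k t₀)) (dom M k t₀) (t, r, θ, φ) e' e := by
    intro e e'
    rw [fderivWithin_clm_apply (hu _ hz) hfd (differentiableWithinAt_const e)]
    simp
  have hsym := ContDiffWithinAt.isSymmSndFDerivWithinAt (hF _ hz)
    (by rw [minSmoothness_of_isRCLikeNormedField]; exact WithTop.coe_le_coe.2 (le_top : (2 : ℕ∞) ≤ ⊤)) hu (dom_subset_closure_interior hz) hz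
  have h1 := hF.dRstar.dT_eq hz
  have h2 := hF.dT.dRstar_eq hz
  rw [fderivWithin_congr (fun z hz' => hF.dRstar_eq hz') (hF.dRstar_eq hz), key] at h1
  rw [fderivWithin_congr (fun z hz' => hF.dT_eq hz') (hF.dT_eq hz), key] at h2
  exact h1.trans ((hsym _ _).trans h2.symm)

end

section

variable {M k t₀ : ℝ}

/-! ## Algebra of the derivations -/

theorem EqOnDomain.refl (F : Field) : EqOnDomain M k t₀ F F := fun _ _ _ _ _ _ _ => rfl

theorem EqOnDomain.symm {F G : Field} (h : EqOnDomain M k t₀ F G) : EqOnDomain M k t₀ G F :=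
  fun t ht r hr θ hθ φ => (h t ht r hr θ hθ φ).symm

theorem EqOnDomain.trans {F G H : Field} (h : EqOnDomain M k t₀ F G)
    (h' : EqOnDomain M k t₀ G H) : EqOnDomain M k t₀ F H :=
  fun t ht r hr θ hθ φ => (h t ht r hr θ hθ φ).trans (h' t ht r hr θ hθ φ)

theorem EqOnDomain.add {F G F' G' : Field} (h : EqOnDomain M k t₀ F G)
    (h' : EqOnDomain M k t₀ F' G') : EqOnDomain M k t₀ (F + F') (G + G') :=
  fun t ht r hr θ hθ φ => congrArg₂ (· + ·) (h t ht r hr θ hθ φ) (h' t ht r hr θ hθ φ)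

theorem EqOnDomain.sub {F G F' G' : Field} (h : EqOnDomain M k t₀ F G)
    (h' : EqOnDomain M k t₀ F' G') : EqOnDomain M k t₀ (F - F') (G - G') :=
  fun t ht r hr θ hθ φ => congrArg₂ (· - ·) (h t ht r hr θ hθ φ) (h' t ht r hr θ hθ φ)

theorem EqOnDomain.const_smul {F G : Field} (c : ℂ) (h : EqOnDomain M k t₀ F G) :
    EqOnDomain M k t₀ (c • F) (c • G) :=
  fun t ht r hr θ hθ φ => congrArg (c • ·) (h t ht r hr θ hθ φ)

theorem EqOnDomain.radMul {F G : Field} (f : ℝ → ℝ) (h : EqOnDomain M k t₀ F G) :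
    EqOnDomain M k t₀ (radMul f F) (radMul f G) :=
  fun t ht r hr θ hθ φ => congrArg ((f r : ℂ) * ·) (h t ht r hr θ hθ φ)

theorem EqOnDomain.conj {F G : Field} (h : EqOnDomain M k t₀ F G) :
    EqOnDomain M k t₀ (conjField F) (conjField G) :=
  fun t ht r hr θ hθ φ => congrArg (starRingEnd ℂ) (h t ht r hr θ hθ φ)

theorem EqOnDomain.dT {F G : Field} (h : EqOnDomain M k t₀ F G) :
    EqOnDomain M k t₀ (dT t₀ F) (dT t₀ G) :=
  fun t ht r hr θ hθ φ => derivWithin_congr (fun τ hτ => h τ hτ r hr θ hθ φ) (h t ht r hr θ hθ φ)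

theorem EqOnDomain.dRstar {F G : Field} (h : EqOnDomain M k t₀ F G) :
    EqOnDomain M k t₀ (dRstar F) (dRstar G) := by
  intro t ht r hr θ hθ φ
  refine Filter.EventuallyEq.deriv_eq ?_
  filter_upwards [isOpen_Ioi.mem_nhds hr] with ρ hρ using h t ht ρ hρ θ hθ φ

theorem EqOnDomain.dTheta {F G : Field} (h : EqOnDomain M k t₀ F G) :
    EqOnDomain M k t₀ (dTheta F) (dTheta G) := by
  intro t ht r hr θ hθ φ
  refine Filter.EventuallyEq.deriv_eq ?_
  filter_upwards [isOpen_Ioo.mem_nhds hθ] with ϑ hϑ using h t ht r hr ϑ hϑ φ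

theorem EqOnDomain.dPhi {F G : Field} (h : EqOnDomain M k t₀ F G) :
    EqOnDomain M k t₀ (dPhi F) (dPhi G) := by
  intro t ht r hr θ hθ φ
  exact Filter.EventuallyEq.deriv_eq (Eventually.of_forall fun ψ => h t ht r hr θ hθ ψ)

theorem EqOnDomain.Dop {F G : Field} (h : EqOnDomain M k t₀ F G) :
    EqOnDomain M k t₀ (Dop M k t₀ F) (Dop M k t₀ G) := by
  refine EqOnDomain.radMul _ (fun t ht r hr θ hθ φ => ?_)
  simp only [dR, h.dRstar t ht r hr θ hθ φ, h.dT t ht r hr θ hθ φ]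

theorem EqOnDomain.angOp {F G : Field} (s : ℤ) (h : EqOnDomain M k t₀ F G) :
    EqOnDomain M k t₀ (angOp s F) (angOp s G) := by
  have h2 : EqOnDomain M k t₀ (fun t' r' θ' φ' => (Real.sin θ' : ℂ) * SchwarzschildAdS.dTheta F t' r' θ' φ')
      (fun t' r' θ' φ' => (Real.sin θ' : ℂ) * SchwarzschildAdS.dTheta G t' r' θ' φ') :=
    fun t ht r hr θ hθ φ => congrArg ((Real.sin θ : ℂ) * ·) (h.dTheta t ht r hr θ hθ φ)
  intro t ht r hr θ hθ φ
  simp only [SchwarzschildAdS.angOp, h2.dTheta t ht r hr θ hθ φ, h.dPhi.dPhi t ht r hr θ hθ φ,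
    h.dPhi t ht r hr θ hθ φ, h t ht r hr θ hθ φ]

theorem EqOnDomain.iterate {O : Field → Field}
    (hO : ∀ {F G : Field}, EqOnDomain M k t₀ F G → EqOnDomain M k t₀ (O F) (O G)) {F G : Field}
    (h : EqOnDomain M k t₀ F G) (n : ℕ) : EqOnDomain M k t₀ (O^[n] F) (O^[n] G) := by
  induction n generalizing F G with
  | zero => exact h
  | succ n ih => exact ih (hO h)

theorem Dop_apply (F : Field) (t r θ φ : ℝ) : Dop M k t₀ F t r θ φ
    = ((Delta M k r / r ^ 2 : ℝ) : ℂ) * dRstar F t r θ φ + ((Delta M k r / r ^ 2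
      * (r ^ 2 / Delta M k r - 1 / (1 + k ^ 2 * r ^ 2)) : ℝ) : ℂ) * dT t₀ F t r θ φ := by
  simp only [Dop, radMul, dR]
  push_cast
  ring

theorem dT_const_smul (c : ℂ) (F : Field) : dT t₀ (c • F) = c • dT t₀ F := by
  funext t r θ φ
  exact derivWithin_const_mul_field c

theorem dRstar_const_smul (c : ℂ) (F : Field) : dRstar (c • F) = c • dRstar F := by
  funext t r θ φ
  exact deriv_const_mul_field c

theorem Dop_const_smul (c : ℂ) (F : Field) : Dop M k t₀ (c • F) = c • Dop M k t₀ F := by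
  funext t r θ φ
  rw [Dop_apply, dT_const_smul, dRstar_const_smul]
  simp only [Pi.smul_apply, Dop_apply, smul_eq_mul]
  ring

theorem dT_radMul (f : ℝ → ℝ) (F : Field) : dT t₀ (radMul f F) = radMul f (dT t₀ F) := by
  funext t r θ φ
  exact derivWithin_const_mul_field _

theorem dT_conjField (F : Field) : dT t₀ (conjField F) = conjField (dT t₀ F) := by
  funext t r θ φ
  exact derivWithin.star

theorem dRstar_conjField (F : Field) : dRstar (conjField F) = conjField (dRstar F) := by
  funext t r θ φ
  exact deriv.star

theorem dTheta_conjField (F : Field) : dTheta (conjField F) = conjField (dTheta F) := by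
  funext t r θ φ
  exact deriv.star

theorem dPhi_conjField (F : Field) : dPhi (conjField F) = conjField (dPhi F) := by
  funext t r θ φ
  exact deriv.star

theorem radMul_conjField (f : ℝ → ℝ) (F : Field) :
    radMul f (conjField F) = conjField (radMul f F) := by
  funext t r θ φ
  simp only [radMul, conjField, map_mul, Complex.conj_ofReal]

theorem Dop_conjField (F : Field) : Dop M k t₀ (conjField F) = conjField (Dop M k t₀ F) := by
  funext t r θ φ
  simp only [Dop_apply, dT_conjField, dRstar_conjField, conjField, map_mul, map_add,
    Complex.conj_ofReal]

theorem angOp_conjField (s : ℤ) (F : Field) :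
    angOp (-s) (conjField F) = conjField (angOp s F) := by
  funext t r θ φ
  have h : dTheta (fun t' r' θ' φ' => (Real.sin θ' : ℂ) * dTheta (conjField F) t' r' θ' φ') t r θ φ
      = conj (dTheta (fun t' r' θ' φ' => (Real.sin θ' : ℂ) * dTheta F t' r' θ' φ') t r θ φ) := by
    have e : (fun t' r' θ' φ' => (Real.sin θ' : ℂ) * dTheta (conjField F) t' r' θ' φ')
        = conjField (fun t' r' θ' φ' => (Real.sin θ' : ℂ) * dTheta F t' r' θ' φ') := by
      rw [dTheta_conjField]
      funext t r θ φ
      simp only [conjField, map_mul, Complex.conj_ofReal]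
    rw [e, dTheta_conjField]
    rfl
  rw [conjField, angOp, angOp, h, dPhi_conjField, dPhi_conjField]
  simp only [conjField, map_neg, map_add, map_sub, map_mul, map_div₀, map_pow, Complex.conj_ofReal,
    Complex.conj_I, map_one, map_ofNat, map_intCast]
  push_cast
  ring

/-- The coefficients of D are independent of t⋆, so this reduces to the equality of mixed partial
derivatives. -/
theorem SmoothField.dT_Dop {F : Field} (hF : SmoothField M k t₀ F) :
    EqOnDomain M k t₀ (SchwarzschildAdS.dT t₀ (Dop M k t₀ F))
      (Dop M k t₀ (SchwarzschildAdS.dT t₀ F)) := by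
  intro t ht r hr θ hθ φ
  have hz : (t, r, θ, φ) ∈ dom M k t₀ := ⟨ht, hr, hθ, mem_univ _⟩
  have h1 := hF.dRstar.hasDerivWithinAt_t hz
  have h2 := hF.dT.hasDerivWithinAt_t hz
  rw [← hF.dRstar.dT_eq hz] at h1
  rw [← hF.dT.dT_eq hz] at h2
  have h := ((h1.const_mul ((Delta M k r / r ^ 2 : ℝ) : ℂ)).add (h2.const_mul ((Delta M k r / r ^ 2
      * (r ^ 2 / Delta M k r - 1 / (1 + k ^ 2 * r ^ 2)) : ℝ) : ℂ))).derivWithin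
      (uniqueDiffOn_Ici t₀ _ ht)
  have e : (fun τ => Dop M k t₀ F τ r θ φ) = _ := funext fun τ => Dop_apply F τ r θ φ
  rw [Dop_apply, ← hF.dT_dRstar t ht r hr θ hθ φ]
  change derivWithin (fun τ => Dop M k t₀ F τ r θ φ) _ _ = _
  rw [e]
  exact h

theorem SmoothField.dT_add {F G : Field} (hF : SmoothField M k t₀ F) (hG : SmoothField M k t₀ G) :
    EqOnDomain M k t₀ (SchwarzschildAdS.dT t₀ (F + G))
      (SchwarzschildAdS.dT t₀ F + SchwarzschildAdS.dT t₀ G) := by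
  intro t ht r hr θ hθ φ
  have hz : (t, r, θ, φ) ∈ dom M k t₀ := ⟨ht, hr, hθ, mem_univ _⟩
  exact derivWithin_add (hF.hasDerivWithinAt_t hz).differentiableWithinAt
    (hG.hasDerivWithinAt_t hz).differentiableWithinAt

theorem SmoothField.Dop_add {F G : Field} (hF : SmoothField M k t₀ F)
    (hG : SmoothField M k t₀ G) :
    EqOnDomain M k t₀ (Dop M k t₀ (F + G)) (Dop M k t₀ F + Dop M k t₀ G) := by
  intro t ht r hr θ hθ φ
  have hz : (t, r, θ, φ) ∈ dom M k t₀ := ⟨ht, hr, hθ, mem_univ _⟩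
  have h : SchwarzschildAdS.dRstar (F + G) t r θ φ = SchwarzschildAdS.dRstar F t r θ φ
      + SchwarzschildAdS.dRstar G t r θ φ :=
    deriv_add (hF.hasDerivAt_r hz).differentiableAt (hG.hasDerivAt_r hz).differentiableAt
  simp only [Pi.add_apply, Dop_apply, h, hF.dT_add hG t ht r hr θ hθ φ]
  ring

theorem SmoothField.Dop_radMul (hM : 0 < M) (hk : 0 < k) {F : Field}
    (hF : SmoothField M k t₀ F) {f f' : ℝ → ℝ}
    (hf : ∀ r, rPlus M k < r → HasDerivAt f (r ^ 2 / Delta M k r * f' r) r) :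
    EqOnDomain M k t₀ (Dop M k t₀ (SchwarzschildAdS.radMul f F))
      (SchwarzschildAdS.radMul f' F + SchwarzschildAdS.radMul f (Dop M k t₀ F)) := by
  intro t ht r hr θ hθ φ
  have hz : (t, r, θ, φ) ∈ dom M k t₀ := ⟨ht, hr, hθ, mem_univ _⟩
  have h0 : r ≠ 0 := ((rPlus_pos hM hk).trans hr).ne'
  have hD := (Delta_pos hM hk hr).ne'
  have h : SchwarzschildAdS.dRstar (SchwarzschildAdS.radMul f F) t r θ φ = _ :=
    ((hf r hr).ofReal_comp.mul (hF.hasDerivAt_r hz)).deriv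
  have e : (fderivWithin ℝ (unc F) (dom M k t₀) (t, r, θ, φ)) (0, 1, 0, 0)
      = SchwarzschildAdS.dRstar F t r θ φ := (hF.dRstar_eq hz).symm
  rw [e] at h
  have hc : ((Delta M k r / r ^ 2 : ℝ) : ℂ) * ((r ^ 2 / Delta M k r * f' r : ℝ) : ℂ)
      = (f' r : ℂ) := by
    rw [← Complex.ofReal_mul]; congr 1; field_simp
  simp only [Pi.add_apply]
  rw [Dop_apply, h, dT_radMul]
  simp only [SchwarzschildAdS.radMul, Dop_apply]
  linear_combination F t r θ φ * hc

theorem SmoothField.Dop (hM : 0 < M) (hk : 0 < k) {F : Field} (hF : SmoothField M k t₀ F) :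
    SmoothField M k t₀ (Dop M k t₀ F) := by
  have hr0 : ∀ r ∈ Ioi (rPlus M k), r ≠ 0 := fun r hr => ((rPlus_pos hM hk).trans hr).ne'
  have hD : ∀ r ∈ Ioi (rPlus M k), Delta M k r ≠ 0 := fun r hr => (Delta_pos hM hk hr).ne'
  have cD : ContDiffOn ℝ (⊤ : ℕ∞) (Delta M k) (Ioi (rPlus M k)) := by
    unfold Delta; fun_prop
  have c1 : ContDiffOn ℝ (⊤ : ℕ∞) (fun r => Delta M k r / r ^ 2) (Ioi (rPlus M k)) :=
    cD.div (by fun_prop) fun r hr => pow_ne_zero 2 (hr0 r hr)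
  have c2 : ContDiffOn ℝ (⊤ : ℕ∞) (fun r => Delta M k r / r ^ 2
      * (r ^ 2 / Delta M k r - 1 / (1 + k ^ 2 * r ^ 2))) (Ioi (rPlus M k)) := by
    refine c1.mul (ContDiffOn.sub (ContDiffOn.div (by fun_prop) cD hD)
      (ContDiffOn.div (by fun_prop) (by fun_prop) fun r _ => by positivity))
  refine ((hF.dRstar.radMul c1).add (hF.dT.radMul c2)).congr fun t _ r _ θ _ φ => ?_
  exact Dop_apply F t r θ φ

theorem SmoothField.iterate_dT {F : Field} (hF : SmoothField M k t₀ F) (p : ℕ) :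
    SmoothField M k t₀ ((SchwarzschildAdS.dT t₀)^[p] F) := by
  induction p with
  | zero => exact hF
  | succ p ih => rw [Function.iterate_succ_apply']; exact ih.dT

theorem SmoothField.iterate_Dop (hM : 0 < M) (hk : 0 < k) {F : Field}
    (hF : SmoothField M k t₀ F) (q : ℕ) :
    SmoothField M k t₀ ((SchwarzschildAdS.Dop M k t₀)^[q] F) := by
  induction q with
  | zero => exact hF
  | succ q ih => rw [Function.iterate_succ_apply']; exact ih.Dop hM hk

theorem SmoothField.dT_iterate_Dop (hM : 0 < M) (hk : 0 < k) {F : Field}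
    (hF : SmoothField M k t₀ F) (q : ℕ) :
    EqOnDomain M k t₀ (SchwarzschildAdS.dT t₀ ((SchwarzschildAdS.Dop M k t₀)^[q] F))
      ((SchwarzschildAdS.Dop M k t₀)^[q] (SchwarzschildAdS.dT t₀ F)) := by
  induction q with
  | zero => exact EqOnDomain.refl _
  | succ q ih =>
    rw [Function.iterate_succ_apply', Function.iterate_succ_apply']
    exact (hF.iterate_Dop hM hk q).dT_Dop.trans ih.Dop

end

section

variable {M k t₀ : ℝ}

/-! ## Local boundedness up to the conformal boundary -/

/-- Points of the domain near `t⋆ = t₁`, `1 / r = y₁`, in the coordinates `(t⋆, 1 / r)`. -/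
def nearPt (M k t₀ t₁ y₁ : ℝ) : Filter (ℝ × ℝ) :=
  𝓝[Ici t₀ ×ˢ Ioo 0 (rPlus M k)⁻¹] (t₁, y₁)

/-- Boundedness near each point of `r₊ < r ≤ ∞`, uniformly over the spheres. -/
def LocBdd (M k t₀ : ℝ) (g : Field) : Prop :=
  ∀ t₁ ∈ Ici t₀, ∀ y₁ ∈ Ico 0 (rPlus M k)⁻¹, ∃ C : ℝ, ∀ᶠ p in nearPt M k t₀ t₁ y₁,
    ∀ θ ∈ Ioo 0 π, ∀ φ : ℝ, ‖g p.1 p.2⁻¹ θ φ‖ ≤ C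

/-- Periodicity in `φ`. -/
def PeriodicField (M k t₀ : ℝ) (F : Field) : Prop :=
  EqOnDomain M k t₀ (fun t r θ φ => F t r θ (φ + 2 * π)) F

theorem mem_nearPt (hM : 0 < M) (hk : 0 < k) (t₁ y₁ : ℝ) :
    ∀ᶠ p in nearPt M k t₀ t₁ y₁, p.1 ∈ Ici t₀ ∧ p.2⁻¹ ∈ Ioi (rPlus M k) := by
  filter_upwards [self_mem_nhdsWithin] with p hp
  exact ⟨hp.1, (lt_inv_comm₀ (rPlus_pos hM hk) hp.2.1).2 hp.2.2⟩

theorem inv_mem_of_gt (hM : 0 < M) (hk : 0 < k) {r : ℝ} (hr : r ∈ Ioi (rPlus M k)) :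
    r⁻¹ ∈ Ioo 0 (rPlus M k)⁻¹ :=
  ⟨inv_pos.2 ((rPlus_pos hM hk).trans hr), inv_strictAnti₀ (rPlus_pos hM hk) hr⟩

theorem Eventually.eval_nearPt (hM : 0 < M) (hk : 0 < k) {t r : ℝ} (ht : t ∈ Ici t₀)
    (hr : r ∈ Ioi (rPlus M k)) {P : ℝ → ℝ → Prop}
    (h : ∀ᶠ p in nearPt M k t₀ t r⁻¹, P p.1 p.2⁻¹) : P t r := by
  have := h.self_of_nhdsWithin ⟨ht, inv_mem_of_gt hM hk hr⟩
  simpa using this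

theorem tendsto_nearPt (hM : 0 < M) (hk : 0 < k) {t r : ℝ}
    (hr : r ∈ Ioi (rPlus M k)) :
    Tendsto (fun p : ℝ × ℝ => (p.1, p.2⁻¹)) (𝓝[Ici t₀] t ×ˢ 𝓝 r) (nearPt M k t₀ t r⁻¹) := by
  have h0 : r ≠ 0 := ((rPlus_pos hM hk).trans hr).ne'
  rw [nearPt, nhdsWithin_prod_eq]
  refine Tendsto.prodMap tendsto_id ?_
  refine tendsto_nhdsWithin_iff.2 ⟨(continuousAt_inv₀ h0), ?_⟩
  filter_upwards [isOpen_Ioi.mem_nhds hr] with x hx using inv_mem_of_gt hM hk hx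

theorem tendsto_nearPt_infinity (hM : 0 < M) (hk : 0 < k) (t : ℝ) :
    Tendsto (fun p : ℝ × ℝ => (p.1, p.2⁻¹)) (𝓝[Ici t₀] t ×ˢ atTop) (nearPt M k t₀ t 0) := by
  rw [nearPt, nhdsWithin_prod_eq]
  refine Tendsto.prodMap tendsto_id ?_
  refine tendsto_nhdsWithin_iff.2 ⟨tendsto_inv_atTop_zero, ?_⟩
  filter_upwards [Ioi_mem_atTop (rPlus M k)] with x hx using inv_mem_of_gt hM hk hx

/-- Two polar caps are handled by the limits at the poles, the remaining band by compactness. The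
restriction φ ∈ [0, 2π] provides that compactness and is removed later by periodicity. -/
theorem SpinContinuousOn.locBdd {s : ℤ} {A : Set (ℝ × ℝ)} {G : ℝ × ℝ → ℝ → ℝ → ℂ}
    (h : SpinContinuousOn s A G) {p : ℝ × ℝ} (hp : p ∈ A) :
    ∃ C : ℝ, ∀ᶠ x in 𝓝[A] p, ∀ θ ∈ Ioo 0 π, ∀ φ ∈ Icc 0 (2 * π), ‖G x θ φ‖ ≤ C := by
  -- The spin phase has modulus one, and the polar limit is uniform in φ since its filter there is
  -- `⊤`.
  have pole : ∀ (s : ℤ) (l : Filter ℝ), (∃ c : ℂ, Tendsto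
      (fun z : (ℝ × ℝ) × ℝ × ℝ => Complex.exp (Complex.I * s * z.2.2) * G z.1 z.2.1 z.2.2)
      (𝓝[A] p ×ˢ l ×ˢ ⊤) (𝓝 c)) → ∃ C : ℝ, ∃ V ∈ l, ∀ᶠ x in 𝓝[A] p, ∀ θ ∈ V, ∀ φ : ℝ,
        ‖G x θ φ‖ ≤ C := by
    rintro s l ⟨c, hc⟩
    have h1 := hc.norm.eventually (eventually_lt_nhds (lt_add_one ‖c‖))
    obtain ⟨pa, ha, pb, hb, hab⟩ := eventually_prod_iff.1 h1
    obtain ⟨pc, hpc, pd, hd, hcd⟩ := eventually_prod_iff.1 hb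
    refine ⟨‖c‖ + 1, {θ | pc θ}, hpc, ha.mono fun x hx θ hθ φ => ?_⟩
    have := hab hx (hcd hθ (eventually_top.1 hd φ))
    simp only [norm_mul, norm_exp_I_mul, one_mul] at this
    exact this.le
  obtain ⟨C₁, V₁, hV₁, h₁⟩ := pole s _ (h.2.1 p hp)
  obtain ⟨C₂, V₂, hV₂, h₂⟩ := pole (-s) (𝓝[<] π) (by
    obtain ⟨c, hc⟩ := h.2.2 p hp
    refine ⟨c, hc.congr fun z => ?_⟩
    congr 2; push_cast; ring)
  obtain ⟨a, ha, hVa⟩ := (mem_nhdsGT_iff_exists_Ioo_subset).1 hV₁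
  obtain ⟨b, hb, hVb⟩ := (mem_nhdsLT_iff_exists_Ioo_subset).1 hV₂
  have ha' : 0 < a := ha
  have hb' : b < π := hb
  set K : Set (ℝ × ℝ) := Icc a b ×ˢ Icc 0 (2 * π) with hK
  have hKc : IsCompact K := isCompact_Icc.prod isCompact_Icc
  have hKsub : ∀ z ∈ K, z.1 ∈ Ioo 0 π := fun z hz =>
    ⟨ha'.trans_le hz.1.1, hz.1.2.trans_lt hb'⟩
  obtain ⟨C₃, hC₃⟩ := hKc.exists_bound_of_continuousOn (f := fun z : ℝ × ℝ => G p z.1 z.2)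
    (h.1.comp (f := fun z : ℝ × ℝ => (p, z.1, z.2)) (by fun_prop)
      fun z hz => ⟨hp, hKsub z hz, mem_univ _⟩)
  have h₃ : ∀ᶠ x in 𝓝 p, ∀ z ∈ K, x ∈ A → ‖G x z.1 z.2‖ ≤ C₃ + 1 := by
    refine hKc.eventually_forall_of_forall_eventually fun z hz => ?_
    have hc := (h.1 (p, z.1, z.2) ⟨hp, hKsub z hz, mem_univ _⟩).norm.eventually
      (eventually_lt_nhds ((hC₃ z hz).trans_lt (lt_add_one C₃)))
    rw [eventually_nhdsWithin_iff] at hc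
    have hth : ∀ᶠ q : (ℝ × ℝ) × ℝ × ℝ in 𝓝 (p, z), q.2.1 ∈ Ioo 0 π :=
      (Continuous.tendsto (f := fun q : (ℝ × ℝ) × ℝ × ℝ => q.2.1) (by fun_prop) (p, z)).eventually
        (isOpen_Ioo.mem_nhds (hKsub z hz))
    filter_upwards [hc, hth] with q hq hq' hqA
    exact (hq ⟨hqA, hq', mem_univ _⟩).le
  refine ⟨max (max C₁ C₂) (C₃ + 1), ?_⟩
  filter_upwards [h₁, h₂, nhdsWithin_le_nhds h₃, self_mem_nhdsWithin] with x hx₁ hx₂ hx₃ hxA θ hθ φ hφ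
  by_cases hθa : θ < a
  · exact (hx₁ θ (hVa ⟨hθ.1, hθa⟩) φ).trans ((le_max_left _ _).trans (le_max_left _ _))
  · by_cases hθb : b < θ
    · exact (hx₂ θ (hVb ⟨hθb, hθ.2⟩) φ).trans ((le_max_right _ _).trans (le_max_left _ _))
    · exact (hx₃ (θ, φ) ⟨⟨not_lt.1 hθa, not_lt.1 hθb⟩, hφ⟩ hxA).trans (le_max_right _ _)

theorem PeriodicField.exists_mem_Icc {F : Field} (h : PeriodicField M k t₀ F) {t r θ : ℝ}
    (ht : t ∈ Ici t₀) (hr : r ∈ Ioi (rPlus M k)) (hθ : θ ∈ Ioo 0 π) (φ : ℝ) :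
    ∃ ψ ∈ Icc 0 (2 * π), F t r θ φ = F t r θ ψ := by
  have hp : Function.Periodic (F t r θ) (2 * π) := fun ψ => h t ht r hr θ hθ ψ
  obtain ⟨ψ, hψ, e⟩ := hp.exists_mem_Ico₀ (by positivity) φ
  exact ⟨ψ, Ico_subset_Icc_self hψ, e⟩

theorem ExtendsToInfinity.locBdd (hM : 0 < M) (hk : 0 < k) {s : ℤ} {F : Field}
    (h : ExtendsToInfinity M k t₀ s F) (hp : PeriodicField M k t₀ F) : LocBdd M k t₀ F := by
  intro t₁ ht₁ y₁ hy₁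
  obtain ⟨G, hG, hGF⟩ := h
  obtain ⟨C, hC⟩ := hG.locBdd (p := (t₁, y₁)) ⟨ht₁, hy₁⟩
  refine ⟨C, ?_⟩
  have hC' := nhdsWithin_mono _ (prod_mono (le_refl (Ici t₀))
    (Ioo_subset_Ico_self (a := 0) (b := (rPlus M k)⁻¹))) hC
  filter_upwards [hC', mem_nearPt hM hk t₁ y₁] with p hpC hpm θ hθ φ
  obtain ⟨ψ, hψ, e⟩ := hp.exists_mem_Icc hpm.1 hpm.2 hθ φ
  rw [e, ← hGF _ hpm.1 _ hpm.2 θ hθ, inv_inv]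
  exact hpC θ hθ ψ hψ

theorem LocBdd.congr (hM : 0 < M) (hk : 0 < k) {f g : Field} (hf : LocBdd M k t₀ f)
    (h : EqOnDomain M k t₀ g f) : LocBdd M k t₀ g := by
  intro t₁ ht₁ y₁ hy₁
  obtain ⟨C, hC⟩ := hf t₁ ht₁ y₁ hy₁
  refine ⟨C, ?_⟩
  filter_upwards [hC, mem_nearPt hM hk t₁ y₁] with p hp hpm θ hθ φ
  rw [h _ hpm.1 _ hpm.2 θ hθ]
  exact hp θ hθ φ

theorem LocBdd.add {f g : Field} (hf : LocBdd M k t₀ f) (hg : LocBdd M k t₀ g) :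
    LocBdd M k t₀ (f + g) := by
  intro t₁ ht₁ y₁ hy₁
  obtain ⟨C, hC⟩ := hf t₁ ht₁ y₁ hy₁
  obtain ⟨C', hC'⟩ := hg t₁ ht₁ y₁ hy₁
  refine ⟨C + C', ?_⟩
  filter_upwards [hC, hC'] with p hp hp' θ hθ φ
  exact (norm_add_le _ _).trans (add_le_add (hp θ hθ φ) (hp' θ hθ φ))

theorem LocBdd.const_smul (c : ℂ) {f : Field} (hf : LocBdd M k t₀ f) : LocBdd M k t₀ (c • f) := by
  intro t₁ ht₁ y₁ hy₁
  obtain ⟨C, hC⟩ := hf t₁ ht₁ y₁ hy₁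
  refine ⟨‖c‖ * C, ?_⟩
  filter_upwards [hC] with p hp θ hθ φ
  exact (norm_mul _ _).le.trans (mul_le_mul_of_nonneg_left (hp θ hθ φ) (norm_nonneg _))

theorem LocBdd.radMul {f : ℝ → ℝ} {g : Field}
    (hf : ∀ t₁ ∈ Ici t₀, ∀ y₁ ∈ Ico 0 (rPlus M k)⁻¹,
      ∃ c, Tendsto (fun p : ℝ × ℝ => f p.2⁻¹) (nearPt M k t₀ t₁ y₁) (𝓝 c))
    (hg : LocBdd M k t₀ g) : LocBdd M k t₀ (radMul f g) := by
  intro t₁ ht₁ y₁ hy₁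
  obtain ⟨C, hC⟩ := hg t₁ ht₁ y₁ hy₁
  obtain ⟨c, hc⟩ := hf t₁ ht₁ y₁ hy₁
  refine ⟨(|c| + 1) * C, ?_⟩
  filter_upwards [hC, hc.abs.eventually (eventually_lt_nhds (lt_add_one |c|))] with p hp hp' θ hθ φ
  refine (norm_mul _ _).le.trans ?_
  rw [Complex.norm_real]
  exact mul_le_mul hp'.le (hp θ hθ φ) (norm_nonneg _) (by positivity)

theorem LocBdd.conj {f : Field} (hf : LocBdd M k t₀ f) : LocBdd M k t₀ (conjField f) := by
  intro t₁ ht₁ y₁ hy₁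
  obtain ⟨C, hC⟩ := hf t₁ ht₁ y₁ hy₁
  refine ⟨C, ?_⟩
  filter_upwards [hC] with p hp θ hθ φ
  rw [conjField, RCLike.norm_conj]
  exact hp θ hθ φ

theorem tendsto_snd_nearPt (t₁ y₁ : ℝ) :
    Tendsto (fun p : ℝ × ℝ => p.2) (nearPt M k t₀ t₁ y₁) (𝓝 y₁) :=
  (Continuous.tendsto continuous_snd (t₁, y₁)).mono_left nhdsWithin_le_nhds

theorem tendsto_inv_inv_nearPt (t₁ y₁ : ℝ) :
    Tendsto (fun p : ℝ × ℝ => (p.2⁻¹)⁻¹) (nearPt M k t₀ t₁ y₁) (𝓝 y₁) := by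
  simpa using tendsto_snd_nearPt t₁ y₁

theorem tendsto_w_nearPt (hM : 0 < M) (hk : 0 < k) (t₁ y₁ : ℝ) :
    Tendsto (fun p : ℝ × ℝ => w M k p.2⁻¹) (nearPt M k t₀ t₁ y₁)
      (𝓝 (k ^ 2 + y₁ ^ 2 - 2 * M * y₁ ^ 3)) := by
  have h : Tendsto (fun p : ℝ × ℝ => k ^ 2 + p.2 ^ 2 - 2 * M * p.2 ^ 3) (nearPt M k t₀ t₁ y₁)
      (𝓝 (k ^ 2 + y₁ ^ 2 - 2 * M * y₁ ^ 3)) := by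
    have h := tendsto_snd_nearPt (M := M) (k := k) (t₀ := t₀) t₁ y₁
    exact ((h.pow 2).const_add _).sub ((h.pow 3).const_mul _)
  refine h.congr' ?_
  filter_upwards [mem_nearPt hM hk t₁ y₁] with p hp
  rw [w_eq ((rPlus_pos hM hk).trans hp.2).ne', inv_inv]

theorem tendsto_w_inv_nearPt (hM : 0 < M) (hk : 0 < k) (t₁ : ℝ) {y₁ : ℝ}
    (hy₁ : y₁ ∈ Ico 0 (rPlus M k)⁻¹) :
    Tendsto (fun p : ℝ × ℝ => (w M k p.2⁻¹)⁻¹) (nearPt M k t₀ t₁ y₁)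
      (𝓝 (k ^ 2 + y₁ ^ 2 - 2 * M * y₁ ^ 3)⁻¹) := by
  refine (tendsto_w_nearPt hM hk t₁ y₁).inv₀ ?_
  rcases hy₁.1.eq_or_lt with h | h
  · simp [← h, hk.ne']
  · have hr : rPlus M k < y₁⁻¹ := (lt_inv_comm₀ (rPlus_pos hM hk) h).2 hy₁.2
    have := w_pos hM hk hr
    rw [w_eq (inv_pos.2 h).ne', inv_inv] at this
    exact this.ne'

/-! ## Periodicity -/

theorem PeriodicField.dT {F : Field} (h : PeriodicField M k t₀ F) :
    PeriodicField M k t₀ (dT t₀ F) := EqOnDomain.dT h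

theorem PeriodicField.Dop {F : Field} (h : PeriodicField M k t₀ F) :
    PeriodicField M k t₀ (Dop M k t₀ F) := EqOnDomain.Dop h

theorem PeriodicField.conj {F : Field} (h : PeriodicField M k t₀ F) :
    PeriodicField M k t₀ (conjField F) := EqOnDomain.conj h

theorem PeriodicField.iterate {O : Field → Field}
    (hO : ∀ {F : Field}, PeriodicField M k t₀ F → PeriodicField M k t₀ (O F))
    {F : Field} (h : PeriodicField M k t₀ F) (n : ℕ) : PeriodicField M k t₀ (O^[n] F) := by
  induction n generalizing F with
  | zero => exact h
  | succ n ih => exact ih (hO h)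

theorem PeriodicField.dTheta {F : Field} (h : PeriodicField M k t₀ F) :
    PeriodicField M k t₀ (dTheta F) := EqOnDomain.dTheta h

theorem PeriodicField.dPhi {F : Field} (h : PeriodicField M k t₀ F) :
    PeriodicField M k t₀ (dPhi F) := by
  have e : (fun t r θ φ => SchwarzschildAdS.dPhi F t r θ (φ + 2 * π))
      = SchwarzschildAdS.dPhi (fun t r θ φ => F t r θ (φ + 2 * π)) := by
    funext t r θ φ
    exact (deriv_comp_add_const (F t r θ) (2 * π) φ).symm
  rw [PeriodicField, e]
  exact EqOnDomain.dPhi h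

theorem PeriodicField.Z1 (s : ℤ) {F : Field} (h : PeriodicField M k t₀ F) :
    PeriodicField M k t₀ (Z1 s F) := by
  intro t ht r hr θ hθ φ
  have h1 := h.dTheta t ht r hr θ hθ φ
  have h2 := h.dPhi t ht r hr θ hθ φ
  have h3 := h t ht r hr θ hθ φ
  simp only at h1 h2 h3
  simp only [SchwarzschildAdS.Z1, h1, h2, h3, Real.sin_add_two_pi, Real.cos_add_two_pi]

theorem PeriodicField.Z2 (s : ℤ) {F : Field} (h : PeriodicField M k t₀ F) :
    PeriodicField M k t₀ (Z2 s F) := by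
  intro t ht r hr θ hθ φ
  have h1 := h.dTheta t ht r hr θ hθ φ
  have h2 := h.dPhi t ht r hr θ hθ φ
  have h3 := h t ht r hr θ hθ φ
  simp only at h1 h2 h3
  simp only [SchwarzschildAdS.Z2, h1, h2, h3, Real.sin_add_two_pi, Real.cos_add_two_pi]

/-! ## Regular fields -/

/-- A smooth field all of whose derivatives along `∂_t` and `(Δ / r²) ∂_r` are bounded near each
point of `r₊ < r ≤ ∞`. -/
structure RegularField (M k t₀ : ℝ) (F : Field) : Prop where
  M_pos : 0 < M
  k_pos : 0 < k
  smooth : SmoothField M k t₀ F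
  per : PeriodicField M k t₀ F
  bdd : ∀ p q : ℕ, LocBdd M k t₀ ((Dop M k t₀)^[q] ((dT t₀)^[p] F))
  theta : ∀ t ∈ Ici t₀, ∀ r ∈ Ioi (rPlus M k), ∃ B : ℝ, ∀ θ ∈ Ioo 0 π, ∀ φ,
    ‖dTheta F t r θ φ‖ ≤ B

theorem iterate_two_smul {O O' : Field → Field} (h : ∀ F, O' F = (2 : ℂ) • O F)
    (hO : ∀ (c : ℂ) F, O (c • F) = c • O F) (n : ℕ) (F : Field) :
    O'^[n] F = (2 : ℂ) ^ n • O^[n] F := by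
  induction n with
  | zero => simp
  | succ n ih =>
    rw [Function.iterate_succ_apply', Function.iterate_succ_apply', ih, h, hO, smul_smul, pow_succ']

/-- L + L̲ = 2∂_t and L - L̲ = 2D, so regularity at infinity bounds all derivatives along ∂_t and D.
The bound on ∂_ϑF comes from ∂_ϑ = -sin φ Z̃₁ - cos φ Z̃₂, a combination in which the singular terms
of the rotation fields cancel. -/
theorem regularField_of_regularAtInfinity (hM : 0 < M) (hk : 0 < k) {s : ℤ} {F : Field}
    (h : SmoothSpin M k t₀ s F) (hr : RegularAtInfinity M k t₀ s F) : RegularField M k t₀ F where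
  M_pos := hM
  k_pos := hk
  smooth := h.2.1
  per := h.1
  bdd p q := by
    have h1 := hr q p 0 0 0
    have hper : PeriodicField M k t₀ F := h.1
    have e1 : (fun G => L M k t₀ G + Lbar M k t₀ G)^[p] F = (2 : ℂ) ^ p • (dT t₀)^[p] F :=
      iterate_two_smul (fun G => by
        rw [two_smul]; simp only [L, Lbar]; abel) dT_const_smul p F
    have e2 : (fun G => L M k t₀ G - Lbar M k t₀ G)^[q] ((2 : ℂ) ^ p • (dT t₀)^[p] F)
        = (2 : ℂ) ^ q • (Dop M k t₀)^[q] ((2 : ℂ) ^ p • (dT t₀)^[p] F) :=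
      iterate_two_smul (fun G => by
        rw [two_smul]; simp only [L, Lbar, Dop]; abel) Dop_const_smul q _
    have e3 : (Dop M k t₀)^[q] ((2 : ℂ) ^ p • (dT t₀)^[p] F)
        = (2 : ℂ) ^ p • (Dop M k t₀)^[q] ((dT t₀)^[p] F) := by
      induction q with
      | zero => rfl
      | succ q ih =>
        rw [Function.iterate_succ_apply', Function.iterate_succ_apply', ih (hr q p 0 0 0) ?_,
          Dop_const_smul]
        exact iterate_two_smul (fun G => by
          rw [two_smul]; simp only [L, Lbar, Dop]; abel) Dop_const_smul q _
    have e0 : ZZZ s 0 0 0 F = F := rfl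
    rw [e0, e1, e2, e3, smul_smul] at h1
    have hp := (hper.iterate PeriodicField.dT p).iterate PeriodicField.Dop q
    have hb := (h1.locBdd hM hk (fun t ht r hr θ hθ φ =>
      congrArg (((2 : ℂ) ^ q * 2 ^ p) * ·) (hp t ht r hr θ hθ φ))).const_smul
        ((2 : ℂ) ^ q * 2 ^ p)⁻¹
    rwa [smul_smul, inv_mul_cancel₀ (by simp), one_smul] at hb
  theta t ht r hr' := by
    have hper : PeriodicField M k t₀ F := h.1
    obtain ⟨C₁, h₁⟩ := (hr 0 0 1 0 0).locBdd hM hk (hper.Z1 s) t ht r⁻¹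
      (Ioo_subset_Ico_self (inv_mem_of_gt hM hk hr'))
    obtain ⟨C₂, h₂⟩ := (hr 0 0 0 1 0).locBdd hM hk (hper.Z2 s) t ht r⁻¹
      (Ioo_subset_Ico_self (inv_mem_of_gt hM hk hr'))
    have h₁' := Eventually.eval_nearPt (P := fun t r => ∀ θ ∈ Ioo 0 π, ∀ φ : ℝ,
      ‖Z1 s F t r θ φ‖ ≤ C₁) hM hk ht hr' h₁
    have h₂' := Eventually.eval_nearPt (P := fun t r => ∀ θ ∈ Ioo 0 π, ∀ φ : ℝ,
      ‖Z2 s F t r θ φ‖ ≤ C₂) hM hk ht hr' h₂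
    refine ⟨C₁ + C₂, fun θ hθ φ => ?_⟩
    have hsc : (Real.sin φ : ℂ) ^ 2 + (Real.cos φ : ℂ) ^ 2 = 1 := by
      exact_mod_cast Real.sin_sq_add_cos_sq φ
    have e : dTheta F t r θ φ = -((Real.sin φ : ℂ) * Z1 s F t r θ φ)
        - (Real.cos φ : ℂ) * Z2 s F t r θ φ := by
      rw [Z1, Z2]
      linear_combination (-dTheta F t r θ φ) * hsc
    rw [e]
    refine (norm_sub_le _ _).trans (add_le_add ?_ ?_)
    · rw [norm_neg, norm_mul, Complex.norm_real]
      exact (mul_le_of_le_one_left (norm_nonneg _) (Real.abs_sin_le_one _)).trans (h₁' θ hθ φ)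
    · rw [norm_mul, Complex.norm_real]
      exact (mul_le_of_le_one_left (norm_nonneg _) (Real.abs_cos_le_one _)).trans (h₂' θ hθ φ)

theorem RegularField.conj {F : Field} (h : RegularField M k t₀ F) :
    RegularField M k t₀ (conjField F) where
  M_pos := h.M_pos
  k_pos := h.k_pos
  smooth := Complex.conjCLE.contDiff.comp_contDiffOn h.smooth
  per := h.per.conj
  bdd p q := by
    have e1 : (dT t₀)^[p] (conjField F) = conjField ((dT t₀)^[p] F) :=
      (Function.Commute.iterate_left (f := dT t₀) (g := conjField) dT_conjField p).eq F
    have e2 : (Dop M k t₀)^[q] (conjField ((dT t₀)^[p] F))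
        = conjField ((Dop M k t₀)^[q] ((dT t₀)^[p] F)) :=
      (Function.Commute.iterate_left (f := Dop M k t₀) (g := conjField) Dop_conjField q).eq _
    rw [e1, e2]
    exact (h.bdd p q).conj
  theta t ht r hr := by
    obtain ⟨B, hB⟩ := h.theta t ht r hr
    refine ⟨B, fun θ hθ φ => ?_⟩
    rw [dTheta_conjField, conjField, RCLike.norm_conj]
    exact hB θ hθ φ

end

section

variable {M k t₀ : ℝ}

/-! ## Tame fields -/

/-- The fields obtained from the derivatives of `F` along `∂_t` and `(Δ / r²) ∂_r` by linear
combinations with coefficients polynomial in `1 / r` and `1 / w`. -/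
inductive Tame (M k t₀ : ℝ) (F : Field) : Field → Prop
  | base (p q : ℕ) : Tame M k t₀ F ((Dop M k t₀)^[q] ((dT t₀)^[p] F))
  | add {g g' : Field} : Tame M k t₀ F g → Tame M k t₀ F g' → Tame M k t₀ F (g + g')
  | const_smul {g : Field} (c : ℂ) : Tame M k t₀ F g → Tame M k t₀ F (c • g)
  | inv_r {g : Field} : Tame M k t₀ F g → Tame M k t₀ F (radMul (fun r => r⁻¹) g)
  | inv_w {g : Field} : Tame M k t₀ F g → Tame M k t₀ F (radMul (fun r => (w M k r)⁻¹) g)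
  | congr {g g' : Field} : Tame M k t₀ F g → EqOnDomain M k t₀ g' g → Tame M k t₀ F g'

variable {F g g' : Field}

theorem Tame.self : Tame M k t₀ F F := Tame.base 0 0

theorem Tame.sub (hg : Tame M k t₀ F g) (hg' : Tame M k t₀ F g') : Tame M k t₀ F (g - g') := by
  have := hg.add (hg'.const_smul (-1))
  rwa [neg_one_smul, ← sub_eq_add_neg] at this

theorem Tame.neg (hg : Tame M k t₀ F g) : Tame M k t₀ F (-g) := by
  have := hg.const_smul (-1)
  rwa [neg_one_smul] at this

theorem Tame.radMul_w (hF : RegularField M k t₀ F) (hg : Tame M k t₀ F g) :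
    Tame M k t₀ F (radMul (w M k) g) := by
  refine (((hg.const_smul ((k ^ 2 : ℝ) : ℂ)).add hg.inv_r.inv_r).sub
    (hg.inv_r.inv_r.inv_r.const_smul ((2 * M : ℝ) : ℂ))).congr fun t _ r hr θ _ φ => ?_
  simp only [radMul, Pi.add_apply, Pi.sub_apply, Pi.smul_apply, smul_eq_mul]
  rw [w_eq ((rPlus_pos hF.M_pos hF.k_pos).trans hr).ne']
  push_cast
  ring

theorem Tame.radMul_hRad (hg : Tame M k t₀ F g) : Tame M k t₀ F (radMul (hRad M) g) := by
  refine ((hg.inv_r.const_smul (-2)).add (hg.inv_r.inv_r.const_smul ((6 * M : ℝ) : ℂ))).congr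
    fun t _ r hr θ _ φ => ?_
  simp only [radMul, hRad, Pi.add_apply, Pi.smul_apply, smul_eq_mul]
  push_cast
  ring

theorem Tame.smooth (hF : RegularField M k t₀ F) (hg : Tame M k t₀ F g) :
    SmoothField M k t₀ g := by
  have hr0 : ∀ r ∈ Ioi (rPlus M k), r ≠ 0 :=
    fun r hr => ((rPlus_pos hF.M_pos hF.k_pos).trans hr).ne'
  induction hg with
  | base p q => exact (hF.smooth.iterate_dT p).iterate_Dop hF.M_pos hF.k_pos q
  | add _ _ h h' => exact h.add h'
  | const_smul c _ h => exact h.const_smul c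
  | inv_r _ h => exact h.radMul (contDiffOn_id.inv hr0)
  | inv_w _ h =>
    refine h.radMul (ContDiffOn.inv ?_ fun r hr => (w_pos hF.M_pos hF.k_pos hr).ne')
    unfold w Delta
    exact ContDiffOn.div (by fun_prop) (by fun_prop) fun r hr => pow_ne_zero 4 (hr0 r hr)
  | congr _ h' h => exact h.congr h'

theorem Tame.per (hF : RegularField M k t₀ F) (hg : Tame M k t₀ F g) : PeriodicField M k t₀ g := by
  induction hg with
  | base p q => exact (hF.per.iterate PeriodicField.dT p).iterate PeriodicField.Dop q
  | add _ _ h h' => exact EqOnDomain.add h h'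
  | const_smul c _ h => exact EqOnDomain.const_smul c h
  | inv_r _ h => exact EqOnDomain.radMul _ h
  | inv_w _ h => exact EqOnDomain.radMul _ h
  | congr _ h' h =>
    exact EqOnDomain.trans (fun t ht r hr θ hθ φ => h' t ht r hr θ hθ _) (h.trans h'.symm)

theorem Tame.locBdd (hF : RegularField M k t₀ F) (hg : Tame M k t₀ F g) : LocBdd M k t₀ g := by
  induction hg with
  | base p q => exact hF.bdd p q
  | add _ _ h h' => exact h.add h'
  | const_smul c _ h => exact h.const_smul c
  | inv_r _ h => exact LocBdd.radMul (fun t₁ _ y₁ _ => ⟨y₁, tendsto_inv_inv_nearPt t₁ y₁⟩) h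
  | inv_w _ h =>
    exact LocBdd.radMul (fun t₁ _ y₁ hy => ⟨_, tendsto_w_inv_nearPt hF.M_pos hF.k_pos t₁ hy⟩) h
  | congr _ h' h => exact h.congr hF.M_pos hF.k_pos h'

theorem Tame.dT (hF : RegularField M k t₀ F) (hg : Tame M k t₀ F g) :
    Tame M k t₀ F (dT t₀ g) := by
  induction hg with
  | base p q =>
    have h := (hF.smooth.iterate_dT p).dT_iterate_Dop hF.M_pos hF.k_pos q
    rw [← Function.iterate_succ_apply' (SchwarzschildAdS.dT t₀)] at h
    exact (Tame.base (p + 1) q).congr h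
  | add hg hg' h h' => exact (h.add h').congr ((hg.smooth hF).dT_add (hg'.smooth hF))
  | const_smul c _ h => rw [dT_const_smul]; exact h.const_smul c
  | inv_r _ h => rw [dT_radMul]; exact h.inv_r
  | inv_w _ h => rw [dT_radMul]; exact h.inv_w
  | congr _ h' h => exact h.congr h'.dT

/-- The class of coefficients is closed under D: D(1/r) = -w and D(1/w) = -h/w, where w and h = D
log w are polynomials in 1/r. -/
theorem Tame.Dop (hF : RegularField M k t₀ F) (hg : Tame M k t₀ F g) :
    Tame M k t₀ F (Dop M k t₀ g) := by
  induction hg with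
  | base p q =>
    rw [← Function.iterate_succ_apply' (SchwarzschildAdS.Dop M k t₀)]
    exact Tame.base p (q + 1)
  | add hg hg' h h' => exact (h.add h').congr ((hg.smooth hF).Dop_add (hg'.smooth hF))
  | const_smul c _ h => rw [Dop_const_smul]; exact h.const_smul c
  | inv_r hg h =>
    refine (((hg.radMul_w hF).neg).add h.inv_r).congr
      (((hg.smooth hF).Dop_radMul hF.M_pos hF.k_pos
        fun r hr => hasDerivAt_inv_rad hF.M_pos hF.k_pos hr).trans
        (EqOnDomain.add (fun t _ r _ θ _ φ => ?_) (EqOnDomain.refl _)))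
    simp [radMul]
  | inv_w hg h =>
    refine ((hg.inv_w.radMul_hRad.neg).add h.inv_w).congr
      (((hg.smooth hF).Dop_radMul hF.M_pos hF.k_pos
        fun r hr => hasDerivAt_w_inv hF.M_pos hF.k_pos hr).trans
        (EqOnDomain.add (fun t _ r _ θ _ φ => ?_) (EqOnDomain.refl _)))
    simp [radMul, mul_assoc]
  | congr _ h' h => exact h.congr h'.Dop

theorem Tame.sphereReg (hF : RegularField M k t₀ F) (hg : Tame M k t₀ F g) {t r : ℝ}
    (ht : t ∈ Ici t₀) (hr : r ∈ Ioi (rPlus M k)) : SphereReg (g t r) where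
  cont := by
    have h : ContinuousOn (unc g) (dom M k t₀) := (hg.smooth hF).continuousOn
    exact h.comp (f := fun z : ℝ × ℝ => (t, r, z.1, z.2)) (by fun_prop)
      fun z hz => ⟨ht, hr, hz⟩
  bdd := by
    obtain ⟨C, hC⟩ := hg.locBdd hF t ht r⁻¹
      (Ioo_subset_Ico_self (inv_mem_of_gt hF.M_pos hF.k_pos hr))
    exact ⟨C, Eventually.eval_nearPt (P := fun t r => ∀ θ ∈ Ioo 0 π, ∀ φ : ℝ, ‖g t r θ φ‖ ≤ C)
      hF.M_pos hF.k_pos ht hr hC⟩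
  per := fun θ hθ φ => hg.per hF t ht r hr θ hθ φ

/-! ## Differentiation of the coefficients -/

theorem Tame.sphCoeff_add (hF : RegularField M k t₀ F) (hg : Tame M k t₀ F g)
    (hg' : Tame M k t₀ F g') {t r : ℝ} (ht : t ∈ Ici t₀) (hr : r ∈ Ioi (rPlus M k)) {m : ℤ} {n : ℕ}
    (hm : m ∈ modes n) :
    sphCoeff m n ((g + g') t r) = sphCoeff m n (g t r) + sphCoeff m n (g' t r) :=
  SchwarzschildAdS.sphCoeff_add (hg.sphereReg hF ht hr) (hg'.sphereReg hF ht hr) hm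

theorem Tame.sphCoeff_sub (hF : RegularField M k t₀ F) (hg : Tame M k t₀ F g)
    (hg' : Tame M k t₀ F g') {t r : ℝ} (ht : t ∈ Ici t₀) (hr : r ∈ Ioi (rPlus M k)) {m : ℤ} {n : ℕ}
    (hm : m ∈ modes n) :
    sphCoeff m n ((g - g') t r) = sphCoeff m n (g t r) - sphCoeff m n (g' t r) :=
  SchwarzschildAdS.sphCoeff_sub (hg.sphereReg hF ht hr) (hg'.sphereReg hF ht hr) hm

theorem Tame.sphCoeff_const_smul (hF : RegularField M k t₀ F) (hg : Tame M k t₀ F g) (c : ℂ)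
    {t r : ℝ} (ht : t ∈ Ici t₀) (hr : r ∈ Ioi (rPlus M k)) {m : ℤ} {n : ℕ} (hm : m ∈ modes n) :
    sphCoeff m n ((c • g) t r) = c * sphCoeff m n (g t r) :=
  SchwarzschildAdS.sphCoeff_const_mul (hg.sphereReg hF ht hr) c hm

theorem Tame.sphCoeff_radMul (hF : RegularField M k t₀ F) (hg : Tame M k t₀ F g) (f : ℝ → ℝ)
    {t r : ℝ} (ht : t ∈ Ici t₀) (hr : r ∈ Ioi (rPlus M k)) {m : ℤ} {n : ℕ} (hm : m ∈ modes n) :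
    sphCoeff m n (radMul f g t r) = f r * sphCoeff m n (g t r) :=
  SchwarzschildAdS.sphCoeff_const_mul (hg.sphereReg hF ht hr) (f r : ℂ) hm

theorem EqOnDomain.sphCoeff_eq (h : EqOnDomain M k t₀ g g') {t r : ℝ} (ht : t ∈ Ici t₀)
    (hr : r ∈ Ioi (rPlus M k)) (m : ℤ) (n : ℕ) :
    sphCoeff m n (g t r) = sphCoeff m n (g' t r) :=
  sphCoeff_congr fun θ hθ φ => h t ht r hr θ hθ φ

theorem hasDerivWithinAt_sphCoeff {s : Set ℝ} (hs : Convex ℝ s) {x : ℝ} (hx : x ∈ s)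
    {f f' : ℝ → ℝ → ℝ → ℂ} (hreg : ∀ y ∈ s, SphereReg (f y)) (hreg' : SphereReg (f' x))
    (hd : ∀ y ∈ s, ∀ θ ∈ Ioo 0 π, ∀ φ, HasDerivWithinAt (fun y => f y θ φ) (f' y θ φ) s y) {C : ℝ}
    (hC : ∀ y ∈ s, ∀ θ ∈ Ioo 0 π, ∀ φ, ‖f' y θ φ‖ ≤ C) {m : ℤ} {n : ℕ} (hm : m ∈ modes n) :
    HasDerivWithinAt (fun y => sphCoeff m n (f y)) (sphCoeff m n (f' x)) s x := by
  rw [sphCoeff_eq_integral hreg' hm]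
  refine HasDerivWithinAt.congr (f := fun y => ∫ z, f y z.2 z.1 * sphKer m n z ∂sphMeas) ?_
    (fun y hy => sphCoeff_eq_integral (hreg y hy) hm) (sphCoeff_eq_integral (hreg x hx) hm)
  refine hasDerivWithinAt_integral (f := fun y (z : ℝ × ℝ) => f y z.2 z.1 * sphKer m n z)
    (f' := fun y (z : ℝ × ℝ) => f' y z.2 z.1 * sphKer m n z) (b := fun _ => C * (n + 3)) hs hx
    (MeasureTheory.integrable_const _) (fun y hy => (hreg y hy).integrable hm) ?_ ?_
  · exact ae_sphMeas fun φ θ hθ y hy => (hd y hy θ hθ φ).mul_const _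
  · refine ae_sphMeas fun φ θ hθ y hy => ?_
    rw [norm_mul]
    exact mul_le_mul (hC y hy θ hθ φ) (norm_sphKer_le (Finset.mem_Icc.1 hm).1 _) (norm_nonneg _)
      ((norm_nonneg _).trans (hC y hy θ hθ φ))

/-- A property which holds near `(t, r)` holds on a convex neighbourhood in `t`. -/
theorem exists_convex_time (hM : 0 < M) (hk : 0 < k) {t r : ℝ} (ht : t ∈ Ici t₀)
    (hr : r ∈ Ioi (rPlus M k)) {P : ℝ → ℝ → Prop}
    (h : ∀ᶠ p in nearPt M k t₀ t r⁻¹, P p.1 p.2⁻¹) :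
    ∃ s ∈ 𝓝[Ici t₀] t, Convex ℝ s ∧ t ∈ s ∧ s ⊆ Ici t₀ ∧ ∀ τ ∈ s, P τ r := by
  have h1 : Tendsto (fun τ : ℝ => (τ, r)) (𝓝[Ici t₀] t) (𝓝[Ici t₀] t ×ˢ 𝓝 r) :=
    tendsto_id.prodMk tendsto_const_nhds
  have h2 := ((tendsto_nearPt hM hk hr).comp h1).eventually h
  obtain ⟨δ, hδ, hsub⟩ := Metric.mem_nhdsWithin_iff.1 h2
  refine ⟨Metric.ball t δ ∩ Ici t₀, inter_mem (mem_nhdsWithin_of_mem_nhds (Metric.ball_mem_nhds t hδ)) self_mem_nhdsWithin,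
    (convex_ball t δ).inter (convex_Ici t₀), ⟨Metric.mem_ball_self hδ, ht⟩, inter_subset_right,
    fun τ hτ => ?_⟩
  simpa using hsub hτ

/-- A property which holds near `(t, r)` holds on a convex neighbourhood in `r`. -/
theorem exists_convex_radius (hM : 0 < M) (hk : 0 < k) {t r : ℝ} (ht : t ∈ Ici t₀)
    (hr : r ∈ Ioi (rPlus M k)) {P : ℝ → ℝ → Prop}
    (h : ∀ᶠ p in nearPt M k t₀ t r⁻¹, P p.1 p.2⁻¹) :
    ∃ s ∈ 𝓝 r, Convex ℝ s ∧ r ∈ s ∧ s ⊆ Ioi (rPlus M k) ∧ ∀ ρ ∈ s, P t ρ := by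
  have h1 : Tendsto (fun ρ : ℝ => (t, ρ)) (𝓝 r) (𝓝[Ici t₀] t ×ˢ 𝓝 r) :=
    (tendsto_const_nhdsWithin ht).prodMk tendsto_id
  have h2 := ((tendsto_nearPt hM hk hr).comp h1).eventually h
  obtain ⟨δ, hδ, hsub⟩ := Metric.mem_nhds_iff.1 (inter_mem h2 (isOpen_Ioi.mem_nhds hr))
  refine ⟨Metric.ball r δ, Metric.ball_mem_nhds r hδ, convex_ball r δ, Metric.mem_ball_self hδ,
    fun ρ hρ => (hsub hρ).2, fun ρ hρ => ?_⟩
  simpa using (hsub hρ).1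

theorem Tame.hasDerivWithinAt_sphCoeff (hF : RegularField M k t₀ F) (hg : Tame M k t₀ F g)
    {t r : ℝ} (ht : t ∈ Ici t₀) (hr : r ∈ Ioi (rPlus M k)) {m : ℤ} {n : ℕ} (hm : m ∈ modes n) :
    HasDerivWithinAt (fun τ => sphCoeff m n (g τ r))
      (sphCoeff m n (SchwarzschildAdS.dT t₀ g t r)) (Ici t₀) t := by
  obtain ⟨C, hC⟩ := (hg.dT hF).locBdd hF t ht r⁻¹
    (Ioo_subset_Ico_self (inv_mem_of_gt hF.M_pos hF.k_pos hr))
  obtain ⟨s, hs, hconv, hts, hsub, hb⟩ := exists_convex_time hF.M_pos hF.k_pos ht hr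
    (P := fun t r => ∀ θ ∈ Ioo 0 π, ∀ φ : ℝ, ‖SchwarzschildAdS.dT t₀ g t r θ φ‖ ≤ C) hC
  refine (SchwarzschildAdS.hasDerivWithinAt_sphCoeff (f := fun τ => g τ r)
    (f' := fun τ => SchwarzschildAdS.dT t₀ g τ r) hconv hts
    (fun τ hτ => hg.sphereReg hF (hsub hτ) hr) ((hg.dT hF).sphereReg hF ht hr)
    (fun τ hτ θ hθ φ => ?_) hb hm).mono_of_mem_nhdsWithin hs
  have hz : (τ, r, θ, φ) ∈ dom M k t₀ := ⟨hsub hτ, hr, hθ, mem_univ _⟩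
  have h := (hg.smooth hF).hasDerivWithinAt_t hz
  rw [← (hg.smooth hF).dT_eq hz] at h
  exact h.mono hsub

/-- `∂_r` at fixed `t⋆` in terms of `(Δ / r²) ∂_r` at fixed `t` and `∂_t`. -/
theorem dRstar_eq_on (hM : 0 < M) (hk : 0 < k) (g : Field) {t r : ℝ} (hr : r ∈ Ioi (rPlus M k))
    (θ φ : ℝ) : dRstar g t r θ φ = ((r ^ 2 / Delta M k r : ℝ) : ℂ) * Dop M k t₀ g t r θ φ
      - ((r ^ 2 / Delta M k r - 1 / (1 + k ^ 2 * r ^ 2) : ℝ) : ℂ) * dT t₀ g t r θ φ := by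
  have h0 : r ≠ 0 := ((rPlus_pos hM hk).trans hr).ne'
  have hD := (Delta_pos hM hk hr).ne'
  have hc : ((r ^ 2 / Delta M k r : ℝ) : ℂ) * ((Delta M k r / r ^ 2 : ℝ) : ℂ) = 1 := by
    rw [← Complex.ofReal_mul, ← Complex.ofReal_one]; congr 1; field_simp
  rw [Dop_apply, Complex.ofReal_mul (Delta M k r / r ^ 2)]
  linear_combination (-dRstar g t r θ φ
    - ((r ^ 2 / Delta M k r - 1 / (1 + k ^ 2 * r ^ 2) : ℝ) : ℂ) * dT t₀ g t r θ φ) * hc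

/-- The two radial coefficients of `dRstar_eq_on` are bounded near `r`. -/
theorem eventually_radial_le (hM : 0 < M) (hk : 0 < k) {r : ℝ} (hr : r ∈ Ioi (rPlus M k)) :
    ∃ K : ℝ, ∀ᶠ ρ in 𝓝 r, |ρ ^ 2 / Delta M k ρ| ≤ K ∧
      |ρ ^ 2 / Delta M k ρ - 1 / (1 + k ^ 2 * ρ ^ 2)| ≤ K := by
  have hD := (Delta_pos hM hk hr).ne'
  have cD : ContinuousAt (fun ρ => Delta M k ρ) r := by unfold Delta; fun_prop
  have c1 : ContinuousAt (fun ρ => ρ ^ 2 / Delta M k ρ) r := ContinuousAt.div (by fun_prop) cD hD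
  have c2 : ContinuousAt (fun ρ => ρ ^ 2 / Delta M k ρ - 1 / (1 + k ^ 2 * ρ ^ 2)) r :=
    c1.sub (ContinuousAt.div (by fun_prop) (by fun_prop) (by positivity))
  obtain ⟨K₁, h₁⟩ : ∃ K, ∀ᶠ ρ in 𝓝 r, |ρ ^ 2 / Delta M k ρ| < K :=
    ⟨_, c1.abs.eventually (eventually_lt_nhds (lt_add_one _))⟩
  obtain ⟨K₂, h₂⟩ : ∃ K, ∀ᶠ ρ in 𝓝 r,
      |ρ ^ 2 / Delta M k ρ - 1 / (1 + k ^ 2 * ρ ^ 2)| < K :=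
    ⟨_, c2.abs.eventually (eventually_lt_nhds (lt_add_one _))⟩
  refine ⟨max K₁ K₂, ?_⟩
  filter_upwards [h₁, h₂] with ρ h1 h2
  exact ⟨h1.le.trans (le_max_left _ _), h2.le.trans (le_max_right _ _)⟩

/-- Differentiation under the integral takes place in ∂_r at fixed t⋆, the genuine coordinate
derivative. It is then expressed through D and ∂_t, for which local bounds are known. -/
theorem Tame.hasDerivAt_sphCoeff (hF : RegularField M k t₀ F) (hg : Tame M k t₀ F g)
    {t r : ℝ} (ht : t ∈ Ici t₀) (hr : r ∈ Ioi (rPlus M k)) {m : ℤ} {n : ℕ} (hm : m ∈ modes n) :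
    HasDerivAt (fun ρ => sphCoeff m n (g t ρ))
      (((r ^ 2 / Delta M k r : ℝ) : ℂ) * sphCoeff m n (SchwarzschildAdS.Dop M k t₀ g t r)
        - ((r ^ 2 / Delta M k r - 1 / (1 + k ^ 2 * r ^ 2) : ℝ) : ℂ)
          * sphCoeff m n (SchwarzschildAdS.dT t₀ g t r)) r := by
  have hM := hF.M_pos
  have hk := hF.k_pos
  have hy := Ioo_subset_Ico_self (inv_mem_of_gt hM hk hr)
  obtain ⟨C, hC⟩ := (hg.dT hF).locBdd hF t ht r⁻¹ hy
  obtain ⟨C', hC'⟩ := (hg.Dop hF).locBdd hF t ht r⁻¹ hy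
  obtain ⟨K, hK⟩ := eventually_radial_le hM hk hr
  obtain ⟨s, hs, hconv, hts, hsub, hb⟩ := exists_convex_radius hM hk ht hr
    (P := fun t r => (∀ θ ∈ Ioo 0 π, ∀ φ : ℝ, ‖SchwarzschildAdS.dT t₀ g t r θ φ‖ ≤ C) ∧
      ∀ θ ∈ Ioo 0 π, ∀ φ : ℝ, ‖SchwarzschildAdS.Dop M k t₀ g t r θ φ‖ ≤ C') (hC.and hC')
  obtain ⟨δ, hδ, hball⟩ := Metric.mem_nhds_iff.1 (inter_mem hs hK)
  have h1 := (hg.Dop hF).sphereReg hF ht hr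
  have h2 := (hg.dT hF).sphereReg hF ht hr
  have e : ∀ ρ ∈ Ioi (rPlus M k), ∀ θ ∈ Ioo 0 π, ∀ φ, dRstar g t ρ θ φ = _ :=
    fun ρ hρ θ _ φ => dRstar_eq_on (t₀ := t₀) hM hk g hρ θ φ
  have h3 := (h1.const_mul ((r ^ 2 / Delta M k r : ℝ) : ℂ)).sub (h2.const_mul
    ((r ^ 2 / Delta M k r - 1 / (1 + k ^ 2 * r ^ 2) : ℝ) : ℂ))
  have hcoef : sphCoeff m n (dRstar g t r) = _ := (sphCoeff_congr (e r hr)).trans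
    ((SchwarzschildAdS.sphCoeff_sub (h1.const_mul _) (h2.const_mul _) hm).trans (congrArg₂ (· - ·)
      (sphCoeff_const_mul h1 _ hm) (sphCoeff_const_mul h2 _ hm)))
  rw [← hcoef]
  refine (SchwarzschildAdS.hasDerivWithinAt_sphCoeff (s := Metric.ball r δ) (f := fun ρ => g t ρ)
    (f' := fun ρ => dRstar g t ρ) (C := K * C' + K * C) (convex_ball r δ)
    (Metric.mem_ball_self hδ)
    (fun ρ hρ => hg.sphereReg hF ht (hsub (hball hρ).1)) (h3.congr (e r hr))
    (fun ρ hρ θ hθ φ => ?_) (fun ρ hρ θ hθ φ => ?_) hm).hasDerivAt (Metric.ball_mem_nhds r hδ)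
  · have hz : (t, ρ, θ, φ) ∈ dom M k t₀ := ⟨ht, hsub (hball hρ).1, hθ, mem_univ _⟩
    have h := (hg.smooth hF).hasDerivAt_r hz
    rw [← (hg.smooth hF).dRstar_eq hz] at h
    exact h.hasDerivWithinAt
  · obtain ⟨hρs, hρK⟩ := hball hρ
    have hK0 : 0 ≤ K := (abs_nonneg _).trans hρK.1
    rw [e ρ (hsub hρs) θ hθ φ]
    refine (norm_sub_le _ _).trans (add_le_add ?_ ?_)
    · rw [norm_mul, Complex.norm_real]
      exact mul_le_mul hρK.1 ((hb ρ hρs).2 θ hθ φ) (norm_nonneg _) hK0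
    · rw [norm_mul, Complex.norm_real]
      exact mul_le_mul hρK.2 ((hb ρ hρs).1 θ hθ φ) (norm_nonneg _) hK0

end

section

variable {M k t₀ : ℝ} {F g g' : Field}

/-! ## Rapid decay of the coefficients -/

/-- The coefficients of `g'` are the eigenvalues `ℓ (ℓ + 1)` times those of `g`. -/
def LamRel (M k t₀ : ℝ) (g g' : Field) : Prop :=
  ∀ t ∈ Ici t₀, ∀ r ∈ Ioi (rPlus M k), ∀ n : ℕ, ∀ m ∈ modes n,
    sphCoeff m n (g' t r) = lam n * sphCoeff m n (g t r)

theorem lamRel_angOp (hF : RegularField M k t₀ F) (hA : Tame M k t₀ F (angOp 2 F)) :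
    LamRel M k t₀ F (angOp 2 F) := by
  intro t ht r hr n m hm
  have hS := hF.smooth
  have hz : ∀ θ ∈ Ioo 0 π, ∀ φ, (t, r, θ, φ) ∈ dom M k t₀ :=
    fun θ hθ φ => ⟨ht, hr, hθ, mem_univ _⟩
  have cont : ∀ {G : Field}, SmoothField M k t₀ G →
      ContinuousOn (fun z : ℝ × ℝ => G t r z.1 z.2) (Ioo 0 π ×ˢ univ) := fun {G} hG =>
    (show ContinuousOn (unc G) (dom M k t₀) from ContDiffOn.continuousOn hG).comp
      (f := fun z : ℝ × ℝ => (t, r, z.1, z.2)) (by fun_prop) fun z hz => ⟨ht, hr, hz⟩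
  have dth : ∀ {G : Field}, SmoothField M k t₀ G → ∀ θ ∈ Ioo 0 π, ∀ φ,
      HasDerivAt (fun x => G t r x φ) (dTheta G t r θ φ) θ := fun {G} hG θ hθ φ =>
    (hG.hasDerivAt_theta (hz θ hθ φ)).differentiableAt.hasDerivAt
  have dph : ∀ {G : Field}, SmoothField M k t₀ G → ∀ θ ∈ Ioo 0 π, ∀ φ,
      HasDerivAt (G t r θ) (dPhi G t r θ φ) φ := fun {G} hG θ hθ φ =>
    (hG.hasDerivAt_phi (hz θ hθ φ)).differentiableAt.hasDerivAt
  exact sphCoeff_angOp (Tame.self.sphereReg hF ht hr) (hA.sphereReg hF ht hr) (cont hS.dTheta)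
    (hF.theta t ht r hr) (cont hS.dTheta.dTheta) (cont hS.dPhi) (cont hS.dPhi.dPhi) (dth hS)
    (dth hS.dTheta) (dph hS) (dph hS.dPhi) hm

/-- Differentiates the relation between the coefficients. This replaces any commutation of ℒ with
∂_t on fields and requires no angular regularity of the derivatives. -/
theorem LamRel.dT (hF : RegularField M k t₀ F) (hg : Tame M k t₀ F g) (hg' : Tame M k t₀ F g')
    (h : LamRel M k t₀ g g') : LamRel M k t₀ (dT t₀ g) (dT t₀ g') := by
  intro t ht r hr n m hm
  have h1 := (hg.hasDerivWithinAt_sphCoeff hF ht hr hm).const_mul (lam n : ℂ)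
  have h2 := hg'.hasDerivWithinAt_sphCoeff hF ht hr hm
  exact ((uniqueDiffOn_Ici t₀ t ht).eq_deriv _ h2
    (h1.congr (fun τ hτ => h τ hτ r hr n m hm) (h t ht r hr n m hm)))

theorem LamRel.Dop (hF : RegularField M k t₀ F) (hg : Tame M k t₀ F g) (hg' : Tame M k t₀ F g')
    (h : LamRel M k t₀ g g') : LamRel M k t₀ (Dop M k t₀ g) (Dop M k t₀ g') := by
  intro t ht r hr n m hm
  have h1 := (hg.hasDerivAt_sphCoeff hF ht hr hm).const_mul (lam n : ℂ)
  have h2 := hg'.hasDerivAt_sphCoeff hF ht hr hm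
  have h3 := h2.unique (h1.congr_of_eventuallyEq (by
    filter_upwards [isOpen_Ioi.mem_nhds hr] with ρ hρ using h t ht ρ hρ n m hm))
  have h4 := (h.dT hF hg hg') t ht r hr n m hm
  have hne : ((r ^ 2 / Delta M k r : ℝ) : ℂ) ≠ 0 := by
    have := (rPlus_pos hF.M_pos hF.k_pos).trans hr
    have := Delta_pos hF.M_pos hF.k_pos hr
    exact_mod_cast (by positivity : r ^ 2 / Delta M k r ≠ 0)
  refine mul_left_cancel₀ hne ?_
  linear_combination h3
    + ((r ^ 2 / Delta M k r - 1 / (1 + k ^ 2 * r ^ 2) : ℝ) : ℂ) * h4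

/-- The only angular input is that ℒF is itself tame; the derivations and the radial multiplications
then carry the eigenvalue relation to every tame field. It can thus be iterated. -/
theorem Tame.exists_lamRel (hF : RegularField M k t₀ F) (hg : Tame M k t₀ F g)
    (hA : Tame M k t₀ F (angOp 2 F)) : ∃ g', Tame M k t₀ F g' ∧ LamRel M k t₀ g g' := by
  induction hg with
  | base p q =>
    induction q with
    | zero =>
      induction p with
      | zero => exact ⟨_, hA, lamRel_angOp hF hA⟩
      | succ p ih =>
        obtain ⟨g', hg', h⟩ := ih
        refine ⟨_, hg'.dT hF, ?_⟩
        rw [Function.iterate_succ_apply']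
        exact h.dT hF (Tame.base p 0) hg'
    | succ q ih =>
      obtain ⟨g', hg', h⟩ := ih
      refine ⟨_, hg'.Dop hF, ?_⟩
      rw [Function.iterate_succ_apply']
      exact h.Dop hF (Tame.base p q) hg'
  | @add g₁ g₂ h₁ h₂ ih₁ ih₂ =>
    obtain ⟨g₁', h₁', e₁⟩ := ih₁
    obtain ⟨g₂', h₂', e₂⟩ := ih₂
    refine ⟨_, h₁'.add h₂', fun t ht r hr n m hm => ?_⟩
    rw [h₁'.sphCoeff_add hF h₂' ht hr hm, h₁.sphCoeff_add hF h₂ ht hr hm, e₁ t ht r hr n m hm,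
      e₂ t ht r hr n m hm, mul_add]
  | const_smul c h ih =>
    obtain ⟨g', h', e⟩ := ih
    refine ⟨_, h'.const_smul c, fun t ht r hr n m hm => ?_⟩
    rw [h'.sphCoeff_const_smul hF c ht hr hm, h.sphCoeff_const_smul hF c ht hr hm,
      e t ht r hr n m hm]
    ring
  | inv_r h ih =>
    obtain ⟨g', h', e⟩ := ih
    refine ⟨_, h'.inv_r, fun t ht r hr n m hm => ?_⟩
    rw [h'.sphCoeff_radMul hF _ ht hr hm, h.sphCoeff_radMul hF _ ht hr hm, e t ht r hr n m hm]
    ring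
  | inv_w h ih =>
    obtain ⟨g', h', e⟩ := ih
    refine ⟨_, h'.inv_w, fun t ht r hr n m hm => ?_⟩
    rw [h'.sphCoeff_radMul hF _ ht hr hm, h.sphCoeff_radMul hF _ ht hr hm, e t ht r hr n m hm]
    ring
  | congr h heq ih =>
    obtain ⟨g', h', e⟩ := ih
    refine ⟨_, h', fun t ht r hr n m hm => ?_⟩
    rw [heq.sphCoeff_eq ht hr, e t ht r hr n m hm]

/-- Rapid decay, locally uniform up to the conformal boundary. -/
def LocRapid (M k t₀ : ℝ) (g : Field) : Prop :=
  ∀ N : ℕ, ∀ t₁ ∈ Ici t₀, ∀ y₁ ∈ Ico 0 (rPlus M k)⁻¹, ∃ C : ℝ, ∀ᶠ p in nearPt M k t₀ t₁ y₁,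
    ∀ n : ℕ, ∀ m ∈ modes n, ‖sphCoeff m n (g p.1 p.2⁻¹)‖ * ((n : ℝ) + 1) ^ N ≤ C

/-- Each application of `Tame.exists_lamRel` gains a factor ℓ(ℓ+1) ≥ n + 1 in the decay, while tame
fields stay bounded up to r = ∞. -/
theorem Tame.locRapid (hF : RegularField M k t₀ F) (hg : Tame M k t₀ F g)
    (hA : Tame M k t₀ F (angOp 2 F)) : LocRapid M k t₀ g := by
  have key : ∀ N : ℕ, ∀ g, Tame M k t₀ F g → ∀ t₁ ∈ Ici t₀, ∀ y₁ ∈ Ico 0 (rPlus M k)⁻¹,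
      ∃ C : ℝ, ∀ᶠ p in nearPt M k t₀ t₁ y₁, ∀ n : ℕ, ∀ m ∈ modes n,
        ‖sphCoeff m n (g p.1 p.2⁻¹)‖ * ((n : ℝ) + 1) ^ N ≤ C * (n + 3) := by
    intro N
    induction N with
    | zero =>
      intro g hg t₁ ht₁ y₁ hy₁
      obtain ⟨C, hC⟩ := hg.locBdd hF t₁ ht₁ y₁ hy₁
      refine ⟨C * sphMeas.real univ, ?_⟩
      filter_upwards [hC, mem_nearPt hF.M_pos hF.k_pos t₁ y₁] with p hp hpm n m hm
      have := norm_sphCoeff_le (hg.sphereReg hF hpm.1 hpm.2) hm hp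
      rw [pow_zero, mul_one]
      linarith
    | succ N ih =>
      intro g hg t₁ ht₁ y₁ hy₁
      obtain ⟨g', hg', e⟩ := hg.exists_lamRel hF hA
      obtain ⟨C, hC⟩ := ih g' hg' t₁ ht₁ y₁ hy₁
      refine ⟨C, ?_⟩
      filter_upwards [hC, mem_nearPt hF.M_pos hF.k_pos t₁ y₁] with p hp hpm n m hm
      have h := hp n m hm
      rw [e _ hpm.1 _ hpm.2 n m hm, norm_mul, Complex.norm_real, Real.norm_eq_abs] at h
      refine le_trans ?_ h
      have hl : (n : ℝ) + 1 ≤ |lam n| := by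
        refine le_trans ?_ (le_abs_self _)
        have : (0 : ℝ) ≤ n := Nat.cast_nonneg n
        unfold lam
        nlinarith
      rw [pow_succ']
      calc ‖sphCoeff m n (g p.1 p.2⁻¹)‖ * (((n : ℝ) + 1) * ((n : ℝ) + 1) ^ N)
          ≤ ‖sphCoeff m n (g p.1 p.2⁻¹)‖ * (|lam n| * ((n : ℝ) + 1) ^ N) := by gcongr
        _ = _ := by ring
  intro N t₁ ht₁ y₁ hy₁
  -- One more power than asked for absorbs the growth n + 3 ≤ 3(n + 1) of the harmonics in the
  -- initial bound.
  obtain ⟨C, hC⟩ := key (N + 1) g hg t₁ ht₁ y₁ hy₁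
  refine ⟨3 * C, ?_⟩
  filter_upwards [hC] with p hp n m hm
  have h := hp n m hm
  have hn : (0 : ℝ) ≤ n := Nat.cast_nonneg n
  have hC0 : 0 ≤ C := by
    by_contra! hneg
    exact absurd (le_trans (by positivity) h) (not_le.2 (mul_neg_of_neg_of_pos hneg (by linarith)))
  rw [pow_succ, ← mul_assoc] at h
  refine le_of_mul_le_mul_right (h.trans ?_) (by linarith : (0 : ℝ) < (n : ℝ) + 1)
  nlinarith

theorem LocRapid.rapidDecay (hM : 0 < M) (hk : 0 < k) (h : LocRapid M k t₀ g) {t r : ℝ}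
    (ht : t ∈ Ici t₀) (hr : r ∈ Ioi (rPlus M k)) : RapidDecay fun m n => sphCoeff m n (g t r) := by
  intro N
  obtain ⟨C, hC⟩ := h N t ht r⁻¹ (Ioo_subset_Ico_self (inv_mem_of_gt hM hk hr))
  exact ⟨C, Eventually.eval_nearPt (P := fun t r => ∀ n : ℕ, ∀ m ∈ modes n,
    ‖sphCoeff m n (g t r)‖ * ((n : ℝ) + 1) ^ N ≤ C) hM hk ht hr hC⟩

/-! ## Combinations of a field and its conjugate -/

/-- The coefficients of `a g + b (𝒞 g)^*`. -/
noncomputable def mixCoeff (a b : ℝ) (m : ℤ) (n : ℕ) (f : ℝ → ℝ → ℂ) : ℂ :=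
  a * sphCoeff m n f + b * conj (sphCoeff (-m) n f)

/-- The field `a g + b (𝒞 g)^*` as a series. -/
noncomputable def mixSer (a b : ℝ) (g : Field) : Field := fun t r θ φ =>
  Ser (fun m n => mixCoeff a b m n (g t r)) (fun m n => harm m n 4) θ φ

theorem norm_mixCoeff_mul_le {a b : ℝ} {n : ℕ} {f : ℝ → ℝ → ℂ} {N : ℕ} {C : ℝ}
    (h : ∀ m ∈ modes n, ‖sphCoeff m n f‖ * ((n : ℝ) + 1) ^ N ≤ C) :
    ∀ m ∈ modes n, ‖mixCoeff a b m n f‖ * ((n : ℝ) + 1) ^ N ≤ (|a| + |b|) * C := by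
  intro m hm
  have h1 := h m hm
  have h2 := h (-m) (neg_mem_modes.2 hm)
  have h3 : ‖mixCoeff a b m n f‖ ≤ |a| * ‖sphCoeff m n f‖ + |b| * ‖sphCoeff (-m) n f‖ := by
    refine (norm_add_le _ _).trans_eq ?_
    rw [norm_mul, norm_mul, RCLike.norm_conj, Complex.norm_real, Complex.norm_real,
      Real.norm_eq_abs, Real.norm_eq_abs]
  calc ‖mixCoeff a b m n f‖ * ((n : ℝ) + 1) ^ N
      ≤ (|a| * ‖sphCoeff m n f‖ + |b| * ‖sphCoeff (-m) n f‖) * ((n : ℝ) + 1) ^ N := by gcongr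
    _ = |a| * (‖sphCoeff m n f‖ * ((n : ℝ) + 1) ^ N)
        + |b| * (‖sphCoeff (-m) n f‖ * ((n : ℝ) + 1) ^ N) := by ring
    _ ≤ |a| * C + |b| * C := by gcongr
    _ = _ := by ring

theorem rapidDecay_mixCoeff (a b : ℝ) {f : ℝ → ℝ → ℂ} (h : RapidDecay fun m n => sphCoeff m n f) :
    RapidDecay fun m n => mixCoeff a b m n f := by
  intro N
  obtain ⟨C, hC⟩ := h N
  exact ⟨_, fun n => norm_mixCoeff_mul_le (hC n)⟩

theorem hasDerivWithinAt_Ser_param {s : Set ℝ} (hs : Convex ℝ s) {x : ℝ} (hx : x ∈ s)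
    {A A' : ℝ → ℤ → ℕ → ℂ} (hA : ∀ y ∈ s, RapidDecay (A y)) {C : ℝ}
    (hC : ∀ y ∈ s, ∀ n : ℕ, ∀ m ∈ modes n, ‖A' y m n‖ * ((n : ℝ) + 1) ^ 4 ≤ C)
    (hd : ∀ y ∈ s, ∀ n : ℕ, ∀ m ∈ modes n,
      HasDerivWithinAt (fun y => A y m n) (A' y m n) s y) (θ φ : ℝ) :
    HasDerivWithinAt (fun y => Ser (A y) (fun m n => harm m n 4) θ φ)
      (Ser (A' x) (fun m n => harm m n 4) θ φ) s x := by
  refine hasDerivWithinAt_tsum hs hx (summable_majorant (5 * C * 3))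
    (u' := fun n y => ∑ m ∈ modes n, A' y m n * ((harm m n 4 θ : ℂ)
      * Complex.exp (Complex.I * m * φ))) (fun n y hy => ?_) (fun n y hy => ?_)
    fun y hy => summable_Ser (hA y hy) (polyBdd_harm 4) θ φ
  · exact HasDerivWithinAt.fun_sum fun m hm => (hd y hy n m hm).mul_const _
  -- The harmonics grow like 3(n + 1)^1, so P = 1 and K = 3; this explains the fourth power in the
  -- hypothesis, P + 3 = 4.
  · refine (norm_sum_le _ _).trans (sum_modes_le (P := 1) (hC y hy n) fun m hm => ?_)
    refine norm_harm_exp_le (h := fun m n => harm m n 4)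
      ((abs_harm_le (Finset.mem_Icc.1 hm).1 _ _).trans ?_) φ
    have : (0 : ℝ) ≤ n := Nat.cast_nonneg n
    linarith

theorem hasDerivWithinAt_mixCoeff {a b : ℝ} {m : ℤ} {n : ℕ} {f : ℝ → ℝ → ℝ → ℂ} {s : Set ℝ}
    {x : ℝ} {c c' : ℂ} (h : HasDerivWithinAt (fun y => sphCoeff m n (f y)) c s x)
    (h' : HasDerivWithinAt (fun y => sphCoeff (-m) n (f y)) c' s x) :
    HasDerivWithinAt (fun y => mixCoeff a b m n (f y)) (a * c + b * conj c') s x :=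
  (h.const_mul (a : ℂ)).add (h'.star.const_mul (b : ℂ))

theorem hasSum_mixSer {a b : ℝ} (hM : 0 < M) (hk : 0 < k) (h : LocRapid M k t₀ g) {t r : ℝ}
    (ht : t ∈ Ici t₀) (hr : r ∈ Ioi (rPlus M k)) (θ φ : ℝ) :
    HasSum (fun n : ℕ => ∑ m ∈ modes n, mixCoeff a b m n (g t r)
      * ((harm m n 4 θ : ℂ) * Complex.exp (Complex.I * m * φ))) (mixSer a b g t r θ φ) :=
  hasSum_Ser (rapidDecay_mixCoeff a b (h.rapidDecay hM hk ht hr)) (polyBdd_harm 4) θ φ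

theorem Tame.dT_mixSer (a b : ℝ) (hF : RegularField M k t₀ F) (hg : Tame M k t₀ F g)
    (hA : Tame M k t₀ F (angOp 2 F)) :
    EqOnDomain M k t₀ (SchwarzschildAdS.dT t₀ (mixSer a b g))
    (mixSer a b (SchwarzschildAdS.dT t₀ g)) := by
  intro t ht r hr θ hθ φ
  have hM := hF.M_pos
  have hk := hF.k_pos
  obtain ⟨C, hC⟩ := (hg.dT hF).locRapid hF hA 4 t ht r⁻¹
    (Ioo_subset_Ico_self (inv_mem_of_gt hM hk hr))
  obtain ⟨s, hs, hconv, hts, hsub, hb⟩ := exists_convex_time hM hk ht hr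
    (P := fun t r => ∀ n : ℕ, ∀ m ∈ modes n,
      ‖sphCoeff m n (SchwarzschildAdS.dT t₀ g t r)‖ * ((n : ℝ) + 1) ^ 4 ≤ C) hC
  refine ((hasDerivWithinAt_Ser_param hconv hts
    (A := fun τ m n => mixCoeff a b m n (g τ r))
    (A' := fun τ m n => mixCoeff a b m n (SchwarzschildAdS.dT t₀ g τ r)) (fun τ hτ =>
      rapidDecay_mixCoeff a b ((hg.locRapid hF hA).rapidDecay hM hk (hsub hτ) hr))
    (fun τ hτ n => norm_mixCoeff_mul_le (hb τ hτ n)) (fun τ hτ n m hm => ?_)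
    θ φ).mono_of_mem_nhdsWithin hs).derivWithin (uniqueDiffOn_Ici t₀ t ht)
  exact hasDerivWithinAt_mixCoeff
    ((hg.hasDerivWithinAt_sphCoeff hF (hsub hτ) hr hm).mono hsub)
    ((hg.hasDerivWithinAt_sphCoeff hF (hsub hτ) hr (neg_mem_modes.2 hm)).mono hsub)

/-- Symmetrization commutes with D: the series is differentiated termwise in r at fixed t⋆, which
the locally uniform rapid decay of the coefficients of Dg and ∂_tg permits. Since a, b and the
coefficients of D are real, conjugation does not interfere. -/
theorem Tame.Dop_mixSer (a b : ℝ) (hF : RegularField M k t₀ F) (hg : Tame M k t₀ F g)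
    (hA : Tame M k t₀ F (angOp 2 F)) :
    EqOnDomain M k t₀ (SchwarzschildAdS.Dop M k t₀ (mixSer a b g))
    (mixSer a b (SchwarzschildAdS.Dop M k t₀ g)) := by
  intro t ht r hr θ hθ φ
  have hM := hF.M_pos
  have hk := hF.k_pos
  have hy := Ioo_subset_Ico_self (inv_mem_of_gt hM hk hr)
  have hR := (hg.locRapid hF hA)
  have hRT := (hg.dT hF).locRapid hF hA
  have hRD := (hg.Dop hF).locRapid hF hA
  obtain ⟨C, hC⟩ := hRT 4 t ht r⁻¹ hy
  obtain ⟨C', hC'⟩ := hRD 4 t ht r⁻¹ hy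
  obtain ⟨K, hK⟩ := eventually_radial_le hM hk hr
  obtain ⟨s, hs, hconv, hts, hsub, hb⟩ := exists_convex_radius hM hk ht hr
    (P := fun t r => (∀ n : ℕ, ∀ m ∈ modes n,
      ‖sphCoeff m n (SchwarzschildAdS.dT t₀ g t r)‖ * ((n : ℝ) + 1) ^ 4 ≤ C) ∧
      ∀ n : ℕ, ∀ m ∈ modes n,
      ‖sphCoeff m n (SchwarzschildAdS.Dop M k t₀ g t r)‖ * ((n : ℝ) + 1) ^ 4 ≤ C') (hC.and hC')
  obtain ⟨δ, hδ, hball⟩ := Metric.mem_nhds_iff.1 (inter_mem hs hK)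
  have hd := (hasDerivWithinAt_Ser_param (s := Metric.ball r δ) (convex_ball r δ)
    (Metric.mem_ball_self hδ) (C := K * ((|a| + |b|) * C') + K * ((|a| + |b|) * C))
    (A := fun ρ m n => mixCoeff a b m n (g t ρ))
    (A' := fun ρ m n => ((ρ ^ 2 / Delta M k ρ : ℝ) : ℂ)
        * mixCoeff a b m n (SchwarzschildAdS.Dop M k t₀ g t ρ)
      - ((ρ ^ 2 / Delta M k ρ - 1 / (1 + k ^ 2 * ρ ^ 2) : ℝ) : ℂ)
        * mixCoeff a b m n (SchwarzschildAdS.dT t₀ g t ρ))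
    (fun ρ hρ => rapidDecay_mixCoeff a b (hR.rapidDecay hM hk ht (hsub (hball hρ).1)))
    (fun ρ hρ n m hm => ?_) (fun ρ hρ n m hm => ?_) θ φ).hasDerivAt (Metric.ball_mem_nhds r hδ)
  · have hsum : Ser (fun m n => ((r ^ 2 / Delta M k r : ℝ) : ℂ)
        * mixCoeff a b m n (SchwarzschildAdS.Dop M k t₀ g t r)
      - ((r ^ 2 / Delta M k r - 1 / (1 + k ^ 2 * r ^ 2) : ℝ) : ℂ)
        * mixCoeff a b m n (SchwarzschildAdS.dT t₀ g t r)) (fun m n => harm m n 4) θ φ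
        = ((r ^ 2 / Delta M k r : ℝ) : ℂ) * mixSer a b (SchwarzschildAdS.Dop M k t₀ g) t r θ φ
        - ((r ^ 2 / Delta M k r - 1 / (1 + k ^ 2 * r ^ 2) : ℝ) : ℂ)
          * mixSer a b (SchwarzschildAdS.dT t₀ g) t r θ φ := by
      have h1 := ((hasSum_mixSer (a := a) (b := b) hM hk hRD ht hr θ φ).mul_left
        ((r ^ 2 / Delta M k r : ℝ) : ℂ)).sub
        ((hasSum_mixSer (a := a) (b := b) hM hk hRT ht hr θ φ).mul_left
        ((r ^ 2 / Delta M k r - 1 / (1 + k ^ 2 * r ^ 2) : ℝ) : ℂ))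
      refine (hasSum_of_eq h1 fun n => ?_).tsum_eq
      rw [Finset.mul_sum, Finset.mul_sum, ← Finset.sum_sub_distrib]
      exact Finset.sum_congr rfl fun m _ => by ring
    rw [hsum] at hd
    have hd' : SchwarzschildAdS.dRstar (mixSer a b g) t r θ φ = _ := hd.deriv
    have h0 : r ≠ 0 := ((rPlus_pos hM hk).trans hr).ne'
    have hD := (Delta_pos hM hk hr).ne'
    have hc : ((Delta M k r / r ^ 2 : ℝ) : ℂ) * ((r ^ 2 / Delta M k r : ℝ) : ℂ) = 1 := by
      rw [← Complex.ofReal_mul, ← Complex.ofReal_one]; congr 1; field_simp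
    rw [Dop_apply, hd', hg.dT_mixSer a b hF hA t ht r hr θ hθ φ,
      Complex.ofReal_mul (Delta M k r / r ^ 2)]
    linear_combination (mixSer a b (SchwarzschildAdS.Dop M k t₀ g) t r θ φ) * hc
  · obtain ⟨hρs, hρK⟩ := hball hρ
    have hK0 : 0 ≤ K := (abs_nonneg _).trans hρK.1
    have h1 := norm_mixCoeff_mul_le (a := a) (b := b) ((hb ρ hρs).2 n) m hm
    have h2 := norm_mixCoeff_mul_le (a := a) (b := b) ((hb ρ hρs).1 n) m hm
    refine (mul_le_mul_of_nonneg_right (norm_sub_le _ _) (by positivity)).trans ?_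
    rw [add_mul, norm_mul, norm_mul, Complex.norm_real, Complex.norm_real, mul_assoc, mul_assoc]
    exact add_le_add (mul_le_mul hρK.1 h1 (by positivity) hK0)
      (mul_le_mul hρK.2 h2 (by positivity) hK0)
  · have hρr := hsub (hball hρ).1
    have h := hasDerivWithinAt_mixCoeff (a := a) (b := b) (s := Metric.ball r δ)
      (hg.hasDerivAt_sphCoeff hF ht hρr hm).hasDerivWithinAt
      (hg.hasDerivAt_sphCoeff hF ht hρr (neg_mem_modes.2 hm)).hasDerivWithinAt
    refine h.congr_deriv ?_
    simp only [mixCoeff, map_sub, map_mul, Complex.conj_ofReal]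
    ring

end

section

variable {M k t₀ : ℝ} {F g g' : Field}

/-! ## Symmetrization -/

/-- Conjugation turns e^{imφ} into e^{-imφ}; relabelling m ↦ -m and `harm_neg` bring back the
harmonics of spin weight 2. Hence (𝒞g)^* has coefficients conj(g_{-m}). -/
theorem conj_Ser (c : ℤ → ℕ → ℂ) (θ φ : ℝ) :
    conj (Ser c (fun m n => harm m n 0) θ φ)
      = Ser (fun m n => conj (c (-m) n)) (fun m n => harm m n 4) θ φ := by
  rw [Ser, Complex.conj_tsum, Ser]
  congr 1
  funext n
  rw [map_sum]
  refine Finset.sum_bij' (fun m _ => -m) (fun m _ => -m) (fun m hm => neg_mem_modes.2 hm)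
    (fun m hm => neg_mem_modes.2 hm) (fun m _ => neg_neg m) (fun m _ => neg_neg m) fun m hm => ?_
  have hm' := Finset.mem_Icc.1 hm
  rw [neg_neg, harm_neg hm'.1 hm'.2, map_mul, map_mul, Complex.conj_ofReal, ← Complex.exp_conj]
  simp only [map_mul, Complex.conj_I, Complex.conj_ofReal, map_intCast]
  congr 3
  push_cast
  ring

theorem conjField_CC (g : Field) (t r : ℝ) {θ : ℝ} (hθ : θ ∈ Ioo 0 π) (φ : ℝ) :
    conjField (CC g) t r θ φ
      = Ser (fun m n => conj (sphCoeff (-m) n (g t r))) (fun m n => harm m n 4) θ φ := by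
  rw [← conj_Ser fun m n => sphCoeff m n (g t r), conjField]
  congr 1
  rw [CC, Ser]
  congr 1
  funext n
  refine Finset.sum_congr rfl fun m hm => ?_
  have hm' := Finset.mem_Icc.1 hm
  rw [coeff_eq_sphCoeff, S_eq_harm (by omega) (by omega) hθ, harm_neg hm'.1 hm'.2]

theorem Tame.eq_Ser (hF : RegularField M k t₀ F) (hg : Tame M k t₀ F g)
    (hA : Tame M k t₀ F (angOp 2 F)) {t r : ℝ} (ht : t ∈ Ici t₀) (hr : r ∈ Ioi (rPlus M k))
    {θ : ℝ} (hθ : θ ∈ Ioo 0 π) (φ : ℝ) :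
    g t r θ φ = Ser (fun m n => sphCoeff m n (g t r)) (fun m n => harm m n 4) θ φ :=
  (hg.sphereReg hF ht hr).eq_Ser ((hg.locRapid hF hA).rapidDecay hF.M_pos hF.k_pos ht hr) hθ φ

theorem Tame.mixSer_eq (hF : RegularField M k t₀ F) (hg : Tame M k t₀ F g)
    (hA : Tame M k t₀ F (angOp 2 F)) (a b : ℝ) :
    EqOnDomain M k t₀ ((a : ℂ) • g + (b : ℂ) • conjField (CC g)) (mixSer a b g) := by
  intro t ht r hr θ hθ φ
  have hR := (hg.locRapid hF hA).rapidDecay hF.M_pos hF.k_pos ht hr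
  simp only [Pi.add_apply, Pi.smul_apply, smul_eq_mul]
  rw [conjField_CC g t r hθ φ, hg.eq_Ser hF hA ht hr hθ φ]
  refine (((hasSum_Ser hR (polyBdd_harm 4) θ φ).mul_left (a : ℂ)).add
    ((hasSum_Ser hR.conj_neg (polyBdd_harm 4) θ φ).mul_left (b : ℂ))).unique
    (hasSum_of_eq (hasSum_mixSer hF.M_pos hF.k_pos (hg.locRapid hF hA) ht hr θ φ) fun n => ?_)
  rw [Finset.mul_sum, Finset.mul_sum, ← Finset.sum_add_distrib]
  exact Finset.sum_congr rfl fun m _ => by simp only [mixCoeff]; ring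

theorem Tame.symPlus_eq (hF : RegularField M k t₀ F) (hg : Tame M k t₀ F g)
    (hA : Tame M k t₀ F (angOp 2 F)) :
    EqOnDomain M k t₀ (symPlus g) (mixSer (1 / 2) (1 / 2) g) := by
  have h := hg.mixSer_eq hF hA (1 / 2) (1 / 2)
  push_cast at h
  exact h

theorem Tame.antiPlus_eq (hF : RegularField M k t₀ F) (hg : Tame M k t₀ F g)
    (hA : Tame M k t₀ F (angOp 2 F)) :
    EqOnDomain M k t₀ (antiPlus g) (mixSer (1 / 2) (-(1 / 2)) g) := by
  have h := hg.mixSer_eq hF hA (1 / 2) (-(1 / 2))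
  push_cast at h
  rwa [neg_smul, ← sub_eq_add_neg] at h

/-! ## Null derivations -/

/-- `∂_t - ε (Δ / r²) ∂_r`, that is `L̲` for `ε = 1` and `L` for `ε = -1`. -/
noncomputable def nullOp (M k t₀ ε : ℝ) (F : Field) : Field :=
  dT t₀ F - (ε : ℂ) • Dop M k t₀ F

/-- `w⁻¹ (∂_t - ε (Δ / r²) ∂_r)`. -/
noncomputable def wNull (M k t₀ ε : ℝ) (F : Field) : Field :=
  radMul (fun r => (w M k r)⁻¹) (nullOp M k t₀ ε F)

theorem nullOp_one (F : Field) : nullOp M k t₀ 1 F = Lbar M k t₀ F := by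
  rw [nullOp, Complex.ofReal_one, one_smul]; rfl

theorem nullOp_neg_one (F : Field) : nullOp M k t₀ (-1) F = L M k t₀ F := by
  rw [nullOp, Complex.ofReal_neg, Complex.ofReal_one, neg_one_smul, sub_neg_eq_add]; rfl

theorem EqOnDomain.nullOp (ε : ℝ) (h : EqOnDomain M k t₀ g g') :
    EqOnDomain M k t₀ (nullOp M k t₀ ε g) (nullOp M k t₀ ε g') :=
  h.dT.sub (h.Dop.const_smul _)

theorem Tame.nullOp (hF : RegularField M k t₀ F) (hg : Tame M k t₀ F g) (ε : ℝ) :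
    Tame M k t₀ F (nullOp M k t₀ ε g) :=
  (hg.dT hF).sub ((hg.Dop hF).const_smul _)

theorem Tame.wNull (hF : RegularField M k t₀ F) (hg : Tame M k t₀ F g) (ε : ℝ) :
    Tame M k t₀ F (wNull M k t₀ ε g) := (hg.nullOp hF ε).inv_w

theorem Tame.iterate_wNull (hF : RegularField M k t₀ F) (hg : Tame M k t₀ F g) (ε : ℝ) (j : ℕ) :
    Tame M k t₀ F ((SchwarzschildAdS.wNull M k t₀ ε)^[j] g) := by
  induction j generalizing g with
  | zero => exact hg
  | succ j ih => exact ih (hg.wNull hF ε)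

theorem Tame.iterate_dT (hF : RegularField M k t₀ F) (hg : Tame M k t₀ F g) (p : ℕ) :
    Tame M k t₀ F ((SchwarzschildAdS.dT t₀)^[p] g) := by
  induction p generalizing g with
  | zero => exact hg
  | succ j ih => exact ih (hg.dT hF)

theorem Tame.mixSer_sub_smul (hF : RegularField M k t₀ F) (hg : Tame M k t₀ F g)
    (hg' : Tame M k t₀ F g') (hA : Tame M k t₀ F (angOp 2 F)) (a b c : ℝ) :
    EqOnDomain M k t₀ (mixSer a b g - (c : ℂ) • mixSer a b g') (mixSer a b (g - (c : ℂ) • g')) := by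
  intro t ht r hr θ hθ φ
  have hM := hF.M_pos
  have hk := hF.k_pos
  refine ((hasSum_mixSer (a := a) (b := b) hM hk (hg.locRapid hF hA) ht hr θ φ).sub
    ((hasSum_mixSer (a := a) (b := b) hM hk (hg'.locRapid hF hA) ht hr θ φ).mul_left
      (c : ℂ))).unique
    (hasSum_of_eq (hasSum_mixSer hM hk ((hg.sub (hg'.const_smul c)).locRapid hF hA) ht hr θ φ)
      fun n => ?_)
  rw [Finset.mul_sum, ← Finset.sum_sub_distrib]
  refine Finset.sum_congr rfl fun m hm => ?_
  simp only [mixCoeff]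
  rw [hg.sphCoeff_sub hF (hg'.const_smul _) ht hr hm,
    hg.sphCoeff_sub hF (hg'.const_smul _) ht hr (neg_mem_modes.2 hm),
    hg'.sphCoeff_const_smul hF _ ht hr hm, hg'.sphCoeff_const_smul hF _ ht hr (neg_mem_modes.2 hm)]
  simp only [map_sub, map_mul, Complex.conj_ofReal]
  ring

theorem Tame.nullOp_mixSer (hF : RegularField M k t₀ F) (hg : Tame M k t₀ F g)
    (hA : Tame M k t₀ F (angOp 2 F)) (a b ε : ℝ) :
    EqOnDomain M k t₀ (SchwarzschildAdS.nullOp M k t₀ ε (mixSer a b g))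
      (mixSer a b (SchwarzschildAdS.nullOp M k t₀ ε g)) :=
  ((hg.dT_mixSer a b hF hA).sub ((hg.Dop_mixSer a b hF hA).const_smul _)).trans
    ((hg.dT hF).mixSer_sub_smul hF (hg.Dop hF) hA a b ε)

theorem Tame.angOp_mixSer (hF : RegularField M k t₀ F) (hg : Tame M k t₀ F g)
    (hA : Tame M k t₀ F (angOp 2 F)) (a b : ℝ) {t r : ℝ} (ht : t ∈ Ici t₀)
    (hr : r ∈ Ioi (rPlus M k)) : ∀ θ ∈ Ioo 0 π, ∀ φ, angOp 2 (mixSer a b g) t r θ φ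
      = Ser (fun m n => (lam n : ℂ) * mixCoeff a b m n (g t r)) (fun m n => harm m n 4) θ φ :=
  angOp_of_eq_Ser (rapidDecay_mixCoeff a b
    ((hg.locRapid hF hA).rapidDecay hF.M_pos hF.k_pos ht hr)) fun _ _ _ => rfl

theorem SmoothField.dT_nullOp (hM : 0 < M) (hk : 0 < k) (hg : SmoothField M k t₀ g) (ε : ℝ) :
    EqOnDomain M k t₀ (SchwarzschildAdS.dT t₀ (nullOp M k t₀ ε g))
      (nullOp M k t₀ ε (SchwarzschildAdS.dT t₀ g)) := by
  have h := hg.dT.dT_add ((hg.Dop hM hk).const_smul (-(ε : ℂ)))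
  rw [neg_smul, ← sub_eq_add_neg, ← neg_smul, dT_const_smul] at h
  refine h.trans ?_
  have h2 := (EqOnDomain.refl (M := M) (k := k) (t₀ := t₀) (SchwarzschildAdS.dT t₀
    (SchwarzschildAdS.dT t₀ g))).add (hg.dT_Dop.const_smul (-(ε : ℂ)))
  refine h2.trans ?_
  rw [neg_smul, ← sub_eq_add_neg]
  exact EqOnDomain.refl _

theorem Tame.dT_wNull (hF : RegularField M k t₀ F) (hg : Tame M k t₀ F g) (ε : ℝ) :
    EqOnDomain M k t₀ (SchwarzschildAdS.dT t₀ (SchwarzschildAdS.wNull M k t₀ ε g))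
      (SchwarzschildAdS.wNull M k t₀ ε (SchwarzschildAdS.dT t₀ g)) := by
  rw [SchwarzschildAdS.wNull, dT_radMul]
  exact ((hg.smooth hF).dT_nullOp hF.M_pos hF.k_pos ε).radMul _

theorem Tame.dT_iterate_wNull (hF : RegularField M k t₀ F) (hg : Tame M k t₀ F g) (ε : ℝ)
    (j : ℕ) :
    EqOnDomain M k t₀ (SchwarzschildAdS.dT t₀ ((SchwarzschildAdS.wNull M k t₀ ε)^[j] g))
      ((SchwarzschildAdS.wNull M k t₀ ε)^[j] (SchwarzschildAdS.dT t₀ g)) := by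
  induction j generalizing g with
  | zero => exact EqOnDomain.refl _
  | succ j ih =>
    rw [Function.iterate_succ_apply, Function.iterate_succ_apply]
    exact (ih (hg.wNull hF ε)).trans (EqOnDomain.iterate
      (fun h => EqOnDomain.radMul _ (h.nullOp ε)) (hg.dT_wNull hF ε) j)

/-! ## The angular side of the Teukolsky-Starobinsky identities -/

/-- Four lowering steps go from spin weight 2 to -2 and collect the product of `wigA_prod`;
conjugation then returns to weight 2 at the opposite azimuthal number. -/
theorem sphCoeff_conj_angLdag {G : Field} {t r : ℝ}
    (hc : RapidDecay fun m n => sphCoeff m n (G t r))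
    (hG : ∀ θ ∈ Ioo 0 π, ∀ φ, G t r θ φ
      = Ser (fun m n => sphCoeff m n (G t r)) (fun m n => harm m n 4) θ φ) :
    ∃ c : ℤ → ℕ → ℂ, RapidDecay c ∧
      (∀ θ ∈ Ioo 0 π, ∀ φ,
        conjField (angLdag (-1) (angLdag 0 (angLdag 1 (angLdag 2 G)))) t r θ φ
          = Ser c (fun m n => harm m n 4) θ φ) ∧
      ∀ m n, c m n = muTS n * conj (sphCoeff (-m) n (G t r)) := by
  have h3 := angLdag_of_eq_Ser 3 hc hG
  have h2 := angLdag_of_eq_Ser 2 (hc.wigA 4) h3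
  have h1 := angLdag_of_eq_Ser 1 ((hc.wigA 4).wigA 3) h2
  have h0 := angLdag_of_eq_Ser 0 (((hc.wigA 4).wigA 3).wigA 2) h1
  have hR := ((((hc.wigA 4).wigA 3).wigA 2).wigA 1).conj_neg
  refine ⟨_, hR, fun θ hθ φ => ?_, fun m n => ?_⟩
  · exact (congrArg (starRingEnd ℂ) (h0 θ hθ φ)).trans (conj_Ser _ θ φ)
  · simp only [map_mul, Complex.conj_ofReal]
    rw [← wigA_prod]
    push_cast
    ring

end

section

variable {M k t₀ : ℝ}

/-! ## Null derivatives of functions of `t⋆` and `r` -/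

/-- `fT` is the time derivative of `f` and `fX` its derivative along `∂_t - ε (Δ / r²) ∂_r`
(for `ε = ±1`). -/
def HasNull (M k t₀ ε : ℝ) (f fT fX : ℝ → ℝ → ℂ) : Prop :=
  ∀ t ∈ Ici t₀, ∀ r ∈ Ioi (rPlus M k),
    HasDerivWithinAt (fun τ => f τ r) (fT t r) (Ici t₀) t ∧
    HasDerivAt (f t) (((r ^ 2 / Delta M k r : ℝ) : ℂ) * (ε * (fT t r - fX t r))
      - ((r ^ 2 / Delta M k r - 1 / (1 + k ^ 2 * r ^ 2) : ℝ) : ℂ) * fT t r) r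

/-- `f'` is the derivative of the radial function `f` along `(Δ / r²) ∂_r`. -/
def HasRadial (M k : ℝ) (f f' : ℝ → ℝ) : Prop :=
  ∀ r, rPlus M k < r → HasDerivAt f (r ^ 2 / Delta M k r * f' r) r

section

variable {ε : ℝ} {f fT fX g gT gX : ℝ → ℝ → ℂ}

/-- The device for applying ∂_t or X to an identity between functions of t⋆ and r. -/
theorem HasNull.unique (hM : 0 < M) (hk : 0 < k) (hε : ε ^ 2 = 1)
    (hf : HasNull M k t₀ ε f fT fX) (hg : HasNull M k t₀ ε g gT gX)
    (h : ∀ t ∈ Ici t₀, ∀ r ∈ Ioi (rPlus M k), f t r = g t r) :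
    ∀ t ∈ Ici t₀, ∀ r ∈ Ioi (rPlus M k), fT t r = gT t r ∧ fX t r = gX t r := by
  intro t ht r hr
  have h1 : fT t r = gT t r := (uniqueDiffOn_Ici t₀ t ht).eq_deriv _ (hf t ht r hr).1
    ((hg t ht r hr).1.congr (fun τ hτ => h τ hτ r hr) (h t ht r hr))
  have h2 := (hf t ht r hr).2.unique ((hg t ht r hr).2.congr_of_eventuallyEq (by
    filter_upwards [isOpen_Ioi.mem_nhds hr] with ρ hρ using h t ht ρ hρ))
  have hne : ((r ^ 2 / Delta M k r : ℝ) : ℂ) ≠ 0 := by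
    have := (rPlus_pos hM hk).trans hr
    have := Delta_pos hM hk hr
    exact_mod_cast (by positivity : r ^ 2 / Delta M k r ≠ 0)
  have hεC : (ε : ℂ) ^ 2 = 1 := by exact_mod_cast hε
  refine ⟨h1, ?_⟩
  rw [h1, sub_left_inj] at h2
  have h3 := mul_left_cancel₀ hne h2
  linear_combination (-(ε : ℂ)) * h3 - (fX t r - gX t r) * hεC

theorem HasNull.add (hf : HasNull M k t₀ ε f fT fX) (hg : HasNull M k t₀ ε g gT gX) :
    HasNull M k t₀ ε (fun t r => f t r + g t r) (fun t r => fT t r + gT t r)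
      (fun t r => fX t r + gX t r) := fun t ht r hr =>
  ⟨(hf t ht r hr).1.add (hg t ht r hr).1,
    ((hf t ht r hr).2.add (hg t ht r hr).2).congr_deriv (by ring)⟩

theorem HasNull.const_mul (c : ℂ) (hf : HasNull M k t₀ ε f fT fX) :
    HasNull M k t₀ ε (fun t r => c * f t r) (fun t r => c * fT t r) (fun t r => c * fX t r) :=
  fun t ht r hr => ⟨(hf t ht r hr).1.const_mul c,
    ((hf t ht r hr).2.const_mul c).congr_deriv (by ring)⟩

theorem HasNull.sub (hf : HasNull M k t₀ ε f fT fX) (hg : HasNull M k t₀ ε g gT gX) :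
    HasNull M k t₀ ε (fun t r => f t r - g t r) (fun t r => fT t r - gT t r)
      (fun t r => fX t r - gX t r) := fun t ht r hr =>
  ⟨(hf t ht r hr).1.sub (hg t ht r hr).1,
    ((hf t ht r hr).2.sub (hg t ht r hr).2).congr_deriv (by ring)⟩

/-- X = ∂_t - εD acts on a radial function as -εD. -/
theorem HasNull.rad_mul (hε : ε ^ 2 = 1) (hf : HasNull M k t₀ ε f fT fX) {ρ ρ' : ℝ → ℝ}
    (hρ : HasRadial M k ρ ρ') :
    HasNull M k t₀ ε (fun t r => (ρ r : ℂ) * f t r) (fun t r => (ρ r : ℂ) * fT t r)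
      (fun t r => (ρ r : ℂ) * fX t r - ε * ρ' r * f t r) := fun t ht r hr =>
  ⟨(hf t ht r hr).1.const_mul _, ((hρ r hr).ofReal_comp.mul (hf t ht r hr).2).congr_deriv (by
    have hεC : (ε : ℂ) ^ 2 = 1 := by exact_mod_cast hε
    rw [Complex.ofReal_mul]
    linear_combination (-((r ^ 2 / Delta M k r : ℝ) : ℂ) * ρ' r * f t r) * hεC)⟩

theorem HasNull.conj (hf : HasNull M k t₀ ε f fT fX) :
    HasNull M k t₀ ε (fun t r => conj (f t r)) (fun t r => conj (fT t r))
      (fun t r => conj (fX t r)) := fun t ht r hr =>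
  ⟨(hf t ht r hr).1.star, (hf t ht r hr).2.star.congr_deriv (by
    simp only [RCLike.star_def, map_sub, map_mul, Complex.conj_ofReal])⟩

theorem Tame.hasNull {F G : Field} (hF : RegularField M k t₀ F) (hG : Tame M k t₀ F G)
    (hε : ε ^ 2 = 1) {m : ℤ} {n : ℕ} (hm : m ∈ modes n) :
    HasNull M k t₀ ε (fun t r => sphCoeff m n (G t r))
      (fun t r => sphCoeff m n (SchwarzschildAdS.dT t₀ G t r))
      (fun t r => sphCoeff m n (SchwarzschildAdS.nullOp M k t₀ ε G t r)) := fun t ht r hr => by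
  refine ⟨hG.hasDerivWithinAt_sphCoeff hF ht hr hm,
    (hG.hasDerivAt_sphCoeff hF ht hr hm).congr_deriv ?_⟩
  have hεC : (ε : ℂ) ^ 2 = 1 := by exact_mod_cast hε
  beta_reduce
  rw [SchwarzschildAdS.nullOp, (hG.dT hF).sphCoeff_sub hF ((hG.Dop hF).const_smul _) ht hr hm,
    (hG.Dop hF).sphCoeff_const_smul hF _ ht hr hm]
  linear_combination (-((r ^ 2 / Delta M k r : ℝ) : ℂ)
    * sphCoeff m n (SchwarzschildAdS.Dop M k t₀ G t r)) * hεC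

end

theorem hasRadial_w (hM : 0 < M) (hk : 0 < k) :
    HasRadial M k (w M k) (fun r => w M k r * hRad M r) := fun _ hr => hasDerivAt_w hM hk hr

theorem hasRadial_hRad (hM : 0 < M) (hk : 0 < k) :
    HasRadial M k (hRad M) (fun r => w M k r * (2 - 12 * M * r⁻¹)) := fun r hr => by
  have h := hasDerivAt_inv_rad hM hk hr
  exact ((h.const_mul (-2)).add ((h.fun_pow 2).const_mul (6 * M))).congr_deriv (by
    simp only [Nat.cast_ofNat, Nat.add_one_sub_one, pow_one]; ring)

theorem hasRadial_affine (hM : 0 < M) (hk : 0 < k) (c d : ℝ) :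
    HasRadial M k (fun r => c + d * r⁻¹) (fun r => -(d * w M k r)) := fun r hr =>
  (((hasDerivAt_inv_rad hM hk hr).const_mul d).const_add c).congr_deriv (by ring)

/-! ## The hierarchy of transport equations -/

/-- The functions `Φ p j = (w⁻¹ X)^j ∂_t^p Φ` for a solution `Φ` of the Teukolsky equation for
one mode, `X = ∂_t - ε (Δ / r²) ∂_r`. -/
structure ModeChain (M k t₀ ε l : ℝ) (Φ : ℕ → ℕ → ℝ → ℝ → ℂ) : Prop where
  M_pos : 0 < M
  k_pos : 0 < k
  sq : ε ^ 2 = 1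
  null : ∀ p j, HasNull M k t₀ ε (Φ p j) (Φ (p + 1) j) (fun t r => (w M k r : ℂ) * Φ p (j + 1) t r)
  teuk : ∀ t ∈ Ici t₀, ∀ r ∈ Ioi (rPlus M k), 2 * Φ 1 1 t r - w M k r * Φ 0 2 t r
    = ε * (hRad M r * Φ 0 1 t r) - ((l - 2 + 6 * M * r⁻¹ : ℝ) : ℂ) * Φ 0 0 t r

namespace ModeChain

variable {ε l : ℝ} {Φ : ℕ → ℕ → ℝ → ℝ → ℂ}

theorem conjugate (h : ModeChain M k t₀ ε l Φ) :
    ModeChain M k t₀ ε l (fun p j t r => conj (Φ p j t r)) where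
  M_pos := h.M_pos
  k_pos := h.k_pos
  sq := h.sq
  null p j := by simpa only [map_mul, Complex.conj_ofReal] using (h.null p j).conj
  teuk t ht r hr := by
    have := congrArg (starRingEnd ℂ) (h.teuk t ht r hr)
    simpa only [map_mul, map_sub, Complex.conj_ofReal, map_ofNat] using this

/-- The coefficients are independent of time, so time derivatives solve the same equation. -/
theorem first (h : ModeChain M k t₀ ε l Φ) (p : ℕ) :
    ∀ t ∈ Ici t₀, ∀ r ∈ Ioi (rPlus M k), 2 * Φ (p + 1) 1 t r - w M k r * Φ p 2 t r
    = ε * (hRad M r * Φ p 1 t r) - ((l - 2 + 6 * M * r⁻¹ : ℝ) : ℂ) * Φ p 0 t r := by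
  have hw := hasRadial_w h.M_pos h.k_pos
  have hh := hasRadial_hRad h.M_pos h.k_pos
  induction p with
  | zero => exact h.teuk
  | succ p ih =>
    intro t ht r hr
    exact (((((h.null (p + 1) 1).const_mul 2).sub ((h.null p 2).rad_mul h.sq hw)).unique
      h.M_pos h.k_pos h.sq ((((h.null p 1).rad_mul h.sq hh).const_mul (ε : ℂ)).sub
      ((h.null p 0).rad_mul h.sq (hasRadial_affine h.M_pos h.k_pos (l - 2) (6 * M)))) ih) t ht r hr).1

theorem w_ne_zero (h : ModeChain M k t₀ ε l Φ) {r : ℝ} (hr : r ∈ Ioi (rPlus M k)) :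
    (w M k r : ℂ) ≠ 0 := by exact_mod_cast (w_pos h.M_pos h.k_pos hr).ne'

/-- X applied to `first`, divided by w. The terms hΦ_2 from X(wΦ_2) and from X(hΦ_1) cancel, and ε²
D h = w(2 - 12M/r) changes the potential l - 2 + 6M/r into l - 6M/r. -/
theorem second (h : ModeChain M k t₀ ε l Φ) (p : ℕ) :
    ∀ t ∈ Ici t₀, ∀ r ∈ Ioi (rPlus M k), 2 * Φ (p + 1) 2 t r - w M k r * Φ p 3 t r
    = -(((l + -(6 * M) * r⁻¹ : ℝ) : ℂ) * Φ p 1 t r) - 6 * ε * M * Φ p 0 t r := by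
  intro t ht r hr
  have hw := hasRadial_w h.M_pos h.k_pos
  have hh := hasRadial_hRad h.M_pos h.k_pos
  have key := (((((h.null (p + 1) 1).const_mul 2).sub ((h.null p 2).rad_mul h.sq hw)).unique
      h.M_pos h.k_pos h.sq ((((h.null p 1).rad_mul h.sq hh).const_mul (ε : ℂ)).sub
      ((h.null p 0).rad_mul h.sq (hasRadial_affine h.M_pos h.k_pos (l - 2) (6 * M))))
      (h.first p)) t ht r hr).2
  have hεC : (ε : ℂ) ^ 2 = 1 := by exact_mod_cast h.sq
  refine mul_left_cancel₀ (h.w_ne_zero hr) ?_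
  push_cast at key ⊢
  linear_combination key - (w M k r * (2 - 12 * M * (r : ℂ)⁻¹) * Φ p 1 t r) * hεC

/-- X applied to `second`, divided by w. The derivative of the potential contributes 6εMΦ_1, which
cancels the term coming from Φ_0. -/
theorem third (h : ModeChain M k t₀ ε l Φ) (p : ℕ) :
    ∀ t ∈ Ici t₀, ∀ r ∈ Ioi (rPlus M k), 2 * Φ (p + 1) 3 t r - w M k r * Φ p 4 t r
    = -(ε * (hRad M r * Φ p 3 t r)) - ((l + -(6 * M) * r⁻¹ : ℝ) : ℂ) * Φ p 2 t r := by
  intro t ht r hr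
  have hw := hasRadial_w h.M_pos h.k_pos
  have key := (((((h.null (p + 1) 2).const_mul 2).sub ((h.null p 3).rad_mul h.sq hw)).unique
      h.M_pos h.k_pos h.sq ((((h.null p 1).rad_mul h.sq
        (hasRadial_affine h.M_pos h.k_pos l (-(6 * M)))).const_mul (-1)).sub
        ((h.null p 0).const_mul (6 * ε * M)))
      (fun t ht r hr => by rw [h.second p t ht r hr]; ring)) t ht r hr).2
  refine mul_left_cancel₀ (h.w_ne_zero hr) ?_
  push_cast at key ⊢
  linear_combination key

/-- X applied to `third`, divided by w. The coefficient -2εh of Φ_4 is what makes the h-terms cancel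
when 2∂_t - X acts on w²Φ_4. -/
theorem fourth (h : ModeChain M k t₀ ε l Φ) (p : ℕ) :
    ∀ t ∈ Ici t₀, ∀ r ∈ Ioi (rPlus M k), 2 * Φ (p + 1) 4 t r - w M k r * Φ p 5 t r
    = -(2 * ε * (hRad M r * Φ p 4 t r)) - ((l - 2 + 6 * M * r⁻¹ : ℝ) : ℂ) * Φ p 3 t r
      + 6 * ε * M * Φ p 2 t r := by
  intro t ht r hr
  have hw := hasRadial_w h.M_pos h.k_pos
  have hh := hasRadial_hRad h.M_pos h.k_pos
  have key := (((((h.null (p + 1) 3).const_mul 2).sub ((h.null p 4).rad_mul h.sq hw)).unique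
      h.M_pos h.k_pos h.sq ((((h.null p 3).rad_mul h.sq hh).const_mul (-(ε : ℂ))).sub
      ((h.null p 2).rad_mul h.sq (hasRadial_affine h.M_pos h.k_pos l (-(6 * M)))))
      (fun t ht r hr => by rw [h.third p t ht r hr]; ring)) t ht r hr).2
  have hεC : (ε : ℂ) ^ 2 = 1 := by exact_mod_cast h.sq
  refine mul_left_cancel₀ (h.w_ne_zero hr) ?_
  push_cast at key ⊢
  linear_combination key + (w M k r * (2 - 12 * M * (r : ℂ)⁻¹) * Φ p 3 t r) * hεC

end ModeChain

end

section

variable {M k t₀ : ℝ}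

/-! ## Limits at the conformal boundary -/

theorem tendsto_mul_zero_of_bdd {α : Type*} {l : Filter α} {f g : α → ℂ}
    (hf : Tendsto f l (𝓝 0)) (hg : ∃ C : ℝ, ∀ᶠ x in l, ‖g x‖ ≤ C) :
    Tendsto (fun x => f x * g x) l (𝓝 0) := by
  obtain ⟨C, hC⟩ := hg
  refine squeeze_zero_norm' (a := fun x => ‖f x‖ * C) ?_ (by simpa using hf.norm.mul_const C)
  filter_upwards [hC] with x hx
  rw [norm_mul]
  exact mul_le_mul_of_nonneg_left hx (norm_nonneg _)

theorem tendsto_sub_zero {α : Type*} {l : Filter α} {f : α → ℂ} {c : ℂ} (h : Tendsto f l (𝓝 c)) :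
    Tendsto (fun x => c - f x) l (𝓝 0) := by
  simpa using h.const_sub c

theorem tendsto_mul_of_zero {α : Type*} {l : Filter α} {f g : α → ℂ} {c : ℂ}
    (hf : Tendsto f l (𝓝 c)) (hg : Tendsto g l (𝓝 0)) :
    Tendsto (fun x => f x * g x) l (𝓝 0) := by
  simpa using hf.mul hg

/-- Taylor's formula with step h, solved for the first derivative. Only times after t enter, so it
is available at t⋆ = t₀. -/
theorem norm_derivWithin_le {u u' u'' : ℝ → ℂ} {t h C : ℝ} (hh : 0 < h)
    (hu : ∀ s ∈ Icc t (t + h), HasDerivWithinAt u (u' s) (Icc t (t + h)) s)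
    (hu' : ∀ s ∈ Icc t (t + h), HasDerivWithinAt u' (u'' s) (Icc t (t + h)) s)
    (hC : ∀ s ∈ Icc t (t + h), ‖u'' s‖ ≤ C) :
    ‖u' t‖ ≤ (‖u (t + h)‖ + ‖u t‖) / h + C * h := by
  have ht : t ∈ Icc t (t + h) := ⟨le_rfl, by linarith⟩
  have hth : t + h ∈ Icc t (t + h) := ⟨by linarith, le_rfl⟩
  have hC0 : 0 ≤ C := (norm_nonneg _).trans (hC t ht)
  have h1 : ∀ s ∈ Icc t (t + h), ‖u' s - u' t‖ ≤ C * h := by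
    intro s hs
    refine ((convex_Icc t (t + h)).norm_image_sub_le_of_norm_hasDerivWithin_le hu' hC ht hs).trans ?_
    gcongr
    rw [Real.norm_eq_abs, abs_of_nonneg (by linarith [hs.1])]
    linarith [hs.2]
  have h2 := (convex_Icc t (t + h)).norm_image_sub_le_of_norm_hasDerivWithin_le
    (f := fun s => u s - (s : ℂ) * u' t) (f' := fun s => u' s - u' t) (C := C * h)
    (fun s hs => by
      have hid : HasDerivWithinAt (fun s : ℝ => (s : ℂ) * u' t) (u' t) (Icc t (t + h)) s := by
        simpa using ((Complex.ofRealCLM.hasDerivAt (x := s)).mul_const (u' t)).hasDerivWithinAt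
      exact (hu s hs).sub hid) h1 ht hth
  have e : (h : ℂ) * u' t = (u (t + h) - u t) - ((u (t + h) - ((t + h : ℝ) : ℂ) * u' t)
      - (u t - (t : ℂ) * u' t)) := by push_cast; ring
  have h3 : h * ‖u' t‖ ≤ (‖u (t + h)‖ + ‖u t‖) + C * h * h := by
    have h4 : ‖(h : ℂ) * u' t‖ = h * ‖u' t‖ := by
      rw [norm_mul, Complex.norm_real, Real.norm_eq_abs, abs_of_pos hh]
    rw [← h4, e]
    refine (norm_sub_le _ _).trans (add_le_add (norm_sub_le _ _) (h2.trans_eq ?_))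
    rw [add_sub_cancel_left, Real.norm_eq_abs, abs_of_pos hh]
  have h5 : (‖u (t + h)‖ + ‖u t‖) / h + C * h = ((‖u (t + h)‖ + ‖u t‖) + C * h * h) / h := by
    field_simp
  rw [h5, le_div_iff₀ hh]
  linarith

/-- If a function tends to zero at infinity at each time, and its second time derivative is bounded
near infinity, then its time derivative tends to zero. -/
theorem tendsto_zero_time_deriv {R : ℝ} {u u' u'' : ℝ → ℝ → ℂ}
    (hu : ∀ t ∈ Ici t₀, ∀ r ∈ Ioi R,
      HasDerivWithinAt (fun τ => u τ r) (u' t r) (Ici t₀) t)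
    (hu' : ∀ t ∈ Ici t₀, ∀ r ∈ Ioi R,
      HasDerivWithinAt (fun τ => u' τ r) (u'' t r) (Ici t₀) t)
    (hb : ∀ t ∈ Ici t₀, ∃ C : ℝ, ∀ᶠ p in 𝓝[Ici t₀] t ×ˢ atTop, ‖u'' p.1 p.2‖ ≤ C)
    (h0 : ∀ t ∈ Ici t₀, Tendsto (u t) atTop (𝓝 0)) :
    ∀ t ∈ Ici t₀, Tendsto (u' t) atTop (𝓝 0) := by
  intro t ht
  obtain ⟨C, hC⟩ := hb t ht
  obtain ⟨pa, hpa, pb, hpb, hab⟩ := eventually_prod_iff.1 hC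
  obtain ⟨δ, hδ, hsub⟩ := Metric.mem_nhdsWithin_iff.1 hpa
  rw [tendsto_zero_iff_norm_tendsto_zero, Metric.tendsto_nhds]
  intro η hη
  -- The step is fixed first, to make the second derivative term small; r → ∞ then takes care of the
  -- difference quotient.
  obtain ⟨h, hh0, hhδ, hhη⟩ : ∃ h : ℝ, 0 < h ∧ h < δ ∧ (|C| + 1) * h < η / 2 := by
    refine ⟨min (δ / 2) (η / 4 / (|C| + 1)), lt_min (by positivity) (by positivity),
      (min_le_left _ _).trans_lt (by linarith), ?_⟩
    calc (|C| + 1) * min (δ / 2) (η / 4 / (|C| + 1)) ≤ (|C| + 1) * (η / 4 / (|C| + 1)) := by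
          gcongr; exact min_le_right _ _
      _ = η / 4 := by field_simp
      _ < η / 2 := by linarith
  have hth : t + h ∈ Ici t₀ := le_trans ht (by linarith : t ≤ t + h)
  have hlim : Tendsto (fun r => (‖u (t + h) r‖ + ‖u t r‖) / h) atTop (𝓝 0) := by
    simpa using ((h0 _ hth).norm.add (h0 t ht).norm).div_const h
  filter_upwards [hlim.eventually (eventually_lt_nhds (half_pos hη)), hpb,
    Ioi_mem_atTop R] with r hr1 hr2 hr3
  have hIcc : Icc t (t + h) ⊆ Ici t₀ := fun s hs => le_trans ht hs.1
  have := norm_derivWithin_le hh0 (u := fun τ => u τ r) (u' := fun τ => u' τ r)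
    (u'' := fun τ => u'' τ r) (C := C) (t := t)
    (fun s hs => (hu s (hIcc hs) r hr3).mono hIcc) (fun s hs => (hu' s (hIcc hs) r hr3).mono hIcc)
    fun s hs => hab (hsub ⟨by
      rw [Metric.mem_ball, Real.dist_eq, abs_of_nonneg (by linarith [hs.1])]
      linarith [hs.2], hIcc hs⟩) hr2
  rw [Real.dist_eq, sub_zero, abs_norm]
  have hCC : C * h ≤ (|C| + 1) * h := by
    gcongr
    linarith [le_abs_self C]
  linarith

theorem tendsto_w_atTop :
    Tendsto (fun r => (w M k r : ℂ)) atTop (𝓝 ((k ^ 2 : ℝ) : ℂ)) := by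
  have h1 : Tendsto (fun r : ℝ => r⁻¹) atTop (𝓝 0) := tendsto_inv_atTop_zero
  have h : Tendsto (fun r : ℝ => k ^ 2 + r⁻¹ ^ 2 - 2 * M * r⁻¹ ^ 3) atTop (𝓝 (k ^ 2)) := by
    simpa using ((h1.pow 2).const_add (k ^ 2)).sub ((h1.pow 3).const_mul (2 * M))
  refine (Complex.continuous_ofReal.tendsto _).comp (h.congr' ?_)
  filter_upwards [eventually_ne_atTop 0] with r hr using (w_eq hr).symm

theorem tendsto_hRad_atTop : Tendsto (fun r => (hRad M r : ℂ)) atTop (𝓝 0) := by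
  have h1 : Tendsto (fun r : ℝ => r⁻¹) atTop (𝓝 0) := tendsto_inv_atTop_zero
  have h : Tendsto (fun r => -2 * r⁻¹ + 6 * M * r⁻¹ ^ 2) atTop (𝓝 (-2 * 0 + 6 * M * 0 ^ 2)) :=
    (h1.const_mul (-2)).add ((h1.pow 2).const_mul (6 * M))
  have h' := (Complex.continuous_ofReal.tendsto _).comp h
  rwa [show -2 * (0 : ℝ) + 6 * M * 0 ^ 2 = 0 by ring, Complex.ofReal_zero] at h'

theorem tendsto_affine_atTop (c d : ℝ) :
    Tendsto (fun r => ((c + d * r⁻¹ : ℝ) : ℂ)) atTop (𝓝 (c : ℂ)) := by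
  have h1 : Tendsto (fun r : ℝ => r⁻¹) atTop (𝓝 0) := tendsto_inv_atTop_zero
  have h : Tendsto (fun r : ℝ => c + d * r⁻¹) atTop (𝓝 c) := by
    simpa using (h1.const_mul d).const_add c
  exact (Complex.continuous_ofReal.tendsto _).comp h

/-- Boundedness near infinity at each time. -/
def BddInf (t₀ : ℝ) (f : ℝ → ℝ → ℂ) : Prop :=
  ∀ t ∈ Ici t₀, ∃ C : ℝ, ∀ᶠ r in atTop, ‖f t r‖ ≤ C

/-- Convergence to zero at infinity at each time. -/
def ZeroInf (t₀ : ℝ) (f : ℝ → ℝ → ℂ) : Prop := ∀ t ∈ Ici t₀, Tendsto (f t) atTop (𝓝 0)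

namespace ModeChain

variable {ε l : ℝ} {Φ : ℕ → ℕ → ℝ → ℝ → ℂ}

/-- The first consequence of the Teukolsky-Starobinsky identity at infinity. Here `b p` stands for
the mode of `∂_t^p` of the other field, `bc p` for the conjugate of the opposite mode, and `a`
for the conjugate of the opposite mode of the field itself. -/
theorem boundary_first (h : ModeChain M k t₀ ε l Φ) (hb : ∀ p j, BddInf t₀ (Φ p j))
    {a : ℝ → ℝ → ℂ} {b bc : ℕ → ℝ → ℝ → ℂ}
    (hTS : ∀ t ∈ Ici t₀, ∀ r ∈ Ioi (rPlus M k), (w M k r : ℂ) ^ 2 * Φ 0 4 t r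
      = (l * (l - 2) : ℝ) * bc 0 t r + 12 * ε * M * b 1 t r)
    (h1 : ZeroInf t₀ fun t r => bc 0 t r - a t r)
    (h2 : ZeroInf t₀ fun t r => b 1 t r - Φ 1 0 t r) :
    ZeroInf t₀ fun t r => 4 * Φ 2 2 t r + 2 * l * (k ^ 2 : ℝ) * Φ 0 2 t r
      - (l * (l - 2) : ℝ) * (Φ 0 0 t r + a t r) := by
  intro t ht
  have hw := tendsto_w_atTop (M := M) (k := k)
  have hh := tendsto_hRad_atTop (M := M)
  have hL := tendsto_affine_atTop (l - 2) (6 * M)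
  have hl := tendsto_affine_atTop l (-(6 * M))
  have e1 := (h1 t ht).const_mul ((l * (l - 2) : ℝ) : ℂ)
  have e2 := (h2 t ht).const_mul (12 * ε * M : ℂ)
  have e3 := tendsto_mul_zero_of_bdd (tendsto_sub_zero ((hw.mul hl).const_mul (2 : ℂ)))
    (hb 0 2 t ht)
  have e4 := tendsto_mul_zero_of_bdd (tendsto_mul_of_zero (hl.mul_const (ε : ℂ)) hh) (hb 0 1 t ht)
  have e5 := tendsto_mul_zero_of_bdd (tendsto_sub_zero (hl.mul hL)) (hb 0 0 t ht)
  have e6 := tendsto_mul_zero_of_bdd (tendsto_mul_of_zero (hw.mul_const (ε : ℂ)) hh) (hb 0 3 t ht)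
  have e := ((((e1.add e2).add e3).sub e4).sub e5).sub e6
  simp only [mul_zero, add_zero, sub_zero] at e
  refine e.congr' ?_
  filter_upwards [Ioi_mem_atTop (rPlus M k)] with r hr
  have c1 := h.first 0 t ht r hr
  have c2 := h.second 1 t ht r hr
  have c3 := h.third 0 t ht r hr
  have c4 := hTS t ht r hr
  simp only [zero_add, one_add_one_eq_two] at c1 c2 c3
  push_cast at *
  -- `third` replaces wΦ_4, `second` (for the time derivative) replaces w∂_tΦ_3 and `first` replaces
  -- 2∂_tΦ_1. The term 12εM∂_tΦ_0 produced by `second` is matched by the Dirichlet condition; `e3`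
  -- to `e6` replace the radial coefficients by their limits.
  linear_combination (-1 : ℂ) * c4 - (w M k r : ℂ) * c3 - 2 * c2
    + ((l : ℂ) - 6 * M * (r : ℂ)⁻¹) * c1

/-- The second consequence of the Teukolsky-Starobinsky identity at infinity. -/
theorem boundary_second (h : ModeChain M k t₀ ε l Φ) (hb : ∀ p j, BddInf t₀ (Φ p j))
    (hlne : l ≠ 2) {b bc bX bcX : ℕ → ℝ → ℝ → ℂ}
    (hnull : ∀ p, HasNull M k t₀ ε (b p) (b (p + 1)) (bX p))
    (hnullc : ∀ p, HasNull M k t₀ ε (bc p) (bc (p + 1)) (bcX p))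
    (hTS : ∀ t ∈ Ici t₀, ∀ r ∈ Ioi (rPlus M k), (w M k r : ℂ) ^ 2 * Φ 0 4 t r
      = (l * (l - 2) : ℝ) * bc 0 t r + 12 * ε * M * b 1 t r)
    {a : ℕ → ℝ → ℝ → ℂ} (ha : ∀ p, BddInf t₀ (a p))
    (h1 : ∀ p, ZeroInf t₀ fun t r => (2 * bc (p + 1) t r - bcX p t r) - w M k r * a p t r)
    (h2 : ∀ p, ZeroInf t₀ fun t r => (2 * b (p + 1) t r - bX p t r) - w M k r * Φ p 1 t r) (p : ℕ) :
    ZeroInf t₀ fun t r => 2 * Φ (p + 1) 2 t r + l * (Φ p 1 t r + a p t r) := by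
  have hwr := hasRadial_w h.M_pos h.k_pos
  -- Time derivatives of the Teukolsky-Starobinsky identity. The product with w is nested to fit two
  -- uses of `HasNull.rad_mul`.
  have hTSp : ∀ p, ∀ t ∈ Ici t₀, ∀ r ∈ Ioi (rPlus M k), (w M k r : ℂ) * (w M k r * Φ p 4 t r)
      = (l * (l - 2) : ℝ) * bc p t r + 12 * ε * M * b (p + 1) t r := by
    intro p
    induction p with
    | zero => intro t ht r hr; rw [← hTS t ht r hr]; ring
    | succ p ih =>
      intro t ht r hr
      exact (((((h.null p 4).rad_mul h.sq hwr).rad_mul h.sq hwr).unique h.M_pos h.k_pos h.sq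
        (((hnullc p).const_mul _).add ((hnull (p + 1)).const_mul _)) ih) t ht r hr).1
  intro t ht
  have hεC : (ε : ℂ) ^ 2 = 1 := by exact_mod_cast h.sq
  have hw := tendsto_w_atTop (M := M) (k := k)
  have hh := tendsto_hRad_atTop (M := M)
  have hL := tendsto_affine_atTop (l - 2) (6 * M)
  have hl := tendsto_affine_atTop l (-(6 * M))
  have e1 := (h1 p t ht).const_mul (-((l * (l - 2) : ℝ) : ℂ))
  have e2 := (h2 (p + 1) t ht).const_mul (-(12 * ε * M : ℂ))
  have e3 := tendsto_mul_zero_of_bdd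
    (tendsto_mul_of_zero (hw.mul_const (-(6 * M : ℂ))) hh) (hb p 1 t ht)
  have e4 := tendsto_mul_zero_of_bdd (tendsto_sub_zero ((hw.mul hL).const_mul (2 : ℂ)))
    (hb (p + 1) 2 t ht)
  have e5 := tendsto_mul_zero_of_bdd (tendsto_sub_zero ((hw.mul hL).mul hl)) (hb p 1 t ht)
  have e6 := tendsto_mul_zero_of_bdd
    (tendsto_sub_zero (hw.mul_const ((l * (l - 2) : ℝ) : ℂ))) (ha p t ht)
  -- After the cancellations everything carries the factor (l - 2)k², which is divided out.
  have hc : (((l - 2) * k ^ 2 : ℝ) : ℂ) ≠ 0 := by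
    have := h.k_pos
    exact_mod_cast mul_ne_zero (sub_ne_zero.2 hlne) (by positivity)
  have e := (((((e1.add e2).add e3).add e4).add e5).add e6).const_mul
    (((l - 2) * k ^ 2 : ℝ) : ℂ)⁻¹
  simp only [mul_zero, add_zero] at e
  refine e.congr' ?_
  filter_upwards [Ioi_mem_atTop (rPlus M k)] with r hr
  have c1 := h.first p t ht r hr
  have c2 := h.second p t ht r hr
  have c4 := h.fourth p t ht r hr
  have cX := (((((h.null p 4).rad_mul h.sq hwr).rad_mul h.sq hwr).unique h.M_pos h.k_pos h.sq
        (((hnullc p).const_mul _).add ((hnull (p + 1)).const_mul _)) (hTSp p)) t ht r hr).2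
  have cT := hTSp (p + 1) t ht r hr
  rw [inv_mul_eq_iff_eq_mul₀ hc]
  push_cast at *
  -- 2`cT` - `cX` is the identity hit by 2∂_t - X. `fourth` then leaves no Φ_4 or Φ_5, `second`
  -- removes Φ_3, and the Φ_0 terms from `second` and `first` cancel exactly; the remaining 12εM
  -- term is matched by `h2`.
  linear_combination 2 * cT - cX - (w M k r : ℂ) ^ 2 * c4
    - (w M k r : ℂ) * ((l : ℂ) - 2 + 6 * M * (r : ℂ)⁻¹) * c2 + 6 * ε * M * (w M k r : ℂ) * c1
    + 6 * M * (w M k r : ℂ) * hRad M r * Φ p 1 t r * hεC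

end ModeChain

end

section

variable {M k t₀ : ℝ}

/-! ## The limits of one pair of modes -/

theorem ZeroInf.conjugate {f : ℝ → ℝ → ℂ} (h : ZeroInf t₀ f) :
    ZeroInf t₀ fun t r => conj (f t r) := fun t ht => by
  simpa [Function.comp_def] using (Complex.continuous_conj.tendsto 0).comp (h t ht)

theorem BddInf.conjugate {f : ℝ → ℝ → ℂ} (h : BddInf t₀ f) :
    BddInf t₀ fun t r => conj (f t r) := fun t ht => by
  obtain ⟨C, hC⟩ := h t ht
  exact ⟨C, hC.mono fun r hr => by rwa [RCLike.norm_conj]⟩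

namespace ModeChain

variable {ε l : ℝ} {Φ Ψ : ℕ → ℕ → ℝ → ℝ → ℂ} {b bX bc bcX : ℕ → ℝ → ℝ → ℂ}

/-- The time derivative of the difference of the second null derivatives of a mode `Φ` and of the
conjugate `Ψ` of the opposite mode vanishes at infinity, hence so does the difference itself; and
the modes of the symmetric part satisfy a first order equation at infinity. -/
theorem boundary_limits (h : ModeChain M k t₀ ε l Φ) (h' : ModeChain M k t₀ ε l Ψ)
    (hb : ∀ p j, BddInf t₀ (Φ p j)) (hb' : ∀ p j, BddInf t₀ (Ψ p j)) (hl0 : l ≠ 0) (hl2 : l ≠ 2)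
    (hnull : ∀ p, HasNull M k t₀ ε (b p) (b (p + 1)) (bX p))
    (hnullc : ∀ p, HasNull M k t₀ ε (bc p) (bc (p + 1)) (bcX p))
    (hTS : ∀ t ∈ Ici t₀, ∀ r ∈ Ioi (rPlus M k), (w M k r : ℂ) ^ 2 * Φ 0 4 t r
      = (l * (l - 2) : ℝ) * bc 0 t r + 12 * ε * M * b 1 t r)
    (hTS' : ∀ t ∈ Ici t₀, ∀ r ∈ Ioi (rPlus M k), (w M k r : ℂ) ^ 2 * Ψ 0 4 t r
      = (l * (l - 2) : ℝ) * b 0 t r + 12 * ε * M * bc 1 t r)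
    (h1 : ∀ p, ZeroInf t₀ fun t r => b p t r - Φ p 0 t r)
    (h1' : ∀ p, ZeroInf t₀ fun t r => bc p t r - Ψ p 0 t r)
    (h2 : ∀ p, ZeroInf t₀ fun t r => (2 * b (p + 1) t r - bX p t r) - w M k r * Φ p 1 t r)
    (h2' : ∀ p, ZeroInf t₀ fun t r => (2 * bc (p + 1) t r - bcX p t r) - w M k r * Ψ p 1 t r) :
    (ZeroInf t₀ fun t r => (k ^ 2 : ℝ) * (l * (w M k r * Φ 0 1 t r + w M k r * Ψ 0 1 t r))
      + ((w M k r * (w M k r * Φ 1 2 t r) - ε * (w M k r * hRad M r : ℝ) * Φ 1 1 t r)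
        + (w M k r * (w M k r * Ψ 1 2 t r) - ε * (w M k r * hRad M r : ℝ) * Ψ 1 1 t r))) ∧
    ZeroInf t₀ fun t r =>
      (w M k r * (w M k r * Φ 0 2 t r) - ε * (w M k r * hRad M r : ℝ) * Φ 0 1 t r)
        - (w M k r * (w M k r * Ψ 0 2 t r) - ε * (w M k r * hRad M r : ℝ) * Ψ 0 1 t r) := by
  -- The same lemmas serve Φ and Ψ, with the roles of b and bc exchanged.
  have A := h.boundary_first hb hTS (h1' 0) (h1 1)
  have A' := h'.boundary_first hb' hTS' (h1 0) (h1' 1)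
  have B := h.boundary_second hb hl2 hnull hnullc hTS (fun p => hb' p 1) h2' h2
  have B' := h'.boundary_second hb' hl2 hnullc hnull hTS' (fun p => hb p 1) h2 h2'
  have hk := h.k_pos
  have hw := tendsto_w_atTop (M := M) (k := k)
  have hh := tendsto_hRad_atTop (M := M)
  have hc : 2 * (l : ℂ) * (k ^ 2 : ℝ) ≠ 0 := by
    exact_mod_cast mul_ne_zero (mul_ne_zero two_ne_zero hl0) (by positivity : k ^ 2 ≠ 0)
  constructor
  · intro t ht
    -- Half the sum of the two second limits, times k²w, is the claim up to replacing k² by w in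
    -- front of the Φ_2 terms and adding terms with h, all of which tend to 0.
    have e1 := ((((B 0 t ht).add (B' 0 t ht)).const_mul ((k ^ 2 : ℝ) : ℂ)).mul hw).const_mul
      (1 / 2 : ℂ)
    have e2 := tendsto_mul_zero_of_bdd (tendsto_mul_of_zero (hw.mul_const (ε : ℂ)) hh) (hb 1 1 t ht)
    have e2' := tendsto_mul_zero_of_bdd (tendsto_mul_of_zero (hw.mul_const (ε : ℂ)) hh)
      (hb' 1 1 t ht)
    have e3 := tendsto_mul_zero_of_bdd (tendsto_mul_of_zero hw (tendsto_sub_zero hw)) (hb 1 2 t ht)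
    have e3' := tendsto_mul_zero_of_bdd (tendsto_mul_of_zero hw (tendsto_sub_zero hw))
      (hb' 1 2 t ht)
    have e := (((e1.sub e2).sub e2').sub e3).sub e3'
    simp only [add_zero, mul_zero, zero_mul, sub_zero] at e
    refine e.congr fun r => ?_
    push_cast
    ring
  · intro t ht
    -- The symmetric brackets drop out of both differences, and twice the second cancels the ∂_t²Φ_2
    -- terms of the first. What remains is 2lk²(Φ_2 - Ψ_2).
    have e1 := ((((A t ht).sub (A' t ht)).sub (((B 1 t ht).sub (B' 1 t ht)).const_mul 2)).const_mul
      (2 * (l : ℂ) * (k ^ 2 : ℝ))⁻¹).mul (hw.mul hw)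
    have e2 := tendsto_mul_zero_of_bdd (tendsto_mul_of_zero (hw.mul_const (ε : ℂ)) hh) (hb 0 1 t ht)
    have e2' := tendsto_mul_zero_of_bdd (tendsto_mul_of_zero (hw.mul_const (ε : ℂ)) hh)
      (hb' 0 1 t ht)
    have e := (e1.sub e2).add e2'
    simp only [add_zero, mul_zero, zero_mul, sub_zero] at e
    refine e.congr fun r => ?_
    have hcc := inv_mul_cancel₀ hc
    push_cast at hcc ⊢
    linear_combination (w M k r : ℂ) * w M k r * (Φ 0 2 t r - Ψ 0 2 t r) * hcc

end ModeChain

end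

section

variable {M k t₀ ε : ℝ} {F G g g' : Field} {m : ℤ} {n : ℕ}

/-! ## The modes of solutions of the Teukolsky equation -/

/-- A regular solution of the Teukolsky equation of spin `+2` (for `ε = 1`), or the complex
conjugate of one of spin `-2` (for `ε = -1`). -/
structure TeukField (M k t₀ ε : ℝ) (F : Field) : Prop where
  reg : RegularField M k t₀ F
  sq : ε ^ 2 = 1
  eq : EqOnDomain M k t₀ (radMul (w M k) (angOp 2 F))
    (-(nullOp M k t₀ (-ε) (nullOp M k t₀ ε F))
      + ((2 * ε : ℝ) : ℂ) • radMul (hRad M) (nullOp M k t₀ ε F)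
      - radMul (w M k) (radMul (fun r => -2 + 6 * M * r⁻¹) F))

theorem Tame.radMul_affine (hg : Tame M k t₀ F g) (c d : ℝ) :
    Tame M k t₀ F (radMul (fun r => c + d * r⁻¹) g) := by
  refine ((hg.const_smul (c : ℂ)).add (hg.inv_r.const_smul (d : ℂ))).congr
    fun t _ r _ θ _ φ => ?_
  simp only [radMul, Pi.add_apply, Pi.smul_apply, smul_eq_mul]
  push_cast
  ring

/-- The Teukolsky equation solved for ℒF: a combination of derivatives along ∂_t and D with radial
coefficients, after division by w. This is the source of the rapid decay. -/
theorem TeukField.tame_angOp (h : TeukField M k t₀ ε F) : Tame M k t₀ F (angOp 2 F) := by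
  have hF := h.reg
  have hN := Tame.nullOp hF Tame.self ε
  have h1 : Tame M k t₀ F (radMul (w M k) (angOp 2 F)) :=
    (((hN.nullOp hF (-ε)).neg.add (hN.radMul_hRad.const_smul _)).sub
      ((Tame.self.radMul_affine _ _).radMul_w hF)).congr h.eq
  refine h1.inv_w.congr fun t _ r hr θ _ φ => ?_
  have hw : (w M k r : ℂ) ≠ 0 := by exact_mod_cast (w_pos hF.M_pos hF.k_pos hr).ne'
  simp only [radMul]
  rw [Complex.ofReal_inv, inv_mul_cancel_left₀ hw]

theorem HasNull.congr {f fT fX gT gX : ℝ → ℝ → ℂ} (h : HasNull M k t₀ ε f fT fX)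
    (hT : ∀ t ∈ Ici t₀, ∀ r ∈ Ioi (rPlus M k), gT t r = fT t r)
    (hX : ∀ t ∈ Ici t₀, ∀ r ∈ Ioi (rPlus M k), gX t r = fX t r) :
    HasNull M k t₀ ε f gT gX := fun t ht r hr => by
  rw [hT t ht r hr, hX t ht r hr]
  exact h t ht r hr

theorem Tame.sphCoeff_nullOp (hF : RegularField M k t₀ F) (hg : Tame M k t₀ F g) (ε : ℝ)
    (hm : m ∈ modes n) {t r : ℝ} (ht : t ∈ Ici t₀) (hr : r ∈ Ioi (rPlus M k)) :
    sphCoeff m n (SchwarzschildAdS.nullOp M k t₀ ε g t r)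
      = w M k r * sphCoeff m n (SchwarzschildAdS.wNull M k t₀ ε g t r) := by
  have hw : (w M k r : ℂ) ≠ 0 := by exact_mod_cast (w_pos hF.M_pos hF.k_pos hr).ne'
  rw [SchwarzschildAdS.wNull, (hg.nullOp hF ε).sphCoeff_radMul hF _ ht hr hm, Complex.ofReal_inv,
    mul_inv_cancel_left₀ hw]

/-- The modes `(w⁻¹ X)^j ∂_t^p F`. -/
noncomputable def modeFun (M k t₀ ε : ℝ) (F : Field) (m : ℤ) (n p j : ℕ) (t r : ℝ) : ℂ :=
  sphCoeff m n ((wNull M k t₀ ε)^[j] ((dT t₀)^[p] F) t r)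

theorem hasNull_modeFun (hF : RegularField M k t₀ F) (hε : ε ^ 2 = 1) (hm : m ∈ modes n)
    (p j : ℕ) : HasNull M k t₀ ε (modeFun M k t₀ ε F m n p j) (modeFun M k t₀ ε F m n (p + 1) j)
      (fun t r => (w M k r : ℂ) * modeFun M k t₀ ε F m n p (j + 1) t r) := by
  have hg : Tame M k t₀ F ((dT t₀)^[p] F) := Tame.self.iterate_dT hF p
  refine ((hg.iterate_wNull hF ε j).hasNull hF hε hm).congr (fun t ht r hr => ?_)
    fun t ht r hr => ?_
  · rw [(hg.dT_iterate_wNull hF ε j).sphCoeff_eq ht hr, modeFun, Function.iterate_succ_apply']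
  · rw [(hg.iterate_wNull hF ε j).sphCoeff_nullOp hF ε hm ht hr, modeFun,
      Function.iterate_succ_apply' (wNull M k t₀ ε)]

namespace TeukField

/-- XF has coefficient wΦ_1; differentiating the factor w produces the term with h, which disappears
at infinity. -/
theorem hasNull_null (h : TeukField M k t₀ ε F) (hm : m ∈ modes n) :
    ∀ t ∈ Ici t₀, ∀ r ∈ Ioi (rPlus M k),
      sphCoeff m n (dT t₀ (nullOp M k t₀ ε F) t r) = w M k r * modeFun M k t₀ ε F m n 1 1 t r ∧
      sphCoeff m n (nullOp M k t₀ ε (nullOp M k t₀ ε F) t r)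
        = w M k r * (w M k r * modeFun M k t₀ ε F m n 0 2 t r)
          - ε * (w M k r * hRad M r : ℝ) * modeFun M k t₀ ε F m n 0 1 t r := by
  have hF := h.reg
  exact ((Tame.self.nullOp hF ε).hasNull hF h.sq hm).unique hF.M_pos hF.k_pos h.sq
    ((hasNull_modeFun hF h.sq hm 0 1).rad_mul h.sq (hasRadial_w hF.M_pos hF.k_pos))
    fun t ht r hr => Tame.self.sphCoeff_nullOp hF ε hm ht hr

theorem sphCoeff_dT_nullOp_nullOp (h : TeukField M k t₀ ε F) (hm : m ∈ modes n) {t r : ℝ}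
    (ht : t ∈ Ici t₀) (hr : r ∈ Ioi (rPlus M k)) :
    sphCoeff m n (dT t₀ (nullOp M k t₀ ε (nullOp M k t₀ ε F)) t r)
      = w M k r * (w M k r * modeFun M k t₀ ε F m n 1 2 t r)
        - ε * (w M k r * hRad M r : ℝ) * modeFun M k t₀ ε F m n 1 1 t r := by
  have hF := h.reg
  have h2 := ((Tame.self.nullOp hF ε).nullOp hF ε).hasDerivWithinAt_sphCoeff hF ht hr hm
  refine (uniqueDiffOn_Ici t₀ t ht).eq_deriv _ h2 (HasDerivWithinAt.congr ?_
    (fun τ hτ => (h.hasNull_null hm τ hτ r hr).2) (h.hasNull_null hm t ht r hr).2)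
  exact (((hasNull_modeFun hF h.sq hm 0 2 t ht r hr).1.const_mul _).const_mul _).sub
    ((hasNull_modeFun hF h.sq hm 0 1 t ht r hr).1.const_mul _)

theorem modeChain (h : TeukField M k t₀ ε F) (hm : m ∈ modes n) :
    ModeChain M k t₀ ε (lam n) (modeFun M k t₀ ε F m n) where
  M_pos := h.reg.M_pos
  k_pos := h.reg.k_pos
  sq := h.sq
  null := hasNull_modeFun h.reg h.sq hm
  teuk t ht r hr := by
    have hF := h.reg
    have hw : (w M k r : ℂ) ≠ 0 := by exact_mod_cast (w_pos hF.M_pos hF.k_pos hr).ne'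
    have hN := Tame.nullOp hF Tame.self ε
    have hNN := hN.nullOp hF (-ε)
    have hA := h.tame_angOp
    have e := h.eq.sphCoeff_eq ht hr m n
    obtain ⟨e1, e2⟩ := h.hasNull_null hm t ht r hr
    -- The opposite null derivation is 2∂_t - X, so the wave operator needs only ∂_tX and XX.
    have e3 : nullOp M k t₀ (-ε) (nullOp M k t₀ ε F) = (2 : ℂ) • dT t₀ (nullOp M k t₀ ε F)
        - nullOp M k t₀ ε (nullOp M k t₀ ε F) := by
      funext t r θ φ
      rw [nullOp, nullOp.eq_1 M k t₀ ε (nullOp M k t₀ ε F)]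
      simp only [Pi.sub_apply, Pi.smul_apply, smul_eq_mul, Complex.ofReal_neg]
      ring
    have e4 : sphCoeff m n (nullOp M k t₀ (-ε) (nullOp M k t₀ ε F) t r)
        = 2 * sphCoeff m n (dT t₀ (nullOp M k t₀ ε F) t r)
          - sphCoeff m n (nullOp M k t₀ ε (nullOp M k t₀ ε F) t r) := by
      rw [e3, ((hN.dT hF).const_smul 2).sphCoeff_sub hF (hN.nullOp hF ε) ht hr hm,
        (hN.dT hF).sphCoeff_const_smul hF 2 ht hr hm]
    have e5 : sphCoeff m n ((-(nullOp M k t₀ (-ε) (nullOp M k t₀ ε F))) t r)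
        = -sphCoeff m n (nullOp M k t₀ (-ε) (nullOp M k t₀ ε F) t r) := by
      rw [← neg_one_smul ℂ, hNN.sphCoeff_const_smul hF _ ht hr hm, neg_one_mul]
    rw [hA.sphCoeff_radMul hF _ ht hr hm, lamRel_angOp hF hA t ht r hr n m hm,
      (hNN.neg.add (hN.radMul_hRad.const_smul _)).sphCoeff_sub hF
        ((Tame.self.radMul_affine _ _).radMul_w hF) ht hr hm,
      hNN.neg.sphCoeff_add hF (hN.radMul_hRad.const_smul _) ht hr hm, e5, e4, e1, e2,
      hN.radMul_hRad.sphCoeff_const_smul hF _ ht hr hm, hN.sphCoeff_radMul hF _ ht hr hm,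
      (Tame.self.radMul_affine _ _).sphCoeff_radMul hF _ ht hr hm,
      Tame.self.sphCoeff_radMul hF _ ht hr hm, Tame.self.sphCoeff_nullOp hF ε hm ht hr] at e
    change _ = -(2 * _ - _) + _ * (_ * (_ * modeFun M k t₀ ε F m n 0 1 t r))
      - _ * (_ * modeFun M k t₀ ε F m n 0 0 t r) at e
    change (w M k r : ℂ) * (_ * modeFun M k t₀ ε F m n 0 0 t r) = _ at e
    refine mul_left_cancel₀ hw ?_
    push_cast at e ⊢
    linear_combination e

end TeukField

/-! ## Coefficients near infinity -/

theorem Tame.eventually_norm_sphCoeff_le (hF : RegularField M k t₀ F) (hg : Tame M k t₀ F g)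
    (hm : m ∈ modes n) {t : ℝ} (ht : t ∈ Ici t₀) :
    ∃ C : ℝ, ∀ᶠ p in 𝓝[Ici t₀] t ×ˢ atTop, ‖sphCoeff m n (g p.1 p.2)‖ ≤ C := by
  have hM := hF.M_pos
  have hk := hF.k_pos
  obtain ⟨C, hC⟩ := hg.locBdd hF t ht 0 ⟨le_rfl, inv_pos.2 (rPlus_pos hM hk)⟩
  refine ⟨C * (n + 3) * sphMeas.real univ, ?_⟩
  have h := (tendsto_nearPt_infinity hM hk t).eventually (hC.and (mem_nearPt hM hk t 0))
  filter_upwards [h] with p hp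
  simp only [inv_inv] at hp
  exact norm_sphCoeff_le (hg.sphereReg hF hp.2.1 hp.2.2) hm hp.1

theorem tendsto_prodMk_atTop {t : ℝ} (ht : t ∈ Ici t₀) :
    Tendsto (fun r : ℝ => (t, r)) atTop (𝓝[Ici t₀] t ×ˢ atTop) :=
  (tendsto_const_nhdsWithin ht).prodMk tendsto_id

theorem Tame.bddInf (hF : RegularField M k t₀ F) (hg : Tame M k t₀ F g) (hm : m ∈ modes n) :
    BddInf t₀ fun t r => sphCoeff m n (g t r) := fun t ht => by
  obtain ⟨C, hC⟩ := hg.eventually_norm_sphCoeff_le hF hm ht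
  exact ⟨C, (tendsto_prodMk_atTop ht).eventually hC⟩

theorem Tame.eventually_norm_le (hF : RegularField M k t₀ F) (hg : Tame M k t₀ F g) {t : ℝ}
    (ht : t ∈ Ici t₀) : ∃ C : ℝ, ∀ᶠ r in atTop, ∀ θ ∈ Ioo 0 π, ∀ φ : ℝ, ‖g t r θ φ‖ ≤ C := by
  obtain ⟨C, hC⟩ := hg.locBdd hF t ht 0 ⟨le_rfl, inv_pos.2 (rPlus_pos hF.M_pos hF.k_pos)⟩
  refine ⟨C, ?_⟩
  have h := ((tendsto_nearPt_infinity hF.M_pos hF.k_pos t).comp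
    (tendsto_prodMk_atTop ht)).eventually hC
  simpa using h

/-- The coefficients of a function which vanishes at infinity vanish at infinity. -/
theorem Tame.zeroInf_sphCoeff_sub (hF : RegularField M k t₀ F) (hg : Tame M k t₀ F g)
    (hG : RegularField M k t₀ G) (hg' : Tame M k t₀ G g') (h : VanishesAtInfinity t₀ (g - g'))
    (hm : m ∈ modes n) :
    ZeroInf t₀ fun t r => sphCoeff m n (g t r) - sphCoeff m n (g' t r) := by
  intro t ht
  obtain ⟨C, hC⟩ := hg.eventually_norm_le hF ht
  obtain ⟨C', hC'⟩ := hg'.eventually_norm_le hG ht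
  have key : Tendsto (fun r => ∫ z, (g - g') t r z.2 z.1 * sphKer m n z ∂sphMeas) atTop
      (𝓝 (∫ _, (0 : ℂ) ∂sphMeas)) := by
    refine MeasureTheory.tendsto_integral_filter_of_dominated_convergence
      (fun _ => (C + C') * (n + 3)) ?_ ?_ (MeasureTheory.integrable_const _) ?_
    · filter_upwards [Ioi_mem_atTop (rPlus M k)] with r hr
      exact (((hg.sphereReg hF ht hr).sub (hg'.sphereReg hG ht hr)).integrable hm).1
    · filter_upwards [hC, hC'] with r h1 h2
      refine ae_sphMeas fun φ θ hθ => ?_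
      have h3 : ‖(g - g') t r θ φ‖ ≤ C + C' :=
        (norm_sub_le _ _).trans (add_le_add (h1 θ hθ φ) (h2 θ hθ φ))
      rw [norm_mul]
      exact mul_le_mul h3 (norm_sphKer_le (Finset.mem_Icc.1 hm).1 _) (norm_nonneg _)
        ((norm_nonneg _).trans h3)
    · refine ae_sphMeas fun φ θ hθ => ?_
      simpa using (h t ht θ hθ φ).mul_const (sphKer m n (φ, θ))
  rw [MeasureTheory.integral_zero] at key
  refine key.congr' ?_
  filter_upwards [Ioi_mem_atTop (rPlus M k)] with r hr
  have h1 := hg.sphereReg hF ht hr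
  have h2 := hg'.sphereReg hG ht hr
  rw [← SchwarzschildAdS.sphCoeff_sub h1 h2 hm, sphCoeff_eq_integral (h1.sub h2) hm]
  rfl

/-- Time derivatives of coefficients which vanish at infinity vanish at infinity. -/
theorem Tame.zeroInf_sphCoeff_dT (hF : RegularField M k t₀ F) (hg : Tame M k t₀ F g)
    (hG : RegularField M k t₀ G) (hg' : Tame M k t₀ G g') (hm : m ∈ modes n)
    (h : ZeroInf t₀ fun t r => sphCoeff m n (g t r) - sphCoeff m n (g' t r)) :
    ZeroInf t₀ fun t r => sphCoeff m n (SchwarzschildAdS.dT t₀ g t r)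
      - sphCoeff m n (SchwarzschildAdS.dT t₀ g' t r) := by
  refine tendsto_zero_time_deriv (R := rPlus M k)
    (u'' := fun t r => sphCoeff m n (SchwarzschildAdS.dT t₀ (SchwarzschildAdS.dT t₀ g) t r)
      - sphCoeff m n (SchwarzschildAdS.dT t₀ (SchwarzschildAdS.dT t₀ g') t r))
    (fun t ht r hr => (hg.hasDerivWithinAt_sphCoeff hF ht hr hm).sub
      (hg'.hasDerivWithinAt_sphCoeff hG ht hr hm))
    (fun t ht r hr => ((hg.dT hF).hasDerivWithinAt_sphCoeff hF ht hr hm).sub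
      ((hg'.dT hG).hasDerivWithinAt_sphCoeff hG ht hr hm)) (fun t ht => ?_) h
  obtain ⟨C, hC⟩ := ((hg.dT hF).dT hF).eventually_norm_sphCoeff_le hF hm ht
  obtain ⟨C', hC'⟩ := ((hg'.dT hG).dT hG).eventually_norm_sphCoeff_le hG hm ht
  refine ⟨C + C', ?_⟩
  filter_upwards [hC, hC'] with p h1 h2
  exact (norm_sub_le _ _).trans (add_le_add h1 h2)

theorem Tame.zeroInf_sphCoeff_iterate_dT (hF : RegularField M k t₀ F) (hg : Tame M k t₀ F g)
    (hG : RegularField M k t₀ G) (hg' : Tame M k t₀ G g') (h : VanishesAtInfinity t₀ (g - g'))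
    (hm : m ∈ modes n) (p : ℕ) :
    ZeroInf t₀ fun t r => sphCoeff m n ((SchwarzschildAdS.dT t₀)^[p] g t r)
      - sphCoeff m n ((SchwarzschildAdS.dT t₀)^[p] g' t r) := by
  induction p with
  | zero => exact hg.zeroInf_sphCoeff_sub hF hG hg' h hm
  | succ p ih =>
    simp only [Function.iterate_succ_apply']
    exact (hg.iterate_dT hF p).zeroInf_sphCoeff_dT hF hG (hg'.iterate_dT hG p) hm ih

end

section

variable {M k t₀ ε : ℝ} {F G g g' : Field}

/-! ## Pairs of solutions -/

/-- A solution `F` of the Teukolsky equation of spin `±2`, the complex conjugate `G` of a solution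
of the opposite spin (both conjugated for spin `-2`), their boundary conditions, and one of the
Teukolsky-Starobinsky identities. -/
structure TeukPair (M k t₀ ε : ℝ) (F G : Field) : Prop where
  fst : TeukField M k t₀ ε F
  snd : TeukField M k t₀ (-ε) G
  dirichlet : VanishesAtInfinity t₀ (G - F)
  neumann : VanishesAtInfinity t₀ (Dop M k t₀ G - -Dop M k t₀ F)
  starobinsky : EqOnDomain M k t₀ (radMul (fun r => w M k r ^ 2) ((wNull M k t₀ ε)^[4] F))
    (conjField (angLdag (-1) (angLdag 0 (angLdag 1 (angLdag 2 G))))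
      + ((12 * ε * M : ℝ) : ℂ) • dT t₀ G)

theorem SmoothField.iterate_dT_Dop (hF : SmoothField M k t₀ F) (p : ℕ) :
    EqOnDomain M k t₀ ((SchwarzschildAdS.dT t₀)^[p] (SchwarzschildAdS.Dop M k t₀ F))
      (SchwarzschildAdS.Dop M k t₀ ((SchwarzschildAdS.dT t₀)^[p] F)) := by
  induction p generalizing F with
  | zero => exact EqOnDomain.refl _
  | succ p ih =>
    rw [Function.iterate_succ_apply, Function.iterate_succ_apply]
    exact (EqOnDomain.iterate (fun h => h.dT) hF.dT_Dop p).trans (ih hF.dT)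

theorem iterate_dT_neg (F : Field) (p : ℕ) : (dT t₀)^[p] (-F) = -(dT t₀)^[p] F := by
  have h : ∀ F, dT t₀ (-F) = -dT t₀ F := fun F => by
    rw [← neg_one_smul ℂ, dT_const_smul, neg_one_smul]
  exact (Function.Commute.iterate_left (f := dT t₀) (g := fun F => -F) h p).eq F

theorem ZeroInf.congr {f f' : ℝ → ℝ → ℂ} (R : ℝ) (h : ZeroInf t₀ f)
    (e : ∀ t ∈ Ici t₀, ∀ r ∈ Ioi R, f' t r = f t r) : ZeroInf t₀ f' := fun t ht => by
  refine (h t ht).congr' ?_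
  filter_upwards [Ioi_mem_atTop R] with r hr using (e t ht r hr).symm

theorem ZeroInf.add {f f' : ℝ → ℝ → ℂ} (h : ZeroInf t₀ f) (h' : ZeroInf t₀ f') :
    ZeroInf t₀ fun t r => f t r + f' t r := fun t ht => by
  simpa using (h t ht).add (h' t ht)

theorem ZeroInf.const_mul {f : ℝ → ℝ → ℂ} (h : ZeroInf t₀ f) (c : ℂ) :
    ZeroInf t₀ fun t r => c * f t r := fun t ht => by
  simpa using (h t ht).const_mul c

namespace TeukPair

variable {m : ℤ} {n : ℕ}

theorem sphCoeff_starobinsky (h : TeukPair M k t₀ ε F G) (hm : m ∈ modes n) :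
    ∀ t ∈ Ici t₀, ∀ r ∈ Ioi (rPlus M k), (w M k r : ℂ) ^ 2 * modeFun M k t₀ ε F m n 0 4 t r
      = (lam n * (lam n - 2) : ℝ) * conj (sphCoeff (-m) n (G t r))
        + 12 * ε * M * sphCoeff m n (dT t₀ G t r) := by
  intro t ht r hr
  have hF := h.fst.reg
  have hG := h.snd.reg
  have hA := h.snd.tame_angOp
  obtain ⟨c, hc, hser, hcm⟩ := sphCoeff_conj_angLdag
    ((Tame.self.locRapid hG hA).rapidDecay hG.M_pos hG.k_pos ht hr)
    fun θ hθ φ => Tame.self.eq_Ser hG hA ht hr hθ φ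
  have hreg : SphereReg (Ser c fun m n => harm m n 4) :=
    sphereReg_Ser hc (polyBdd_harm 4) fun m n => continuous_harm m n 4
  have hT : Tame M k t₀ G (dT t₀ G) := Tame.self.dT hG
  have e := h.starobinsky.sphCoeff_eq ht hr m n
  rw [(Tame.self.iterate_wNull hF ε 4).sphCoeff_radMul hF _ ht hr hm] at e
  have e2 : sphCoeff m n ((conjField (angLdag (-1) (angLdag 0 (angLdag 1 (angLdag 2 G))))
      + ((12 * ε * M : ℝ) : ℂ) • dT t₀ G) t r)
      = c m n + ((12 * ε * M : ℝ) : ℂ) * sphCoeff m n (dT t₀ G t r) := by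
    rw [← sphCoeff_Ser hc hm, ← hT.sphCoeff_const_smul hG _ ht hr hm,
      ← sphCoeff_add hreg ((hT.const_smul _).sphereReg hG ht hr) hm]
    refine sphCoeff_congr fun θ hθ φ => ?_
    simp only [Pi.add_apply]
    rw [hser θ hθ φ]
  rw [e2, hcm, muTS] at e
  push_cast at e ⊢
  exact e

theorem zeroInf_dirichlet (h : TeukPair M k t₀ ε F G) (hm : m ∈ modes n) (p : ℕ) :
    ZeroInf t₀ fun t r => sphCoeff m n ((dT t₀)^[p] G t r) - modeFun M k t₀ ε F m n p 0 t r :=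
  Tame.self.zeroInf_sphCoeff_iterate_dT h.snd.reg h.fst.reg Tame.self h.dirichlet hm p

/-- 2∂_t - X = ∂_t + εD, so the two boundary conditions together say that reflection at infinity
turns the derivative of G along the opposite null direction into XF. -/
theorem zeroInf_neumann (h : TeukPair M k t₀ ε F G) (hm : m ∈ modes n) (p : ℕ) :
    ZeroInf t₀ fun t r => (2 * sphCoeff m n ((dT t₀)^[p + 1] G t r)
      - sphCoeff m n (nullOp M k t₀ ε ((dT t₀)^[p] G) t r))
      - w M k r * modeFun M k t₀ ε F m n p 1 t r := by
  have hF := h.fst.reg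
  have hG := h.snd.reg
  have hN := (Tame.self.Dop hG).zeroInf_sphCoeff_iterate_dT hG hF (Tame.self.Dop hF).neg
    h.neumann hm p
  have hD := h.zeroInf_dirichlet hm (p + 1)
  refine (hD.add (hN.const_mul (ε : ℂ))).congr (rPlus M k) fun t ht r hr => ?_
  have hFp : Tame M k t₀ F ((dT t₀)^[p] F) := Tame.self.iterate_dT hF p
  have hGp : Tame M k t₀ G ((dT t₀)^[p] G) := Tame.self.iterate_dT hG p
  have e1 := hFp.sphCoeff_nullOp hF ε hm ht hr
  have e2 : ∀ {H : Field} (hH : RegularField M k t₀ H),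
      sphCoeff m n (nullOp M k t₀ ε ((dT t₀)^[p] H) t r) = sphCoeff m n ((dT t₀)^[p + 1] H t r)
        - ε * sphCoeff m n (Dop M k t₀ ((dT t₀)^[p] H) t r) := fun {H} hH => by
    have hHp : Tame M k t₀ H ((dT t₀)^[p] H) := Tame.self.iterate_dT hH p
    rw [nullOp, (hHp.dT hH).sphCoeff_sub hH ((hHp.Dop hH).const_smul _) ht hr hm,
      (hHp.Dop hH).sphCoeff_const_smul hH _ ht hr hm, Function.iterate_succ_apply']
  have e3 : sphCoeff m n ((dT t₀)^[p] (-Dop M k t₀ F) t r)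
      = -sphCoeff m n (Dop M k t₀ ((dT t₀)^[p] F) t r) := by
    rw [iterate_dT_neg, ← neg_one_smul ℂ,
      ((Tame.self.Dop hF).iterate_dT hF p).sphCoeff_const_smul hF _ ht hr hm,
      (hF.smooth.iterate_dT_Dop p).sphCoeff_eq ht hr]
    ring
  rw [e3, (hG.smooth.iterate_dT_Dop p).sphCoeff_eq ht hr]
  rw [e2 hF] at e1
  change _ = (w M k r : ℂ) * modeFun M k t₀ ε F m n p 1 t r at e1
  rw [← e1, e2 hG]
  change _ = sphCoeff m n ((dT t₀)^[p + 1] G t r) - sphCoeff m n ((dT t₀)^[p + 1] F t r) + _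
  ring

theorem bddInf_modeFun (h : TeukPair M k t₀ ε F G) (hm : m ∈ modes n) (p j : ℕ) :
    BddInf t₀ (modeFun M k t₀ ε F m n p j) :=
  ((Tame.self.iterate_dT h.fst.reg p).iterate_wNull h.fst.reg ε j).bddInf h.fst.reg hm

theorem hasNull_snd (h : TeukPair M k t₀ ε F G) (hm : m ∈ modes n) (p : ℕ) :
    HasNull M k t₀ ε (fun t r => sphCoeff m n ((dT t₀)^[p] G t r))
      (fun t r => sphCoeff m n ((dT t₀)^[p + 1] G t r))
      (fun t r => sphCoeff m n (nullOp M k t₀ ε ((dT t₀)^[p] G) t r)) := by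
  simp only [Function.iterate_succ_apply']
  exact (Tame.self.iterate_dT h.snd.reg p).hasNull h.snd.reg h.fst.sq hm

/-- As ℓ ≥ 2, the divisions by l and by l - 2 are legitimate. -/
theorem lam_gt (n : ℕ) : 2 < lam n := by
  have : (0 : ℝ) ≤ n := Nat.cast_nonneg n
  unfold lam
  nlinarith

/-- The boundary conditions satisfied by each mode. -/
theorem mode_limits (h : TeukPair M k t₀ ε F G) (hm : m ∈ modes n) :
    (ZeroInf t₀ fun t r => (k ^ 2 : ℝ) * (lam n
        * mixCoeff (1 / 2) (1 / 2) m n (nullOp M k t₀ ε F t r))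
      + mixCoeff (1 / 2) (1 / 2) m n (dT t₀ (nullOp M k t₀ ε (nullOp M k t₀ ε F)) t r)) ∧
    ZeroInf t₀ fun t r =>
      mixCoeff (1 / 2) (-(1 / 2)) m n (nullOp M k t₀ ε (nullOp M k t₀ ε F) t r) := by
  have hm' : -m ∈ modes n := neg_mem_modes.2 hm
  have hl := lam_gt n
  -- Ψ is the conjugated chain of the mode -m. Conjugating the Starobinsky identity of that mode
  -- exchanges the coefficient of G at m with the conjugate of the one at -m.
  obtain ⟨h1, h2⟩ := (h.fst.modeChain hm).boundary_limits (h.fst.modeChain hm').conjugate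
    (h.bddInf_modeFun hm) (fun p j => (h.bddInf_modeFun hm' p j).conjugate)
    (by linarith) (by linarith) (h.hasNull_snd hm) (fun p => (h.hasNull_snd hm' p).conj)
    (h.sphCoeff_starobinsky hm) (fun t ht r hr => by
      have e := congrArg (starRingEnd ℂ) (h.sphCoeff_starobinsky hm' t ht r hr)
      simp only [map_add, map_mul, map_pow, Complex.conj_ofReal, Complex.conj_conj, neg_neg,
        map_ofNat] at e
      exact e)
    (h.zeroInf_dirichlet hm) (fun p => by
      simpa only [map_sub] using (h.zeroInf_dirichlet hm' p).conjugate)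
    (h.zeroInf_neumann hm) (fun p => by
      simpa only [map_sub, map_mul, map_ofNat, Complex.conj_ofReal]
        using (h.zeroInf_neumann hm' p).conjugate)
  have hF := h.fst.reg
  constructor
  · refine (h1.const_mul (1 / 2)).congr (rPlus M k) fun t ht r hr => ?_
    rw [mixCoeff, mixCoeff, Tame.self.sphCoeff_nullOp hF ε hm ht hr,
      Tame.self.sphCoeff_nullOp hF ε hm' ht hr, h.fst.sphCoeff_dT_nullOp_nullOp hm ht hr,
      h.fst.sphCoeff_dT_nullOp_nullOp hm' ht hr]
    change (_ : ℂ) * (_ * (_ * (_ * modeFun M k t₀ ε F m n 0 1 t r)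
      + _ * conj (_ * modeFun M k t₀ ε F (-m) n 0 1 t r))) + _ = _
    simp only [map_sub, map_mul, Complex.conj_ofReal]
    push_cast
    ring
  · refine (h2.const_mul (1 / 2)).congr (rPlus M k) fun t ht r hr => ?_
    rw [mixCoeff, (h.fst.hasNull_null hm t ht r hr).2, (h.fst.hasNull_null hm' t ht r hr).2]
    simp only [map_sub, map_mul, Complex.conj_ofReal]
    push_cast
    ring

end TeukPair

/-! ## Summation over the modes -/

/-- Rapid decay, uniformly near infinity. -/
def RapidInf (c : ℝ → ℤ → ℕ → ℂ) : Prop :=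
  ∀ N : ℕ, ∃ C : ℝ, ∀ᶠ r in atTop, ∀ n : ℕ, ∀ m ∈ modes n, ‖c r m n‖ * ((n : ℝ) + 1) ^ N ≤ C

/-- Dominated convergence: the uniform decay gives a summable majorant independent of r near
infinity. -/
theorem RapidInf.tendsto_Ser {c : ℝ → ℤ → ℕ → ℂ} (hc : RapidInf c)
    (h0 : ∀ n : ℕ, ∀ m ∈ modes n, Tendsto (fun r => c r m n) atTop (𝓝 0)) (θ φ : ℝ) :
    Tendsto (fun r => Ser (c r) (fun m n => harm m n 4) θ φ) atTop (𝓝 0) := by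
  obtain ⟨P, K, hK⟩ := polyBdd_harm 4
  obtain ⟨C, hC⟩ := hc (P + 3)
  have h := tendsto_tsum_of_dominated_convergence (𝓕 := atTop)
    (f := fun r n => ∑ m ∈ modes n, c r m n
      * ((harm m n 4 θ : ℂ) * Complex.exp (Complex.I * m * φ))) (g := fun _ => 0)
    (summable_majorant (5 * C * K)) (fun n => ?_) ?_
  · rwa [tsum_zero] at h
  · simpa using tendsto_finsetSum (modes n) fun m hm => (h0 n m hm).mul_const
      ((harm m n 4 θ : ℂ) * Complex.exp (Complex.I * m * φ))
  · filter_upwards [hC] with r hr n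
    exact (norm_sum_le _ _).trans (sum_modes_le (hr n)
      fun m hm => norm_harm_exp_le (h := fun m n => harm m n 4) (hK n m hm θ) φ)

theorem RapidInf.add {c c' : ℝ → ℤ → ℕ → ℂ} (h : RapidInf c) (h' : RapidInf c') :
    RapidInf fun r m n => c r m n + c' r m n := fun N => by
  obtain ⟨C, hC⟩ := h N
  obtain ⟨C', hC'⟩ := h' N
  refine ⟨C + C', ?_⟩
  filter_upwards [hC, hC'] with r h1 h2 n m hm
  refine (mul_le_mul_of_nonneg_right (norm_add_le _ _) (by positivity)).trans ?_
  rw [add_mul]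
  exact add_le_add (h1 n m hm) (h2 n m hm)

theorem RapidInf.const_mul {c : ℝ → ℤ → ℕ → ℂ} (h : RapidInf c) (a : ℂ) :
    RapidInf fun r m n => a * c r m n := fun N => by
  obtain ⟨C, hC⟩ := h N
  refine ⟨‖a‖ * C, ?_⟩
  filter_upwards [hC] with r h1 n m hm
  rw [norm_mul, mul_assoc]
  exact mul_le_mul_of_nonneg_left (h1 n m hm) (norm_nonneg _)

theorem RapidInf.lam {c : ℝ → ℤ → ℕ → ℂ} (h : RapidInf c) :
    RapidInf fun r m n => (lam n : ℂ) * c r m n := fun N => by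
  obtain ⟨C, hC⟩ := h (N + 2)
  refine ⟨6 * C, ?_⟩
  filter_upwards [hC] with r h1 n m hm
  have hn : (0 : ℝ) ≤ n := Nat.cast_nonneg n
  have hl : ‖(SchwarzschildAdS.lam n : ℂ)‖ ≤ 6 * ((n : ℝ) + 1) ^ 2 := by
    rw [Complex.norm_real, Real.norm_eq_abs, abs_of_pos (by linarith [TeukPair.lam_gt n])]
    unfold SchwarzschildAdS.lam
    nlinarith
  rw [norm_mul]
  calc ‖(SchwarzschildAdS.lam n : ℂ)‖ * ‖c r m n‖ * ((n : ℝ) + 1) ^ N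
      ≤ 6 * ((n : ℝ) + 1) ^ 2 * ‖c r m n‖ * ((n : ℝ) + 1) ^ N := by gcongr
    _ = 6 * (‖c r m n‖ * ((n : ℝ) + 1) ^ (N + 2)) := by ring
    _ ≤ 6 * C := by linarith [h1 n m hm]

theorem Tame.rapidInf_mixCoeff (hF : RegularField M k t₀ F) (hg : Tame M k t₀ F g)
    (hA : Tame M k t₀ F (angOp 2 F)) (a b : ℝ) {t : ℝ} (ht : t ∈ Ici t₀) :
    RapidInf fun r m n => mixCoeff a b m n (g t r) := fun N => by
  obtain ⟨C, hC⟩ := hg.locRapid hF hA N t ht 0 ⟨le_rfl, inv_pos.2 (rPlus_pos hF.M_pos hF.k_pos)⟩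
  refine ⟨(|a| + |b|) * C, ?_⟩
  have h := ((tendsto_nearPt_infinity hF.M_pos hF.k_pos t).comp
    (tendsto_prodMk_atTop ht)).eventually hC
  filter_upwards [h] with r hr n
  simp only [Function.comp_apply, inv_inv] at hr
  exact norm_mixCoeff_mul_le (hr n)

theorem EqOnDomain.vanishesAtInfinity (e : EqOnDomain M k t₀ g g')
    (h : VanishesAtInfinity t₀ g') : VanishesAtInfinity t₀ g := fun t ht θ hθ φ => by
  refine (h t ht θ hθ φ).congr' ?_
  filter_upwards [Ioi_mem_atTop (rPlus M k)] with r hr using (e t ht r hr θ hθ φ).symm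

/-- The operators are moved inside the series of the symmetric part, ℒ acting by the eigenvalue, so
that the sum is a single series whose coefficients are those of `mode_limits`. -/
theorem TeukPair.vanishes_symPlus (h : TeukPair M k t₀ ε F G) :
    VanishesAtInfinity t₀ (radMul (fun _ => k ^ 2) (angOp 2 (nullOp M k t₀ ε (symPlus F)))
      + dT t₀ (nullOp M k t₀ ε (nullOp M k t₀ ε (symPlus F)))) := by
  have hF := h.fst.reg
  have hA := h.fst.tame_angOp
  have hN : Tame M k t₀ F (nullOp M k t₀ ε F) := Tame.self.nullOp hF ε
  have hNN := hN.nullOp hF ε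
  have hT := hNN.dT hF
  have e1 := ((Tame.self.symPlus_eq hF hA).nullOp ε).trans (Tame.self.nullOp_mixSer hF hA _ _ ε)
  have e2 := ((e1.nullOp ε).trans (hN.nullOp_mixSer hF hA _ _ ε)).dT.trans (hNN.dT_mixSer _ _ hF hA)
  refine (((e1.angOp 2).radMul _).add e2).vanishesAtInfinity fun t ht θ hθ φ => ?_
  refine ((((hN.rapidInf_mixCoeff hF hA (1 / 2) (1 / 2) ht).lam.const_mul ((k ^ 2 : ℝ) : ℂ)).add
    (hT.rapidInf_mixCoeff hF hA (1 / 2) (1 / 2) ht)).tendsto_Ser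
    (fun n m hm => (h.mode_limits hm).1 t ht) θ φ).congr' ?_
  filter_upwards [Ioi_mem_atTop (rPlus M k)] with r hr
  have hM := hF.M_pos
  have hk := hF.k_pos
  have s1 := hasSum_Ser (rapidDecay_mixCoeff (1 / 2) (1 / 2)
    ((hN.locRapid hF hA).rapidDecay hM hk ht hr)).lam (polyBdd_harm 4) θ φ
  have s2 := hasSum_mixSer (a := 1 / 2) (b := 1 / 2) hM hk (hT.locRapid hF hA) ht hr θ φ
  rw [← hN.angOp_mixSer hF hA _ _ ht hr θ hθ φ] at s1
  refine (hasSum_of_eq ((s1.mul_left ((k ^ 2 : ℝ) : ℂ)).add s2) fun n => ?_).tsum_eq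
  rw [Finset.mul_sum, ← Finset.sum_add_distrib]
  exact Finset.sum_congr rfl fun m _ => by ring

theorem TeukPair.vanishes_antiPlus (h : TeukPair M k t₀ ε F G) :
    VanishesAtInfinity t₀ (nullOp M k t₀ ε (nullOp M k t₀ ε (antiPlus F))) := by
  have hF := h.fst.reg
  have hA := h.fst.tame_angOp
  have hN : Tame M k t₀ F (nullOp M k t₀ ε F) := Tame.self.nullOp hF ε
  have e1 := ((Tame.self.antiPlus_eq hF hA).nullOp ε).trans (Tame.self.nullOp_mixSer hF hA _ _ ε)
  refine ((e1.nullOp ε).trans (hN.nullOp_mixSer hF hA _ _ ε)).vanishesAtInfinity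
    fun t ht θ _ φ => ?_
  exact ((hN.nullOp hF ε).rapidInf_mixCoeff hF hA (1 / 2) (-(1 / 2)) ht).tendsto_Ser
    (fun n m hm => (h.mode_limits hm).2 t ht) θ φ

end

section

variable {M k t₀ : ℝ} {F G : Field}

/-! ## The two pairs of a solution of the Teukolsky problem -/

theorem nullOp_nullOp (hM : 0 < M) (hk : 0 < k) (hF : SmoothField M k t₀ F)
    (a b : ℝ) :
    EqOnDomain M k t₀ (nullOp M k t₀ a (nullOp M k t₀ b F))
      (dT t₀ (dT t₀ F) - ((a + b : ℝ) : ℂ) • dT t₀ (Dop M k t₀ F)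
        + ((a * b : ℝ) : ℂ) • Dop M k t₀ (Dop M k t₀ F)) := by
  have hD := (hF.Dop hM hk).const_smul (-(b : ℂ))
  have e : nullOp M k t₀ b F = dT t₀ F + (-(b : ℂ)) • Dop M k t₀ F := by
    rw [nullOp, neg_smul, ← sub_eq_add_neg]
  intro t ht r hr θ hθ φ
  have h1 := hF.dT.dT_add hD t ht r hr θ hθ φ
  have h2 := hF.dT.Dop_add hD t ht r hr θ hθ φ
  have h3 := hF.dT_Dop t ht r hr θ hθ φ
  rw [← e] at h1 h2
  rw [dT_const_smul] at h1
  rw [Dop_const_smul] at h2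
  rw [nullOp.eq_1 M k t₀ a]
  simp only [Pi.add_apply, Pi.sub_apply, Pi.smul_apply, smul_eq_mul] at h1 h2 h3 ⊢
  rw [h1, h2, ← h3]
  push_cast
  ring

theorem nullOp_comm (hM : 0 < M) (hk : 0 < k) (hF : SmoothField M k t₀ F)
    (a b : ℝ) :
    EqOnDomain M k t₀ (nullOp M k t₀ a (nullOp M k t₀ b F))
      (nullOp M k t₀ b (nullOp M k t₀ a F)) := by
  have h := nullOp_nullOp hM hk hF b a
  rw [add_comm b a, mul_comm b a] at h
  exact (nullOp_nullOp hM hk hF a b).trans h.symm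

theorem conjField_conjField (F : Field) : conjField (conjField F) = F := by
  funext t r θ φ
  simp only [conjField, Complex.conj_conj]

theorem conjField_add (F G : Field) : conjField (F + G) = conjField F + conjField G := by
  funext t r θ φ
  simp only [conjField, Pi.add_apply, map_add]

theorem conjField_sub (F G : Field) : conjField (F - G) = conjField F - conjField G := by
  funext t r θ φ
  simp only [conjField, Pi.sub_apply, map_sub]

theorem conjField_ofReal_smul (c : ℝ) (F : Field) :
    conjField ((c : ℂ) • F) = (c : ℂ) • conjField F := by
  funext t r θ φ
  simp only [conjField, Pi.smul_apply, smul_eq_mul, map_mul, Complex.conj_ofReal]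

theorem nullOp_conjField (ε : ℝ) (F : Field) :
    nullOp M k t₀ ε (conjField F) = conjField (nullOp M k t₀ ε F) := by
  rw [nullOp, nullOp, dT_conjField, Dop_conjField, conjField_sub, conjField_ofReal_smul]

theorem wNull_conjField (ε : ℝ) (F : Field) :
    wNull M k t₀ ε (conjField F) = conjField (wNull M k t₀ ε F) := by
  rw [wNull, wNull, nullOp_conjField, radMul_conjField]

theorem iterate_wNull_conjField (ε : ℝ) (n : ℕ) (F : Field) :
    (wNull M k t₀ ε)^[n] (conjField F) = conjField ((wNull M k t₀ ε)^[n] F) :=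
  (Function.Commute.iterate_left (f := wNull M k t₀ ε) (g := conjField) (wNull_conjField ε) n).eq F

theorem angL_conjField (n : ℤ) (F : Field) :
    angL n (conjField F) = conjField (angLdag n F) := by
  funext t r θ φ
  simp only [angL, angLdag, dTheta_conjField, dPhi_conjField, conjField, map_add, map_sub, map_mul, map_div₀, Complex.conj_I, Complex.conj_ofReal,
    map_intCast]
  ring

theorem wNull_one : wNull M k t₀ 1 = wLbar M k t₀ := funext fun F => by
  rw [wNull, nullOp_one, wLbar]

theorem wNull_neg_one : wNull M k t₀ (-1) = wL M k t₀ := funext fun F => by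
  rw [wNull, nullOp_neg_one, wL]

theorem radMul_const (c : ℝ) (F : Field) : radMul (fun _ => c) F = (c : ℂ) • F := rfl

theorem VanishesAtInfinity.conj (h : VanishesAtInfinity t₀ F) :
    VanishesAtInfinity t₀ (conjField F) := fun t ht θ hθ φ => by
  simpa [Function.comp_def, conjField] using
    (Complex.continuous_conj.tendsto 0).comp (h t ht θ hθ φ)

/-- Δ/r² = w r² and w has the finite limit k², so the condition on r²∂_r passes to D. -/
theorem vanishes_Dop (hM : 0 < M) (hk : 0 < k)
    (h : VanishesAtInfinity t₀ (radMul (fun r => r ^ 2) (dR M k t₀ F)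
      + radMul (fun r => r ^ 2) (dR M k t₀ G))) :
    VanishesAtInfinity t₀ (Dop M k t₀ F - -Dop M k t₀ G) := fun t ht θ hθ φ => by
  refine (tendsto_mul_of_zero (tendsto_w_atTop (M := M) (k := k)) (h t ht θ hθ φ)).congr' ?_
  filter_upwards [Ioi_mem_atTop (rPlus M k)] with r hr
  have h0 : r ≠ 0 := ((rPlus_pos hM hk).trans hr).ne'
  have e : ((Delta M k r / r ^ 2 : ℝ) : ℂ) = w M k r * (r ^ 2 : ℝ) := by
    rw [← Complex.ofReal_mul, w]
    congr 1
    field_simp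
  simp only [Dop, Pi.add_apply, Pi.sub_apply, Pi.neg_apply, radMul, e]
  ring

section

variable {αp αm : Field}

theorem IsTeukolskySolution.teukField_plus (hM : 0 < M) (hk : 0 < k)
    (h : IsTeukolskySolution M k t₀ αp αm) : TeukField M k t₀ 1 αp where
  reg := regularField_of_regularAtInfinity hM hk h.smooth_plus h.infinity_plus
  sq := by norm_num
  eq t ht r hr θ hθ φ := by
    have e := h.eq_plus t ht r hr θ hθ φ
    rw [nullOp_neg_one, nullOp_one]
    simp only [teukPlus, Pi.add_apply, Pi.sub_apply, Pi.neg_apply, Pi.smul_apply, smul_eq_mul,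
      Pi.zero_apply, radMul, mul_assoc, deriv_log_w hM hk hr] at e ⊢
    rw [← w] at e
    push_cast [div_eq_mul_inv] at e ⊢
    linear_combination -e

/-- Conjugation turns spin -2 into spin +2 for the angular operator and leaves L, L̲ unchanged as
they are real; with L̲L in place of LL̲, which commute, the equation has the common form with ε =
-1. -/
theorem IsTeukolskySolution.teukField_minus (hM : 0 < M) (hk : 0 < k)
    (h : IsTeukolskySolution M k t₀ αp αm) : TeukField M k t₀ (-1) (conjField αm) where
  reg := (regularField_of_regularAtInfinity hM hk h.smooth_minus h.infinity_minus).conj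
  sq := by norm_num
  eq := by
    have hreg := regularField_of_regularAtInfinity hM hk h.smooth_minus h.infinity_minus
    have hA : angOp 2 (conjField αm) = conjField (angOp (-2) αm) := by
      rw [← angOp_conjField, neg_neg]
    have hc := nullOp_comm hM hk hreg.smooth 1 (-1)
    rw [neg_neg, hA, nullOp_conjField, nullOp_conjField]
    intro t ht r hr θ hθ φ
    have e := congrArg (starRingEnd ℂ) (h.eq_minus t ht r hr θ hθ φ)
    have c := congrArg (starRingEnd ℂ) (hc t ht r hr θ hθ φ)
    simp only [nullOp_one, nullOp_neg_one] at c ⊢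
    simp only [teukMinus, Pi.add_apply, Pi.sub_apply, Pi.neg_apply, Pi.smul_apply, smul_eq_mul,
      Pi.zero_apply, radMul, mul_assoc, deriv_log_w hM hk hr, conjField, map_sub, map_add, map_neg,
      map_mul, Complex.conj_ofReal, map_zero] at e ⊢
    rw [← w] at e
    push_cast [div_eq_mul_inv] at e ⊢
    linear_combination -e + c

theorem IsTeukolskySolution.teukPair_plus (hM : 0 < M) (hk : 0 < k)
    (h : IsTeukolskySolution M k t₀ αp αm) (hTS : TeukolskyStarobinsky M k t₀ αp αm) :
    TeukPair M k t₀ 1 αp (conjField αm) where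
  fst := h.teukField_plus hM hk
  snd := h.teukField_minus hM hk
  dirichlet t ht θ hθ φ := by simpa using (h.dirichlet t ht θ hθ φ).neg
  neumann := by
    have := h.neumann
    rw [add_comm] at this
    exact vanishes_Dop hM hk this
  starobinsky := by
    have e := hTS.minus.conj
    rw [← wNull_one, iterate_wNull_conjField, radMul_conjField, conjField_conjField, conjField_add,
      radMul_const, conjField_ofReal_smul, ← dT_conjField] at e
    rwa [mul_one]

/-- The first Starobinsky identity already has the required form, since the operators ℒ_n on
conjugates are the conjugates of ℒ†_n; the other one, used for ε = 1, has to be conjugated. -/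
theorem IsTeukolskySolution.teukPair_minus (hM : 0 < M) (hk : 0 < k)
    (h : IsTeukolskySolution M k t₀ αp αm) (hTS : TeukolskyStarobinsky M k t₀ αp αm) :
    TeukPair M k t₀ (-1) (conjField αm) αp where
  fst := h.teukField_minus hM hk
  snd := by rw [neg_neg]; exact h.teukField_plus hM hk
  dirichlet := h.dirichlet
  neumann := vanishes_Dop hM hk h.neumann
  starobinsky := by
    have e := hTS.plus
    rw [← wNull_neg_one, angL_conjField, angL_conjField, angL_conjField, angL_conjField,
      radMul_const] at e
    rwa [mul_neg_one, neg_mul, Complex.ofReal_neg, neg_smul, ← sub_eq_add_neg]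

end

theorem symMinus_eq (F : Field) : symMinus F = conjField (symPlus (conjField F)) := by
  funext t r θ φ
  simp [symMinus, symPlus, conjField, map_ofNat]

theorem antiMinus_eq (F : Field) : antiMinus F = conjField (antiPlus (conjField F)) := by
  funext t r θ φ
  simp [antiMinus, antiPlus, conjField, map_ofNat]

end

end SchwarzschildAdS

theorem corollaryB1 (M k t₀ : ℝ) (hM : 0 < M) (hk : 0 < k)
    (αp αm : Field)
    (hsol : IsTeukolskySolution M k t₀ αp αm)
    (hTS : TeukolskyStarobinsky M k t₀ αp αm) :
    (VanishesAtInfinity t₀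
        (radMul (fun _ => k ^ 2)
            (angOp 2
              (Lbar M k t₀ (symPlus αp)))
          + dT t₀
              (Lbar M k t₀
                (Lbar M k t₀ (symPlus αp)))) ∧
      VanishesAtInfinity t₀
        (Lbar M k t₀
          (Lbar M k t₀ (antiPlus αp)))) ∧
    (VanishesAtInfinity t₀
        (radMul (fun _ => k ^ 2)
            (angOp (-2)
              (L M k t₀ (symMinus αm)))
          + dT t₀
              (L M k t₀
                (L M k t₀ (symMinus αm)))) ∧
      VanishesAtInfinity t₀
        (L M k t₀
          (L M k t₀ (antiMinus αm)))) := by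
  have h := hsol.teukPair_plus hM hk hTS
  have h' := hsol.teukPair_minus hM hk hTS
  have e1 := h.vanishes_symPlus
  have e2 := h.vanishes_antiPlus
  -- The second pair is made of (α⁻)^*, so its conclusions are conjugated back to spin -2.
  have e3 := h'.vanishes_symPlus.conj
  have e4 := h'.vanishes_antiPlus.conj
  simp only [nullOp_one] at e1 e2
  have hA : ∀ F, conjField (angOp 2 F) = angOp (-2) (conjField F) :=
    fun F => (angOp_conjField 2 F).symm
  rw [conjField_add, ← radMul_conjField, hA, ← dT_conjField, ← nullOp_conjField,
    ← nullOp_conjField, ← nullOp_conjField, ← symMinus_eq] at e3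
  rw [← nullOp_conjField, ← nullOp_conjField, ← antiMinus_eq] at e4
  simp only [nullOp_neg_one] at e3 e4
  exact ⟨⟨e1, e2⟩, e3, e4⟩
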